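/- **Hybrid instances.** A (structured) instance $\mathcal H$ of the Hybrid problem is a system of linear equations mod $2$ of the following form. There are $n\ge 1$ circles; circle $l$ has $7t_l$ variables $x^l_1,\dots,x^l_{7t_l}$ with $t_l\ge 1$. The variables $x^l_i$ with $7\mid i$ are called contact variables, the other ones checker variables. The equations are * the circle equations $x^l_i\oplus x^l_{i+1}=0$ for $1\le i<7t_l$ and the circle border equation $x^l_1\oplus x^l_{7t_l}=0$, for every $l$; * the matching equations $x^l_i\oplus x^l_j=0$ for $\{i,j\}\in M_l$, where $M_l$ is a perfect matching on the checker variables of circle $l$; * $m_3$ equations with exactly three variables, of the form $x\oplus y\oplus z=b$ with $b\in\{0,1\}$, in three distinct contact variables, such that every contact variable of $\mathcal H$ occurs in exactly one of them. Thus every variable occurs exactly three times. Let $m_2$ be the number of equations with two variables (circle, border and matching equations). **TSP instances.** An instance of the $(1,B)$-TSP problem is a metric space $(V,d)$ on a finite set $V$, $|V|\ge 3$, with $d(x,y)\in\{1,\dots,B\}$ for $x\ne y$. A tour is a cycle visiting every point exactly once, and its length $\ell(\sigma)$ is the sum of the distances along it. **Theorem.** (i) There is a polynomial-time algorithm that constructs,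 from every such $\mathcal H$, an instance $G_{\mathcal H}$ of the $(1,2)$-TSP problem, and a polynomial-time algorithm that constructs, from $\mathcal H$ and any tour $\sigma$ in $G_{\mathcal H}$, an assignment $\psi_\sigma$ to the variables of $\mathcal H$, such that for every $\mathcal H$ and every integer $u\ge 0$: * (a) if some assignment leaves at most $u$ equations of $\mathcal H$ unsatisfied, then there is a tour in $G_{\mathcal H}$ of length at most $8m_2+27m_3+3n+1+u$; * (b) for every tour $\sigma$ in $G_{\mathcal H}$ of length at most $8m_2+27m_3+3n+1+u$, the assignment $\psi_\sigma$ leaves at most $u$ equations of $\mathcal H$ unsatisfied. (ii) There is a polynomial-time algorithm that constructs, from every such $\mathcal H$, an instance $(V_{\mathcal H},d_{\mathcal H})$ of the $(1,4)$-TSP problem, in which $d_{\mathcal H}(x,y)=\min\{\text{length of a shortest path from }x\text{ to }y,\ 4\}$ for a graph on $V_{\mathcal H}$ whose edges have weight $1$ or $2$, and a polynomial-time algorithm that constructs, from $\mathcal H$ and any tour $\sigma$ in $(V_{\mathcal H},d_{\mathcal H})$, an assignment $\psi_\sigma$ to the variables of $\mathcal H$, such that for every $\mathcal H$ and every integer $u\ge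 0$: * (a) if some assignment leaves at most $u$ equations of $\mathcal H$ unsatisfied, then there is a tour in $(V_{\mathcal H},d_{\mathcal H})$ of length at most $10m_2+36m_3+6n+2+2u$; * (b) for every tour $\sigma$ in $(V_{\mathcal H},d_{\mathcal H})$ of length at most $10m_2+36m_3+6n+2+2u$, the assignment $\psi_\sigma$ leaves at most $u$ equations of $\mathcal H$ unsatisfied. -/

import Mathlib

/-! ## Polynomial time: structured programs for a random access machine

The machine has scalar registers and arrays (all holding natural numbers, with indirect addressing)
and a write-only output stream.  The only arithmetic operations are addition and truncated
subtraction, and every executed instruction costs one unit, so that running times are polynomially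
related to those of Turing machines. -/

namespace Ram

/-- Machine states: scalar registers, arrays, and what has been output so far. -/
structure State where
  reg : ℕ → ℕ
  arr : ℕ → ℕ → ℕ
  out : List ℕ

inductive Expr where
  | const (k : ℕ)
  | reg (x : ℕ)
  | arr (a : ℕ) (i : Expr)
  | add (e₁ e₂ : Expr)
  | sub (e₁ e₂ : Expr)

def Expr.eval (s : State) : Expr → ℕ
  | .const k => k
  | .reg x => s.reg x
  | .arr a i => s.arr a (i.eval s)
  | .add e₁ e₂ => e₁.eval s + e₂.eval s
  | .sub e₁ e₂ => e₁.eval s - e₂.eval s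

/-- Programs; `ite` is a conditional, and `loop e p` repeats `p` as long as `e` is nonzero. -/
inductive Prog where
  | skip
  | assign (x : ℕ) (e : Expr)
  | store (a : ℕ) (i e : Expr)
  | write (e : Expr)
  | seq (p q : Prog)
  | ite (e : Expr) (p q : Prog)
  | loop (e : Expr) (p : Prog)

/-- `Exec p s t s'`: started in state `s`, the program `p` halts in state `s'` after `t` steps.
A test succeeds if the tested expression is nonzero. -/
inductive Exec : Prog → State → ℕ → State → Prop
  | skip (s : State) : Exec .skip s 1 s
  | assign (x : ℕ) (e : Expr) (s : State) :
      Exec (.assign x e) s 1 ⟨Function.update s.reg x (e.eval s), s.arr, s.out⟩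
  | store (a : ℕ) (i e : Expr) (s : State) :
      Exec (.store a i e) s 1
        ⟨s.reg, Function.update s.arr a (Function.update (s.arr a) (i.eval s) (e.eval s)), s.out⟩
  | write (e : Expr) (s : State) : Exec (.write e) s 1 ⟨s.reg, s.arr, s.out ++ [e.eval s]⟩
  | seq (p q : Prog) (s s' s'' : State) (t t' : ℕ) :
      Exec p s t s' → Exec q s' t' s'' → Exec (.seq p q) s (t + t') s''
  | ite_true (e : Expr) (p q : Prog) (s s' : State) (t : ℕ) :
      e.eval s ≠ 0 → Exec p s t s' → Exec (.ite e p q) s (t + 1) s'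
  | ite_false (e : Expr) (p q : Prog) (s s' : State) (t : ℕ) :
      e.eval s = 0 → Exec q s t s' → Exec (.ite e p q) s (t + 1) s'
  | loop_true (e : Expr) (p : Prog) (s s' s'' : State) (t t' : ℕ) :
      e.eval s ≠ 0 → Exec p s t s' → Exec (.loop e p) s' t' s'' →
      Exec (.loop e p) s (t + t' + 1) s''
  | loop_false (e : Expr) (p : Prog) (s : State) :
      e.eval s = 0 → Exec (.loop e p) s 1 s

/-- The initial state on input `l`: register `0` holds the length of `l`, array `0` holds the
entries of `l`, everything else is zero, and nothing has been output. -/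
def start (l : List ℕ) : State where
  reg := fun x => if x = 0 then l.length else 0
  arr := fun a i => if a = 0 then l.getD i 0 else 0
  out := []

/-- The size of an input in bits, with one separator per entry. -/
def bitSize (l : List ℕ) : ℕ := (l.map fun x => x.size + 1).sum

/-- Some program transforms, for every `x : α`, the word `inp x` into the word `outp x`,
in a number of steps that is polynomial in the bit size of `inp x`. -/
def PolyTime {α : Type} (inp outp : α → List ℕ) : Prop :=
  ∃ (p : Prog) (k : ℕ), ∀ x : α, ∃ (t : ℕ) (s : State),
    Exec p (start (inp x)) t s ∧ s.out = outp x ∧ t ≤ k * bitSize (inp x) ^ k + k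

end Ram

/-! ## The Hybrid problem -/

/-- A linear equation mod 2: the sum of the variables in `vars` equals `rhs`. -/
structure LinEq (V : Type) where
  vars : Finset V
  rhs : ZMod 2

def LinEq.Holds {V : Type} (E : LinEq V) (φ : V → ZMod 2) : Prop :=
  ∑ v ∈ E.vars, φ v = E.rhs

/-- The combinatorial data of a Hybrid instance built from circles.  Circle `l` has the `7 * t l`
variables `x₁, …, x_{7 t l}`, the variable `x_{i+1}` being represented by the index `i`; those whose
number is a multiple of `7` are the contact variables, the other ones the checker variables.
The perfect matching on the checker variables of circle `l` is given as the involution `partner l`,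
whose fixed points are the contact variables.  Every contact variable of the instance occurs in
exactly one of the `m₃` equations with three variables, at exactly one place. -/
structure HybridInstance where
  n : ℕ
  n_pos : 0 < n
  t : Fin n → ℕ
  t_pos : ∀ l, 0 < t l
  partner : (l : Fin n) → Fin (7 * t l) → Fin (7 * t l)
  partner_partner : ∀ l i, partner l (partner l i) = i
  partner_eq_self_iff : ∀ l i, partner l i = i ↔ 7 ∣ (i : ℕ) + 1
  m₃ : ℕ
  triple : Fin m₃ → Fin 3 → (l : Fin n) × Fin (7 * t l)
  triple_contact : ∀ c k, 7 ∣ ((triple c k).2 : ℕ) + 1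
  triple_unique : ∀ v : (l : Fin n) × Fin (7 * t l), 7 ∣ (v.2 : ℕ) + 1 →
    ∃! p : Fin m₃ × Fin 3, triple p.1 p.2 = v
  rhs : Fin m₃ → ZMod 2

namespace HybridInstance

variable (H : HybridInstance)

abbrev Var : Type := (l : Fin H.n) × Fin (7 * H.t l)

/-- The successor of a variable on its circle; the last variable is followed by the first one. -/
def next (v : H.Var) : H.Var :=
  ⟨v.1, ⟨((v.2 : ℕ) + 1) % (7 * H.t v.1),
    Nat.mod_lt _ (Nat.mul_pos (by norm_num) (H.t_pos v.1))⟩⟩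

/-- The matching partner of a variable (a contact variable is its own partner). -/
def mate (v : H.Var) : H.Var := ⟨v.1, H.partner v.1 v.2⟩

/-- The circle equations and circle border equations `x_i ⊕ x_{i+1} = 0`. -/
def circleEqs : Multiset (LinEq H.Var) :=
  (Finset.univ : Finset H.Var).val.map fun v => ⟨{v, H.next v}, 0⟩

/-- The matching equations `x_i ⊕ x_j = 0`, one for every pair `{i, j}` of the matchings. -/
def matchingEqs : Multiset (LinEq H.Var) :=
  ((Finset.univ : Finset H.Var).filter fun v => v.2 < H.partner v.1 v.2).val.map
    fun v => ⟨{v, H.mate v}, 0⟩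

/-- The equations with two variables. -/
def twoEqs : Multiset (LinEq H.Var) := H.circleEqs + H.matchingEqs

/-- The equations with three variables. -/
def threeEqs : Multiset (LinEq H.Var) :=
  (Finset.univ : Finset (Fin H.m₃)).val.map fun c => ⟨Finset.univ.image (H.triple c), H.rhs c⟩

def equations : Multiset (LinEq H.Var) := H.twoEqs + H.threeEqs

/-- The number of equations with two variables. -/
def m₂ : ℕ := Multiset.card H.twoEqs

abbrev Assignment : Type := H.Var → ZMod 2

open Classical in
/-- The number of equations that the assignment `φ` leaves unsatisfied. -/
noncomputable def unsat (φ : H.Assignment) : ℕ :=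
  Multiset.card (H.equations.filter fun E => ¬ E.Holds φ)

/-- The list of all values `f v`, circle by circle. -/
def listVars (f : H.Var → ℕ) : List ℕ :=
  (List.ofFn fun l : Fin H.n => List.ofFn fun i : Fin (7 * H.t l) => f ⟨l, i⟩).flatten

/-- The code of an instance: `n`, the `t l`, the matching partners, `m₃`, and, for every equation
with three variables, its variables (circle and index) and its right-hand side. -/
def encode : List ℕ :=
  [H.n] ++ List.ofFn H.t ++ H.listVars (fun v => (H.partner v.1 v.2 : ℕ)) ++ [H.m₃] ++
    (List.ofFn fun c : Fin H.m₃ =>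
      (List.ofFn fun k : Fin 3 => [((H.triple c k).1 : ℕ), ((H.triple c k).2 : ℕ)]).flatten ++
        [(H.rhs c).val]).flatten

/-- The code of an assignment: the list of its values. -/
def encodeAssignment (φ : H.Assignment) : List ℕ := H.listVars fun v => (φ v).val

end HybridInstance

/-! ## The traveling salesperson problem -/

/-- A symmetric TSP instance: a metric with natural values on `N ≥ 3` points. -/
structure TSPInstance where
  N : ℕ
  three_le : 3 ≤ N
  d : Fin N → Fin N → ℕ
  d_self : ∀ x, d x x = 0
  d_pos : ∀ x y, x ≠ y → 1 ≤ d x y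
  d_symm : ∀ x y, d x y = d y x
  d_triangle : ∀ x y z, d x z ≤ d x y + d y z

namespace TSPInstance

variable (I : TSPInstance)

/-- An instance of the `(1,B)`-TSP problem: the distances of distinct points lie in `{1, …, B}`. -/
def IsOneB (B : ℕ) : Prop := ∀ x y, x ≠ y → I.d x y ≤ B

/-- A tour `v₀ - v₁ - ⋯ - v_{N-1} - v₀`, given by the enumeration `i ↦ v_i` of the points. -/
abbrev Tour : Type := Equiv.Perm (Fin I.N)

/-- The length of a tour; `finRotate` sends `i` to `i + 1` and the last index to `0`. -/
def length (σ : I.Tour) : ℕ := ∑ i, I.d (σ i) (σ (finRotate I.N i))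

/-- The code of an instance: the number of points and the distance matrix, row by row. -/
def encode : List ℕ :=
  I.N :: (List.ofFn fun x => List.ofFn fun y => I.d x y).flatten

/-- The code of a tour: the list of its points. -/
def encodeTour (σ : I.Tour) : List ℕ := List.ofFn fun i => (σ i : ℕ)

/-- The metric is the shortest path metric of a graph whose edges have weight `1` or `2`,
bounded by the value `B`: `d x y = min {length of a shortest path from x to y, B}`. -/
def IsGraphMetricCappedAt (B : ℕ) : Prop :=
  ∃ (G : SimpleGraph (Fin I.N)) (w : Sym2 (Fin I.N) → ℕ),
    (∀ e ∈ G.edgeSet, w e = 1 ∨ w e = 2) ∧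
    ∀ x y, x ≠ y →
      IsLeast ({k | ∃ p : G.Walk x y, k = (p.edges.map w).sum} ∪ {B}) (I.d x y)

end TSPInstance

/-! ## Reductions from Hybrid instances to TSP instances -/

/-- `G` maps Hybrid instances to TSP instances in polynomial time, and `ψ` maps every Hybrid
instance `H` with a tour in `G H` to an assignment for `H` in polynomial time. -/
def PolyTimeReduction (G : HybridInstance → TSPInstance)
    (ψ : (H : HybridInstance) → (G H).Tour → H.Assignment) : Prop :=
  Ram.PolyTime (fun H : HybridInstance => H.encode) (fun H => (G H).encode) ∧
  Ram.PolyTime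
    (fun x : (H : HybridInstance) × (G H).Tour => x.1.encode ++ (G x.1).encodeTour x.2)
    (fun x => x.1.encodeAssignment (ψ x.1 x.2))

noncomputable section
open scoped Classical

/-! ## Parity gadgets and networks of gadgets -/

/-! The reduction forces tours to behave like assignments by means of parity gadgets. A gadget has
the terminals 0, 1, 2, 3 and is visited at minimal cost only by a path between 0 and 1 or by one
between 2 and 3. Both metrics are treated together: the distances of the (1,2)-metric are doubled,
so that in both cases a link between gadgets has length 2 and a step that is not a link has length
at most 4. A gadget with one link costs 16 or 10 (`gadBase`).

Every circle equation is a gadget, traversed between 0 and 1 for the value true and between 2 and 3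
for the value false. At a variable `h` the way from one circle gadget to the next is a direct link
if the value differs from `nu h`, and otherwise leads through a further gadget. For matched
variables this gadget is shared and `nu` takes opposite values on the two, so equal values make
exactly one of them visit it. For contact variables it belongs to the equation with three variables,
and `nu` is chosen so that the equation holds iff an odd number of its three gadgets is visited
along the circles. The remaining gadgets lie on a path from `vA` to `vB`, which can consist of links
only if their number is even. Each circle is cut open between two single vertices `vq` and `vp`, and
all these paths are strung on a chain of hubs.

From assignments to tours (`exists_tour_le`): the pieces of the tour are listed in order, and every
violated equation is responsible for one missing link (`gaps_pieces`), which lengthens the doubled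
tour by at most 2.

From tours to assignments: the length of every step is divided between the two gadgets that it joins
(`half`, `charge`), so that gadgets can be bounded separately. For a parity gadget this is linear
programming duality with explicit dual solutions (`cert_le`, `le_cost_gad`); the excess over the
base cost is `gadDelta`, the distance of the terminal degrees from those of a proper traversal. For
single vertices `four_le_cost_add` and `four_le_cost_hub` suffice. Each variable has three places at
which inconsistent use is detected, and by parity an inconsistent variable fails at two of them
(`two_le_mix`). The sum is `lower_bound`: each inconsistent variable, and each equation violated by
consistent values, costs 2.

Finally, inconsistent variables are given values one after the other, by majority of their three
equations (`improve`); each of them creates at most one further violated equation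
(`badNum_improve`). One detail: the circle of `star` and the equation `c0` are joined by a direct
link instead of a hub. If a tour omits it, the extra cost of 2 covers only one of the two equations
that meet there. As both contain `star`, a last majority step at `star` repairs this
(`card_viol_improve_star`).

For the running time, a small calculus of polynomial-time computable functions is set up, closed
under sums and quantifiers over polynomially large index types. Distances are evaluated from a
first-order description of the links (`link_iff`, `d_eq`), and the assignment is improved in place
in an array. -/

/-- The number of vertices of a parity gadget: `8` for the `(1,2)`-metric, `9` for the graph metric. -/
def gadK : Bool → ℕ
  | false => 8
  | true => 9

/-- The distances inside a parity gadget (doubled in the case of the `(1,2)`-metric). -/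
def gadTab : Bool → List (List ℕ)
  | false => [[0, 4, 4, 4, 2, 4, 4, 2], [4, 0, 4, 4, 4, 2, 2, 4], [4, 4, 0, 4, 4, 2, 4, 2],
      [4, 4, 4, 0, 2, 4, 2, 4], [2, 4, 4, 2, 0, 2, 4, 4], [4, 2, 2, 4, 2, 0, 4, 4],
      [4, 2, 4, 2, 4, 4, 0, 4], [2, 4, 2, 4, 4, 4, 4, 0]]
  | true => [[0, 4, 2, 2, 1, 3, 3, 1, 2], [4, 0, 2, 2, 3, 1, 1, 3, 2], [2, 2, 0, 4, 3, 1, 3, 1, 2],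
      [2, 2, 4, 0, 1, 3, 1, 3, 2], [1, 3, 3, 1, 0, 2, 2, 2, 1], [3, 1, 1, 3, 2, 0, 2, 2, 1],
      [3, 1, 3, 1, 2, 2, 0, 4, 3], [1, 3, 1, 3, 2, 2, 4, 0, 3], [2, 2, 2, 2, 1, 1, 3, 3, 0]]

def gadD (md : Bool) (a b : ℕ) : ℕ := ((gadTab md).getD a []).getD b 0

/-- The cost of a traversal of a parity gadget, including one link. -/
def gadBase : Bool → ℕ
  | false => 16
  | true => 10

theorem gadK_pos (md : Bool) : 4 < gadK md := by cases md <;> decide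

theorem gadD_self (md : Bool) (a : Fin (gadK md)) : gadD md a a = 0 := by
  revert a; cases md <;> decide

theorem gadD_symm (md : Bool) (a b : Fin (gadK md)) : gadD md a b = gadD md b a := by
  revert a b; cases md <;> decide

theorem gadD_le (md : Bool) (a b : Fin (gadK md)) : gadD md a b ≤ 4 := by
  revert a b; cases md <;> decide

theorem gadD_pos (md : Bool) (a b : Fin (gadK md)) (h : (a : ℕ) ≠ b) : 1 ≤ gadD md a b := by
  revert a b; cases md <;> decide

theorem gadD_triangle (md : Bool) (a b c : Fin (gadK md)) :
    gadD md a c ≤ gadD md a b + gadD md b c := by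
  revert a b c; cases md <;> decide

/-- This makes the inner distances 3 of the second table path lengths in a graph with weights 1 and
2. The doubled table has no entry 3. -/
theorem gadD_three (md : Bool) (a b : Fin (gadK md)) (h : gadD md a b = 3) :
    ∃ c : Fin (gadK md), gadD md a c = 1 ∧ gadD md c b = 2 := by
  revert a b; cases md <;> decide

theorem gadD_false (a b : Fin (gadK false)) : gadD false a b = 2 * (gadD false a b / 2) := by
  revert a b; decide

/-- Consequently a vertex that is a terminal is not close to another one, so a step out of the
gadget cannot count for two terminals. -/
theorem gadD_term (md : Bool) (a b : Fin (gadK md)) (ha : (a : ℕ) < 4) (hb : (b : ℕ) < 4) :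
    gadD md a b ≠ 1 := by
  revert a b; cases md <;> decide

abbrev Vtx (md : Bool) (Bk S : Type) : Type := Bk × Fin (gadK md) ⊕ S

namespace Vtx
variable {md : Bool} {Bk S : Type}

/-- The gadget of a vertex; single vertices are their own gadgets. -/
def blk (x : Vtx md Bk S) : Bk ⊕ S := Sum.map Prod.fst id x

/-- The position of a vertex inside its gadget. -/
def loc : Vtx md Bk S → Fin (gadK md)
  | .inl p => p.2
  | .inr _ => ⟨0, (Nat.zero_lt_succ 3).trans (gadK_pos md)⟩

theorem ext_iff' {x y : Vtx md Bk S} : x = y ↔ x.blk = y.blk ∧ x.loc = y.loc := by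
  rcases x with ⟨b, k⟩ | s <;> rcases y with ⟨c, j⟩ | r <;> simp [blk, loc]

/-- `near x t`: equal, or adjacent with weight `1` inside a gadget. -/
def near (x t : Vtx md Bk S) : Prop := x.blk = t.blk ∧ (x.loc = t.loc ∨ gadD md x.loc t.loc = 1)

theorem near_refl (x : Vtx md Bk S) : near x x := ⟨rfl, .inl rfl⟩

theorem near_single {x : Vtx md Bk S} {s : S} (h : near x (.inr s)) : x = .inr s := by
  rcases x with ⟨b, k⟩ | r
  · simp [near, blk] at h
  · simpa [near, blk] using h.1

end Vtx

open Vtx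

/-- A network of parity gadgets (indexed by `Bk`) and single vertices (indexed by `S`): every vertex
has a list of partners, to which it is linked by edges of weight `2`. Hubs are single vertices that
are linked only to single vertices that are no hubs. -/
structure Net (md : Bool) (Bk S : Type) where
  nbr : Vtx md Bk S → List (Vtx md Bk S)
  hub : S → Bool
  symm : ∀ x y, y ∈ nbr x → x ∈ nbr y
  blk_ne : ∀ x y, y ∈ nbr x → y.blk ≠ x.blk
  blk_pw : ∀ x, (nbr x).Pairwise fun y z => y.blk ≠ z.blk
  term : ∀ b k y, y ∈ nbr (.inl (b, k)) → (k : ℕ) < 4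
  hub_nbr : ∀ s y, hub s = true → y ∈ nbr (.inr s) → ∃ r, y = .inr r ∧ hub r = false

namespace Net
variable {md : Bool} {Bk S : Type} (W : Net md Bk S)

theorem partner_unique {x y z : Vtx md Bk S} (hy : y ∈ W.nbr x) (hz : z ∈ W.nbr x)
    (h : y.blk = z.blk) : y = z := by
  by_contra hne
  have hs : Std.Symm fun y z : Vtx md Bk S => y.blk ≠ z.blk := ⟨fun _ _ h => h.symm⟩
  exact (W.blk_pw x).forall hy hz hne h

/-- The distance of two vertices. -/
def d (x y : Vtx md Bk S) : ℕ :=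
  if x.blk = y.blk then gadD md x.loc y.loc
  else if y ∈ W.nbr x then 2
  else if (∃ t ∈ W.nbr x, near y t) ∨ (∃ t ∈ W.nbr y, near x t) then 3
  else 4

theorem d_self (x : Vtx md Bk S) : W.d x x = 0 := by simp [d, gadD_self]

theorem d_symm (x y : Vtx md Bk S) : W.d x y = W.d y x := by
  unfold d
  have h1 : y ∈ W.nbr x ↔ x ∈ W.nbr y := ⟨W.symm _ _, W.symm _ _⟩
  simp only [h1, gadD_symm md x.loc y.loc, eq_comm (a := x.blk), or_comm]

theorem d_le (x y : Vtx md Bk S) : W.d x y ≤ 4 := by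
  unfold d
  split_ifs <;> first | omega | exact gadD_le _ _ _

theorem d_pos {x y : Vtx md Bk S} (h : x ≠ y) : 1 ≤ W.d x y := by
  unfold d
  split_ifs with h1
  · exact gadD_pos _ _ _ fun h2 => h (ext_iff'.2 ⟨h1, Fin.ext h2⟩)
  all_goals omega

theorem two_le_d {x y : Vtx md Bk S} (h : x.blk ≠ y.blk) : 2 ≤ W.d x y := by
  rw [d, if_neg h]
  split_ifs <;> omega

theorem mem_of_d_eq_two {x y : Vtx md Bk S} (h : x.blk ≠ y.blk) (h2 : W.d x y ≤ 2) :
    y ∈ W.nbr x := by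
  by_contra h3
  rw [d, if_neg h, if_neg h3] at h2
  split_ifs at h2 <;> omega

theorem d_le_three {x y t : Vtx md Bk S} (h : x.blk ≠ y.blk) (ht : t ∈ W.nbr y) (hx : near x t) :
    W.d x y ≤ 3 := by
  unfold d
  rw [if_neg h]
  split_ifs with h1 h2
  · omega
  · omega
  · exact absurd (.inr ⟨t, ht, hx⟩) h2

theorem d_link {x y : Vtx md Bk S} (h : y ∈ W.nbr x) : W.d x y = 2 := by
  unfold d
  rw [if_neg fun h1 => W.blk_ne _ _ h h1.symm, if_pos h]

/-- Distances between different gadgets are 2, 3 or 4. So the inequality could fail only if the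
inner step has length 1 and the outer one is a link; but then `x` is near a partner of `z`, and the
definition gives distance at most 3. -/
theorem d_triangle_aux (x y z : Vtx md Bk S) (hxy : x.blk = y.blk) (hyz : y.blk ≠ z.blk) :
    W.d x z ≤ W.d x y + W.d y z := by
  by_cases hxy' : x = y
  · subst hxy'; omega
  have h1 := W.d_pos hxy'
  have h2 := W.two_le_d hyz
  have h4 := W.d_le x z
  by_contra hlt
  have h3 : W.d x y = 1 := by omega
  have h5 := W.mem_of_d_eq_two hyz (by omega)
  have h6 := W.d_le_three (x := x) (y := z) (t := y) (hxy ▸ hyz) (W.symm _ _ h5)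
    ⟨hxy, .inr (by unfold d at h3; rwa [if_pos hxy] at h3)⟩
  omega

theorem d_triangle (x y z : Vtx md Bk S) : W.d x z ≤ W.d x y + W.d y z := by
  by_cases hxy : x.blk = y.blk
  · by_cases hyz : y.blk = z.blk
    · unfold d
      rw [if_pos hxy, if_pos hyz, if_pos (hxy.trans hyz)]
      exact gadD_triangle _ _ _ _
    · exact W.d_triangle_aux x y z hxy hyz
  · by_cases hyz : y.blk = z.blk
    · have := W.d_triangle_aux z y x hyz.symm (Ne.symm hxy)
      rw [W.d_symm z x, W.d_symm z y, W.d_symm y x] at this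
      omega
    -- Both steps change the gadget, and 2 + 2 already reaches the maximal distance.
    · have h1 := W.two_le_d hxy
      have h2 := W.two_le_d hyz
      have h4 := W.d_le x z
      omega

/-- Distance `3` is attained by a path of two edges. -/
theorem d_three {x y : Vtx md Bk S} (h : W.d x y = 3) :
    ∃ z, (W.d x z = 1 ∧ W.d z y = 2) ∨ (W.d x z = 2 ∧ W.d z y = 1) := by
  by_cases hb : x.blk = y.blk
  · have h1 : gadD md x.loc y.loc = 3 := by unfold d at h; rwa [if_pos hb] at h
    obtain ⟨c, hc1, hc2⟩ := gadD_three _ _ _ h1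
    rcases x with ⟨b, k⟩ | s <;> rcases y with ⟨b', k'⟩ | s' <;> simp [blk] at hb
    · subst hb
      exact ⟨.inl (b, c), .inl ⟨by simpa [d, blk, loc] using hc1, by simpa [d, blk, loc] using hc2⟩⟩
    · subst hb
      rw [W.d_self] at h
      omega
  · have h' := h
    rw [d, if_neg hb] at h'
    have h2 : (∃ t ∈ W.nbr x, near y t) ∨ (∃ t ∈ W.nbr y, near x t) := by
      by_contra h2
      rw [if_neg h2] at h'
      split_ifs at h' <;> omega
    have key : ∀ (x y t : Vtx md Bk S), W.d x y = 3 → t ∈ W.nbr x → near y t →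
        W.d x t = 2 ∧ W.d t y = 1 := by
      intro x y t h ht hn
      have h3 := W.d_link ht
      refine ⟨h3, ?_⟩
      have h4 : y ≠ t := by rintro rfl; omega
      unfold d
      rw [if_pos hn.1.symm, gadD_symm]
      rcases hn.2 with h5 | h5
      · exact absurd (ext_iff'.2 ⟨hn.1, h5⟩) h4
      · exact h5
    rcases h2 with ⟨t, ht, hn⟩ | ⟨t, ht, hn⟩
    · exact ⟨t, .inr (key x y t h ht hn)⟩
    · have := key y x t ((W.d_symm _ _).trans h) ht hn
      exact ⟨t, .inl ⟨(W.d_symm _ _).trans this.2, (W.d_symm _ _).trans this.1⟩⟩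

end Net

/-- The doubled table contains no 1, so `near` is equality there. A vertex near a partner is then
the partner itself, and the value 3 does not occur. -/
theorem Net.d_false {Bk S : Type} (W : Net false Bk S)
    (x y : Vtx false Bk S) : W.d x y = 2 * (W.d x y / 2) := by
  have h1 : ∀ a b : Fin (gadK false), gadD false a b ≠ 1 := by decide
  have h2 : ∀ x t : Vtx false Bk S, near x t → x = t := by
    rintro x t ⟨h, h' | h'⟩
    · exact ext_iff'.2 ⟨h, h'⟩
    · exact absurd h' (h1 _ _)
  unfold Net.d
  split_ifs with h3 h4 h5
  · exact gadD_false _ _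
  · rfl
  · rcases h5 with ⟨t, ht, hn⟩ | ⟨t, ht, hn⟩
    · exact absurd (h2 _ _ hn ▸ ht) h4
    · exact absurd (W.symm _ _ (h2 _ _ hn ▸ ht)) h4
  · rfl

end


noncomputable section
open scoped Classical

open Vtx

/-! ## Tours in networks -/

/-- The rotation is a single cycle. This is the only place where it matters that a tour is
connected. -/
theorem closed_finRotate_univ {n : ℕ} (P : Fin n → Prop) (i₀ : Fin n) (h₀ : P i₀)
    (h : ∀ i, P i → P (finRotate n i)) (i : Fin n) : P i := by
  cases n with
  | zero => exact i.elim0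
  | succ n =>
    have key : ∀ k : ℕ, P (i₀ + Fin.ofNat (n + 1) k) := by
      intro k
      induction k with
      | zero => simpa using h₀
      | succ k ih =>
        have := h _ ih
        rw [finRotate_apply, add_assoc] at this
        convert this using 2
        ext
        simp [Fin.val_add]
    have := key ((i - i₀ : Fin (n + 1)) : ℕ)
    rwa [Fin.ofNat_val_eq_self, add_sub_cancel] at this

/-- The subtour inequality: a tour that meets a proper subset must leave it, so some point of the
subset has its successor outside. -/
theorem subtour {V : Type} [Fintype V] {n : ℕ} (σ : Fin n ≃ V) (P : V → Prop) (h : ∃ v, ¬ P v) :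
    (∑ i, if P (σ i) ∧ P (σ (finRotate n i)) then 1 else 0) ≤
      (Finset.univ.filter P).card - 1 := by
  have hc : (Finset.univ.filter P).card = (Finset.univ.filter fun i => P (σ i)).card := by
    rw [← Finset.card_map σ.toEmbedding]
    congr 1
    ext v
    simp only [Finset.mem_filter, Finset.mem_univ, true_and, Finset.mem_map_equiv]
    simp
  rw [Finset.sum_boole, Nat.cast_id, hc]
  by_cases hne : ∃ i, P (σ i)
  · obtain ⟨i₀, hi₀⟩ := hne
    obtain ⟨v, hv⟩ := h
    have : ∃ i, P (σ i) ∧ ¬ P (σ (finRotate n i)) := by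
      by_contra hcon
      push Not at hcon
      have := closed_finRotate_univ (fun i => P (σ i)) i₀ hi₀ hcon (σ.symm v)
      simp only [Equiv.apply_symm_apply] at this
      exact hv this
    obtain ⟨j, hj1, hj2⟩ := this
    refine Nat.le_sub_one_of_lt (Finset.card_lt_card ?_)
    rw [Finset.ssubset_iff_of_subset]
    · exact ⟨j, by simp [hj1], fun h => hj2 (Finset.mem_filter.1 h).2.2⟩
    · intro i
      simp only [Finset.mem_filter, Finset.mem_univ, true_and]
      exact fun h => h.1
  · push Not at hne
    simp [hne]

theorem sum_finRotate {V : Type} [Fintype V] {n : ℕ} (σ : Fin n ≃ V) (f : V → ℤ) :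
    ∑ i, (f (σ i) + f (σ (finRotate n i))) = 2 * ∑ v, f v := by
  rw [Finset.sum_add_distrib, Equiv.sum_comp (finRotate n) (fun i => f (σ i)), Equiv.sum_comp σ f]
  ring

namespace Net
variable {md : Bool} {Bk S : Type} (W : Net md Bk S)

/-- The pair `(x, y)` realizes the link from `t` to `u`. -/
def real (t u x y : Vtx md Bk S) : Prop := near x t ∧ near y u ∧ (x = t ∨ y = u)

theorem real_symm {t u x y : Vtx md Bk S} : real t u x y ↔ real u t y x := by
  unfold real; tauto

def hubv : Vtx md Bk S → Bool
  | .inl _ => false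
  | .inr s => W.hub s

/-- The part of the length of a step from `x` out of its gadget to `y` that is charged to the
gadget of `x`. -/
def half (x y : Vtx md Bk S) : ℕ :=
  if W.hubv x then 2
  else if ∃ u ∈ W.nbr x, near y u ∧ W.hubv u then 0
  else if ∃ u ∈ W.nbr x, near y u then 1
  else 2

theorem half_le_two (x y : Vtx md Bk S) : W.half x y ≤ 2 := by
  unfold half; split_ifs <;> omega

theorem hub_partner {x u : Vtx md Bk S} (hx : W.hubv x) (hu : u ∈ W.nbr x) :
    ∃ r, u = .inr r ∧ W.hub r = false := by
  rcases x with p | s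
  · simp [hubv] at hx
  · exact W.hub_nbr s u hx hu

theorem half_le_one {x y u : Vtx md Bk S} (hx : W.hubv x = false) (hu : u ∈ W.nbr x)
    (hn : near y u) : W.half x y ≤ 1 := by
  unfold half
  rw [hx, if_neg (by simp)]
  split_ifs with h1 h2
  · omega
  · omega
  · exact absurd ⟨u, hu, hn⟩ h2

theorem half_eq_zero {x y : Vtx md Bk S} (hy : W.hubv y) (h : y ∈ W.nbr x) : W.half x y = 0 := by
  obtain ⟨r, rfl, hr⟩ := W.hub_partner hy (W.symm _ _ h)
  unfold half
  rw [if_neg (by simp [hubv, hr]), if_pos ⟨y, h, near_refl y, hy⟩]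

/-- A link is paid half and half, or entirely by its hub. At distance 3 one endpoint is near a
partner of the other endpoint, which is charged at most 1. That other endpoint is no hub, because a
partner of a hub is a single vertex and near only to itself. At distance 4 each endpoint may be
charged 2. -/
theorem half_add_le {x y : Vtx md Bk S} (h : x.blk ≠ y.blk) :
    W.half x y + W.half y x ≤ W.d x y := by
  have key : ∀ x y t : Vtx md Bk S, x.blk ≠ y.blk → y ∉ W.nbr x → t ∈ W.nbr x → near y t →
      W.half x y + W.half y x ≤ 3 := by
    intro x y t hb hl ht hn
    have hx : W.hubv x = false := by
      by_contra hx
      obtain ⟨r, rfl, -⟩ := W.hub_partner (by simpa using hx) ht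
      exact hl (near_single hn ▸ ht)
    have h1 := W.half_le_one hx ht hn
    have h2 := W.half_le_two y x
    omega
  unfold d
  rw [if_neg h]
  split_ifs with h1 h2
  · by_cases hx : W.hubv x
    · have := W.half_eq_zero hx (W.symm _ _ h1)
      have := W.half_le_two x y
      omega
    · by_cases hy : W.hubv y
      · have := W.half_eq_zero hy h1
        have := W.half_le_two y x
        omega
      · have h3 := W.half_le_one (by simpa using hx) h1 (near_refl y)
        have h4 := W.half_le_one (by simpa using hy) (W.symm _ _ h1) (near_refl x)
        omega
  · rcases h2 with ⟨t, ht, hn⟩ | ⟨t, ht, hn⟩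
    · exact key x y t h h1 ht hn
    · rw [add_comm]
      exact key y x t h.symm (fun h' => h1 (W.symm _ _ h')) ht hn
  · have := W.half_le_two x y
    have := W.half_le_two y x
    omega

/-- The part of the length of the step from `x` to `y` that is charged to the gadget `b`. -/
def charge (b : Bk ⊕ S) (x y : Vtx md Bk S) : ℕ :=
  if x.blk = b then (if y.blk = b then W.d x y else W.half x y)
  else if y.blk = b then W.half y x else 0

theorem sum_charge_le [Fintype Bk] [Fintype S] (x y : Vtx md Bk S) :
    ∑ b, W.charge b x y ≤ W.d x y := by
  by_cases h : x.blk = y.blk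
  · rw [Finset.sum_eq_single x.blk]
    · simp [charge, h]
    · intro b _ hb
      simp [charge, ← h, hb.symm]
    · simp
  · refine le_trans ?_ (W.half_add_le h)
    rw [Finset.sum_eq_add_of_mem x.blk y.blk (Finset.mem_univ _) (Finset.mem_univ _) h]
    · simp [charge, h, Ne.symm h]
    · intro b _ hb
      simp [charge, hb.1.symm, hb.2.symm]

section tour
variable {n : ℕ} (σ : Fin n ≃ Vtx md Bk S)

/-- How often a tour realizes the link between `t` and `u`. -/
def cnt (t u : Vtx md Bk S) : ℕ :=
  ∑ i, ((if real t u (σ i) (σ (finRotate n i)) then 1 else 0) +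
    (if real t u (σ (finRotate n i)) (σ i) then 1 else 0))

theorem cnt_symm (t u : Vtx md Bk S) : cnt σ t u = cnt σ u t := by
  unfold cnt
  refine Finset.sum_congr rfl fun i _ => ?_
  rw [add_comm]
  simp only [real_symm (t := t) (u := u)]

/-- The cost charged to the gadget `b`. -/
def cost (b : Bk ⊕ S) : ℕ := ∑ i, W.charge b (σ i) (σ (finRotate n i))

theorem sum_cost_le [Fintype Bk] [Fintype S] : ∑ b, W.cost σ b ≤ ∑ i, W.d (σ i) (σ (finRotate n i)) := by
  unfold cost
  rw [Finset.sum_comm]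
  exact Finset.sum_le_sum fun i _ => W.sum_charge_le _ _

/-- How often a tour realizes a link at `t`. -/
def deg (t : Vtx md Bk S) : ℕ := ((W.nbr t).map (cnt σ t)).sum

/-- The pair `(x, y)` realizes a link at `t`. -/
def realAt (t x y : Vtx md Bk S) : Prop := ∃ u ∈ W.nbr t, real t u x y

/-- The partners of `t` lie in different gadgets, so a step in a fixed direction realizes at most
one link at `t`. Hence adding the counts over all partners is the same as counting the steps. -/
theorem deg_eq (t : Vtx md Bk S) : W.deg σ t =
    ∑ i, ((if W.realAt t (σ i) (σ (finRotate n i)) then 1 else 0) +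
      (if W.realAt t (σ (finRotate n i)) (σ i) then 1 else 0)) := by
  have key : ∀ (x y : Vtx md Bk S) (l : List (Vtx md Bk S)),
      (l.Pairwise fun u v => u.blk ≠ v.blk) →
      (l.map fun u => if real t u x y then 1 else 0).sum =
        if ∃ u ∈ l, real t u x y then 1 else 0 := by
    intro x y l
    induction l with
    | nil => simp
    | cons a l ih =>
      intro hl
      rw [List.pairwise_cons] at hl
      rw [List.map_cons, List.sum_cons, ih hl.2]
      by_cases ha : real t a x y
      · have : ¬ ∃ u ∈ l, real t u x y := by
          rintro ⟨u, hu, hr⟩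
          exact hl.1 u hu (ha.2.1.1.symm.trans hr.2.1.1)
        simp [ha, this]
      · simp [ha]
  have e : ∀ x y, (if W.realAt t x y then 1 else 0) =
      ((W.nbr t).map fun u => if real t u x y then 1 else 0).sum := by
    intro x y
    rw [key x y _ (W.blk_pw t)]
    unfold realAt
    congr
  unfold deg cnt
  simp only [e]
  clear e
  generalize W.nbr t = l
  clear key
  induction l with
  | nil => simp
  | cons a l ih =>
    simp only [List.map_cons, List.sum_cons, ih, ← Finset.sum_add_distrib]
    exact Finset.sum_congr rfl fun i _ => by ring

end tour

/-! ### Lower bounds for parity gadgets -/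

/-- If the step starts exactly at one of the terminals, the other one cannot be near it, by
`gadD_term`. Otherwise it ends exactly at a common partner, and that vertex has only one partner in
this gadget. -/
theorem realAt_unique {b : Bk} {k k' : Fin (gadK md)} {x y : Vtx md Bk S}
    (h : W.realAt (.inl (b, k)) x y) (h' : W.realAt (.inl (b, k')) x y) : k = k' := by
  obtain ⟨u, hu, hr⟩ := h
  obtain ⟨u', hu', hr'⟩ := h'
  have hk := W.term _ _ _ hu
  have hk' := W.term _ _ _ hu'
  have hb : u.blk = u'.blk := hr.2.1.1.symm.trans hr'.2.1.1
  rcases hr.2.2 with h1 | h1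
  · rcases hr'.1.2 with h2 | h2
    · rw [h1] at h2; exact h2
    · rw [h1] at h2
      exact absurd h2 (gadD_term _ _ _ hk hk')
  · rcases hr'.2.2 with h2 | h2
    · rcases hr.1.2 with h3 | h3
      · rw [h2] at h3; exact h3.symm
      · rw [h2] at h3
        exact absurd h3 (gadD_term _ _ _ hk' hk)
    · have h3 : u = u' := h1.symm.trans h2
      subst h3
      have := W.partner_unique (W.symm _ _ hu) (W.symm _ _ hu') rfl
      simpa using this

/-- A step out of a gadget realizes no link, or starts exactly at a terminal, or starts beside a
terminal and ends exactly at its partner. In the first and the last case it is charged the full 2.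
-/
theorem half_cases {b : Bk} {x y : Vtx md Bk S} (hx : x.blk = .inl b) :
    (W.half x y = 2 ∧ ∀ k, ¬ W.realAt (.inl (b, k)) x y) ∨
    ∃ k, W.realAt (.inl (b, k)) x y ∧
      ((x.loc = k ∧ 1 ≤ W.half x y) ∨ (gadD md x.loc k = 1 ∧ W.half x y = 2)) := by
  rcases x with ⟨b', a⟩ | s
  swap
  · simp [blk] at hx
  obtain rfl : b' = b := by simpa [blk] using hx
  -- Hubs are linked to single vertices only, so the discount for hubs never applies to a gadget
  -- vertex.
  have h0 : ¬ ∃ u ∈ W.nbr (.inl (b', a)), near y u ∧ W.hubv u := by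
    rintro ⟨u, hu, -, hh⟩
    obtain ⟨r, hr, -⟩ := W.hub_partner hh (W.symm _ _ hu)
    exact absurd hr (by simp)
  have hhalf : W.half (.inl (b', a)) y =
      if ∃ u ∈ W.nbr (.inl (b', a)), near y u then 1 else 2 := by
    unfold half
    rw [if_neg (by simp [hubv]), if_neg h0]
  by_cases h1 : ∃ u ∈ W.nbr (.inl (b', a)), near y u
  · obtain ⟨u, hu, hn⟩ := h1
    right
    refine ⟨a, ⟨u, hu, near_refl _, hn, .inl rfl⟩, .inl ⟨rfl, ?_⟩⟩
    rw [hhalf, if_pos ⟨u, hu, hn⟩]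
  · rw [if_neg h1] at hhalf
    by_cases h2 : ∃ k, W.realAt (.inl (b', k)) (.inl (b', a)) y
    · obtain ⟨k, hk⟩ := h2
      right
      refine ⟨k, hk, .inr ⟨?_, hhalf⟩⟩
      obtain ⟨u, hu, hr⟩ := hk
      rcases hr.1.2 with h3 | h3
      · exact absurd ⟨u, (show a = k from h3) ▸ hu, hr.2.1⟩ h1
      · exact h3
    · push Not at h2
      exact .inl ⟨hhalf, h2⟩

end Net

/-- A dual solution bounding the cost of a parity gadget from below: vertex potentials, vertex sets
(in which a tour has fewer steps than vertices), terminals whose links are counted, and weights for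
the uses of inner edges. -/
structure Cert where
  pot : List ℤ
  cuts : List (List ℕ)
  ext : List ℕ
  edges : List ((ℕ × ℕ) × ℤ)

namespace Cert

def edgeVal (c : Cert) (a b : ℕ) : ℤ :=
  (c.edges.map fun e => if e.1 = (a, b) ∨ e.1 = (b, a) then e.2 else 0).sum

def cutVal (c : Cert) (a b : ℕ) : ℤ :=
  (c.cuts.map fun A => if a ∈ A ∧ b ∈ A then (2 : ℤ) else 0).sum

/-- Every vertex lies on two steps of the tour, hence the factor 2 of the potentials. A cut set `A`
has weight 2 and contains at most `|A| - 1` steps. -/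
def bound (c : Cert) : ℤ := 2 * c.pot.sum - (c.cuts.map fun A => 2 * ((A.length : ℤ) - 1)).sum

/-- Dual feasibility, one condition for each type of step. `inner` concerns the steps inside the
gadget; `outer` concerns those that leave it without a counted link, which are charged 2. A step
from a counted terminal is charged at least 1 and has to provide 1 for the count (`term`); a step
from a neighbour of the terminal is charged 2 and also provides 1 (`near`). -/
structure Valid (md : Bool) (c : Cert) : Prop where
  len : c.pot.length = gadK md
  cut : ∀ A ∈ c.cuts, A ≠ []
  nodup : c.ext.Nodup
  inner : ∀ a b : Fin (gadK md), a ≠ b →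
    c.pot.getD a 0 + c.pot.getD b 0 + c.edgeVal a b ≤ gadD md a b + c.cutVal a b
  outer : ∀ a : Fin (gadK md), c.pot.getD a 0 ≤ 2
  term : ∀ k ∈ c.ext, c.pot.getD k 0 ≤ 0
  near : ∀ k ∈ c.ext, ∀ a : Fin (gadK md), gadD md a k = 1 → c.pot.getD a 0 ≤ 1

end Cert
end


/-! ### Weak duality for parity gadgets -/

noncomputable section
open scoped Classical

open Vtx

namespace Net
variable {md : Bool} {Bk S : Type} (W : Net md Bk S)

/-- The potential of a vertex with respect to the gadget `b`. -/
def potAt (c : Cert) (b : Bk) (x : Vtx md Bk S) : ℤ :=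
  if x.blk = .inl b then c.pot.getD x.loc 0 else 0

def inCut (b : Bk) (A : List ℕ) (x : Vtx md Bk S) : Prop := x.blk = .inl b ∧ (x.loc : ℕ) ∈ A

/-- The pair `(x, y)` is the inner edge `e` of the gadget `b`. -/
def isEdge (b : Bk) (e : ℕ × ℕ) (x y : Vtx md Bk S) : Prop :=
  x.blk = .inl b ∧ y.blk = .inl b ∧ (e = (↑x.loc, ↑y.loc) ∨ e = (↑y.loc, ↑x.loc))

theorem list_sum_eq_zero {ι : Type} (l : List ι) (f : ι → ℤ) (h : ∀ a ∈ l, f a = 0) :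
    (l.map f).sum = 0 := by
  induction l with
  | nil => rfl
  | cons a l ih => rw [List.map_cons, List.sum_cons, h a (by simp), ih fun a ha => h a (by simp [ha])]; rfl

theorem list_sum_nonneg {ι : Type} (l : List ι) (f : ι → ℤ) (h : ∀ a ∈ l, 0 ≤ f a) :
    0 ≤ (l.map f).sum := by
  induction l with
  | nil => simp
  | cons a l ih =>
    rw [List.map_cons, List.sum_cons]
    have := h a (by simp)
    have := ih fun a ha => h a (by simp [ha])
    omega

theorem list_sum_ext (l : List ℕ) (hl : l.Nodup) (P : ℕ → Prop) (k₀ : ℕ)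
    (h : ∀ k ∈ l, P k → k = k₀) :
    (l.map fun k => if P k then (1 : ℤ) else 0).sum ≤ if k₀ ∈ l then 1 else 0 := by
  induction l with
  | nil => simp
  | cons a l ih =>
    rw [List.nodup_cons] at hl
    have := ih hl.2 fun k hk => h k (by simp [hk])
    rw [List.map_cons, List.sum_cons]
    by_cases ha : P a
    · have hak := h a (by simp) ha
      subst hak
      rw [if_neg hl.1] at this
      simp [ha]
      omega
    · rw [if_neg ha]
      by_cases hk : k₀ ∈ l
      · simp [hk] at this ⊢; omega
      · simp only [hk, if_false] at this
        split_ifs <;> omega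

/-- Reduction modulo the number of vertices only makes the function total. -/
def termOf (b : Bk) (k : ℕ) : Vtx md Bk S := .inl (b, ⟨k % gadK md,
  Nat.mod_lt _ ((Nat.zero_lt_succ 3).trans (gadK_pos md))⟩)

/-- The cases of `half_cases` correspond to the conditions `outer`, `term` and `near`, and by
`realAt_unique` at most one summand of the list is nonzero. Terminals missing from `c.ext` are
assumed to have no link in use. -/
theorem step_out {c : Cert} (hc : c.Valid md) {b : Bk} {x y : Vtx md Bk S} (hx : x.blk = .inl b)
    (hext : ∀ k : Fin (gadK md), (k : ℕ) ∉ c.ext → ¬ W.realAt (.inl (b, k)) x y)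
    (hK : ∀ k ∈ c.ext, k < gadK md) :
    potAt c b x + (c.ext.map fun k => if W.realAt (termOf b k) x y then (1 : ℤ) else 0).sum ≤
      W.half x y := by
  have hp : potAt c b x = c.pot.getD x.loc 0 := by rw [potAt, if_pos hx]
  have ht : ∀ k (hk : k < gadK md), (termOf b k : Vtx md Bk S) = .inl (b, ⟨k, hk⟩) := by
    intro k hk
    simp [termOf, Nat.mod_eq_of_lt hk]
  rw [hp]
  rcases W.half_cases (y := y) hx with ⟨h2, hno⟩ | ⟨k, hk, h⟩
  · have : (c.ext.map fun k => if W.realAt (termOf b k) x y then (1 : ℤ) else 0).sum = 0 := by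
      apply list_sum_eq_zero
      intro k _
      exact if_neg (hno _)
    rw [this, h2]
    simpa using hc.outer x.loc
  · have hmem : (k : ℕ) ∈ c.ext := by
      by_contra hmem
      exact hext k hmem hk
    have hs := list_sum_ext c.ext hc.nodup (fun k => W.realAt (termOf b k) x y) k (by
      intro k' hk' hr
      rw [ht k' (hK k' hk')] at hr
      rw [W.realAt_unique hk hr])
    rw [if_pos hmem] at hs
    rcases h with ⟨h1, h2⟩ | ⟨h1, h2⟩
    · have := hc.term k hmem
      rw [h1]
      omega
    · have := hc.near k hmem x.loc h1
      rw [h2]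
      push_cast
      omega

theorem not_realAt_of_blk {b : Bk} {k : Fin (gadK md)} {x y : Vtx md Bk S} (h : x.blk ≠ .inl b) :
    ¬ W.realAt (.inl (b, k)) x y := by
  rintro ⟨u, -, hr⟩
  exact h hr.1.1

theorem not_realAt_inner {b : Bk} {k : Fin (gadK md)} {x y : Vtx md Bk S} (h : y.blk = .inl b) :
    ¬ W.realAt (.inl (b, k)) x y := by
  rintro ⟨u, hu, hr⟩
  exact W.blk_ne _ _ hu (hr.2.1.1.symm.trans h)

/-- The dual constraint of a single step; `cert_le` is its sum over the tour. The counts of links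
are nonzero only for steps that leave the gadget, the terms of inner edges and cuts only for steps
inside it. -/
theorem step_le {c : Cert} (hc : c.Valid md) {b : Bk} {x y : Vtx md Bk S} (hne : x ≠ y)
    (hext : ∀ k : Fin (gadK md), (k : ℕ) ∉ c.ext →
      ¬ W.realAt (.inl (b, k)) x y ∧ ¬ W.realAt (.inl (b, k)) y x)
    (hK : ∀ k ∈ c.ext, k < gadK md) :
    potAt c b x + potAt c b y +
      (c.ext.map fun k => (if W.realAt (termOf b k) x y then (1 : ℤ) else 0) +
        (if W.realAt (termOf b k) y x then 1 else 0)).sum +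
      (c.edges.map fun e => if isEdge b e.1 x y then e.2 else 0).sum ≤
    W.charge (.inl b) x y +
      (c.cuts.map fun A => 2 * (if inCut b A x ∧ inCut b A y then (1 : ℤ) else 0)).sum := by
  have hcut : 0 ≤ (c.cuts.map fun A => 2 * (if inCut b A x ∧ inCut b A y then (1 : ℤ) else 0)).sum :=
    list_sum_nonneg _ _ fun A _ => by split_ifs <;> omega
  have hadd : (c.ext.map fun k => (if W.realAt (termOf b k) x y then (1 : ℤ) else 0) +
        (if W.realAt (termOf b k) y x then 1 else 0)).sum =
      (c.ext.map fun k => if W.realAt (termOf b k) x y then (1 : ℤ) else 0).sum +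
      (c.ext.map fun k => if W.realAt (termOf b k) y x then (1 : ℤ) else 0).sum :=
    List.sum_map_add
  rw [hadd]
  have hzero : ∀ x y : Vtx md Bk S, (x.blk ≠ .inl b ∨ y.blk = .inl b) →
      (c.ext.map fun k => if W.realAt (termOf b k) x y then (1 : ℤ) else 0).sum = 0 := by
    intro x y h
    apply list_sum_eq_zero
    intro k _
    rw [if_neg]
    rcases h with h | h
    · exact W.not_realAt_of_blk h
    · exact W.not_realAt_inner h
  have hedge : (x.blk ≠ .inl b ∨ y.blk ≠ .inl b) →
      (c.edges.map fun e => if isEdge b e.1 x y then e.2 else 0).sum = 0 := by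
    intro h
    apply list_sum_eq_zero
    intro e _
    rw [if_neg]
    rintro ⟨h1, h2, -⟩
    tauto
  by_cases hx : x.blk = .inl b
  · by_cases hy : y.blk = .inl b
    · rw [hzero x y (.inr hy), hzero y x (.inr hx), potAt, potAt, if_pos hx, if_pos hy, charge,
        if_pos hx, if_pos hy, d, if_pos (hx.trans hy.symm)]
      have h := hc.inner x.loc y.loc fun h => hne (ext_iff'.2 ⟨hx.trans hy.symm, h⟩)
      have h1 : (c.edges.map fun e => if isEdge b e.1 x y then e.2 else 0).sum =
          c.edgeVal x.loc y.loc := by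
        unfold Cert.edgeVal isEdge
        congr 1
        refine List.map_congr_left fun e _ => ?_
        simp [hx, hy]
      have h2 : (c.cuts.map fun A => 2 * (if inCut b A x ∧ inCut b A y then (1 : ℤ) else 0)).sum =
          c.cutVal x.loc y.loc := by
        unfold Cert.cutVal inCut
        congr 1
        refine List.map_congr_left fun A _ => ?_
        simp [hx, hy]
      rw [h1, h2]
      omega
    · rw [hzero y x (.inl hy), hedge (.inr hy)]
      have h1 : potAt c b y = 0 := by rw [potAt, if_neg hy]
      have h2 := W.step_out hc hx (fun k hk => (hext k hk).1) hK
      rw [charge, if_pos hx, if_neg hy]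
      omega
  · by_cases hy : y.blk = .inl b
    · rw [hzero x y (.inl hx), hedge (.inl hx)]
      have h1 : potAt c b x = 0 := by rw [potAt, if_neg hx]
      have h2 := W.step_out hc hy (fun k hk => (hext k hk).2) hK
      rw [charge, if_neg hx, if_pos hy]
      omega
    · rw [hzero x y (.inl hx), hzero y x (.inl hy), hedge (.inl hx), potAt, potAt, if_neg hx,
        if_neg hy]
      have := Int.natCast_nonneg (W.charge (.inl b) x y)
      omega

variable {n : ℕ} (σ : Fin n ≃ Vtx md Bk S)

/-- How often a tour uses an inner edge of the gadget `b`. -/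
def uses (b : Bk) (e : ℕ × ℕ) : ℕ :=
  ∑ i, if isEdge b e (σ i) (σ (finRotate n i)) then 1 else 0

theorem finRotate_ne (hn : 2 ≤ n) (i : Fin n) : i ≠ finRotate n i := by
  obtain ⟨m, rfl⟩ : ∃ m, n = m + 2 := ⟨n - 2, by omega⟩
  rw [finRotate_apply]
  intro h
  simp at h

theorem card_inCut_le [Fintype Bk] [Fintype S] (b : Bk) (A : List ℕ) :
    (Finset.univ.filter fun x : Vtx md Bk S => inCut b A x).card ≤ A.length := by
  refine le_trans ?_ A.toFinset_card_le
  refine Finset.card_le_card_of_injOn (fun x => (x.loc : ℕ)) ?_ ?_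
  · intro x hx
    simpa using (Finset.mem_filter.1 hx).2.2
  · intro x hx y hy h
    have h1 := (Finset.mem_filter.1 hx).2.1
    have h2 := (Finset.mem_filter.1 hy).2.1
    exact ext_iff'.2 ⟨h1.trans h2.symm, Fin.ext h⟩

theorem sum_list_comm {ι : Type} (l : List ι) (f : Fin n → ι → ℤ) :
    ∑ i, (l.map (f i)).sum = (l.map fun a => ∑ i, f i a).sum := by
  induction l with
  | nil => simp
  | cons a l ih => simp only [List.map_cons, List.sum_cons, Finset.sum_add_distrib, ih]

theorem sum_potAt [Fintype Bk] [Fintype S] (c : Cert) (hlen : c.pot.length = gadK md) (b : Bk) :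
    ∑ x : Vtx md Bk S, potAt c b x = c.pot.sum := by
  rw [Fintype.sum_sum_type, Fintype.sum_prod_type, Finset.sum_eq_single b]
  · have h1 : ∀ s : S, potAt (md := md) c b (.inr s) = 0 := fun s => by simp [potAt, blk]
    simp only [h1, Finset.sum_const_zero, add_zero]
    have h2 : ∀ k : Fin (gadK md), potAt (S := S) c b (.inl (b, k)) = c.pot.getD k 0 := fun k => by
      simp [potAt, blk, loc]
    simp only [h2]
    rw [← Fin.sum_univ_getElem, ← hlen]
    simp
  · intro b' _ hb
    refine Finset.sum_eq_zero fun k _ => ?_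
    simp [potAt, blk, hb]
  · simp

/-- Weak duality. Summed over the tour, the potentials appear twice, the link terms become the
degrees of the terminals, and each cut set is controlled by `subtour`, which applies because the
tour also has points outside the gadget. -/
theorem cert_le [Fintype Bk] [Fintype S] (hn : 2 ≤ n) {c : Cert} (hc : c.Valid md) (b : Bk)
    (hK : ∀ k ∈ c.ext, k < gadK md)
    (hout : ∃ x : Vtx md Bk S, x.blk ≠ .inl b)
    (hext : ∀ k : Fin (gadK md), (k : ℕ) ∉ c.ext → W.deg σ (.inl (b, k)) = 0) :
    c.bound + (c.ext.map fun k => (W.deg σ (termOf b k) : ℤ)).sum +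
      (c.edges.map fun e => e.2 * (uses σ b e.1 : ℤ)).sum ≤ W.cost σ (.inl b) := by
  have h := Finset.sum_le_sum fun i (_ : i ∈ Finset.univ) =>
    W.step_le (b := b) (x := σ i) (y := σ (finRotate n i)) hc
      (fun h => finRotate_ne hn i (σ.injective h)) (fun k hk => by
        have := hext k hk
        rw [deg_eq, Finset.sum_eq_zero_iff] at this
        have := this i (Finset.mem_univ _)
        constructor
        · intro h; rw [if_pos h] at this; omega
        · intro h; rw [if_pos h] at this; omega) hK
  simp only [Finset.sum_add_distrib, sum_list_comm] at h
  have h1 := sum_finRotate σ (potAt c b)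
  rw [Finset.sum_add_distrib, sum_potAt c hc.len] at h1
  have h2 : ∀ k, (∑ i, ((if W.realAt (termOf b k) (σ i) (σ (finRotate n i)) then (1 : ℤ) else 0))) +
      ∑ i, (if W.realAt (termOf b k) (σ (finRotate n i)) (σ i) then 1 else 0) =
      W.deg σ (termOf b k) := by
    intro k
    rw [deg_eq, ← Finset.sum_add_distrib]
    push_cast
    rfl
  have h3 : ∀ e : (ℕ × ℕ) × ℤ,
      ∑ i, (if isEdge b e.1 (σ i) (σ (finRotate n i)) then e.2 else 0) =
        e.2 * (uses σ b e.1 : ℤ) := by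
    intro e
    unfold uses
    push_cast
    rw [Finset.mul_sum]
    refine Finset.sum_congr rfl fun i _ => ?_
    split_ifs <;> simp
  have h4 : ∑ i, (W.charge (.inl b) (σ i) (σ (finRotate n i)) : ℤ) = W.cost σ (.inl b) := by
    unfold cost
    push_cast
    rfl
  have h5 : (c.cuts.map fun A => ∑ i, 2 * (if inCut b A (σ i) ∧ inCut b A (σ (finRotate n i))
      then (1 : ℤ) else 0)).sum ≤ (c.cuts.map fun A => 2 * ((A.length : ℤ) - 1)).sum := by
    refine List.sum_le_sum fun A hA => ?_
    rw [← Finset.mul_sum]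
    have h6 := subtour σ (fun x => inCut b A x) (by
      obtain ⟨x, hx⟩ := hout
      exact ⟨x, fun h => hx h.1⟩)
    have h7 := card_inCut_le (md := md) (S := S) b A
    have h8 := List.length_pos_iff.2 (hc.cut A hA)
    have h9 : (∑ i, (if inCut b A (σ i) ∧ inCut b A (σ (finRotate n i)) then (1 : ℤ) else 0)) =
        ((∑ i, (if inCut b A (σ i) ∧ inCut b A (σ (finRotate n i)) then 1 else 0) : ℕ) : ℤ) := by
      push_cast
      rfl
    rw [h9]
    omega
  simp only [h2, h3, h4] at h
  unfold Cert.bound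
  linarith

end Net
end


/-! ### Dual solutions and the cost of a parity gadget -/

noncomputable section
open scoped Classical

open Vtx

/-- The certificates for the parity gadgets. -/
def gadCert : Bool → List Cert
  | false => [
    ⟨[0, 0, 0, 0, 2, 2, 2, 2], [[4, 5]], [0, 1, 2, 3], []⟩,
    ⟨[2, 0, 2, 0, 2, 2, 2, 2], [[0, 2, 4, 5, 7]], [1, 3], []⟩,
    ⟨[0, 2, 0, 2, 2, 2, 2, 2], [[1, 3, 4, 5, 6]], [0, 2], []⟩,
    ⟨[2, 0, 0, 2, 0, 2, 2, 2], [[0, 7], [3, 6]], [1, 2], []⟩,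
    ⟨[0, 2, 2, 0, 2, 0, 2, 2], [[1, 6], [2, 7]], [0, 3], []⟩,
    ⟨[2, 2, 2, 2, 2, 2, 2, 2], [[0, 1, 2, 3, 4, 5, 6, 7]], [], []⟩]
  | true => [
    ⟨[0, 0, 0, 0, 1, 1, 1, 1, 2], [[4, 5, 8]], [0, 1, 2, 3], []⟩,
    ⟨[2, 0, 2, 0, 1, 1, 1, 1, 2], [[0, 2, 4, 5, 7, 8]], [1, 3], []⟩,
    ⟨[0, 2, 0, 2, 1, 1, 1, 1, 2], [[1, 3, 4, 5, 6, 8]], [0, 2], []⟩,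
    -- A case distinction for the terminals 1 and 2. The first two certificates lose 2 for each use
    -- of the edge 0–4 or 3–4, respectively; the third has a bound smaller by 4 but gains 2 for each
    -- use of either edge. As an edge is used at most once, one of the three always gives the value
    -- 10. The three that follow treat the terminals 3 and 0 in the same way, with the edges 1–5 and
    -- 2–5.
    ⟨[2, 0, 0, 0, 1, 1, 1, 1, 0], [[0, 7]], [1, 2], [((0, 4), -2)]⟩,
    ⟨[0, 0, 0, 2, 1, 1, 1, 1, 0], [[3, 6]], [1, 2], [((3, 4), -2)]⟩,
    ⟨[0, 0, 0, 0, -1, 1, 1, 1, 2], [[5, 8]], [1, 2], [((3, 4), 2), ((0, 4), 2)]⟩,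
    ⟨[0, 2, 0, 0, 1, 1, 1, 1, 0], [[1, 6]], [3, 0], [((1, 5), -2)]⟩,
    ⟨[0, 0, 2, 0, 1, 1, 1, 1, 0], [[2, 7]], [3, 0], [((2, 5), -2)]⟩,
    ⟨[0, 0, 0, 0, 1, -1, 1, 1, 2], [[4, 8]], [3, 0], [((2, 5), 2), ((1, 5), 2)]⟩,
    ⟨[2, 2, 2, 2, 1, 1, 1, 1, 2], [[0, 1, 2, 3, 4, 5, 6, 7, 8]], [], []⟩]

theorem gadCert_valid (md : Bool) : ∀ c ∈ gadCert md, c.Valid md := by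
  have h : ∀ c ∈ gadCert md, (c.pot.length = gadK md ∧ (∀ A ∈ c.cuts, A ≠ []) ∧ c.ext.Nodup ∧
      (∀ a b : Fin (gadK md), a ≠ b →
        c.pot.getD a 0 + c.pot.getD b 0 + c.edgeVal a b ≤ gadD md a b + c.cutVal a b) ∧
      (∀ a : Fin (gadK md), c.pot.getD a 0 ≤ 2)) ∧ (∀ k ∈ c.ext, c.pot.getD k 0 ≤ 0) ∧
      ∀ k ∈ c.ext, ∀ a : Fin (gadK md), gadD md a k = 1 → c.pot.getD a 0 ≤ 1 := by
    cases md
    · decide +kernel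
    · decide +kernel
  intro c hc
  obtain ⟨⟨h1, h2, h3, h4, h5⟩, h6, h7⟩ := h c hc
  exact ⟨h1, h2, h3, h4, h5, h6, h7⟩

theorem gadCert_ext (md : Bool) : ∀ c ∈ gadCert md, ∀ k ∈ c.ext, k < 4 := by
  cases md <;> decide

/-- The excess cost of a parity gadget, as a function of how often links at its terminals are
realized. -/
def gadDelta (n₀ n₁ n₂ n₃ : ℕ) : ℕ :=
  min ((n₀ - 1) + (1 - n₀) + ((n₁ - 1) + (1 - n₁)) + n₂ + n₃)
    (n₀ + n₁ + ((n₂ - 1) + (1 - n₂)) + ((n₃ - 1) + (1 - n₃)))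

/-- If both terminals of one traversal are used, the excess is at most the sum of the degrees minus
2, and `h1` suffices. Otherwise one of `n₀, n₁` and one of `n₂, n₃` vanish, which leaves the
patterns of the other hypotheses. -/
theorem gadDelta_le {a C n₀ n₁ n₂ n₃ : ℕ} (h1 : a + (n₀ + n₁ + n₂ + n₃) ≤ C + 2)
    (h2 : n₀ = 0 → n₂ = 0 → a + (n₁ + n₃) ≤ C) (h3 : n₁ = 0 → n₃ = 0 → a + (n₀ + n₂) ≤ C)
    (h4 : n₀ = 0 → n₃ = 0 → 1 ≤ n₁ → 1 ≤ n₂ → a + (n₁ + n₂) ≤ C)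
    (h5 : n₁ = 0 → n₂ = 0 → 1 ≤ n₀ → 1 ≤ n₃ → a + (n₀ + n₃) ≤ C)
    (h6 : n₀ = 0 → n₁ = 0 → n₂ = 0 → n₃ = 0 → a + 2 ≤ C) :
    a + gadDelta n₀ n₁ n₂ n₃ ≤ C := by
  have hA : gadDelta n₀ n₁ n₂ n₃ ≤ _ := min_le_left _ _
  have hB : gadDelta n₀ n₁ n₂ n₃ ≤ _ := min_le_right _ _
  generalize gadDelta n₀ n₁ n₂ n₃ = D at *
  rcases Nat.eq_zero_or_pos n₀ with rfl | e0 <;> rcases Nat.eq_zero_or_pos n₁ with rfl | e1 <;>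
    rcases Nat.eq_zero_or_pos n₂ with rfl | e2 <;> rcases Nat.eq_zero_or_pos n₃ with rfl | e3 <;>
    omega

namespace Net
variable {md : Bool} {Bk S : Type} (W : Net md Bk S)
variable {n : ℕ} (σ : Fin n ≃ Vtx md Bk S)

/-- The subtour inequality for the two ends of the edge. -/
theorem uses_le_one [Fintype Bk] [Fintype S] (b : Bk) (e : ℕ × ℕ) (hout : ∃ x : Vtx md Bk S, x.blk ≠ .inl b) :
    uses σ b e ≤ 1 := by
  have h1 := subtour σ (fun x => inCut b [e.1, e.2] x) (by
    obtain ⟨x, hx⟩ := hout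
    exact ⟨x, fun h => hx h.1⟩)
  have h2 := card_inCut_le (md := md) (S := S) b [e.1, e.2]
  refine le_trans (Finset.sum_le_sum fun i _ => ?_) (h1.trans (Nat.sub_le_sub_right h2 1))
  by_cases h : isEdge b e (σ i) (σ (finRotate n i))
  · rw [if_pos h, if_pos]
    obtain ⟨hx, hy, h | h⟩ := h
    · subst h; exact ⟨⟨hx, by simp⟩, hy, by simp⟩
    · subst h; exact ⟨⟨hx, by simp⟩, hy, by simp⟩
  · rw [if_neg h]; omega

theorem deg_eq_zero_of_four_le (b : Bk) (k : Fin (gadK md)) (h : 4 ≤ (k : ℕ)) :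
    W.deg σ (.inl (b, k)) = 0 := by
  have : W.nbr (.inl (b, k)) = [] := by
    by_contra hne
    obtain ⟨y, hy⟩ := List.exists_mem_of_ne_nil _ hne
    have := W.term _ _ _ hy
    omega
  simp [deg, this]

/-- The cost of a parity gadget in a tour. -/
theorem le_cost_gad [Fintype Bk] [Fintype S] (hn : 2 ≤ n) (b : Bk) (hout : ∃ x : Vtx md Bk S, x.blk ≠ .inl b) :
    gadBase md + gadDelta (W.deg σ (termOf b 0)) (W.deg σ (termOf b 1)) (W.deg σ (termOf b 2))
      (W.deg σ (termOf b 3)) ≤ W.cost σ (.inl b) := by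
  have h4 : ∀ k : Fin (gadK md), 4 ≤ (k : ℕ) ∨ .inl (b, k) = (termOf b 0 : Vtx md Bk S) ∧ (k : ℕ) = 0 ∨
      .inl (b, k) = (termOf b 1 : Vtx md Bk S) ∧ (k : ℕ) = 1 ∨
      .inl (b, k) = (termOf b 2 : Vtx md Bk S) ∧ (k : ℕ) = 2 ∨
      .inl (b, k) = (termOf b 3 : Vtx md Bk S) ∧ (k : ℕ) = 3 := by
    intro k
    have hk : (.inl (b, k) : Vtx md Bk S) = termOf b k := by
      simp [termOf, Nat.mod_eq_of_lt k.2]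
    by_cases h : 4 ≤ (k : ℕ)
    · exact .inl h
    · right
      rw [hk]
      have : (k : ℕ) = 0 ∨ (k : ℕ) = 1 ∨ (k : ℕ) = 2 ∨ (k : ℕ) = 3 := by omega
      rcases this with h | h | h | h <;> simp [h]
  have hext : ∀ l : List ℕ, (0 ∈ l ∨ W.deg σ (termOf b 0) = 0) → (1 ∈ l ∨ W.deg σ (termOf b 1) = 0) →
      (2 ∈ l ∨ W.deg σ (termOf b 2) = 0) → (3 ∈ l ∨ W.deg σ (termOf b 3) = 0) →
      ∀ k : Fin (gadK md), (k : ℕ) ∉ l → W.deg σ (.inl (b, k)) = 0 := by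
    intro l h0 h1 h2 h3 k hk
    rcases h4 k with h | ⟨h, h'⟩ | ⟨h, h'⟩ | ⟨h, h'⟩ | ⟨h, h'⟩
    · exact W.deg_eq_zero_of_four_le σ b k h
    all_goals rw [h]; rw [h'] at hk; tauto
  have key : ∀ c ∈ gadCert md, _ := fun c hc => W.cert_le σ hn (gadCert_valid md c hc) b
    (fun k hk => lt_of_lt_of_le (gadCert_ext md c hc k hk) (gadK_pos md).le) hout
  have hu := fun e => uses_le_one σ b e hout
  generalize W.cost σ (.inl b) = C at *
  generalize hn0 : W.deg σ (termOf b 0) = n0 at *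
  generalize hn1 : W.deg σ (termOf b 1) = n1 at *
  generalize hn2 : W.deg σ (termOf b 2) = n2 at *
  generalize hn3 : W.deg σ (termOf b 3) = n3 at *
  cases md
  · simp only [gadCert, List.forall_mem_cons, Cert.bound, List.map_cons, List.map_nil, List.sum_cons,
      List.sum_nil, hn0, hn1, hn2, hn3, List.length_cons, List.length_nil] at key
    obtain ⟨k1, k2, k3, k4, k5, k6, -⟩ := key
    have k1 := k1 (hext _ (by simp) (by simp) (by simp) (by simp))
    have k2 := fun h h' => k2 (hext _ (.inr h) (by simp) (.inr h') (by simp))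
    have k3 := fun h h' => k3 (hext _ (by simp) (.inr h) (by simp) (.inr h'))
    have k4 := fun h h' => k4 (hext _ (.inr h) (by simp) (by simp) (.inr h'))
    have k5 := fun h h' => k5 (hext _ (by simp) (.inr h) (.inr h') (by simp))
    have k6 := fun h h' h2 h3 => k6 (hext _ (.inr h) (.inr h') (.inr h2) (.inr h3))
    clear hext h4 hu hn0 hn1 hn2 hn3
    simp only [gadBase]
    apply gadDelta_le <;> intros <;> omega
  · simp only [gadCert, List.forall_mem_cons, Cert.bound, List.map_cons, List.map_nil, List.sum_cons,
      List.sum_nil, hn0, hn1, hn2, hn3, List.length_cons, List.length_nil] at key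
    obtain ⟨k1, k2, k3, k4, k5, k6, k7, k8, k9, k10, -⟩ := key
    have k1 := k1 (hext _ (by simp) (by simp) (by simp) (by simp))
    have k2 := fun h h' => k2 (hext _ (.inr h) (by simp) (.inr h') (by simp))
    have k3 := fun h h' => k3 (hext _ (by simp) (.inr h) (by simp) (.inr h'))
    have k4 := fun h h' => k4 (hext _ (.inr h) (by simp) (by simp) (.inr h'))
    have k5 := fun h h' => k5 (hext _ (.inr h) (by simp) (by simp) (.inr h'))
    have k6 := fun h h' => k6 (hext _ (.inr h) (by simp) (by simp) (.inr h'))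
    have k7 := fun h h' => k7 (hext _ (by simp) (.inr h) (.inr h') (by simp))
    have k8 := fun h h' => k8 (hext _ (by simp) (.inr h) (.inr h') (by simp))
    have k9 := fun h h' => k9 (hext _ (by simp) (.inr h) (.inr h') (by simp))
    have k10 := fun h h' h2 h3 => k10 (hext _ (.inr h) (.inr h') (.inr h2) (.inr h3))
    -- Integrality enters here: since the uses are 0 or 1, the three bounds available for one
    -- pattern of terminals combine to the desired one.
    have u1 := hu (0, 4)
    have u2 := hu (3, 4)
    have u3 := hu (1, 5)
    have u4 := hu (2, 5)
    generalize uses σ b (0, 4) = x1 at *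
    generalize uses σ b (3, 4) = x2 at *
    generalize uses σ b (1, 5) = x3 at *
    generalize uses σ b (2, 5) = x4 at *
    clear hext h4 hu hn0 hn1 hn2 hn3
    simp only [gadBase]
    apply gadDelta_le
    · clear k2 k3 k4 k5 k6 k7 k8 k9 k10; omega
    · intro h h'; have := k2 h h'; clear k1 k2 k3 k4 k5 k6 k7 k8 k9 k10; omega
    · intro h h'; have := k3 h h'; clear k1 k2 k3 k4 k5 k6 k7 k8 k9 k10; omega
    · intro h h' _ _; have := k4 h h'; have := k5 h h'; have := k6 h h'
      clear k1 k2 k3 k4 k5 k6 k7 k8 k9 k10; omega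
    · intro h h' _ _; have := k7 h h'; have := k8 h h'; have := k9 h h'
      clear k1 k2 k3 k4 k5 k6 k7 k8 k9 k10; omega
    · intro h h' h'' h'''; have := k10 h h' h'' h'''; clear k1 k2 k3 k4 k5 k6 k7 k8 k9 k10; omega

end Net
end


noncomputable section
open scoped Classical

open Vtx

namespace Net
variable {md : Bool} {Bk S : Type} (W : Net md Bk S)

/-! ### Lower bounds for single vertices -/

/-- What a realized link to `u` may take off the charge 2 of a step at a single vertex: a hub pays
for the whole link, any other partner for half of it. -/
def weight (u : Vtx md Bk S) : ℕ := if W.hubv u then 2 else 1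

theorem two_le_half (x y : Vtx md Bk S) :
    2 ≤ W.half x y + ((W.nbr x).map fun u => W.weight u * if real x u x y then 1 else 0).sum := by
  have key : ∀ u ∈ W.nbr x, near y u → W.weight u ≤
      ((W.nbr x).map fun u => W.weight u * if real x u x y then 1 else 0).sum := by
    intro u hu hn
    have h : W.weight u * (if real x u x y then 1 else 0) ∈
        (W.nbr x).map fun u => W.weight u * if real x u x y then 1 else 0 :=
      List.mem_map_of_mem hu
    have := List.le_sum_of_mem h
    rwa [if_pos ⟨near_refl x, hn, .inl rfl⟩, mul_one] at this
  by_cases hx : W.hubv x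
  · simp [half, hx]
  by_cases h1 : ∃ u ∈ W.nbr x, near y u ∧ W.hubv u
  · obtain ⟨u, hu, hn, hh⟩ := h1
    have := key u hu hn
    rw [weight, if_pos hh] at this
    omega
  by_cases h2 : ∃ u ∈ W.nbr x, near y u
  · have h3 : W.half x y = 1 := by
      unfold half
      rw [if_neg hx, if_neg h1, if_pos h2]
    obtain ⟨u, hu, hn⟩ := h2
    have := key u hu hn
    have h4 : 1 ≤ W.weight u := by unfold weight; split_ifs <;> omega
    omega
  · have h3 : W.half x y = 2 := by
      unfold half
      rw [if_neg hx, if_neg h1, if_neg h2]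
    omega

section tour
variable {n : ℕ} (σ : Fin n ≃ Vtx md Bk S)

theorem sum_ind [Fintype Bk] [Fintype S] (v : Vtx md Bk S) :
    ∑ i, ((if σ i = v then 1 else 0) + (if σ (finRotate n i) = v then 1 else 0)) = 2 := by
  have := sum_finRotate σ (fun x => if x = v then 1 else 0)
  rw [Finset.sum_ite_eq' Finset.univ v, if_pos (Finset.mem_univ _)] at this
  exact_mod_cast this

/-- Each of the two steps at a single vertex is charged 2, less the weight of the link that it
realizes. -/
theorem four_le_cost_add [Fintype Bk] [Fintype S] (hn : 2 ≤ n) (s : S) :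
    4 ≤ W.cost σ (.inr s) +
      ((W.nbr (.inr s)).map fun u => W.weight u * cnt σ (.inr s) u).sum := by
  set v : Vtx md Bk S := .inr s with hv
  have hstep : ∀ i, 2 * ((if σ i = v then 1 else 0) + (if σ (finRotate n i) = v then 1 else 0)) ≤
      W.charge (.inr s) (σ i) (σ (finRotate n i)) +
      (((W.nbr v).map fun u => W.weight u * if real v u (σ i) (σ (finRotate n i)) then 1 else 0).sum +
      ((W.nbr v).map fun u => W.weight u * if real v u (σ (finRotate n i)) (σ i) then 1 else 0).sum) := by
    intro i
    have hne : σ i ≠ σ (finRotate n i) := fun h => finRotate_ne hn i (σ.injective h)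
    generalize σ i = x at *
    generalize σ (finRotate n i) = y at *
    have hb : ∀ z : Vtx md Bk S, z ≠ v → z.blk ≠ .inr s := by
      intro z hz h
      rcases z with p | r
      · simp [blk] at h
      · exact hz (by rw [hv]; simpa [blk] using h)
    by_cases hx : x = v
    · rw [hx] at hne ⊢
      have h1 : W.charge (.inr s) v y = W.half v y := by
        rw [charge, if_pos (show v.blk = .inr s from rfl), if_neg (hb y hne.symm)]
      have := W.two_le_half v y
      rw [if_pos rfl, if_neg hne.symm, h1]
      omega
    · by_cases hy : y = v
      · rw [hy]
        have h1 : W.charge (.inr s) x v = W.half v x := by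
          rw [charge, if_neg (hb x hx), if_pos (show v.blk = .inr s from rfl)]
        have := W.two_le_half v x
        rw [if_neg hx, if_pos rfl, h1]
        omega
      · rw [if_neg hx, if_neg hy]
        omega
  have h := Finset.sum_le_sum fun i (_ : i ∈ Finset.univ) => hstep i
  rw [← Finset.mul_sum, sum_ind, Finset.sum_add_distrib] at h
  refine h.trans (Nat.add_le_add_left (le_of_eq ?_) _)
  unfold cnt
  generalize W.nbr v = l
  induction l with
  | nil => simp
  | cons a l ih =>
    simp only [List.map_cons, List.sum_cons]
    rw [← ih, Finset.mul_sum]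
    simp only [← Finset.sum_add_distrib]
    exact Finset.sum_congr rfl fun i _ => by ring

/-- A hub is charged 2 for each of its two steps, whether they are links or not; therefore the links
at hubs need no counting from the side of the hub. -/
theorem four_le_cost_hub [Fintype Bk] [Fintype S] (hn : 2 ≤ n) (s : S) (hs : W.hub s = true) :
    4 ≤ W.cost σ (.inr s) := by
  have hstep : ∀ i, 2 * ((if σ i = (.inr s) then 1 else 0) +
      (if σ (finRotate n i) = (.inr s) then 1 else 0)) ≤
      W.charge (.inr s) (σ i) (σ (finRotate n i)) := by
    intro i
    have hne : σ i ≠ σ (finRotate n i) := fun h => finRotate_ne hn i (σ.injective h)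
    generalize σ i = x at *
    generalize σ (finRotate n i) = y at *
    have hb : ∀ z : Vtx md Bk S, z ≠ .inr s → z.blk ≠ .inr s := by
      intro z hz h
      rcases z with p | r
      · simp [blk] at h
      · exact hz (by simpa [blk] using h)
    have hh : ∀ z, W.half (.inr s) z = 2 := fun z => by simp [half, hubv, hs]
    by_cases hx : x = .inr s
    · subst hx
      rw [charge, if_pos (show blk (.inr s : Vtx md Bk S) = .inr s from rfl), if_neg (hb y hne.symm), hh,
        if_pos rfl, if_neg hne.symm]
    · by_cases hy : y = .inr s
      · subst hy
        rw [charge, if_neg (hb x hx), if_pos (show blk (.inr s : Vtx md Bk S) = .inr s from rfl), hh, if_neg hx, if_pos rfl]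
      · rw [if_neg hx, if_neg hy]
        omega
  have h := Finset.sum_le_sum fun i (_ : i ∈ Finset.univ) => hstep i
  rwa [← Finset.mul_sum, sum_ind] at h

/-- Only the vertex itself is near a single vertex, so each of its two steps realizes at most one of
its links. -/
theorem deg_single_le [Fintype Bk] [Fintype S] (s : S) : W.deg σ (.inr s) ≤ 2 := by
  rw [deg_eq, ← sum_ind σ (.inr s)]
  refine Finset.sum_le_sum fun i _ => Nat.add_le_add ?_ ?_
  all_goals
    split_ifs with h1 h2
    · omega
    · obtain ⟨u, -, hr⟩ := h1
      exact absurd (near_single hr.1) h2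
    · omega
    · omega

/-- By the subtour inequality for the pair: with a third point present, the tour does not go back
and forth between the two. -/
theorem cnt_single_le [Fintype Bk] [Fintype S] (s r : S) (hsr : s ≠ r)
    (hout : ∃ x : Vtx md Bk S, x ≠ .inr s ∧ x ≠ .inr r) :
    cnt σ (.inr s) (.inr r) ≤ 1 := by
  have h1 := subtour σ (fun x => x = .inr s ∨ x = .inr r) (by
    obtain ⟨x, hx⟩ := hout
    exact ⟨x, by tauto⟩)
  have h2 : (Finset.univ.filter fun x : Vtx md Bk S => x = .inr s ∨ x = .inr r).card ≤ 2 := by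
    have : (Finset.univ.filter fun x : Vtx md Bk S => x = .inr s ∨ x = .inr r) =
        {.inr s, .inr r} := by
      ext x; simp
    rw [this]
    exact Finset.card_le_two
  refine le_trans (Finset.sum_le_sum fun i _ => ?_) (h1.trans (Nat.sub_le_sub_right (m := 2) (by convert h2) 1))
  by_cases h3 : real (.inr s) (.inr r) (σ i) (σ (finRotate n i))
  · have e1 := near_single h3.1
    have e2 := near_single h3.2.1
    have h4 : ¬ real (.inr s) (.inr r) (σ (finRotate n i)) (σ i) := by
      intro h4
      have := near_single h4.1
      rw [e2] at this
      exact hsr (by simpa using this.symm)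
    rw [if_pos h3, if_neg h4, if_pos ⟨.inl e1, .inr e2⟩]
  · by_cases h4 : real (.inr s) (.inr r) (σ (finRotate n i)) (σ i)
    · rw [if_neg h3, if_pos h4, if_pos ⟨.inr (near_single h4.2.1), .inl (near_single h4.1)⟩]
    · rw [if_neg h3, if_neg h4]; omega

end tour
end Net
end


noncomputable section
open scoped Classical

open Vtx

/-! ## The network of a Hybrid instance -/

namespace HybridInstance

section construction
variable (H : HybridInstance)

/-- The predecessor of a variable on its circle. -/
def prev (v : H.Var) : H.Var :=
  ⟨v.1, ⟨((v.2 : ℕ) + (7 * H.t v.1 - 1)) % (7 * H.t v.1),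
    Nat.mod_lt _ (Nat.mul_pos (by norm_num) (H.t_pos v.1))⟩⟩

theorem next_prev (v : H.Var) : H.next (H.prev v) = v := by
  obtain ⟨l, i⟩ := v
  simp only [next, prev, Sigma.mk.injEq, heq_eq_eq, true_and]
  ext
  have := i.2
  show (((i : ℕ) + (7 * H.t l - 1)) % (7 * H.t l) + 1) % (7 * H.t l) = i
  rw [Nat.mod_add_mod]
  show ((i : ℕ) + (7 * H.t l - 1) + 1) % (7 * H.t l) = i
  rw [show (i : ℕ) + (7 * H.t l - 1) + 1 = i + 7 * H.t l by omega, Nat.add_mod_right,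
    Nat.mod_eq_of_lt this]

theorem prev_next (v : H.Var) : H.prev (H.next v) = v := by
  obtain ⟨l, i⟩ := v
  simp only [next, prev, Sigma.mk.injEq, heq_eq_eq, true_and]
  ext
  have := i.2
  show (((i : ℕ) + 1) % (7 * H.t l) + (7 * H.t l - 1)) % (7 * H.t l) = i
  rw [Nat.mod_add_mod]
  show ((i : ℕ) + 1 + (7 * H.t l - 1)) % (7 * H.t l) = i
  rw [show (i : ℕ) + 1 + (7 * H.t l - 1) = i + 7 * H.t l by omega, Nat.add_mod_right,
    Nat.mod_eq_of_lt this]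

def nextEquiv : H.Var ≃ H.Var := ⟨H.next, H.prev, H.prev_next, H.next_prev⟩

theorem next_ne (v : H.Var) : H.next v ≠ v := by
  obtain ⟨l, i⟩ := v
  intro h
  simp only [next, Sigma.mk.injEq, heq_eq_eq, true_and] at h
  have h := congrArg Fin.val h
  simp only at h
  have := H.t_pos l
  have := i.2
  by_cases h2 : (i : ℕ) + 1 = 7 * H.t l
  · rw [h2, Nat.mod_self] at h; omega
  · rw [Nat.mod_eq_of_lt (by omega)] at h; omega

def IsContact (v : H.Var) : Prop := 7 ∣ (v.2 : ℕ) + 1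

theorem mate_mate (v : H.Var) : H.mate (H.mate v) = v := by
  obtain ⟨l, i⟩ := v
  simp [mate, H.partner_partner]

theorem mate_eq_iff (v : H.Var) : H.mate v = v ↔ H.IsContact v := by
  obtain ⟨l, i⟩ := v
  simp [mate, IsContact, H.partner_eq_self_iff]

/-- The place of a contact variable in the equations with three variables. -/
def place (v : H.Var) (h : H.IsContact v) : Fin H.m₃ × Fin 3 := (H.triple_unique v h).choose

theorem triple_place (v : H.Var) (h : H.IsContact v) :
    H.triple (H.place v h).1 (H.place v h).2 = v := (H.triple_unique v h).choose_spec.1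

theorem place_triple (p : Fin H.m₃ × Fin 3) (h : H.IsContact (H.triple p.1 p.2)) :
    H.place _ h = p := ((H.triple_unique _ h).choose_spec.2 p rfl).symm

/-- The last variable of a circle has a number divisible by 7, so it is a contact variable and
occurs in some equation with three variables. -/
theorem m₃_pos : 0 < H.m₃ := by
  have h := H.t_pos ⟨0, H.n_pos⟩
  obtain ⟨p, -⟩ := H.triple_unique ⟨⟨0, H.n_pos⟩, ⟨7 * H.t ⟨0, H.n_pos⟩ - 1, by omega⟩⟩
    ⟨H.t ⟨0, H.n_pos⟩, by simp only; omega⟩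
  exact p.1.pos

/-- The lower one of two matched variables. -/
def IsLow (v : H.Var) : Prop := v.2 < H.partner v.1 v.2

theorem isLow_mate {v : H.Var} (hc : ¬ H.IsContact v) (h : ¬ H.IsLow v) : H.IsLow (H.mate v) := by
  have h1 : H.partner v.1 v.2 ≠ v.2 := fun h' => hc ((H.partner_eq_self_iff _ _).1 h')
  unfold IsLow at *
  simp only [mate, H.partner_partner]
  exact lt_of_le_of_ne (not_lt.1 h) h1

theorem not_contact_of_low {v : H.Var} (h : H.IsLow v) : ¬ H.IsContact v := fun hc => by
  have := (H.partner_eq_self_iff _ _).2 hc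
  unfold IsLow at h
  rw [this] at h
  exact lt_irrefl _ h

theorem not_low_mate {v : H.Var} (h : H.IsLow v) : ¬ H.IsLow (H.mate v) := by
  unfold IsLow at *
  simp only [mate, H.partner_partner]
  exact not_lt.2 h.le

theorem not_contact_mate {v : H.Var} (h : ¬ H.IsContact v) : ¬ H.IsContact (H.mate v) := by
  intro h'
  have := (H.mate_eq_iff _).2 h'
  rw [H.mate_mate] at this
  exact h ((H.mate_eq_iff _).1 this.symm)

abbrev Pair : Type := {v : H.Var // H.IsLow v}

/-- The parity gadgets: one for every circle equation, one for every occurrence of a variable in an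
equation with three variables, and one for every matching equation. -/
abbrev Blk : Type := H.Var ⊕ (Fin H.m₃ × Fin 3) ⊕ H.Pair

/-- The single vertices: two for every equation with three variables, two for every circle, and the
hubs. -/
abbrev Sgl : Type := (Fin H.m₃ × Bool) ⊕ (Fin H.n × Bool) ⊕ Fin (H.n + H.m₃)

/-- The value of a variable for which its variable gadget is visited. -/
def nu (v : H.Var) : Bool :=
  -- The value is reversed at the middle place of an equation with right-hand side 0. Thus, for
  -- either right-hand side, the equation says that an odd number of its variables agree with `nu`.
  if h : H.IsContact v then decide ((H.place v h).2 ≠ 1 ∨ H.rhs (H.place v h).1 = 1)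
  else decide (H.IsLow v)

/-- The variable at which the equation number 0 and its circle are joined without a hub. Place 0 is
chosen because there `nu` is true for either right-hand side. -/
def star : H.Var := H.triple ⟨0, H.m₃_pos⟩ 0

theorem isContact_star : H.IsContact H.star := H.triple_contact _ _

theorem nu_star : H.nu H.star = true := by
  have h : H.place H.star H.isContact_star = (⟨0, H.m₃_pos⟩, 0) :=
    H.place_triple (⟨0, H.m₃_pos⟩, 0) H.isContact_star
  rw [nu, dif_pos H.isContact_star, h]
  simp

/-- The circle equation at which a circle is cut open. -/
def cutv (l : Fin H.n) : H.Var :=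
  -- This circle is cut at `star`, so that the equation at the cut contains `star`, just as the
  -- equation `c0` does.
  if l = H.star.1 then H.star
  else ⟨l, ⟨7 * H.t l - 1, by have := H.t_pos l; omega⟩⟩

theorem cutv_fst (l : Fin H.n) : (H.cutv l).1 = l := by
  unfold cutv
  split_ifs with h
  · exact h.symm
  · rfl

def IsCut (v : H.Var) : Prop := v = H.cutv v.1

theorem isCut_cutv (l : Fin H.n) : H.IsCut (H.cutv l) := by
  unfold IsCut; rw [H.cutv_fst]

theorem cutv_star : H.cutv H.star.1 = H.star := by simp [cutv]

variable {H} {md : Bool}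

abbrev vL (g : H.Var) (k : ℕ) : Vtx md H.Blk H.Sgl := Net.termOf (.inl g) k
abbrev vC (p : Fin H.m₃ × Fin 3) (k : ℕ) : Vtx md H.Blk H.Sgl := Net.termOf (.inr (.inl p)) k
abbrev vM (v : H.Pair) (k : ℕ) : Vtx md H.Blk H.Sgl := Net.termOf (.inr (.inr v)) k
abbrev vA (c : Fin H.m₃) : Vtx md H.Blk H.Sgl := .inr (.inl (c, false))
abbrev vB (c : Fin H.m₃) : Vtx md H.Blk H.Sgl := .inr (.inl (c, true))
abbrev vq (l : Fin H.n) : Vtx md H.Blk H.Sgl := .inr (.inr (.inl (l, false)))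
abbrev vp (l : Fin H.n) : Vtx md H.Blk H.Sgl := .inr (.inr (.inl (l, true)))
abbrev vs (j : Fin (H.n + H.m₃)) : Vtx md H.Blk H.Sgl := .inr (.inr (.inr j))

/-- The Boolean is the value that is carried along the circle: terminals 0 and 1 serve the value
true, terminals 2 and 3 the value false. -/
def vout (r : Bool) (g : H.Var) : Vtx md H.Blk H.Sgl := vL g (if r then 1 else 3)

/-- At a cut the way along the circle ends in a single vertex: in `vp` for true and in `vq` for
false. The gadget itself is then linked at 0 to `vq` and at 2 to `vp`, so that a round trip with a
constant value connects `vq` with `vp`. -/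
def vin (r : Bool) (g : H.Var) : Vtx md H.Blk H.Sgl :=
  if H.IsCut g then (if r then vp g.1 else vq g.1) else vL g (if r then 0 else 2)

/-- The vertex `k` on the side of the variable `h` of the variable gadget of `h`. -/
def vY (h : H.Var) (k : ℕ) : Vtx md H.Blk H.Sgl :=
  if hc : H.IsContact h then vC (H.place h hc) k
  else if hl : H.IsLow h then vM ⟨h, hl⟩ k
  else vM ⟨H.mate h, H.isLow_mate hc hl⟩ (2 + k)

/-- The neighbour of `vin r h` on the side of the variable `h`: the exit of the variable gadget if
`h` visits it for the value `r`, and the preceding circle gadget otherwise. `toOut` is the same seen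
from the preceding circle gadget. -/
def toIn (r : Bool) (h : H.Var) : Vtx md H.Blk H.Sgl :=
  if r = H.nu h then vY h 1 else vout r (H.prev h)

def toOut (r : Bool) (h : H.Var) : Vtx md H.Blk H.Sgl :=
  if r = H.nu h then vY h 0 else vin r h

def c0 (H : HybridInstance) : Fin H.m₃ := ⟨0, H.m₃_pos⟩

/-- The hub of a single vertex. -/
def hubNum : (Fin H.m₃ × Bool) ⊕ (Fin H.n × Bool) → Option (Fin (H.n + H.m₃))
  | .inl (c, false) => some (if (c : ℕ) = 0 then ⟨H.star.1, by have := H.star.1.2; omega⟩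
      else ⟨H.n + c - 1, by omega⟩)
  | .inl (c, true) => if (c : ℕ) = 0 then none else some ⟨H.n + c, by omega⟩
  | .inr (l, false) => if l = H.star.1 then none else some ⟨l, by omega⟩
  | .inr (l, true) => some ⟨l + 1, by have := H.m₃_pos; omega⟩

def vSing : (Fin H.m₃ × Bool) ⊕ (Fin H.n × Bool) → Vtx md H.Blk H.Sgl
  | .inl p => .inr (.inl p)
  | .inr p => .inr (.inr (.inl p))

def hubList (s : (Fin H.m₃ × Bool) ⊕ (Fin H.n × Bool)) : List (Vtx md H.Blk H.Sgl) :=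
  (hubNum s).toList.map vs

variable (md)

/-- The links of a vertex. -/
def nbrs : Vtx md H.Blk H.Sgl → List (Vtx md H.Blk H.Sgl)
  | .inl (.inl g, k) =>
    match (k : ℕ) with
    | 0 => [if H.IsCut g then vq g.1 else toIn true g]
    | 1 => [toOut true (H.next g)]
    | 2 => [if H.IsCut g then vp g.1 else toIn false g]
    | 3 => [toOut false (H.next g)]
    | _ => []
  | .inl (.inr (.inl p), k) =>
    match (k : ℕ) with
    | 0 => [vout (H.nu (H.triple p.1 p.2)) (H.prev (H.triple p.1 p.2))]
    | 1 => [vin (H.nu (H.triple p.1 p.2)) (H.triple p.1 p.2)]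
    | 2 => if p.2 = 0 then [vA p.1] else if p.2 = 1 then [vC (p.1, 0) 3, vC (p.1, 2) 2]
        else [vC (p.1, 0) 3, vC (p.1, 1) 2]
    | 3 => if p.2 = 0 then [vC (p.1, 1) 2, vC (p.1, 2) 2] else if p.2 = 1 then [vA p.1, vB p.1]
        else [vB p.1]
    | _ => []
  | .inl (.inr (.inr v), k) =>
    match (k : ℕ) with
    | 0 => [vout true (H.prev v)]
    | 1 => [vin true v]
    | 2 => [vout false (H.prev (H.mate v))]
    | 3 => [vin false (H.mate v)]
    | _ => []
  | .inr (.inl (c, false)) => [vC (c, 0) 2, vC (c, 1) 3, vB c] ++ hubList (.inl (c, false))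
  | .inr (.inl (c, true)) => [vC (c, 1) 3, vC (c, 2) 3, vA c] ++ hubList (.inl (c, true)) ++
      (if (c : ℕ) = 0 then [vq H.star.1] else [])
  | .inr (.inr (.inl (l, false))) => [vL (H.cutv l) 0, toIn false (H.cutv l)] ++
      hubList (.inr (l, false)) ++ (if l = H.star.1 then [vB H.c0] else [])
  | .inr (.inr (.inl (l, true))) => [vL (H.cutv l) 2, toIn true (H.cutv l)] ++
      hubList (.inr (l, true))
  | .inr (.inr (.inr j)) => (Finset.univ.toList.filter fun s => hubNum s = some j).map vSing

/-- The links, in one direction. -/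
inductive Link : Vtx md H.Blk H.Sgl → Vtx md H.Blk H.Sgl → Prop
  | enter (h : H.Var) : Link (vout (H.nu h) (H.prev h)) (vY h 0)
  | leave (h : H.Var) : Link (vY h 1) (vin (H.nu h) h)
  | pass (h : H.Var) (r : Bool) : r ≠ H.nu h → Link (vout r (H.prev h)) (vin r h)
  | q (l : Fin H.n) : Link (vq l) (vL (H.cutv l) 0)
  | p (l : Fin H.n) : Link (vL (H.cutv l) 2) (vp l)
  | Ax (c : Fin H.m₃) : Link (vA c) (vC (c, 0) 2)
  | Ay (c : Fin H.m₃) : Link (vA c) (vC (c, 1) 3)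
  | xy (c : Fin H.m₃) : Link (vC (c, 0) 3) (vC (c, 1) 2)
  | xz (c : Fin H.m₃) : Link (vC (c, 0) 3) (vC (c, 2) 2)
  | yz (c : Fin H.m₃) : Link (vC (c, 1) 2) (vC (c, 2) 2)
  | yB (c : Fin H.m₃) : Link (vC (c, 1) 3) (vB c)
  | zB (c : Fin H.m₃) : Link (vC (c, 2) 3) (vB c)
  | AB (c : Fin H.m₃) : Link (vA c) (vB c)
  | Bq : Link (vB H.c0) (vq H.star.1)
  | hub (s : (Fin H.m₃ × Bool) ⊕ (Fin H.n × Bool)) (j : Fin (H.n + H.m₃)) :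
      hubNum s = some j → Link (vSing s) (vs j)

variable {md}

theorem mod_gadK (md : Bool) {k : ℕ} (h : k < 4) : k % gadK md = k :=
  Nat.mod_eq_of_lt (h.trans (gadK_pos md))

theorem nbrs_L0 (g : H.Var) : nbrs md (vL g 0) = [if H.IsCut g then vq g.1 else toIn true g] := by
  simp [vL, Net.termOf, nbrs]
theorem nbrs_L1 (g : H.Var) : nbrs md (vL g 1) = [toOut true (H.next g)] := by
  simp [vL, Net.termOf, nbrs, mod_gadK]
theorem nbrs_L2 (g : H.Var) : nbrs md (vL g 2) = [if H.IsCut g then vp g.1 else toIn false g] := by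
  simp [vL, Net.termOf, nbrs, mod_gadK]
theorem nbrs_L3 (g : H.Var) : nbrs md (vL g 3) = [toOut false (H.next g)] := by
  simp [vL, Net.termOf, nbrs, mod_gadK]
theorem nbrs_C0 (p : Fin H.m₃ × Fin 3) : nbrs md (vC p 0) =
    [vout (H.nu (H.triple p.1 p.2)) (H.prev (H.triple p.1 p.2))] := by
  simp [vC, Net.termOf, nbrs, mod_gadK]
theorem nbrs_C1 (p : Fin H.m₃ × Fin 3) : nbrs md (vC p 1) =
    [vin (H.nu (H.triple p.1 p.2)) (H.triple p.1 p.2)] := by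
  simp [vC, Net.termOf, nbrs, mod_gadK]
theorem nbrs_C2 (p : Fin H.m₃ × Fin 3) : nbrs md (vC p 2) =
    if p.2 = 0 then [vA p.1] else if p.2 = 1 then [vC (p.1, 0) 3, vC (p.1, 2) 2]
      else [vC (p.1, 0) 3, vC (p.1, 1) 2] := by
  simp [Net.termOf, nbrs, mod_gadK]
theorem nbrs_C3 (p : Fin H.m₃ × Fin 3) : nbrs md (vC p 3) =
    if p.2 = 0 then [vC (p.1, 1) 2, vC (p.1, 2) 2] else if p.2 = 1 then [vA p.1, vB p.1]
      else [vB p.1] := by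
  simp [Net.termOf, nbrs, mod_gadK]
theorem nbrs_M0 (v : H.Pair) : nbrs md (vM v 0) = [vout true (H.prev v)] := by
  simp [vM, Net.termOf, nbrs, mod_gadK]
theorem nbrs_M1 (v : H.Pair) : nbrs md (vM v 1) = [vin true v] := by
  simp [vM, Net.termOf, nbrs, mod_gadK]
theorem nbrs_M2 (v : H.Pair) : nbrs md (vM v 2) = [vout false (H.prev (H.mate v))] := by
  simp [vM, Net.termOf, nbrs, mod_gadK]
theorem nbrs_M3 (v : H.Pair) : nbrs md (vM v 3) = [vin false (H.mate v)] := by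
  simp [vM, Net.termOf, nbrs, mod_gadK]

theorem nu_low {v : H.Var} (h : H.IsLow v) : H.nu v = true := by
  simp [nu, H.not_contact_of_low h, h]

theorem nu_mate {v : H.Var} (h : H.IsLow v) : H.nu (H.mate v) = false := by
  simp [nu, H.not_contact_mate (H.not_contact_of_low h), H.not_low_mate h]

theorem vY_triple (p : Fin H.m₃ × Fin 3) (k : ℕ) :
    (vY (H.triple p.1 p.2) k : Vtx md H.Blk H.Sgl) = vC p k := by
  rw [vY, dif_pos (show H.IsContact _ from H.triple_contact p.1 p.2), H.place_triple]

theorem vY_low (v : H.Pair) (k : ℕ) : (vY v.1 k : Vtx md H.Blk H.Sgl) = vM v k := by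
  rw [vY, dif_neg (H.not_contact_of_low v.2), dif_pos v.2]

theorem vY_mate (v : H.Pair) (k : ℕ) : (vY (H.mate v.1) k : Vtx md H.Blk H.Sgl) = vM v (2 + k) := by
  rw [vY, dif_neg (H.not_contact_mate (H.not_contact_of_low v.2)), dif_neg (H.not_low_mate v.2)]
  congr 2
  simp only [H.mate_mate]

/-- Every variable is a contact variable, or one of a matched pair. -/
theorem var_cases (h : H.Var) : (∃ p : Fin H.m₃ × Fin 3, h = H.triple p.1 p.2) ∨
    (∃ v : H.Pair, h = v.1) ∨ ∃ v : H.Pair, h = H.mate v.1 := by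
  by_cases hc : H.IsContact h
  · exact .inl ⟨_, (H.triple_place h hc).symm⟩
  · by_cases hl : H.IsLow h
    · exact .inr (.inl ⟨⟨h, hl⟩, rfl⟩)
    · exact .inr (.inr ⟨⟨H.mate h, H.isLow_mate hc hl⟩, (H.mate_mate h).symm⟩)

theorem nbrs_vY0 (h : H.Var) : nbrs md (vY h 0) = [vout (H.nu h) (H.prev h)] := by
  rcases H.var_cases h with ⟨p, rfl⟩ | ⟨v, rfl⟩ | ⟨v, rfl⟩
  · rw [vY_triple, nbrs_C0]
  · rw [vY_low, nbrs_M0, nu_low v.2]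
  · rw [vY_mate, nbrs_M2, nu_mate v.2]

theorem nbrs_vY1 (h : H.Var) : nbrs md (vY h 1) = [vin (H.nu h) h] := by
  rcases H.var_cases h with ⟨p, rfl⟩ | ⟨v, rfl⟩ | ⟨v, rfl⟩
  · rw [vY_triple, nbrs_C1]
  · rw [vY_low, nbrs_M1, nu_low v.2]
  · rw [vY_mate, nbrs_M3, nu_mate v.2]

theorem nbrs_vout (r : Bool) (g : H.Var) : nbrs md (vout r g) = [toOut r (H.next g)] := by
  cases r
  · exact nbrs_L3 g
  · exact nbrs_L1 g

theorem toIn_mem_vin (r : Bool) (g : H.Var) : toIn r g ∈ nbrs md (vin r g) := by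
  unfold vin
  by_cases h : H.IsCut g
  · have h' : g = H.cutv g.1 := h
    rw [if_pos h]
    cases r
    · simp [nbrs, ← h']
    · simp [nbrs, ← h']
  · rw [if_neg h]
    cases r
    · simp only [Bool.false_eq_true, if_false]
      rw [nbrs_L2, if_neg h]; simp
    · simp only [if_true]
      rw [nbrs_L0, if_neg h]; simp

/-- `Link` names each link in one direction, while `nbrs` lists partners at both ends. Together with
`link_of_mem` this shows that the lists are symmetric, and later arguments can use whichever form is
shorter. -/
theorem Link.mem {x y : Vtx md H.Blk H.Sgl} (h : Link md x y) : y ∈ nbrs md x ∧ x ∈ nbrs md y := by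
  cases h with
  | enter h =>
    rw [nbrs_vout, H.next_prev, nbrs_vY0, toOut, if_pos rfl]; simp
  | leave h =>
    have := toIn_mem_vin (md := md) (H.nu h) h
    rw [toIn, if_pos rfl] at this
    rw [nbrs_vY1]
    exact ⟨by simp, this⟩
  | pass h r hr =>
    have := toIn_mem_vin (md := md) r h
    rw [toIn, if_neg hr] at this
    rw [nbrs_vout, H.next_prev, toOut, if_neg hr]
    exact ⟨by simp, this⟩
  | q l => rw [nbrs_L0, if_pos (H.isCut_cutv l), H.cutv_fst]; simp [nbrs]
  | p l => rw [nbrs_L2, if_pos (H.isCut_cutv l), H.cutv_fst]; simp [nbrs]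
  | Ax c => rw [nbrs_C2]; simp [nbrs]
  | Ay c => rw [nbrs_C3]; simp [nbrs]
  | xy c => rw [nbrs_C2, nbrs_C3]; simp
  | xz c => rw [nbrs_C2, nbrs_C3]; simp
  | yz c => rw [nbrs_C2, nbrs_C2]; simp
  | yB c => rw [nbrs_C3]; simp [nbrs]
  | zB c => rw [nbrs_C3]; simp [nbrs]
  | AB c => simp [nbrs]
  | Bq => simp [nbrs, c0]
  | hub s j hs =>
    constructor
    · rcases s with ⟨c, _ | _⟩ | ⟨l, _ | _⟩ <;> simp [vSing, nbrs, hubList, hs]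
    · simp only [nbrs, List.mem_map, List.mem_filter]
      exact ⟨s, by simp [hs], rfl⟩

theorem link_toIn {r : Bool} {g : H.Var} : Link md (toIn r g) (vin r g) := by
  unfold toIn
  split_ifs with h
  · subst h; exact .leave g
  · exact .pass g r h

theorem link_toOut {r : Bool} {g : H.Var} : Link md (vout r (H.prev g)) (toOut r g) := by
  unfold toOut
  split_ifs with h
  · subst h; exact .enter g
  · exact .pass g r h

theorem mem_hubList {s : (Fin H.m₃ × Bool) ⊕ (Fin H.n × Bool)} {y : Vtx md H.Blk H.Sgl}
    (h : y ∈ hubList s) : ∃ j, hubNum s = some j ∧ y = vs j := by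
  simp only [hubList, List.mem_map, Option.mem_toList] at h
  obtain ⟨j, hj, rfl⟩ := h
  exact ⟨j, hj, rfl⟩

theorem eq_termOf (b : H.Blk) (k : Fin (gadK md)) :
    (.inl (b, k) : Vtx md H.Blk H.Sgl) = Net.termOf b k := by
  simp [Net.termOf, Nat.mod_eq_of_lt k.2]

theorem nbrs_of_four_le (b : H.Blk) (k : Fin (gadK md)) (h : 4 ≤ (k : ℕ)) :
    nbrs md (.inl (b, k)) = [] := by
  obtain ⟨k, hk⟩ := k
  obtain ⟨k, rfl⟩ := Nat.exists_eq_add_of_le' h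
  rcases b with g | p | v <;> simp [nbrs]

theorem link_of_mem {x y : Vtx md H.Blk H.Sgl} (h : y ∈ nbrs md x) : Link md x y ∨ Link md y x := by
  rcases x with ⟨b, k⟩ | ⟨c, _ | _⟩ | ⟨l, _ | _⟩ | j
  · by_cases hk : 4 ≤ (k : ℕ)
    · rw [nbrs_of_four_le b k hk] at h
      simp at h
    rw [eq_termOf] at h ⊢
    have hk : (k : ℕ) = 0 ∨ (k : ℕ) = 1 ∨ (k : ℕ) = 2 ∨ (k : ℕ) = 3 := by omega
    rcases b with g | p | v
    · rcases hk with hk | hk | hk | hk <;> rw [hk] at h ⊢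
      · rw [nbrs_L0, List.mem_singleton] at h
        by_cases hg : H.IsCut g
        · rw [if_pos hg] at h
          subst h
          have := Link.q (md := md) g.1
          rw [← show g = H.cutv g.1 from hg] at this
          exact .inr this
        · rw [if_neg hg] at h
          subst h
          have := link_toIn (md := md) (r := true) (g := g)
          rw [vin, if_neg hg] at this
          exact .inr this
      · rw [nbrs_L1, List.mem_singleton] at h
        subst h
        have := link_toOut (md := md) (r := true) (g := H.next g)
        rw [H.prev_next] at this
        exact .inl this
      · rw [nbrs_L2, List.mem_singleton] at h
        by_cases hg : H.IsCut g
        · rw [if_pos hg] at h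
          subst h
          have := Link.p (md := md) g.1
          rw [← show g = H.cutv g.1 from hg] at this
          exact .inl this
        · rw [if_neg hg] at h
          subst h
          have := link_toIn (md := md) (r := false) (g := g)
          rw [vin, if_neg hg] at this
          exact .inr this
      · rw [nbrs_L3, List.mem_singleton] at h
        subst h
        have := link_toOut (md := md) (r := false) (g := H.next g)
        rw [H.prev_next] at this
        exact .inl this
    · obtain ⟨c, i⟩ := p
      have hv := vY_triple (md := md) (c, i)
      rcases hk with hk | hk | hk | hk <;> rw [hk] at h ⊢
      · change y ∈ nbrs md (vC (c, i) 0) at h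
        change Link md (vC (c, i) 0) y ∨ Link md y (vC (c, i) 0)
        rw [← hv, nbrs_vY0, List.mem_singleton] at h
        rw [h, ← hv]
        exact .inr (.enter _)
      · change y ∈ nbrs md (vC (c, i) 1) at h
        change Link md (vC (c, i) 1) y ∨ Link md y (vC (c, i) 1)
        rw [← hv, nbrs_vY1, List.mem_singleton] at h
        rw [h, ← hv]
        exact .inl (.leave _)
      · rw [nbrs_C2] at h
        fin_cases i
        · simp at h; subst h; exact .inr (.Ax c)
        · simp at h; rcases h with rfl | rfl
          exacts [.inr (.xy c), .inl (.yz c)]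
        · simp at h; rcases h with rfl | rfl
          exacts [.inr (.xz c), .inr (.yz c)]
      · rw [nbrs_C3] at h
        fin_cases i
        · simp at h; rcases h with rfl | rfl
          exacts [.inl (.xy c), .inl (.xz c)]
        · simp at h; rcases h with rfl | rfl
          exacts [.inr (.Ay c), .inl (.yB c)]
        · simp at h; subst h; exact .inl (.zB c)
    · have h1 := vY_low (md := md) v
      have h2 := vY_mate (md := md) v
      rcases hk with hk | hk | hk | hk <;> rw [hk] at h ⊢
      · change y ∈ nbrs md (vM v 0) at h
        change Link md (vM v 0) y ∨ Link md y (vM v 0)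
        rw [← h1, nbrs_vY0, List.mem_singleton] at h
        rw [h, ← h1]
        exact .inr (.enter _)
      · change y ∈ nbrs md (vM v 1) at h
        change Link md (vM v 1) y ∨ Link md y (vM v 1)
        rw [← h1, nbrs_vY1, List.mem_singleton] at h
        rw [h, ← h1]
        exact .inl (.leave _)
      · change y ∈ nbrs md (vM v (2 + 0)) at h
        change Link md (vM v (2 + 0)) y ∨ Link md y (vM v (2 + 0))
        rw [← h2 0, nbrs_vY0, List.mem_singleton] at h
        rw [h, ← h2 0]
        exact .inr (.enter _)
      · change y ∈ nbrs md (vM v (2 + 1)) at h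
        change Link md (vM v (2 + 1)) y ∨ Link md y (vM v (2 + 1))
        rw [← h2 1, nbrs_vY1, List.mem_singleton] at h
        rw [h, ← h2 1]
        exact .inl (.leave _)
  · simp only [nbrs, List.mem_append, List.mem_cons, List.not_mem_nil, or_false] at h
    rcases h with (rfl | rfl | rfl) | h
    · exact .inl (.Ax c)
    · exact .inl (.Ay c)
    · exact .inl (.AB c)
    · obtain ⟨j, hj, rfl⟩ := mem_hubList h
      exact .inl (.hub _ j hj)
  · simp only [nbrs, List.mem_append, List.mem_cons, List.not_mem_nil, or_false] at h
    rcases h with ((rfl | rfl | rfl) | h) | h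
    · exact .inr (.yB c)
    · exact .inr (.zB c)
    · exact .inr (.AB c)
    · obtain ⟨j, hj, rfl⟩ := mem_hubList h
      exact .inl (.hub _ j hj)
    · split_ifs at h with hc
      · have : c = H.c0 := Fin.ext hc
        simp only [List.mem_singleton] at h
        subst h this
        exact .inl .Bq
      · simp at h
  · simp only [nbrs, List.mem_append, List.mem_cons, List.not_mem_nil, or_false] at h
    rcases h with ((rfl | rfl) | h) | h
    · exact .inl (.q l)
    · have := link_toIn (md := md) (r := false) (g := H.cutv l)
      rw [vin, if_pos (H.isCut_cutv l), H.cutv_fst] at this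
      exact .inr this
    · obtain ⟨j, hj, rfl⟩ := mem_hubList h
      exact .inl (.hub _ j hj)
    · split_ifs at h with hc
      · simp only [List.mem_singleton] at h
        subst h hc
        exact .inr .Bq
      · simp at h
  · simp only [nbrs, List.mem_append, List.mem_cons, List.not_mem_nil, or_false] at h
    rcases h with (rfl | rfl) | h
    · exact .inr (.p l)
    · have := link_toIn (md := md) (r := true) (g := H.cutv l)
      rw [vin, if_pos (H.isCut_cutv l), H.cutv_fst] at this
      exact .inr this
    · obtain ⟨j, hj, rfl⟩ := mem_hubList h
      exact .inl (.hub _ j hj)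
  · simp only [nbrs, List.mem_map, List.mem_filter] at h
    obtain ⟨s, ⟨-, hs⟩, rfl⟩ := h
    exact .inr (.hub s j (by simpa using hs))

end construction
end HybridInstance
end


/-! ### The axioms of a network for the Hybrid construction -/

noncomputable section
open scoped Classical

open Vtx

namespace HybridInstance

variable {H : HybridInstance} {md : Bool}

theorem prev_ne (v : H.Var) : H.prev v ≠ v := fun h => H.next_ne (H.prev v) (by
  rw [H.next_prev, h])

theorem blk_vout (r : Bool) (g : H.Var) :
    (vout r g : Vtx md H.Blk H.Sgl).blk = .inl (.inl g) := rfl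

theorem blk_vin (r : Bool) (g : H.Var) : (vin r g : Vtx md H.Blk H.Sgl).blk = .inl (.inl g) ∨
    ∃ s, (vin r g : Vtx md H.Blk H.Sgl).blk = .inr (.inr (.inl s)) := by
  unfold vin
  split_ifs
  · exact .inr ⟨_, rfl⟩
  · exact .inr ⟨_, rfl⟩
  all_goals exact .inl rfl

theorem blk_vY (h : H.Var) (k : ℕ) :
    ∃ b, (vY h k : Vtx md H.Blk H.Sgl).blk = .inl (.inr b) := by
  unfold vY
  split_ifs
  all_goals exact ⟨_, rfl⟩

theorem blk_toIn (r : Bool) (g : H.Var) : (∃ b, (toIn r g : Vtx md H.Blk H.Sgl).blk = .inl (.inr b)) ∨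
    (toIn r g : Vtx md H.Blk H.Sgl).blk = .inl (.inl (H.prev g)) := by
  unfold toIn
  split_ifs
  · exact .inl (blk_vY _ _)
  · exact .inr rfl

theorem Link.blk_ne {x y : Vtx md H.Blk H.Sgl} (h : Link md x y) : y.blk ≠ x.blk := by
  cases h with
  | enter h => obtain ⟨b, hb⟩ := blk_vY (md := md) h 0; rw [hb, blk_vout]; simp
  | leave h =>
    obtain ⟨b, hb⟩ := blk_vY (md := md) h 1
    rcases blk_vin (md := md) (H.nu h) h with h1 | ⟨s, h1⟩ <;> rw [hb, h1] <;> simp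
  | pass h r hr =>
    rcases blk_vin (md := md) r h with h1 | ⟨s, h1⟩ <;> rw [blk_vout, h1]
    · simpa using (prev_ne h).symm
    · simp
  | hub s j hs => rcases s with s | s <;> simp [vSing, blk]
  | _ => simp [blk, Net.termOf]

theorem hubList_eq (s : (Fin H.m₃ × Bool) ⊕ (Fin H.n × Bool)) :
    (hubList s : List (Vtx md H.Blk H.Sgl)) = [] ∨
      ∃ j, (hubList s : List (Vtx md H.Blk H.Sgl)) = [vs j] := by
  unfold hubList
  cases hubNum s
  · exact .inl rfl
  · exact .inr ⟨_, rfl⟩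

/-- The delicate case is a cut: its single vertex is linked to the gadget of the cut and possibly to
the gadget of the preceding variable. These differ because no variable is its own predecessor. -/
theorem nbrs_pairwise (x : Vtx md H.Blk H.Sgl) :
    (nbrs md x).Pairwise fun y z => y.blk ≠ z.blk := by
  rcases x with ⟨b, k⟩ | ⟨c, _ | _⟩ | ⟨l, _ | _⟩ | j
  · by_cases hk : 4 ≤ (k : ℕ)
    · rw [nbrs_of_four_le b k hk]; exact List.Pairwise.nil
    rw [eq_termOf]
    have hk : (k : ℕ) = 0 ∨ (k : ℕ) = 1 ∨ (k : ℕ) = 2 ∨ (k : ℕ) = 3 := by omega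
    rcases b with g | p | v
    · rcases hk with hk | hk | hk | hk <;> rw [hk]
      · rw [nbrs_L0]; exact List.pairwise_singleton _ _
      · rw [nbrs_L1]; exact List.pairwise_singleton _ _
      · rw [nbrs_L2]; exact List.pairwise_singleton _ _
      · rw [nbrs_L3]; exact List.pairwise_singleton _ _
    · rcases hk with hk | hk | hk | hk <;> rw [hk]
      · rw [nbrs_C0]; exact List.pairwise_singleton _ _
      · rw [nbrs_C1]; exact List.pairwise_singleton _ _
      · rw [nbrs_C2]; split_ifs <;> simp [blk, Net.termOf]
      · rw [nbrs_C3]; split_ifs <;> simp [blk, Net.termOf]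
    · rcases hk with hk | hk | hk | hk <;> rw [hk]
      · rw [nbrs_M0]; exact List.pairwise_singleton _ _
      · rw [nbrs_M1]; exact List.pairwise_singleton _ _
      · rw [nbrs_M2]; exact List.pairwise_singleton _ _
      · rw [nbrs_M3]; exact List.pairwise_singleton _ _
  · rcases hubList_eq (md := md) (H := H) (.inl (c, false)) with h | ⟨j, h⟩ <;>
      simp [nbrs, h, blk, Net.termOf]
  · rcases hubList_eq (md := md) (H := H) (.inl (c, true)) with h | ⟨j, h⟩ <;>
      by_cases hc : (c : ℕ) = 0 <;> simp [nbrs, h, hc, blk, Net.termOf]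
  · rcases blk_toIn (md := md) false (H.cutv l) with ⟨b, hb⟩ | hb <;>
    rcases hubList_eq (md := md) (H := H) (.inr (l, false)) with h | ⟨j, h⟩ <;>
      by_cases hl : l = H.star.1 <;> simp only [nbrs, h, hl, if_true, if_false] <;>
      simp_all [blk, Net.termOf, (prev_ne _).symm]
  · rcases blk_toIn (md := md) true (H.cutv l) with ⟨b, hb⟩ | hb <;>
    rcases hubList_eq (md := md) (H := H) (.inr (l, true)) with h | ⟨j, h⟩ <;>
      simp only [nbrs, h] <;>
      simp_all [blk, Net.termOf, (prev_ne _).symm]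
  · simp only [nbrs]
    rw [List.pairwise_map]
    refine List.Pairwise.filter _ (List.Pairwise.imp ?_ (Finset.nodup_toList _))
    intro a b hab h
    apply hab
    rcases a with a | a <;> rcases b with b | b <;> simp [vSing, blk] at h ⊢ <;> exact h

variable (H md)

/-- The network of a Hybrid instance. -/
def net : Net md H.Blk H.Sgl where
  nbr := nbrs md
  hub s := match s with
    | .inr (.inr _) => true
    | _ => false
  symm x y h := by
    rcases link_of_mem h with h' | h'
    exacts [h'.mem.2, h'.mem.1]
  blk_ne x y h := by
    rcases link_of_mem h with h' | h'
    exacts [h'.blk_ne, h'.blk_ne.symm]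
  blk_pw := nbrs_pairwise
  term b k y h := by
    by_contra hk
    rw [nbrs_of_four_le b k (not_lt.1 hk)] at h
    simp at h
  hub_nbr s y hs hy := by
    rcases s with s | s | j
    · simp at hs
    · simp at hs
    · simp only [nbrs, List.mem_map, List.mem_filter] at hy
      obtain ⟨a, -, rfl⟩ := hy
      rcases a with a | a
      exacts [⟨_, rfl, rfl⟩, ⟨_, rfl, rfl⟩]

end HybridInstance
end


noncomputable section
open scoped Classical

open Vtx

/-! ## Lower bounds for the groups of gadgets of the equations -/

/-- Two kinds of inconsistency. `mix` is applied to the ways for the two values, exactly one of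
which should be used; `dif` is applied to the entry and the exit of a variable gadget, which should
be used together. -/
def mix (a b : ℕ) : ℕ := if 0 < a ↔ 0 < b then 1 else 0
def dif (a b : ℕ) : ℕ := if 0 < a ↔ 0 < b then 0 else 1

theorem mix_cases (a b : ℕ) : (mix a b = 1 ∧ a = 0 ∧ b = 0) ∨ (mix a b = 1 ∧ 0 < a ∧ 0 < b) ∨
    (mix a b = 0 ∧ 0 < a ∧ b = 0) ∨ (mix a b = 0 ∧ a = 0 ∧ 0 < b) := by
  unfold mix; split_ifs <;> omega

theorem dif_cases (a b : ℕ) : (dif a b = 0 ∧ a = 0 ∧ b = 0) ∨ (dif a b = 0 ∧ 0 < a ∧ 0 < b) ∨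
    (dif a b = 1 ∧ 0 < a ∧ b = 0) ∨ (dif a b = 1 ∧ a = 0 ∧ 0 < b) := by
  unfold dif; split_ifs <;> omega

/-- For circle gadgets: errors at the two ends add up, and consistent but different values at the
ends cost 2. The summand `n3 - 1` is a reserve, needed for the gadget in front of `star`, where a
link may be realized twice. -/
theorem gadDelta_circle (n0 n1 n2 n3 : ℕ) : mix n0 n2 + mix n1 n3 + (n3 - 1) ≤ gadDelta n0 n1 n2 n3 ∧
    (0 < n0 → n2 = 0 → n1 = 0 → 0 < n3 → 2 ≤ gadDelta n0 n1 n2 n3 - (n3 - 1)) ∧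
    (n0 = 0 → 0 < n2 → 0 < n1 → n3 = 0 → 2 ≤ gadDelta n0 n1 n2 n3 - (n3 - 1)) := by
  unfold gadDelta
  refine ⟨?_, ?_, ?_⟩
  · rcases mix_cases n0 n2 with h | h | h | h <;> rcases mix_cases n1 n3 with h' | h' | h' | h' <;>
      rw [h.1, h'.1] <;> omega
  · omega
  · omega

/-- For matching gadgets: each of the two variables should use both terminals of its side or none.
If both variables visit the gadget, or neither does, the equation is violated and the cost is 2. -/
theorem gadDelta_match (n0 n1 n2 n3 : ℕ) : dif n0 n1 + dif n2 n3 ≤ gadDelta n0 n1 n2 n3 ∧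
    (n0 = 0 → n1 = 0 → n2 = 0 → n3 = 0 → 2 ≤ gadDelta n0 n1 n2 n3) ∧
    (0 < n0 → 0 < n1 → 0 < n2 → 0 < n3 → 2 ≤ gadDelta n0 n1 n2 n3) := by
  unfold gadDelta
  refine ⟨?_, ?_, ?_⟩
  · rcases dif_cases n0 n1 with h | h | h | h <;> rcases dif_cases n2 n3 with h' | h' | h' | h' <;>
      rw [h.1, h'.1] <;> omega
  · omega
  · omega

/-- The cost of a gadget inside the gadget group of an equation with three variables. -/
def side (vis : Bool) (n2 n3 : ℕ) : ℕ :=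
  if vis then n2 + n3 else (n2 - 1) + (1 - n2) + ((n3 - 1) + (1 - n3))

/-- `vis` tells which of the two alternatives in the minimum is used: traversal along the circle or
along the path of the equation. Without an error at the terminals 0 and 1 it is determined by their
use. -/
theorem gadDelta_side (n0 n1 n2 n3 : ℕ) : ∃ vis : Bool,
    dif n0 n1 + side vis n2 n3 ≤ gadDelta n0 n1 n2 n3 ∧ (dif n0 n1 = 0 → (vis = true ↔ 0 < n0)) := by
  unfold gadDelta
  rcases dif_cases n0 n1 with h | h | h | h
  · exact ⟨false, by rw [h.1]; simp only [side]; simp; omega, by simp; omega⟩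
  · exact ⟨true, by rw [h.1]; simp only [side]; simp; omega, by simp; omega⟩
  all_goals
    by_cases hc : n2 + n3 ≤ (n2 - 1) + (1 - n2) + ((n3 - 1) + (1 - n3))
    · exact ⟨true, by rw [h.1]; simp only [side]; simp; omega, by omega⟩
    · exact ⟨false, by rw [h.1]; simp only [side]; simp; omega, by omega⟩

/-- The numbers `c1` to `c8` count the links A–x, A–y, x–y, x–z, y–z, y–B, z–B and A–B, where x, y,
z are the three gadgets; `a` and `b` count the links to hubs. The parity comes from the triangle:
terminal 3 of x and terminals 2 of y and z are linked only to each other, so their degrees have an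
even sum. Hence without extra cost the number of gadgets not visited along circles is even. -/
theorem core_bound (v0 v1 v2 : Bool) (c1 c2 c3 c4 c5 c6 c7 c8 a b CA CB : ℕ)
    (hA : 4 ≤ CA + (c1 + c2 + c8 + 2 * a)) (hA' : c1 + c2 + c8 + a ≤ 2) (ha : a ≤ 1)
    (hB : 4 ≤ CB + (c6 + c7 + c8 + 2 * b)) (hB' : c6 + c7 + c8 + b ≤ 2) (hb : b ≤ 1) (h8 : c8 ≤ 1) :
    2 + (if xor v0 (xor v1 v2) then 0 else 2) ≤
      side v0 c1 (c3 + c4) + side v1 (c3 + c5) (c2 + c6) + side v2 (c4 + c5) c7 + CA + CB := by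
  cases v0 <;> cases v1 <;> cases v2 <;> simp only [side] <;> simp <;> omega

/-- The version for the equation `c0`, whose vertex B has in place of the hub an ordinary partner of
weight 1. This raises the base value from 2 to 3; if that link is not used, the cost is at least 4
in any case. -/
theorem core_bound_link (v0 v1 v2 : Bool) (c1 c2 c3 c4 c5 c6 c7 c8 a b CA CB : ℕ)
    (hA : 4 ≤ CA + (c1 + c2 + c8 + 2 * a)) (hA' : c1 + c2 + c8 + a ≤ 2) (ha : a ≤ 1)
    (hB : 4 ≤ CB + (c6 + c7 + c8 + b)) (hB' : c6 + c7 + c8 + b ≤ 2) (hb : b ≤ 1) (h8 : c8 ≤ 1) :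
    (0 < b → 3 + (if xor v0 (xor v1 v2) then 0 else 2) ≤
      side v0 c1 (c3 + c4) + side v1 (c3 + c5) (c2 + c6) + side v2 (c4 + c5) c7 + CA + CB) ∧
    (b = 0 → 4 ≤
      side v0 c1 (c3 + c4) + side v1 (c3 + c5) (c2 + c6) + side v2 (c4 + c5) c7 + CA + CB) := by
  cases v0 <;> cases v1 <;> cases v2 <;> simp only [side] <;> simp <;> omega

/-- At a cut the two single vertices transmit the value. In the optimal case each uses its hub link
and exactly one other link, so `n2 + P = 1` and `n0 + Q = 1`; thus `P` plays the role of `n0` and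
`Q` that of `n2` in `gadDelta_circle`. -/
theorem border_bound (n0 n1 n2 n3 P Q hp hq CP CQ : ℕ) 
    (h1 : 4 ≤ CP + (n2 + P + 2 * hp)) (h2 : n2 + P + hp ≤ 2) (h3 : hp ≤ 1)
    (h4 : 4 ≤ CQ + (n0 + Q + 2 * hq)) (h5 : n0 + Q + hq ≤ 2) (h6 : hq ≤ 1) :
    2 + mix P Q + mix n1 n3 ≤ gadDelta n0 n1 n2 n3 + CP + CQ ∧
    (0 < P → Q = 0 → n1 = 0 → 0 < n3 → 4 ≤ gadDelta n0 n1 n2 n3 + CP + CQ) ∧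
    (P = 0 → 0 < Q → 0 < n1 → n3 = 0 → 4 ≤ gadDelta n0 n1 n2 n3 + CP + CQ) := by
  unfold gadDelta
  refine ⟨?_, ?_, ?_⟩
  · rcases mix_cases P Q with h | h | h | h <;> rcases mix_cases n1 n3 with h' | h' | h' | h' <;>
      rw [h.1, h'.1] <;> omega
  · omega
  · omega

/-- The version for the circle of `star`, where the second single vertex has an ordinary partner in
place of a hub. If that link is unused, both steps may realize the link counted by `Q`, which is why
`Q - 1` appears as a correction. -/
theorem border_bound_link (n0 n1 n2 n3 P Q hp hq CP CQ : ℕ) 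
    (h1 : 4 ≤ CP + (n2 + P + 2 * hp)) (h2 : n2 + P + hp ≤ 2) (h3 : hp ≤ 1)
    (h4 : 4 ≤ CQ + (n0 + Q + hq)) (h5 : n0 + Q + hq ≤ 2) (h6 : hq ≤ 1) :
    (0 < hq → 3 + mix P Q + mix n1 n3 ≤ gadDelta n0 n1 n2 n3 + CP + CQ) ∧
    (0 < hq → 0 < P → Q = 0 → n1 = 0 → 0 < n3 → 5 ≤ gadDelta n0 n1 n2 n3 + CP + CQ) ∧
    (0 < hq → P = 0 → 0 < Q → 0 < n1 → n3 = 0 → 5 ≤ gadDelta n0 n1 n2 n3 + CP + CQ) ∧ 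
    (hq = 0 → 4 + mix n1 n3 ≤ gadDelta n0 n1 n2 n3 + CP + CQ + mix P Q + (Q - 1)) := by
  unfold gadDelta
  refine ⟨?_, ?_, ?_, ?_⟩
  · rcases mix_cases P Q with h | h | h | h <;> rcases mix_cases n1 n3 with h' | h' | h' | h' <;>
      rw [h.1, h'.1] <;> omega
  · omega
  · omega
  · rcases mix_cases P Q with h | h | h | h <;> rcases mix_cases n1 n3 with h' | h' | h' | h' <;>
      rw [h.1, h'.1] <;> omega
end


noncomputable section
open scoped Classical

open Vtx

namespace HybridInstance

variable {H : HybridInstance} {md : Bool} {n : ℕ} (σ : Fin n ≃ Vtx md H.Blk H.Sgl)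

/-! ### The use of the links around a variable -/

/-- A tour can pass a variable `h` through its gadget, using the links counted by `cntEnter` and
`cntLeave`, for the value `nu h`; or by the direct link counted by `cntPass`, for the other value.
-/
def cntEnter (h : H.Var) : ℕ := Net.cnt σ (vout (H.nu h) (H.prev h)) (vY h 0)
def cntLeave (h : H.Var) : ℕ := Net.cnt σ (vY h 1) (vin (H.nu h) h)
def cntPass (h : H.Var) : ℕ := Net.cnt σ (vout (!H.nu h) (H.prev h)) (vin (!H.nu h) h)

def cntOut (r : Bool) (h : H.Var) : ℕ := if r = H.nu h then cntEnter σ h else cntPass σ h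
def cntIn (r : Bool) (h : H.Var) : ℕ := if r = H.nu h then cntLeave σ h else cntPass σ h

theorem cnt_toOut (r : Bool) (h : H.Var) :
    Net.cnt σ (vout r (H.prev h)) (toOut r h) = cntOut σ r h := by
  unfold cntOut toOut
  split_ifs with hr
  · subst hr; rfl
  · have : r = !H.nu h := by cases r <;> cases hh : H.nu h <;> simp_all
    subst this; rfl

theorem cnt_toIn (r : Bool) (h : H.Var) :
    Net.cnt σ (vin r h) (toIn r h) = cntIn σ r h := by
  rw [Net.cnt_symm]
  unfold cntIn toIn
  split_ifs with hr
  · subst hr; rfl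
  · have : r = !H.nu h := by cases r <;> cases hh : H.nu h <;> simp_all
    subst this; rfl

/-- The tour gives a consistent value to the variable `h`. -/
def Pure (h : H.Var) : Prop := (0 < cntEnter σ h ↔ 0 < cntLeave σ h) ∧
  (0 < cntEnter σ h ↔ cntPass σ h = 0)

def val (h : H.Var) : Bool := if 0 < cntEnter σ h then H.nu h else !H.nu h

def mixO (h : H.Var) : ℕ := mix (cntOut σ true h) (cntOut σ false h)
def mixI (h : H.Var) : ℕ := mix (cntIn σ true h) (cntIn σ false h)
def mixY (h : H.Var) : ℕ := dif (cntEnter σ h) (cntLeave σ h)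

theorem mix_comm (a b : ℕ) : mix a b = mix b a := by
  unfold mix; simp only [iff_comm]

theorem mixO_eq (h : H.Var) : mixO σ h = mix (cntEnter σ h) (cntPass σ h) := by
  unfold mixO cntOut
  cases H.nu h
  · simp [mix_comm]
  · simp

theorem mixI_eq (h : H.Var) : mixI σ h = mix (cntLeave σ h) (cntPass σ h) := by
  unfold mixI cntIn
  cases H.nu h
  · simp [mix_comm]
  · simp

/-- With E, L, P the truth values of "entered", "left" and "passed", the three errors are E = P, L =
P and E ≠ L. The number of errors is always even, so it is at least 2 once it is nonzero. -/
theorem two_le_mix (h : H.Var) (hp : ¬ Pure σ h) : 2 ≤ mixO σ h + mixI σ h + mixY σ h := by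
  rw [mixO_eq, mixI_eq, mixY]
  unfold Pure at hp
  rcases dif_cases (cntEnter σ h) (cntLeave σ h) with h1 | h1 | h1 | h1 <;>
  rcases mix_cases (cntEnter σ h) (cntPass σ h) with h2 | h2 | h2 | h2 <;>
  rcases mix_cases (cntLeave σ h) (cntPass σ h) with h3 | h3 | h3 | h3 <;>
  rw [h1.1, h2.1, h3.1] <;> omega

theorem cntOut_pos {h : H.Var} (hp : Pure σ h) (r : Bool) : 0 < cntOut σ r h ↔ val σ h = r := by
  unfold cntOut val
  obtain ⟨h1, h2⟩ := hp
  by_cases h0 : 0 < cntEnter σ h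
  · have := h2.1 h0
    cases r <;> cases H.nu h <;> simp [h0, this]
  · have : 0 < cntPass σ h := Nat.pos_of_ne_zero fun h' => h0 (h2.2 h')
    have h0' : cntEnter σ h = 0 := by omega
    cases r <;> cases H.nu h <;> simp [h0', this]

theorem cntIn_pos {h : H.Var} (hp : Pure σ h) (r : Bool) : 0 < cntIn σ r h ↔ val σ h = r := by
  have : 0 < cntIn σ r h ↔ 0 < cntOut σ r h := by
    unfold cntIn cntOut
    split_ifs
    exacts [hp.1.symm, Iff.rfl]
  rw [this, cntOut_pos σ hp]

theorem val_eq_nu (h : H.Var) : val σ h = H.nu h ↔ 0 < cntEnter σ h := by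
  unfold val
  split_ifs with h0 <;> simp [h0]

/-! ### Gadget degrees -/

theorem cntOut_next (r : Bool) (g : H.Var) :
    Net.cnt σ (vout r g) (toOut r (H.next g)) = cntOut σ r (H.next g) := by
  rw [← cnt_toOut, H.prev_next]

theorem deg_L1 (g : H.Var) : (H.net md).deg σ (vL g 1) = cntOut σ true (H.next g) := by
  rw [← cntOut_next]
  simp only [Net.deg, net, nbrs_L1, List.map_cons, List.map_nil, List.sum_cons, List.sum_nil,
    Nat.add_zero]
  rfl

theorem deg_L3 (g : H.Var) : (H.net md).deg σ (vL g 3) = cntOut σ false (H.next g) := by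
  rw [← cntOut_next]
  simp only [Net.deg, net, nbrs_L3, List.map_cons, List.map_nil, List.sum_cons, List.sum_nil,
    Nat.add_zero]
  rfl

theorem deg_L0 {g : H.Var} (hg : ¬ H.IsCut g) : (H.net md).deg σ (vL g 0) = cntIn σ true g := by
  rw [← cnt_toIn]
  simp [Net.deg, net, nbrs_L0, hg, vin]

theorem deg_L2 {g : H.Var} (hg : ¬ H.IsCut g) : (H.net md).deg σ (vL g 2) = cntIn σ false g := by
  rw [← cnt_toIn]
  simp [Net.deg, net, nbrs_L2, hg, vin]

theorem deg_L0_cut {g : H.Var} (hg : H.IsCut g) :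
    (H.net md).deg σ (vL g 0) = Net.cnt σ (vL g 0) (vq g.1) := by
  simp [Net.deg, net, nbrs_L0, hg]

theorem deg_L2_cut {g : H.Var} (hg : H.IsCut g) :
    (H.net md).deg σ (vL g 2) = Net.cnt σ (vL g 2) (vp g.1) := by
  simp [Net.deg, net, nbrs_L2, hg]

theorem deg_Y0 (h : H.Var) : (H.net md).deg σ (vY h 0) = cntEnter σ h := by
  simp [Net.deg, net, nbrs_vY0, cntEnter, Net.cnt_symm σ (vY h 0)]

theorem deg_Y1 (h : H.Var) : (H.net md).deg σ (vY h 1) = cntLeave σ h := by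
  simp [Net.deg, net, nbrs_vY1, cntLeave]

/-! ### Circle and matching equations -/

theorem exists_hub : ∃ x : Vtx md H.Blk H.Sgl, ∃ j, x = vs j :=
  ⟨vs ⟨0, by have := H.n_pos; omega⟩, _, rfl⟩

theorem le_cost_blk (hn : 2 ≤ n) (b : H.Blk) :
    gadBase md + gadDelta ((H.net md).deg σ (Net.termOf b 0)) ((H.net md).deg σ (Net.termOf b 1))
      ((H.net md).deg σ (Net.termOf b 2)) ((H.net md).deg σ (Net.termOf b 3)) ≤
      (H.net md).cost σ (.inl b) := by
  apply Net.le_cost_gad _ _ hn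
  obtain ⟨x, j, rfl⟩ := exists_hub (H := H) (md := md)
  exact ⟨vs j, by simp [blk]⟩

/-- The equation of `g` and its successor is violated by consistent values. -/
def BadC (g : H.Var) : Prop := Pure σ g ∧ Pure σ (H.next g) ∧ val σ g ≠ val σ (H.next g)

def BadM (v : H.Pair) : Prop := Pure σ v.1 ∧ Pure σ (H.mate v) ∧ val σ v.1 ≠ val σ (H.mate v)

def BadE (c : Fin H.m₃) : Prop := (∀ k, Pure σ (H.triple c k)) ∧
  (xor (val σ (H.triple c 0) == H.nu (H.triple c 0)) (xor (val σ (H.triple c 1) == H.nu (H.triple c 1))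
    (val σ (H.triple c 2) == H.nu (H.triple c 2)))) = false

theorem badC_cases {g : H.Var} (h : BadC σ g) :
    (0 < cntIn σ true g ∧ cntIn σ false g = 0 ∧ cntOut σ true (H.next g) = 0 ∧
      0 < cntOut σ false (H.next g)) ∨
    (cntIn σ true g = 0 ∧ 0 < cntIn σ false g ∧ 0 < cntOut σ true (H.next g) ∧
      cntOut σ false (H.next g) = 0) := by
  obtain ⟨h1, h2, h3⟩ := h
  have e1 := cntIn_pos σ h1 true
  have e2 := cntIn_pos σ h1 false
  have e3 := cntOut_pos σ h2 true
  have e4 := cntOut_pos σ h2 false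
  cases hv : val σ g <;> cases hw : val σ (H.next g) <;> simp [hv, hw] at * <;> omega

theorem mixI_pure {h : H.Var} (hp : Pure σ h) : mixI σ h = 0 := by
  rw [mixI_eq, mix, if_neg]
  have := hp.1; have := hp.2
  omega

theorem mixO_pure {h : H.Var} (hp : Pure σ h) : mixO σ h = 0 := by
  rw [mixO_eq, mix, if_neg]
  have := hp.1; have := hp.2
  omega

theorem mixY_pure {h : H.Var} (hp : Pure σ h) : mixY σ h = 0 := by
  rw [mixY, dif, if_pos hp.1]

/-- The gadget between `g` and its successor pays for an error on the near side of each of the two.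
In total, the three errors of one variable are paid by three different places: the two circle
gadgets beside it and its variable gadget. So the bounds can be added. -/
theorem circle_bound (hn : 2 ≤ n) {g : H.Var} (hg : ¬ H.IsCut g) :
    gadBase md + mixI σ g + mixO σ (H.next g) + (if BadC σ g then 2 else 0)
      + (cntOut σ false (H.next g) - 1) ≤ (H.net md).cost σ (.inl (.inl g)) := by
  have h := le_cost_blk σ hn (.inl g)
  rw [deg_L0 σ hg, deg_L2 σ hg, deg_L1, deg_L3] at h
  obtain ⟨h1, h2, h3⟩ := gadDelta_circle (cntIn σ true g) (cntOut σ true (H.next g))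
    (cntIn σ false g) (cntOut σ false (H.next g))
  split_ifs with hb
  · rw [mixI_pure σ hb.1, mixO_pure σ hb.2.1]
    rcases badC_cases σ hb with hb | hb
    · have := h2 hb.1 hb.2.1 hb.2.2.1 hb.2.2.2
      omega
    · have := h3 hb.1 hb.2.1 hb.2.2.1 hb.2.2.2
      omega
  · unfold mixI mixO
    omega

theorem match_bound (hn : 2 ≤ n) (v : H.Pair) :
    gadBase md + mixY σ v.1 + mixY σ (H.mate v) + (if BadM σ v then 2 else 0) ≤
      (H.net md).cost σ (.inl (.inr (.inr v))) := by
  have h := le_cost_blk σ hn (.inr (.inr v))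
  have e0 := deg_Y0 σ (md := md) v.1
  have e1 := deg_Y1 σ (md := md) v.1
  have e2 := deg_Y0 σ (md := md) (H.mate v.1)
  have e3 := deg_Y1 σ (md := md) (H.mate v.1)
  rw [vY_low] at e0 e1
  rw [vY_mate] at e2 e3
  rw [e0, e1, e2, e3] at h
  obtain ⟨h1, h2, h3⟩ := gadDelta_match (cntEnter σ v.1) (cntLeave σ v.1)
    (cntEnter σ (H.mate v)) (cntLeave σ (H.mate v))
  split_ifs with hb
  · obtain ⟨p1, p2, hv⟩ := hb
    have m1 := mixY_pure σ p1
    have m2 := mixY_pure σ p2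
    have n1 := val_eq_nu σ v.1
    have n2 := val_eq_nu σ (H.mate v.1)
    rw [nu_low v.2] at n1
    rw [nu_mate v.2] at n2
    -- The values differ and `nu` differs as well, hence either both variables enter the shared
    -- gadget or neither does.
    have : 0 < cntEnter σ v.1 ↔ 0 < cntEnter σ (H.mate v.1) := by
      rw [← n1, ← n2]
      cases hx : val σ v.1 <;> cases hy : val σ (H.mate v.1) <;> simp_all
    have q1 := p1.1
    have q2 := p2.1
    by_cases h0 : 0 < cntEnter σ v.1
    · have := h3 h0 (by omega) (by omega) (by omega)
      omega
    · have := h2 (by omega) (by omega) (by omega) (by omega)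
      omega
  · unfold mixY
    omega

/-! ### Circle border equations -/

theorem weight_hub (j : Fin (H.n + H.m₃)) : (H.net md).weight (vs j) = 2 := rfl
theorem weight_termOf (b : H.Blk) (k) : (H.net md).weight (Net.termOf b k) = 1 := rfl
theorem weight_E (x) : (H.net md).weight (.inr (.inl x)) = 1 := rfl
theorem weight_border (x) : (H.net md).weight (.inr (.inr (.inl x))) = 1 := rfl

theorem weight_vY (g : H.Var) (k : ℕ) : (H.net md).weight (vY g k) = 1 := by
  unfold vY; split_ifs <;> rfl
theorem weight_toIn (r : Bool) (g : H.Var) : (H.net md).weight (toIn r g) = 1 := by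
  unfold toIn; split_ifs <;> first | rfl | exact weight_vY _ _

theorem cnt_sgl_le {s r : H.Sgl} (hsr : s ≠ r) : Net.cnt σ (.inr s) (.inr r) ≤ 1 :=
  Net.cnt_single_le σ s r hsr ⟨vL H.star 0, by simp [Net.termOf], by simp [Net.termOf]⟩

/-- The single vertices `p`, which are linked to a hub. -/
theorem p_bound (hn : 2 ≤ n) (l : Fin H.n) : ∃ hp ≤ 1,
    4 ≤ (H.net md).cost σ (.inr (.inr (.inl (l, true)))) +
      ((H.net md).deg σ (vL (H.cutv l) 2) + cntIn σ true (H.cutv l) + 2 * hp) ∧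
    (H.net md).deg σ (vL (H.cutv l) 2) + cntIn σ true (H.cutv l) + hp ≤ 2 := by
  obtain ⟨j, hj⟩ : ∃ j, hubNum (.inr (l, true)) = some j := ⟨_, rfl⟩
  have h1 := (H.net md).four_le_cost_add σ hn (.inr (.inl (l, true)))
  have h2 := (H.net md).deg_single_le σ (.inr (.inl (l, true)))
  have hn : (H.net md).nbr (.inr (.inr (.inl (l, true)))) = _ := nbrs.eq_7 md l
  rw [Net.deg, hn] at h2
  rw [hn] at h1
  have e := cnt_toIn (md := md) σ true (H.cutv l)
  rw [vin, if_pos (H.isCut_cutv l), H.cutv_fst, if_pos rfl] at e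
  rw [deg_L2_cut σ (H.isCut_cutv l), H.cutv_fst, Net.cnt_symm σ (vL (H.cutv l) 2), ← e]
  simp only [vp] at *
  simp only [hubList, hj, Option.toList_some, List.map_cons, List.map_nil, List.cons_append,
    List.nil_append, List.sum_cons, List.sum_nil, weight_termOf, weight_toIn, weight_hub] at h1 h2
  exact ⟨Net.cnt σ (.inr (.inr (.inl (l, true)))) (vs j), cnt_sgl_le σ (by simp), by omega, by omega⟩

theorem q_bound (hn : 2 ≤ n) (l : Fin H.n) (hl : l ≠ H.star.1) : ∃ hq ≤ 1,
    4 ≤ (H.net md).cost σ (.inr (.inr (.inl (l, false)))) +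
      ((H.net md).deg σ (vL (H.cutv l) 0) + cntIn σ false (H.cutv l) + 2 * hq) ∧
    (H.net md).deg σ (vL (H.cutv l) 0) + cntIn σ false (H.cutv l) + hq ≤ 2 := by
  obtain ⟨j, hj⟩ : ∃ j, hubNum (.inr (l, false)) = some j := ⟨_, if_neg hl⟩
  have h1 := (H.net md).four_le_cost_add σ hn (.inr (.inl (l, false)))
  have h2 := (H.net md).deg_single_le σ (.inr (.inl (l, false)))
  have hn : (H.net md).nbr (.inr (.inr (.inl (l, false)))) = _ := nbrs.eq_6 md l
  rw [Net.deg, hn] at h2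
  rw [hn] at h1
  have e := cnt_toIn (md := md) σ false (H.cutv l)
  rw [vin, if_pos (H.isCut_cutv l), H.cutv_fst, if_neg (by simp)] at e
  rw [deg_L0_cut σ (H.isCut_cutv l), H.cutv_fst, Net.cnt_symm σ (vL (H.cutv l) 0), ← e]
  simp only [vq, vB] at *
  simp only [hubList, hj, hl, if_false, Option.toList_some, List.map_cons, List.map_nil,
    List.cons_append, List.append_nil,
    List.nil_append, List.sum_cons, List.sum_nil, weight_termOf, weight_toIn, weight_hub] at h1 h2
  exact ⟨Net.cnt σ (.inr (.inr (.inl (l, false)))) (vs j), cnt_sgl_le σ (by simp), by omega, by omega⟩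

/-- Here the third partner is `vB H.c0`, of weight 1, since this vertex has no hub. -/
theorem q_bound_star (hn : 2 ≤ n) : 
    4 ≤ (H.net md).cost σ (.inr (.inr (.inl (H.star.1, false)))) +
      ((H.net md).deg σ (vL H.star 0) + cntIn σ false H.star +
        Net.cnt σ (vq H.star.1) (vB H.c0)) ∧
    (H.net md).deg σ (vL H.star 0) + cntIn σ false H.star +
      Net.cnt σ (vq H.star.1) (vB H.c0) ≤ 2 := by
  have h1 := (H.net md).four_le_cost_add σ hn (.inr (.inl (H.star.1, false)))
  have h2 := (H.net md).deg_single_le σ (.inr (.inl (H.star.1, false)))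
  have hn : (H.net md).nbr (.inr (.inr (.inl (H.star.1, false)))) = _ := nbrs.eq_6 md H.star.1
  have hc := H.isCut_cutv H.star.1
  rw [H.cutv_star] at hc
  rw [Net.deg, hn, H.cutv_star] at h2
  rw [hn, H.cutv_star] at h1
  have e := cnt_toIn (md := md) σ false H.star
  rw [vin, if_pos hc, if_neg (by simp)] at e
  rw [deg_L0_cut σ hc, Net.cnt_symm σ (vL H.star 0), ← e]
  simp only [vq, vB] at *
  simp only [hubList, hubNum, if_true, Option.toList_none, List.map_cons, List.map_nil,
    List.cons_append, List.append_nil,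
    List.nil_append, List.sum_cons, List.sum_nil, weight_termOf, weight_toIn, weight_E] at h1 h2
  omega

theorem A_bound (hn : 2 ≤ n) (c : Fin H.m₃) : ∃ a ≤ 1,
    4 ≤ (H.net md).cost σ (.inr (.inl (c, false))) +
      (Net.cnt σ (vA c) (vC (c, 0) 2) + Net.cnt σ (vA c) (vC (c, 1) 3) +
        Net.cnt σ (vA c) (vB c) + 2 * a) ∧
    Net.cnt σ (vA c) (vC (c, 0) 2) + Net.cnt σ (vA c) (vC (c, 1) 3) +
        Net.cnt σ (vA c) (vB c) + a ≤ 2 := by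
  obtain ⟨j, hj⟩ : ∃ j, hubNum (.inl (c, false)) = some j := ⟨_, rfl⟩
  have h1 := (H.net md).four_le_cost_add σ hn (.inl (c, false))
  have h2 := (H.net md).deg_single_le σ (.inl (c, false))
  have hn : (H.net md).nbr (.inr (.inl (c, false))) = _ := nbrs.eq_4 md c
  rw [Net.deg, hn] at h2
  rw [hn] at h1
  simp only [vA, vB] at *
  simp only [hubList, hj, Option.toList_some, List.map_cons, List.map_nil, List.cons_append,
    List.nil_append, List.sum_cons, List.sum_nil, weight_termOf, weight_E, weight_hub] at h1 h2
  exact ⟨Net.cnt σ (.inr (.inl (c, false))) (vs j), cnt_sgl_le σ (by simp), by omega, by omega⟩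

theorem B_bound (hn : 2 ≤ n) (c : Fin H.m₃) (hc : c ≠ H.c0) : ∃ a ≤ 1,
    4 ≤ (H.net md).cost σ (.inr (.inl (c, true))) +
      (Net.cnt σ (vB c) (vC (c, 1) 3) + Net.cnt σ (vB c) (vC (c, 2) 3) +
        Net.cnt σ (vA c) (vB c) + 2 * a) ∧
    Net.cnt σ (vB c) (vC (c, 1) 3) + Net.cnt σ (vB c) (vC (c, 2) 3) +
        Net.cnt σ (vA c) (vB c) + a ≤ 2 := by
  have hc' : (c : ℕ) ≠ 0 := fun h => hc (Fin.ext h)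
  obtain ⟨j, hj⟩ : ∃ j, hubNum (.inl (c, true)) = some j := ⟨_, if_neg hc'⟩
  have h1 := (H.net md).four_le_cost_add σ hn (.inl (c, true))
  have h2 := (H.net md).deg_single_le σ (.inl (c, true))
  have hn : (H.net md).nbr (.inr (.inl (c, true))) = _ := nbrs.eq_5 md c
  rw [Net.deg, hn] at h2
  rw [hn] at h1
  rw [Net.cnt_symm σ (vA c)]
  simp only [vq, vA, vB] at *
  simp only [hubList, hj, hc', if_false, Option.toList_some, List.map_cons, List.map_nil, List.cons_append,
    List.append_nil,
    List.nil_append, List.sum_cons, List.sum_nil, weight_termOf, weight_E, weight_hub] at h1 h2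
  exact ⟨Net.cnt σ (.inr (.inl (c, true))) (vs j), cnt_sgl_le σ (by simp), by omega, by omega⟩

theorem B_bound_zero (hn : 2 ≤ n) :
    4 ≤ (H.net md).cost σ (.inr (.inl (H.c0, true))) +
      (Net.cnt σ (vB H.c0) (vC (H.c0, 1) 3) + Net.cnt σ (vB H.c0) (vC (H.c0, 2) 3) +
        Net.cnt σ (vA H.c0) (vB H.c0) + Net.cnt σ (vq H.star.1) (vB H.c0)) ∧
    Net.cnt σ (vB H.c0) (vC (H.c0, 1) 3) + Net.cnt σ (vB H.c0) (vC (H.c0, 2) 3) +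
        Net.cnt σ (vA H.c0) (vB H.c0) + Net.cnt σ (vq H.star.1) (vB H.c0) ≤ 2 := by
  have h1 := (H.net md).four_le_cost_add σ hn (.inl (H.c0, true))
  have h2 := (H.net md).deg_single_le σ (.inl (H.c0, true))
  have hn : (H.net md).nbr (.inr (.inl (H.c0, true))) = _ := nbrs.eq_5 md H.c0
  have hc' : (H.c0 : ℕ) = 0 := rfl
  rw [Net.deg, hn] at h2
  rw [hn] at h1
  rw [Net.cnt_symm σ (vA H.c0), Net.cnt_symm σ (vq H.star.1)]
  simp only [vq, vA, vB] at *
  simp only [hubList, hubNum, hc', if_true, Option.toList_none, List.map_cons, List.map_nil, List.cons_append,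
    List.append_nil,
    List.nil_append, List.sum_cons, List.sum_nil, weight_termOf, weight_E, weight_border] at h1 h2
  omega

end HybridInstance
end


/-! ### Cost of the cuts, of the equations with three variables, and of the special link -/

noncomputable section
open scoped Classical

open Vtx

namespace HybridInstance

variable {H : HybridInstance} {md : Bool} {n : ℕ} (σ : Fin n ≃ Vtx md H.Blk H.Sgl)

def costL (g : H.Var) : ℕ := (H.net md).cost σ (.inl (.inl g))
def costPQ (l : Fin H.n) : ℕ := (H.net md).cost σ (.inr (.inr (.inl (l, true)))) +
  (H.net md).cost σ (.inr (.inr (.inl (l, false))))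
def costE (c : Fin H.m₃) : ℕ := (H.net md).cost σ (.inl (.inr (.inl (c, 0)))) +
  (H.net md).cost σ (.inl (.inr (.inl (c, 1)))) + (H.net md).cost σ (.inl (.inr (.inl (c, 2)))) +
  (H.net md).cost σ (.inr (.inl (c, false))) + (H.net md).cost σ (.inr (.inl (c, true)))

theorem le_cost_L (hn : 2 ≤ n) (g : H.Var) :
    gadBase md + gadDelta ((H.net md).deg σ (vL g 0)) (cntOut σ true (H.next g))
      ((H.net md).deg σ (vL g 2)) (cntOut σ false (H.next g)) ≤ costL σ g := by
  rw [← deg_L1, ← deg_L3]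
  exact le_cost_blk σ hn (.inl g)

theorem le_cost_C (hn : 2 ≤ n) (p : Fin H.m₃ × Fin 3) :
    gadBase md + gadDelta (cntEnter σ (H.triple p.1 p.2)) (cntLeave σ (H.triple p.1 p.2))
      ((H.net md).deg σ (vC p 2)) ((H.net md).deg σ (vC p 3)) ≤
      (H.net md).cost σ (.inl (.inr (.inl p))) := by
  rw [← deg_Y0, ← deg_Y1, vY_triple, vY_triple]
  exact le_cost_blk σ hn (.inr (.inl p))

theorem border_bound' (hn : 2 ≤ n) (l : Fin H.n) (hl : l ≠ H.star.1) :
    gadBase md + 2 + mixI σ (H.cutv l) + mixO σ (H.next (H.cutv l)) +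
      (if BadC σ (H.cutv l) then 2 else 0) ≤ costL σ (H.cutv l) + costPQ σ l := by
  have h := le_cost_L σ hn (H.cutv l)
  obtain ⟨hp, p1, p2, p3⟩ := p_bound σ hn l
  obtain ⟨hq, q1, q2, q3⟩ := q_bound σ hn l hl
  obtain ⟨h1, h2, h3⟩ := border_bound _ (cntOut σ true (H.next (H.cutv l))) _
    (cntOut σ false (H.next (H.cutv l))) _ _ _ _ _ _ p2 p3 p1 q2 q3 q1
  unfold costPQ
  split_ifs with hb
  · rw [mixI_pure σ hb.1, mixO_pure σ hb.2.1]
    rcases badC_cases σ hb with hb | hb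
    · have := h2 hb.1 hb.2.1 hb.2.2.1 hb.2.2.2
      omega
    · have := h3 hb.1 hb.2.1 hb.2.2.1 hb.2.2.2
      omega
  · unfold mixI mixO
    omega

/-- Since `nu` is true at `star`, the value false passes `star` by the direct link, which is the way
in and the way out at once. So a double use at the cut is visible in the gadget in front of `star`,
which has a reserve for it. -/
theorem cntOut_false_star : cntOut σ false H.star = cntIn σ false H.star := by
  simp [cntOut, cntIn, H.nu_star]

/-- If the special link is used, the bound is as at the other cuts, raised by 1. If it is not, 4 is
guaranteed independently of whether the equation is violated, but the error on the incoming side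
then stands on the right-hand side. -/
theorem border_bound_star (hn : 2 ≤ n) :
    (0 < Net.cnt σ (vq H.star.1) (vB H.c0) →
      gadBase md + 3 + mixI σ H.star + mixO σ (H.next H.star) +
        (if BadC σ H.star then 2 else 0) ≤ costL σ H.star + costPQ σ H.star.1) ∧
    (Net.cnt σ (vq H.star.1) (vB H.c0) = 0 → gadBase md + 4 + mixO σ (H.next H.star) ≤
      costL σ H.star + costPQ σ H.star.1 + mixI σ H.star + (cntOut σ false H.star - 1)) := by
  have h := le_cost_L σ hn H.star
  obtain ⟨hp, p1, p2, p3⟩ := p_bound σ hn H.star.1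
  rw [H.cutv_star] at p2 p3
  obtain ⟨q2, q3⟩ := q_bound_star σ hn
  obtain ⟨h1, h2, h3, h4⟩ := border_bound_link _ (cntOut σ true (H.next H.star)) _
    (cntOut σ false (H.next H.star)) _ _ _ _ _ _ p2 p3 p1 q2 q3 (cnt_sgl_le σ (by simp))
  unfold costPQ
  refine ⟨fun hq => ?_, fun hq => ?_⟩
  · split_ifs with hb
    · rw [mixI_pure σ hb.1, mixO_pure σ hb.2.1]
      rcases badC_cases σ hb with hb | hb
      · have := h2 hq hb.1 hb.2.1 hb.2.2.1 hb.2.2.2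
        omega
      · have := h3 hq hb.1 hb.2.1 hb.2.2.1 hb.2.2.2
        omega
    · have := h1 hq
      unfold mixI mixO
      omega
  · have := h4 hq
    rw [cntOut_false_star]
    unfold mixI mixO
    omega

/-! ### Equations with three variables -/

theorem deg_C (c : Fin H.m₃) :
    (H.net md).deg σ (vC (c, 0) 2) = Net.cnt σ (vA c) (vC (c, 0) 2) ∧
    (H.net md).deg σ (vC (c, 0) 3) = Net.cnt σ (vC (c, 0) 3) (vC (c, 1) 2) +
      Net.cnt σ (vC (c, 0) 3) (vC (c, 2) 2) ∧
    (H.net md).deg σ (vC (c, 1) 2) = Net.cnt σ (vC (c, 0) 3) (vC (c, 1) 2) +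
      Net.cnt σ (vC (c, 1) 2) (vC (c, 2) 2) ∧
    (H.net md).deg σ (vC (c, 1) 3) = Net.cnt σ (vA c) (vC (c, 1) 3) +
      Net.cnt σ (vB c) (vC (c, 1) 3) ∧
    (H.net md).deg σ (vC (c, 2) 2) = Net.cnt σ (vC (c, 0) 3) (vC (c, 2) 2) +
      Net.cnt σ (vC (c, 1) 2) (vC (c, 2) 2) ∧
    (H.net md).deg σ (vC (c, 2) 3) = Net.cnt σ (vB c) (vC (c, 2) 3) := by
  refine ⟨?_, ?_, ?_, ?_, ?_, ?_⟩
  · simp [Net.deg, net, nbrs_C2, Net.cnt_symm σ (vC (c, 0) 2)]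
  · simp [Net.deg, net, nbrs_C3]
  · simp [Net.deg, net, nbrs_C2, Net.cnt_symm σ (vC (c, 1) 2) (vC (c, 0) 3)]
  · simp [Net.deg, net, nbrs_C3, Net.cnt_symm σ (vC (c, 1) 3)]
  · simp [Net.deg, net, nbrs_C2, Net.cnt_symm σ (vC (c, 2) 2)]
  · simp [Net.deg, net, nbrs_C3, Net.cnt_symm σ (vC (c, 2) 3)]

theorem occurrence_bound (hn : 2 ≤ n) (p : Fin H.m₃ × Fin 3) : ∃ vis : Bool,
    gadBase md + mixY σ (H.triple p.1 p.2) +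
      side vis ((H.net md).deg σ (vC p 2)) ((H.net md).deg σ (vC p 3)) ≤
      (H.net md).cost σ (.inl (.inr (.inl p))) ∧
    (Pure σ (H.triple p.1 p.2) → vis = (val σ (H.triple p.1 p.2) == H.nu (H.triple p.1 p.2))) := by
  have h := le_cost_C σ hn p
  obtain ⟨vis, h1, h2⟩ := gadDelta_side (cntEnter σ (H.triple p.1 p.2))
    (cntLeave σ (H.triple p.1 p.2)) ((H.net md).deg σ (vC p 2)) ((H.net md).deg σ (vC p 3))
  refine ⟨vis, by unfold mixY; omega, fun hp => ?_⟩
  have h3 := h2 (mixY_pure σ hp)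
  rw [← val_eq_nu] at h3
  cases vis <;> simp_all

theorem clause_bound (hn : 2 ≤ n) (c : Fin H.m₃) (hc : c ≠ H.c0) :
    3 * gadBase md + 2 + (mixY σ (H.triple c 0) + mixY σ (H.triple c 1) + mixY σ (H.triple c 2)) +
      (if BadE σ c then 2 else 0) ≤ costE σ c := by
  obtain ⟨v0, h0, p0⟩ := occurrence_bound σ hn (c, 0)
  obtain ⟨v1, h1, p1⟩ := occurrence_bound σ hn (c, 1)
  obtain ⟨v2, h2, p2⟩ := occurrence_bound σ hn (c, 2)
  obtain ⟨e1, e2, e3, e4, e5, e6⟩ := deg_C σ c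
  rw [e1, e2] at h0
  rw [e3, e4] at h1
  rw [e5, e6] at h2
  obtain ⟨a, a1, a2, a3⟩ := A_bound σ hn c
  obtain ⟨b, b1, b2, b3⟩ := B_bound σ hn c hc
  have h := core_bound v0 v1 v2 _ _ (Net.cnt σ (vC (c, 0) 3) (vC (c, 1) 2))
    (Net.cnt σ (vC (c, 0) 3) (vC (c, 2) 2)) (Net.cnt σ (vC (c, 1) 2) (vC (c, 2) 2))
    _ _ _ _ _ _ _ a2 a3 a1 b2 b3 b1 (cnt_sgl_le σ (by simp))
  unfold costE
  simp only at h0 h1 h2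
  split_ifs with hb
  · have e := hb.2
    rw [← p0 (hb.1 0), ← p1 (hb.1 1), ← p2 (hb.1 2)] at e
    rw [e] at h
    simp only [Bool.false_eq_true, if_false] at h
    omega
  · split_ifs at h <;> omega

theorem clause_bound_zero (hn : 2 ≤ n) :
    (0 < Net.cnt σ (vq H.star.1) (vB H.c0) →
    3 * gadBase md + 3 + (mixY σ (H.triple H.c0 0) + mixY σ (H.triple H.c0 1) +
      mixY σ (H.triple H.c0 2)) + (if BadE σ H.c0 then 2 else 0) ≤ costE σ H.c0) ∧
    (Net.cnt σ (vq H.star.1) (vB H.c0) = 0 →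
    3 * gadBase md + 4 + (mixY σ (H.triple H.c0 0) + mixY σ (H.triple H.c0 1) +
      mixY σ (H.triple H.c0 2)) ≤ costE σ H.c0) := by
  generalize hc : H.c0 = c
  obtain ⟨v0, h0, p0⟩ := occurrence_bound σ hn (c, 0)
  obtain ⟨v1, h1, p1⟩ := occurrence_bound σ hn (c, 1)
  obtain ⟨v2, h2, p2⟩ := occurrence_bound σ hn (c, 2)
  obtain ⟨e1, e2, e3, e4, e5, e6⟩ := deg_C σ c
  rw [e1, e2] at h0
  rw [e3, e4] at h1
  rw [e5, e6] at h2
  obtain ⟨a, a1, a2, a3⟩ := A_bound σ hn c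
  obtain ⟨b2, b3⟩ := B_bound_zero σ hn
  rw [hc] at b2 b3
  have h := core_bound_link v0 v1 v2 _ _ (Net.cnt σ (vC (c, 0) 3) (vC (c, 1) 2))
    (Net.cnt σ (vC (c, 0) 3) (vC (c, 2) 2)) (Net.cnt σ (vC (c, 1) 2) (vC (c, 2) 2))
    _ _ _ _ _ _ _ a2 a3 a1 b2 b3 (cnt_sgl_le σ (by simp)) (cnt_sgl_le σ (by simp))
  unfold costE
  simp only at h0 h1 h2
  refine ⟨fun hq => ?_, fun hq => ?_⟩
  · have h := h.1 hq
    split_ifs with hb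
    · have e := hb.2
      rw [← p0 (hb.1 0), ← p1 (hb.1 1), ← p2 (hb.1 2)] at e
      rw [e] at h
      simp only [Bool.false_eq_true, if_false] at h
      omega
    · split_ifs at h <;> omega
  · have h := h.2 hq
    omega

/-- With the special link in use, the two groups contribute 3 each and both violations are charged.
Without it they contribute 4 each; the surplus of 2 is the same for one violated equation as for
two, so only the disjunction can be charged. -/
theorem star_bound (hn : 2 ≤ n) :
    4 * gadBase md + 6 + mixI σ H.star + mixO σ (H.next H.star) + (mixY σ (H.triple H.c0 0) +
      mixY σ (H.triple H.c0 1) + mixY σ (H.triple H.c0 2)) +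
      (if BadC σ H.star ∨ BadE σ H.c0 then 2 else 0) ≤
    costL σ H.star + costPQ σ H.star.1 + costE σ H.c0 + (cntOut σ false H.star - 1) := by
  obtain ⟨a1, a2⟩ := border_bound_star σ hn
  obtain ⟨b1, b2⟩ := clause_bound_zero σ hn
  -- Without the special link, `mixI` has to change sides. For an error this is `8 - 1 ≥ 6 + 1`; if
  -- one of the two equations is counted as violated, `star` is consistent and the error is 0.
  have hm : mixI σ H.star ≤ 1 := by unfold mixI mix; split_ifs <;> omega
  by_cases hq : 0 < Net.cnt σ (vq H.star.1) (vB H.c0)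
  · have a1 := a1 hq
    have b1 := b1 hq
    by_cases h1 : BadC σ H.star <;> by_cases h2 : BadE σ H.c0 <;>
      simp only [h1, h2, if_true, if_false, or_true, or_false] at a1 b1 ⊢ <;> omega
  · have a2 := a2 (by omega)
    have b2 := b2 (by omega)
    split_ifs with hb
    · have : mixI σ H.star = 0 := by
        rcases hb with hb | hb
        · exact mixI_pure σ hb.1
        · exact mixI_pure σ (hb.1 0)
      omega
    · omega

end HybridInstance
end


/-! ### The total lower bound -/

noncomputable section
open scoped Classical

open Vtx

namespace HybridInstance

section
variable (H : HybridInstance)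

theorem triple_injective : Function.Injective fun p : Fin H.m₃ × Fin 3 => H.triple p.1 p.2 := by
  intro p p' h
  have h1 := H.place_triple p (H.triple_contact _ _)
  have h2 := H.place_triple p' (H.triple_contact _ _)
  simp only at h
  rw [← h1, ← h2]
  congr

def varEquiv : H.Pair ⊕ H.Pair ⊕ (Fin H.m₃ × Fin 3) ≃ H.Var :=
  Equiv.ofBijective (Sum.elim (fun v => v.1) (Sum.elim (fun v => H.mate v.1)
    fun p => H.triple p.1 p.2)) (by
    have hm : Function.Injective H.mate := fun v w h => by rw [← H.mate_mate v, h, H.mate_mate]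
    constructor
    · rintro (v | v | p) (w | w | p') h <;> simp only [Sum.elim_inl, Sum.elim_inr] at h
      · rw [Subtype.ext h]
      · exact absurd (h ▸ v.2) (H.not_low_mate w.2)
      · exact absurd (h ▸ H.triple_contact _ _) (H.not_contact_of_low v.2)
      · exact absurd (h ▸ w.2) (H.not_low_mate v.2)
      · rw [Subtype.ext (hm h)]
      · exact absurd (h ▸ H.triple_contact _ _) (H.not_contact_mate (H.not_contact_of_low v.2))
      · exact absurd (h ▸ H.triple_contact _ _) (H.not_contact_of_low w.2)
      · exact absurd (h ▸ H.triple_contact _ _) (H.not_contact_mate (H.not_contact_of_low w.2))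
      · rw [H.triple_injective h]
    · intro h
      rcases H.var_cases h with ⟨p, rfl⟩ | ⟨v, rfl⟩ | ⟨v, rfl⟩
      exacts [⟨.inr (.inr p), rfl⟩, ⟨.inl v, rfl⟩, ⟨.inr (.inl v), rfl⟩])

theorem sum_var (f : H.Var → ℕ) : ∑ h, f h = ∑ v : H.Pair, (f v.1 + f (H.mate v.1)) +
    ∑ c, (f (H.triple c 0) + f (H.triple c 1) + f (H.triple c 2)) := by
  rw [← H.varEquiv.sum_comp, Fintype.sum_sum_type, Fintype.sum_sum_type, Fintype.sum_prod_type,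
    Finset.sum_add_distrib, ← add_assoc]
  simp only [Fin.sum_univ_three]
  rfl

theorem sum_cut (f : Fin H.n → ℕ) : ∑ g : H.Var, (if H.IsCut g then f g.1 else 0) = ∑ l, f l := by
  rw [← Finset.sum_filter]
  refine Finset.sum_nbij' (fun g => g.1) H.cutv ?_ ?_ ?_ ?_ ?_
  · simp
  · intro l _; simpa using H.isCut_cutv l
  · intro g hg; exact (Finset.mem_filter.1 hg).2.symm
  · intro l _; exact H.cutv_fst l
  · intro g _; rfl

theorem isCut_star : H.IsCut H.star := by
  have := H.isCut_cutv H.star.1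
  rwa [H.cutv_star] at this

end

variable {H : HybridInstance} {md : Bool} {n : ℕ} (σ : Fin n ≃ Vtx md H.Blk H.Sgl)

/-- The number of inconsistent variables and of equations violated by consistent values; for two of
the equations, it is only counted whether one of them is violated. -/
def defect : ℕ := ∑ h, (if Pure σ h then 0 else 1) +
  ∑ g ∈ Finset.univ.erase H.star, (if BadC σ g then 1 else 0) +
  ∑ v, (if BadM σ v then 1 else 0) + ∑ c ∈ Finset.univ.erase H.c0, (if BadE σ c then 1 else 0) +
  (if BadC σ H.star ∨ BadE σ H.c0 then 1 else 0)

/-- A common form for cut and uncut gadgets: the gadget at a cut is grouped with the two single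
vertices of its circle. The last summand on the left isolates the reserve of the gadget in front of
`star`, which balances the correction in `star_bound`. -/
theorem circle_bound' (hn : 2 ≤ n) {g : H.Var} (hg : g ≠ H.star) :
    gadBase md + (if H.IsCut g then 2 else 0) + mixI σ g + mixO σ (H.next g) +
      2 * (if BadC σ g then 1 else 0) +
      (if g = H.prev H.star then cntOut σ false H.star - 1 else 0) ≤
      costL σ g + (if H.IsCut g then costPQ σ g.1 else 0) := by
  by_cases hc : H.IsCut g
  · have h1 : g.1 ≠ H.star.1 := by
      intro h
      apply hg
      rw [show g = H.cutv g.1 from hc, h, H.cutv_star]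
    -- The gadget in front of `star` is not at a cut, because its circle is cut at `star` only.
    have h2 : g ≠ H.prev H.star := by rintro rfl; exact h1 rfl
    have := border_bound' σ hn g.1 h1
    rw [← show g = H.cutv g.1 from hc] at this
    rw [if_pos hc, if_pos hc, if_neg h2]
    split_ifs at * <;> omega
  · have := circle_bound σ hn hc
    rw [if_neg hc, if_neg hc]
    have h3 : (if g = H.prev H.star then cntOut σ false H.star - 1 else 0) ≤
        cntOut σ false (H.next g) - 1 := by
      split_ifs with h
      · rw [h, H.next_prev]
      · omega
    unfold costL
    generalize (if g = H.prev H.star then cntOut σ false H.star - 1 else 0) = e at h3 ⊢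
    split_ifs at this ⊢ <;> omega

/-- The groups partition the gadgets and single vertices. Beyond the base costs there is 2 for each
circle, 2 for each equation with three variables and 4 for each hub. The further 2 arises because
the special circle and the special equation cost 3 each and not 2. -/
theorem lower_bound (hn : 2 ≤ n) :
    gadBase md * (Fintype.card H.Var + 3 * H.m₃ + Fintype.card H.Pair) + 2 * H.m₃ + 2 * H.n +
      4 * (H.n + H.m₃) + 2 + 2 * defect σ ≤
      ∑ i, (H.net md).d (σ i) (σ (finRotate n i)) := by
  refine le_trans ?_ ((H.net md).sum_cost_le σ)
  have hsum : ∑ b, (H.net md).cost σ b = (∑ g, (costL σ g + (if H.IsCut g then costPQ σ g.1 else 0)) +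
      ∑ c, costE σ c) + ∑ v : H.Pair, (H.net md).cost σ (.inl (.inr (.inr v))) +
      ∑ j : Fin (H.n + H.m₃), (H.net md).cost σ (.inr (.inr (.inr j))) := by
    rw [Finset.sum_add_distrib, sum_cut]
    simp only [Fintype.sum_sum_type, Fintype.sum_prod_type, Fin.sum_univ_three, Fintype.sum_bool,
      costL, costPQ, costE, Finset.sum_add_distrib]
    ring
  rw [hsum]
  have hs : 4 * (H.n + H.m₃) ≤ ∑ j : Fin (H.n + H.m₃), (H.net md).cost σ (.inr (.inr (.inr j))) := by
    have := Finset.card_nsmul_le_sum (Finset.univ : Finset (Fin (H.n + H.m₃)))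
      (fun j => (H.net md).cost σ (.inr (.inr (.inr j)))) 4
      fun j _ => (H.net md).four_le_cost_hub σ hn _ rfl
    rw [Finset.card_univ, Fintype.card_fin, smul_eq_mul] at this
    omega
  have hM := Finset.sum_le_sum fun (v : H.Pair) (_ : v ∈ Finset.univ) => match_bound σ hn v
  have hL := Finset.sum_le_sum fun (g : H.Var) (hg : g ∈ Finset.univ.erase H.star) =>
    circle_bound' σ hn (Finset.ne_of_mem_erase hg)
  have hE := Finset.sum_le_sum fun (c : Fin H.m₃) (hc : c ∈ Finset.univ.erase H.c0) =>
    clause_bound σ hn c (Finset.ne_of_mem_erase hc)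
  have hS := star_bound σ hn
  have hp : H.prev H.star ∈ Finset.univ.erase H.star :=
    Finset.mem_erase.2 ⟨prev_ne _, Finset.mem_univ _⟩
  rw [Finset.sum_add_distrib, Finset.sum_ite_eq' _ _ fun _ => cntOut σ false H.star - 1, if_pos hp] at hL
  -- Here the three errors are collected variable by variable: shifting along the circle permutes
  -- the variables, and `sum_var` distributes the errors of the variable gadgets over pairs and
  -- equations.
  have hmix : 2 * ∑ h, (if Pure σ h then 0 else 1) ≤ ∑ h, mixI σ h + ∑ h, mixO σ (H.next h) +
      (∑ v : H.Pair, (mixY σ v.1 + mixY σ (H.mate v.1)) + ∑ c, (mixY σ (H.triple c 0) +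
        mixY σ (H.triple c 1) + mixY σ (H.triple c 2))) := by
    have hnext : ∑ h, mixO σ (H.next h) = ∑ h, mixO σ h := H.nextEquiv.sum_comp (mixO σ)
    rw [← sum_var, hnext, Finset.mul_sum, ← Finset.sum_add_distrib,
      ← Finset.sum_add_distrib]
    refine Finset.sum_le_sum fun h _ => ?_
    split_ifs with hh
    · omega
    · have := two_le_mix σ h hh
      omega
  have hcut : ∑ g ∈ Finset.univ.erase H.star, (if H.IsCut g then 2 else 0) + 2 = 2 * H.n := by
    have h1 := H.sum_cut fun _ => 2
    rw [← Finset.add_sum_erase _ _ (Finset.mem_univ H.star), if_pos H.isCut_star] at h1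
    rw [Finset.sum_const, Finset.card_univ, Fintype.card_fin, smul_eq_mul] at h1
    omega
  have cL : (Finset.univ.erase H.star).card + 1 = Fintype.card H.Var :=
    Finset.card_erase_add_one (Finset.mem_univ _)
  have cE : (Finset.univ.erase H.c0).card + 1 = H.m₃ := by
    rw [Finset.card_erase_add_one (Finset.mem_univ _), Finset.card_univ, Fintype.card_fin]
  have cM : (Finset.univ : Finset H.Pair).card = Fintype.card H.Pair := rfl
  rw [← Finset.add_sum_erase _ _ (Finset.mem_univ H.star), if_pos H.isCut_star,
    ← Finset.add_sum_erase _ _ (Finset.mem_univ H.c0)]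
  rw [← Finset.add_sum_erase _ (mixI σ) (Finset.mem_univ H.star),
    ← Finset.add_sum_erase _ (fun h => mixO σ (H.next h)) (Finset.mem_univ H.star),
    ← Finset.add_sum_erase _ (fun c => mixY σ (H.triple c 0) +
        mixY σ (H.triple c 1) + mixY σ (H.triple c 2)) (Finset.mem_univ H.c0)] at hmix
  have e2 : ∀ (p : Prop) [Decidable p], (if p then 2 else 0) = 2 * (if p then 1 else 0) := by
    intro p _; split_ifs <;> rfl
  have e3 := e2 (BadC σ H.star ∨ BadE σ H.c0)
  have e4 : ∑ v, (if BadM σ v then 2 else 0) = 2 * ∑ v, (if BadM σ v then 1 else 0) := by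
    rw [Finset.mul_sum]; exact Finset.sum_congr rfl fun v _ => e2 _
  have e5 : ∑ c ∈ Finset.univ.erase H.c0, (if BadE σ c then 2 else 0) =
      2 * ∑ c ∈ Finset.univ.erase H.c0, (if BadE σ c then 1 else 0) := by
    rw [Finset.mul_sum]; exact Finset.sum_congr rfl fun v _ => e2 _
  simp only [Finset.sum_add_distrib (s := Finset.univ.erase H.star), ← Finset.mul_sum,
    Finset.sum_const, smul_eq_mul] at hL hmix ⊢
  rw [Finset.sum_add_distrib, Finset.sum_add_distrib, Finset.sum_add_distrib, e4] at hM
  rw [Finset.sum_add_distrib, Finset.sum_add_distrib, Finset.sum_add_distrib, e5] at hE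
  rw [Finset.sum_add_distrib (s := Finset.univ (α := H.Pair))] at hmix
  simp only [Finset.sum_const, smul_eq_mul] at hM hE
  unfold defect
  rw [e3] at hS
  -- The products with `gadBase md` are expanded beforehand, so that the rest is linear in atoms
  -- shared by all inequalities.
  have m1 : ∀ a b c x y z : ℕ, a + 1 = x → b + 1 = y → c = z →
      gadBase md * (x + 3 * y + z) = a * gadBase md + gadBase md + b * (3 * gadBase md) +
        3 * gadBase md + c * gadBase md ∧ 2 * y = b * 2 + 2 := by
    rintro a b c _ _ _ rfl rfl rfl
    constructor <;> ring
  obtain ⟨m1, m2⟩ := m1 _ _ _ _ _ _ cL cE cM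
  rw [m1, m2]
  omega

end HybridInstance
end


noncomputable section
open scoped Classical

/-! ## Assignments from tours -/

namespace HybridInstance

section
variable (H : HybridInstance)

/-- The equations: circle equations, matching equations, equations with three variables. -/
abbrev Eqn : Type := H.Var ⊕ H.Pair ⊕ Fin H.m₃

/-- The third equation of a variable. -/
def third (x : H.Var) : H.Eqn :=
  if hc : H.IsContact x then .inr (.inr (H.place x hc).1)
  else if hl : H.IsLow x then .inr (.inl ⟨x, hl⟩)
  else .inr (.inl ⟨H.mate x, H.isLow_mate hc hl⟩)

def eqnsOf (x : H.Var) : Finset H.Eqn := {.inl (H.prev x), .inl x, H.third x}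

variable {H}

/-- Equations with three variables are expressed by agreement with `nu`, in the form in which the
gadgets see them; `holds_triple` relates this to the right-hand side. -/
def Viol (φ : H.Var → Bool) : H.Eqn → Prop
  | .inl g => φ g ≠ φ (H.next g)
  | .inr (.inl v) => φ v.1 ≠ φ (H.mate v.1)
  | .inr (.inr c) => xor (φ (H.triple c 0) == H.nu (H.triple c 0))
      (xor (φ (H.triple c 1) == H.nu (H.triple c 1)) (φ (H.triple c 2) == H.nu (H.triple c 2))) = false

def flip (x : H.Var) (φ : H.Var → Bool) : H.Var → Bool := Function.update φ x (!φ x)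

theorem third_triple (p : Fin H.m₃ × Fin 3) : H.third (H.triple p.1 p.2) = .inr (.inr p.1) := by
  rw [third, dif_pos (show H.IsContact _ from H.triple_contact p.1 p.2), H.place_triple]

theorem third_low (v : H.Pair) : H.third v.1 = .inr (.inl v) := by
  rw [third, dif_neg (H.not_contact_of_low v.2), dif_pos v.2]

theorem third_mate (v : H.Pair) : H.third (H.mate v.1) = .inr (.inl v) := by
  rw [third, dif_neg (H.not_contact_mate (H.not_contact_of_low v.2)), dif_neg (H.not_low_mate v.2)]
  congr 3
  simp only [H.mate_mate]

theorem third_ne (x g : H.Var) : H.third x ≠ .inl g := by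
  unfold third; split_ifs <;> simp

theorem mem_eqnsOf_inl {x g : H.Var} : .inl g ∈ H.eqnsOf x ↔ x = g ∨ x = H.next g := by
  unfold eqnsOf
  simp only [Finset.mem_insert, Finset.mem_singleton, Sum.inl.injEq, (third_ne x g).symm, or_false]
  constructor
  · rintro (rfl | rfl)
    exacts [.inr (H.next_prev x).symm, .inl rfl]
  · rintro (rfl | rfl)
    exacts [.inr rfl, .inl (H.prev_next g).symm]

theorem mem_eqnsOf_pair {x : H.Var} {v : H.Pair} :
    .inr (.inl v) ∈ H.eqnsOf x ↔ x = v.1 ∨ x = H.mate v.1 := by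
  unfold eqnsOf
  simp only [Finset.mem_insert, Finset.mem_singleton, reduceCtorEq, false_or]
  rcases H.var_cases x with ⟨p, rfl⟩ | ⟨w, rfl⟩ | ⟨w, rfl⟩
  · rw [third_triple]
    simp only [Sum.inr.injEq, reduceCtorEq, false_iff, not_or]
    exact ⟨fun h => H.not_contact_of_low v.2 (h ▸ H.triple_contact p.1 p.2),
      fun h => H.not_contact_mate (H.not_contact_of_low v.2) (h ▸ H.triple_contact p.1 p.2)⟩
  · rw [third_low]
    simp only [Sum.inr.injEq, Sum.inl.injEq]
    constructor
    · rintro rfl; exact .inl rfl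
    · rintro (h | h)
      · exact Subtype.ext h.symm
      · exact absurd (h ▸ w.2) (H.not_low_mate v.2)
  · rw [third_mate]
    simp only [Sum.inr.injEq, Sum.inl.injEq]
    constructor
    · rintro rfl; exact .inr rfl
    · rintro (h | h)
      · exact absurd (h ▸ v.2) (H.not_low_mate w.2)
      · apply Subtype.ext
        rw [← H.mate_mate v.1, ← h, H.mate_mate]

theorem mem_eqnsOf_triple {x : H.Var} {c : Fin H.m₃} :
    .inr (.inr c) ∈ H.eqnsOf x ↔ ∃ k, x = H.triple c k := by
  unfold eqnsOf
  simp only [Finset.mem_insert, Finset.mem_singleton, reduceCtorEq, false_or]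
  rcases H.var_cases x with ⟨p, rfl⟩ | ⟨w, rfl⟩ | ⟨w, rfl⟩
  · rw [third_triple]
    simp only [Sum.inr.injEq]
    constructor
    · rintro rfl; exact ⟨_, rfl⟩
    · rintro ⟨k, hk⟩
      exact (congrArg Prod.fst (H.triple_injective (a₁ := p) (a₂ := (c, k)) hk)).symm
  · rw [third_low]
    simp only [Sum.inr.injEq, reduceCtorEq, false_iff, not_exists]
    exact fun k h => H.not_contact_of_low w.2 (h ▸ H.triple_contact c k)
  · rw [third_mate]
    simp only [Sum.inr.injEq, reduceCtorEq, false_iff, not_exists]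
    exact fun k h => H.not_contact_mate (H.not_contact_of_low w.2) (h ▸ H.triple_contact c k)

theorem viol_flip_of_notMem {x : H.Var} {e : H.Eqn} (φ : H.Var → Bool) (h : e ∉ H.eqnsOf x) :
    Viol (flip x φ) e ↔ Viol φ e := by
  rcases e with g | v | c
  · rw [mem_eqnsOf_inl, not_or] at h
    simp only [Viol, flip, Function.update_of_ne (Ne.symm h.1), Function.update_of_ne (Ne.symm h.2)]
  · rw [mem_eqnsOf_pair, not_or] at h
    simp only [Viol, flip, Function.update_of_ne (Ne.symm h.1), Function.update_of_ne (Ne.symm h.2)]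
  · rw [mem_eqnsOf_triple, not_exists] at h
    simp only [Viol, flip, Function.update_of_ne (Ne.symm (h _))]

/-- A variable occurs only once in each of its equations, so changing its value changes the parity.
-/
theorem viol_flip_of_mem {x : H.Var} {e : H.Eqn} (φ : H.Var → Bool) (h : e ∈ H.eqnsOf x) :
    Viol (flip x φ) e ↔ ¬ Viol φ e := by
  rcases e with g | v | c
  · rw [mem_eqnsOf_inl] at h
    rcases h with rfl | rfl
    · simp only [Viol, flip, Function.update_self, Function.update_of_ne (H.next_ne x)]
      cases φ x <;> cases φ (H.next x) <;> simp
    · simp only [Viol, flip, Function.update_self, Function.update_of_ne (H.next_ne g).symm]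
      cases φ g <;> cases φ (H.next g) <;> simp
  · have hne : H.mate v.1 ≠ v.1 := fun h => H.not_contact_of_low v.2 ((H.mate_eq_iff _).1 h)
    rw [mem_eqnsOf_pair] at h
    rcases h with rfl | rfl
    · simp only [Viol, flip, Function.update_self, Function.update_of_ne hne]
      cases φ v.1 <;> cases φ (H.mate v.1) <;> simp
    · simp only [Viol, flip, Function.update_self, Function.update_of_ne hne.symm]
      cases φ v.1 <;> cases φ (H.mate v.1) <;> simp
  · rw [mem_eqnsOf_triple] at h
    obtain ⟨k, rfl⟩ := h
    have hne : ∀ j k, j ≠ k → H.triple c j ≠ H.triple c k := fun j k hjk h =>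
      hjk (congrArg Prod.snd (H.triple_injective (a₁ := (c, j)) (a₂ := (c, k)) h))
    have key : ∀ j, (flip (H.triple c k) φ (H.triple c j) == H.nu (H.triple c j)) =
        xor (decide (j = k)) (φ (H.triple c j) == H.nu (H.triple c j)) := by
      intro j
      by_cases hjk : j = k
      · subst hjk
        simp only [flip, Function.update_self, decide_true]
        cases φ (H.triple c j) <;> cases H.nu (H.triple c j) <;> rfl
      · simp only [flip, Function.update_of_ne (hne j k hjk), decide_eq_false hjk]
        cases φ (H.triple c j) <;> cases H.nu (H.triple c j) <;> rfl
    simp only [Viol, key]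
    generalize (φ (H.triple c 0) == H.nu (H.triple c 0)) = b0
    generalize (φ (H.triple c 1) == H.nu (H.triple c 1)) = b1
    generalize (φ (H.triple c 2) == H.nu (H.triple c 2)) = b2
    clear key hne
    revert k b0 b1 b2
    decide

/-- The number of violated equations of a variable. -/
def violAt (x : H.Var) (φ : H.Var → Bool) : ℕ := ((H.eqnsOf x).filter (Viol φ)).card

/-- Change the value of a variable if most of its equations are violated. -/
def improve (x : H.Var) (φ : H.Var → Bool) : H.Var → Bool := if 2 ≤ violAt x φ then flip x φ else φ

/-- A variable has at most three equations. If two or more are violated, the change leaves at most 3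
- 2 of them violated. -/
theorem violAt_improve_le (x : H.Var) (φ : H.Var → Bool) : violAt x (improve x φ) ≤ 1 := by
  unfold improve
  split_ifs with h
  · have h1 : (H.eqnsOf x).filter (Viol (flip x φ)) = (H.eqnsOf x).filter fun e => ¬ Viol φ e :=
      Finset.filter_congr fun e he => viol_flip_of_mem φ he
    have h2 := Finset.card_filter_add_card_filter_not (s := H.eqnsOf x) (Viol φ)
    have h3 : (H.eqnsOf x).card ≤ 3 := Finset.card_le_three
    unfold violAt at h ⊢
    rw [h1]
    omega
  · omega

theorem viol_improve {x : H.Var} {e : H.Eqn} (φ : H.Var → Bool) (h : e ∉ H.eqnsOf x) :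
    Viol (improve x φ) e ↔ Viol φ e := by
  unfold improve
  split_ifs
  exacts [viol_flip_of_notMem φ h, Iff.rfl]

/-- The violated equations all of whose variables are settled. -/
def badSet (S : H.Var → Prop) (φ : H.Var → Bool) : Finset H.Eqn :=
  Finset.univ.filter fun e => (∀ y, e ∈ H.eqnsOf y → S y) ∧ Viol φ e

theorem mem_badSet {S : H.Var → Prop} {φ : H.Var → Bool} {e : H.Eqn} :
    e ∈ badSet S φ ↔ (∀ y, e ∈ H.eqnsOf y → S y) ∧ Viol φ e := by
  simp [badSet]

/-- The subtraction mirrors the last term of `defect`: the two special equations count as one if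
both are violated. -/
def badNum (S : H.Var → Prop) (φ : H.Var → Bool) : ℕ :=
  (badSet S φ).card - if .inl H.star ∈ badSet S φ ∧ .inr (.inr H.c0) ∈ badSet S φ then 1 else 0

/-- Only equations of `x` can become fully settled by settling `x`, and at most one of them is
violated after the majority step. Equations settled before do not contain `x` and are not affected,
so the discount for the special equations is not lost either. -/
theorem badNum_improve {S : H.Var → Prop} {x : H.Var} (hx : ¬ S x) (φ : H.Var → Bool) :
    badNum (fun y => S y ∨ y = x) (improve x φ) ≤ badNum S φ + 1 := by
  have h1 : badSet (fun y => S y ∨ y = x) (improve x φ) ⊆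
      badSet S φ ∪ (H.eqnsOf x).filter (Viol (improve x φ)) := by
    intro e he
    simp only [badSet, Finset.mem_union, Finset.mem_filter, Finset.mem_univ, true_and] at he ⊢
    by_cases hm : e ∈ H.eqnsOf x
    · exact .inr ⟨hm, he.2⟩
    · refine .inl ⟨fun y hy => ?_, (viol_improve φ hm).1 he.2⟩
      rcases he.1 y hy with h | rfl
      exacts [h, absurd hy hm]
  have h2 : badSet S φ ⊆ badSet (fun y => S y ∨ y = x) (improve x φ) := by
    intro e he
    simp only [badSet, Finset.mem_filter, Finset.mem_univ, true_and] at he ⊢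
    have hm : e ∉ H.eqnsOf x := fun h => hx (he.1 x h)
    exact ⟨fun y hy => .inl (he.1 y hy), (viol_improve φ hm).2 he.2⟩
  have h3 := (Finset.card_le_card h1).trans (Finset.card_union_le _ _)
  have h4 := violAt_improve_le x φ
  have h5 := Finset.card_le_card h2
  unfold violAt at h4
  unfold badNum
  split_ifs with h6 h7 h7
  · omega
  · omega
  · exact absurd ⟨h2 h7.1, h2 h7.2⟩ h6
  · omega

/-- If the discount applies, two equations of `star` are violated and the majority step removes at
least one violation, so the discount is earned. If it does not apply, the step does no harm. -/
theorem card_viol_improve_star (φ : H.Var → Bool) :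
    (Finset.univ.filter (Viol (improve H.star φ))).card ≤ badNum (fun _ => True) φ := by
  have h0 : badSet (fun _ => True) φ = Finset.univ.filter (Viol φ) := by
    unfold badSet; simp
  have split : ∀ ψ : H.Var → Bool, (Finset.univ.filter (Viol ψ)).card = violAt H.star ψ +
      ((Finset.univ \ H.eqnsOf H.star).filter (Viol ψ)).card := by
    intro ψ
    rw [violAt, ← Finset.card_union_of_disjoint, ← Finset.filter_union,
      Finset.union_sdiff_of_subset (Finset.subset_univ _)]
    exact Finset.disjoint_filter_filter Finset.disjoint_sdiff
  have h1 : (Finset.univ \ H.eqnsOf H.star).filter (Viol (improve H.star φ)) =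
      (Finset.univ \ H.eqnsOf H.star).filter (Viol φ) :=
    Finset.filter_congr fun e he => viol_improve φ (Finset.mem_sdiff.1 he).2
  have h2 := split φ
  have h3 := split (improve H.star φ)
  have h4 := violAt_improve_le H.star φ
  rw [h1] at h3
  unfold badNum
  rw [h0]
  have e1 : (.inl H.star : H.Eqn) ∈ H.eqnsOf H.star := mem_eqnsOf_inl.2 (.inl rfl)
  have e2 : (.inr (.inr H.c0) : H.Eqn) ∈ H.eqnsOf H.star := mem_eqnsOf_triple.2 ⟨0, rfl⟩
  split_ifs with h
  · have h5 : 2 ≤ violAt H.star φ := by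
      have : ({.inl H.star, .inr (.inr H.c0)} : Finset H.Eqn) ⊆ (H.eqnsOf H.star).filter (Viol φ) := by
        intro e he
        simp only [Finset.mem_insert, Finset.mem_singleton] at he
        simp only [Finset.mem_filter, Finset.mem_univ, true_and] at h ⊢
        rcases he with rfl | rfl
        exacts [⟨e1, h.1⟩, ⟨e2, h.2⟩]
      have := Finset.card_le_card this
      rwa [Finset.card_pair (by simp)] at this
    omega
  · by_cases h6 : 2 ≤ violAt H.star φ
    · omega
    · have : improve H.star φ = φ := if_neg h6
      rw [this]
      omega

/-- Settle the variables of a list one after the other, except those that are settled already. -/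
def settle (S : H.Var → Prop) (L : List H.Var) (φ : H.Var → Bool) : H.Var → Bool :=
  L.foldl (fun φ x => if S x then φ else improve x φ) φ

/-- `S` is the initial set of settled variables, which the procedure consults throughout; `T` is the
set reached so far. On the rest of the list the two agree, since the list has no repetitions. -/
theorem badNum_settle (S : H.Var → Prop) (L : List H.Var) (hL : L.Nodup) (φ : H.Var → Bool)
    (T : H.Var → Prop) (hT : ∀ x ∈ L, T x ↔ S x) :
    badNum (fun y => T y ∨ y ∈ L) (settle S L φ) ≤ badNum T φ + (L.filter fun x => ¬ S x).length := by
  induction L generalizing φ T with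
  | nil => simp [settle]
  | cons x L ih =>
    rw [List.nodup_cons] at hL
    have e : (fun y => T y ∨ y ∈ x :: L) = fun y => (T y ∨ y = x) ∨ y ∈ L := by
      funext y; simp [or_assoc]
    by_cases hx : S x
    · have hTx := (hT x (by simp)).2 hx
      have e' : (fun y => T y ∨ y = x) = T := by
        funext y; simp only [eq_iff_iff, or_iff_left_iff_imp]; rintro rfl; exact hTx
      have := ih hL.2 φ T fun y hy => hT y (by simp [hy])
      rw [e, ← e'] at *
      simpa [settle, hx] using this
    · have hTx : ¬ T x := fun h => hx ((hT x (by simp)).1 h)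
      have h1 := badNum_improve hTx φ
      have := ih hL.2 (improve x φ) (fun y => T y ∨ y = x) fun y hy => by
        have : y ≠ x := fun h => hL.1 (h ▸ hy)
        simp only [this, or_false]
        exact hT y (by simp [hy])
      rw [e]
      simp only [settle, List.foldl_cons, hx, if_false] at this ⊢
      rw [List.filter_cons_of_pos (by simpa using hx), List.length_cons]
      omega

variable (H)

def numVar : ℕ := ∑ l, 7 * H.t l

/-- The numbering of the variables. -/
def gid : H.Var ≃ Fin H.numVar := finSigmaFinEquiv

def varList : List H.Var := List.ofFn H.gid.symm

variable {H}

theorem varList_nodup : H.varList.Nodup := List.nodup_ofFn.2 H.gid.symm.injective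

theorem mem_varList (v : H.Var) : v ∈ H.varList := by
  unfold varList
  rw [List.mem_ofFn]
  exact ⟨H.gid v, by simp⟩

/-- The assignment obtained from partial information about a tour. -/
def decode (S : H.Var → Prop) (φ : H.Var → Bool) : H.Var → Bool :=
  improve H.star (settle S H.varList φ)

/-- One violated equation per variable outside `S`, plus those counted at the start; the discount
disappears in the last step at `star`. -/
theorem card_viol_decode (S : H.Var → Prop) (φ : H.Var → Bool) :
    (Finset.univ.filter (Viol (decode S φ))).card ≤ badNum S φ + ∑ h, if S h then 0 else 1 := by
  have h1 := card_viol_improve_star (settle S H.varList φ)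
  have h2 := badNum_settle S H.varList varList_nodup φ S fun _ _ => Iff.rfl
  have e : (fun y => S y ∨ y ∈ H.varList) = fun _ => True := by
    funext y; simp [mem_varList]
  have h3 : (H.varList.filter fun x => ¬ S x).length = ∑ h, if S h then 0 else 1 := by
    rw [← List.toFinset_card_of_nodup (varList_nodup.filter _)]
    rw [Finset.card_eq_sum_ones, List.toFinset_filter]
    have : H.varList.toFinset = Finset.univ := by
      ext v; simp [mem_varList]
    rw [this, Finset.sum_filter]
    refine Finset.sum_congr rfl fun v _ => ?_
    by_cases h : S v <;> simp [h]
  rw [e, h3] at h2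
  exact h1.trans h2

end

/-! ### Unsatisfied equations -/

section unsat
variable {H : HybridInstance}

def toAssignment (φ : H.Var → Bool) : H.Assignment := fun v => if φ v then 1 else 0

theorem holds_pair (φ : H.Var → Bool) {v w : H.Var} (h : v ≠ w) :
    ¬ LinEq.Holds ⟨{v, w}, 0⟩ (toAssignment φ) ↔ φ v ≠ φ w := by
  unfold LinEq.Holds toAssignment
  rw [Finset.sum_pair h]
  change ¬ ((if φ v then 1 else 0) + (if φ w then 1 else 0) = (0 : ZMod 2)) ↔ _
  cases φ v <;> cases φ w <;> decide

theorem nu_triple (c : Fin H.m₃) (k : Fin 3) :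
    H.nu (H.triple c k) = decide (k ≠ 1 ∨ H.rhs c = 1) := by
  rw [nu, dif_pos (show H.IsContact _ from H.triple_contact c k), H.place_triple (c, k)]

/-- For right-hand side 1, agreement with `nu` is the value itself at all three places. For
right-hand side 0 it is negated at the middle place, which turns an even sum into an odd one. -/
theorem holds_triple (φ : H.Var → Bool) (c : Fin H.m₃) :
    ¬ LinEq.Holds ⟨Finset.univ.image (H.triple c), H.rhs c⟩ (toAssignment φ) ↔
      Viol φ (.inr (.inr c)) := by
  unfold LinEq.Holds
  rw [Finset.sum_image fun j _ k _ h =>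
    congrArg Prod.snd (H.triple_injective (a₁ := (c, j)) (a₂ := (c, k)) h), Fin.sum_univ_three]
  simp only [Viol, nu_triple, toAssignment]
  generalize φ (H.triple c 0) = b0
  generalize φ (H.triple c 1) = b1
  generalize φ (H.triple c 2) = b2
  generalize H.rhs c = r
  revert b0 b1 b2 r
  decide

theorem unsat_eq (φ : H.Var → Bool) :
    H.unsat (toAssignment φ) = (Finset.univ.filter (Viol φ)).card := by
  have h1 : ∀ v : H.Var, ¬ LinEq.Holds ⟨{v, H.next v}, 0⟩ (toAssignment φ) ↔ Viol φ (.inl v) :=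
    fun v => holds_pair φ (H.next_ne v).symm
  have h2 : ∀ v : H.Pair, ¬ LinEq.Holds ⟨{v.1, H.mate v.1}, 0⟩ (toAssignment φ) ↔
      Viol φ (.inr (.inl v)) := fun v => holds_pair φ fun h =>
        H.not_contact_of_low v.2 ((H.mate_eq_iff _).1 h.symm)
  rw [Finset.card_filter, Fintype.sum_sum_type, Fintype.sum_sum_type, ← add_assoc]
  unfold unsat equations twoEqs circleEqs matchingEqs threeEqs
  rw [Multiset.filter_add, Multiset.filter_add, Multiset.card_add, Multiset.card_add]
  congr 1
  · congr 1
    · rw [Multiset.filter_map, Multiset.card_map, ← Finset.card_filter]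
      simp only [Function.comp_def, h1]
      rfl
    · rw [Multiset.filter_map, Multiset.card_map]
      simp only [← h2]
      rw [← Finset.sum_subtype (Finset.univ.filter fun v : H.Var => v.2 < H.partner v.1 v.2)
        (p := H.IsLow) (fun x => by simp [IsLow])
        (f := fun v => if ¬ LinEq.Holds ⟨{v, H.mate v}, 0⟩ (toAssignment φ) then 1 else 0),
        ← Finset.card_filter]
      rfl
  · rw [Multiset.filter_map, Multiset.card_map, ← Finset.card_filter]
    simp only [Function.comp_def, holds_triple]
    rfl

theorem exists_toAssignment (ψ : H.Assignment) : ∃ φ, ψ = toAssignment φ := by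
  refine ⟨fun v => decide (ψ v = 1), funext fun v => ?_⟩
  change ψ v = if decide (ψ v = 1) = true then 1 else 0
  generalize ψ v = a
  revert a
  decide

theorem m₂_eq : H.m₂ = Fintype.card H.Var + Fintype.card H.Pair := by
  unfold m₂ twoEqs circleEqs matchingEqs
  rw [Multiset.card_add, Multiset.card_map, Multiset.card_map]
  congr 1
  rw [Finset.card_val, Fintype.card_subtype]
  congr

end unsat

section tour
variable {H : HybridInstance} {md : Bool} {n : ℕ} (σ : Fin n ≃ Vtx md H.Blk H.Sgl)

/-- For the consistent variables of a tour, the fully settled violated equations are precisely those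
counted by `BadC`, `BadM` and `BadE`. -/
theorem badNum_le : badNum (Pure σ) (val σ) + ∑ h, (if Pure σ h then 0 else 1) ≤ defect σ := by
  have e1 : ∀ g, .inl g ∈ badSet (Pure σ) (val σ) ↔ BadC σ g := by
    intro g
    rw [mem_badSet]
    simp only [mem_eqnsOf_inl, forall_eq_or_imp,
      forall_eq, Viol, BadC, and_assoc]
  have e2 : ∀ v, .inr (.inl v) ∈ badSet (Pure σ) (val σ) ↔ BadM σ v := by
    intro v
    rw [mem_badSet]
    simp only [mem_eqnsOf_pair, forall_eq_or_imp,
      forall_eq, Viol, BadM, and_assoc]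
  have e3 : ∀ c, .inr (.inr c) ∈ badSet (Pure σ) (val σ) ↔ BadE σ c := by
    intro c
    rw [mem_badSet]
    simp only [mem_eqnsOf_triple,
      Viol, BadE, forall_exists_index, forall_eq_apply_imp_iff]
  have h : (badSet (Pure σ) (val σ)).card = ∑ g, (if BadC σ g then 1 else 0) +
      (∑ v, (if BadM σ v then 1 else 0) + ∑ c, if BadE σ c then 1 else 0) := by
    rw [← Finset.filter_univ_mem (badSet (Pure σ) (val σ)), Finset.card_filter,
      Fintype.sum_sum_type, Fintype.sum_sum_type]
    simp only [e1, e2, e3]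
  unfold badNum defect
  simp only [h, e1, e3]
  rw [← Finset.add_sum_erase _ _ (Finset.mem_univ H.star),
    ← Finset.add_sum_erase (Finset.univ : Finset (Fin H.m₃)) _ (Finset.mem_univ H.c0)]
  by_cases h1 : BadC σ H.star <;> by_cases h2 : BadE σ H.c0 <;> simp only [h1, h2, if_true, if_false,
    and_true, and_false, or_true, or_false, and_self, or_self] <;> omega

theorem unsat_decode_le (hn : 2 ≤ n) :
    gadBase md * (H.m₂ + 3 * H.m₃) + 2 * H.m₃ + 2 * H.n + 4 * (H.n + H.m₃) + 2 +
      2 * H.unsat (toAssignment (decode (Pure σ) (val σ))) ≤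
      ∑ i, (H.net md).d (σ i) (σ (finRotate n i)) := by
  have h1 := lower_bound σ hn
  have h2 := badNum_le σ
  have h3 := card_viol_decode (Pure σ) (val σ)
  rw [unsat_eq, m₂_eq]
  rw [show Fintype.card H.Var + Fintype.card H.Pair + 3 * H.m₃ =
    Fintype.card H.Var + 3 * H.m₃ + Fintype.card H.Pair by ring]
  omega

end tour
end HybridInstance
end


noncomputable section
open scoped Classical

open Vtx

/-! ## Tours from lists of gadgets -/

/-- The length of the path that visits the elements of a list. -/
def pathLen {V : Type} (d : V → V → ℕ) : List V → ℕ
  | [] => 0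
  | [_] => 0
  | x :: y :: l => d x y + pathLen d (y :: l)

theorem pathLen_append {V : Type} (d : V → V → ℕ) (l l' : List V) (x : V) :
    pathLen d (l ++ x :: l') = pathLen d (l ++ [x]) + pathLen d (x :: l') := by
  induction l with
  | nil => simp [pathLen]
  | cons a l ih =>
    cases l with
    | nil => simp [pathLen]
    | cons b l =>
      simp only [List.cons_append, pathLen] at ih ⊢
      rw [ih]; ring

theorem pathLen_concat {V : Type} (d : V → V → ℕ) (l : List V) (x y : V) :
    pathLen d (l ++ [x, y]) = pathLen d (l ++ [x]) + d x y := by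
  rw [pathLen_append]; rfl

theorem pathLen_eq_sum {V : Type} (d : V → V → ℕ) (l : List V) (m : ℕ) (h : l.length = m + 1) :
    pathLen d l = ∑ i : Fin m, d (l[(i : ℕ)]'(by omega)) (l[(i : ℕ) + 1]'(by omega)) := by
  induction m generalizing l with
  | zero =>
    obtain ⟨a, rfl⟩ := List.length_eq_one_iff.1 h
    simp [pathLen]
  | succ m ih =>
    rcases l with _ | ⟨x, _ | ⟨y, l⟩⟩
    · simp at h
    · simp at h
    · rw [pathLen, ih (y :: l) (by simpa using h), Fin.sum_univ_succ]
      simp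

/-- The tour of a list of all points. -/
theorem exists_tour {V : Type} [Fintype V] (d : V → V → ℕ) (l : List V) (hl : l.Nodup)
    (hm : ∀ v, v ∈ l) (B : ℕ) (hB : ∀ x y, d x y ≤ B) (n : ℕ) (hn : Fintype.card V = n) :
    ∃ σ : Fin n ≃ V, ∑ i, d (σ i) (σ (finRotate n i)) ≤ pathLen d l + B := by
  have hlen : l.length = n := by
    rw [← List.toFinset_card_of_nodup hl, ← hn, ← Finset.card_univ]
    congr
    ext v; simp [hm]
  subst hlen
  refine ⟨hl.getEquivOfForallMemList l hm, ?_⟩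
  by_cases h0 : l.length = 0
  · rw [Fintype.sum_eq_zero]
    · omega
    · intro i; exact absurd i.2 (by omega)
  obtain ⟨m, hk⟩ := Nat.exists_eq_succ_of_ne_zero h0
  have e : ∀ i : Fin l.length, (i : ℕ) ≠ m → ((finRotate l.length i : Fin _) : ℕ) = i + 1 := by
    rw [hk]
    intro i hi
    exact coe_finRotate_of_ne_last fun h => hi (by rw [h]; rfl)
  have key : ∑ i : Fin l.length, d (l[(i : ℕ)]) (l[((finRotate l.length i : Fin _) : ℕ)]) ≤
      pathLen d l + B := by
    -- The last summand is the step that closes the tour; it is not part of the path and is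
    -- estimated by `B`.
    rw [pathLen_eq_sum d l m hk, ← Fin.sum_congr' _ hk.symm, Fin.sum_univ_castSucc]
    refine Nat.add_le_add (le_of_eq (Finset.sum_congr rfl fun i _ => ?_)) (hB _ _)
    have h1 := e (Fin.cast hk.symm i.castSucc) (by simp; omega)
    simp only [h1]
    rfl
  exact key

/-- The end of a traversal of a parity gadget. -/
def opp (i : Fin 4) : Fin 4 := match i with
  | 0 => 1 | 1 => 0 | 2 => 3 | 3 => 2

/-- The traversals of a parity gadget. -/
def gadPath : Bool → Fin 4 → List ℕ
  | false, 0 => [0, 7, 2, 5, 4, 3, 6, 1]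
  | false, 1 => [1, 6, 3, 4, 5, 2, 7, 0]
  | false, 2 => [2, 7, 0, 4, 5, 1, 6, 3]
  | false, 3 => [3, 6, 1, 5, 4, 0, 7, 2]
  | true, 0 => [0, 7, 2, 5, 8, 4, 3, 6, 1]
  | true, 1 => [1, 6, 3, 4, 8, 5, 2, 7, 0]
  | true, 2 => [2, 7, 0, 4, 8, 5, 1, 6, 3]
  | true, 3 => [3, 6, 1, 5, 8, 4, 0, 7, 2]

/-- A gadget with the terminal at which it is entered, or a single vertex. -/
abbrev Piece (Bk S : Type) : Type := Bk × Fin 4 ⊕ S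

namespace Piece
variable {Bk S : Type} {md : Bool}

def name : Piece Bk S → Bk ⊕ S := Sum.map Prod.fst id

def flip : Piece Bk S → Piece Bk S := Sum.map (fun p => (p.1, opp p.2)) id

def entry : Piece Bk S → Vtx md Bk S
  | .inl p => Net.termOf p.1 p.2
  | .inr s => .inr s

def exit : Piece Bk S → Vtx md Bk S
  | .inl p => Net.termOf p.1 (opp p.2)
  | .inr s => .inr s

def verts : Piece Bk S → List (Vtx md Bk S)
  | .inl p => (gadPath md p.2).map (Net.termOf p.1)
  | .inr s => [.inr s]

theorem name_flip (p : Piece Bk S) : p.flip.name = p.name := by rcases p with p | s <;> rfl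

theorem entry_flip (p : Piece Bk S) : (p.flip.entry : Vtx md Bk S) = p.exit := by
  rcases p with p | s <;> rfl

theorem exit_flip (p : Piece Bk S) : (p.flip.exit : Vtx md Bk S) = p.entry := by
  rcases p with ⟨b, i⟩ | s
  · fin_cases i <;> rfl
  · rfl

end Piece

namespace Net
variable {md : Bool} {Bk S : Type} (W : Net md Bk S)

/-- Whether two consecutive pieces are linked. -/
def gap (p p' : Piece Bk S) : ℕ := if p'.entry ∈ W.nbr p.exit then 0 else 1

def gaps (L : List (Piece Bk S)) : ℕ := pathLen W.gap L

theorem gap_le (p p' : Piece Bk S) : W.gap p p' ≤ 1 := by unfold gap; split_ifs <;> omega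

theorem gap_flip (p p' : Piece Bk S) : W.gap p'.flip p.flip = W.gap p p' := by
  unfold gap
  simp only [Piece.entry_flip, Piece.exit_flip]
  have : p.exit ∈ W.nbr p'.entry ↔ p'.entry ∈ W.nbr p.exit := ⟨W.symm _ _, W.symm _ _⟩
  simp only [this]

theorem gaps_reverse (L : List (Piece Bk S)) : W.gaps (L.reverse.map Piece.flip) = W.gaps L := by
  unfold gaps
  induction L with
  | nil => rfl
  | cons x L ih =>
    cases L with
    | nil => simp [pathLen]
    | cons y L =>
      rw [pathLen, ← ih]
      simp only [List.reverse_cons, List.map_append, List.map_cons, List.map_nil, List.append_assoc,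
        List.cons_append, List.nil_append]
      rw [pathLen_concat, gap_flip, add_comm]

/-- The traversals in `gadPath` use only shortest inner edges; the summand 2 stands for one link to
the next piece. So the base cost of the lower bound is attained. -/
theorem pathLen_verts (p : Piece Bk S) : pathLen W.d (p.verts) + 2 =
    (match p with | .inl _ => gadBase md | .inr _ => 2) := by
  rcases p with ⟨b, i⟩ | s
  · have hd : ∀ x y : ℕ, W.d (termOf b x) (termOf b y) = gadD md (x % gadK md) (y % gadK md) := by
      intro x y; simp [d, termOf, blk, loc]
    cases md <;> fin_cases i <;>
      simp only [Piece.verts, gadPath, List.map_cons, List.map_nil, pathLen, hd] <;> decide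
  · rfl

theorem verts_eq (p : Piece Bk S) : (∃ l, (p.verts : List (Vtx md Bk S)) = p.entry :: l) ∧
    ∃ l, (p.verts : List (Vtx md Bk S)) = l ++ [p.exit] := by
  rcases p with ⟨b, i⟩ | s
  · have h1 : gadPath md i = (i : ℕ) :: (gadPath md i).tail ∧
        gadPath md i = (gadPath md i).dropLast ++ [((opp i : Fin 4) : ℕ)] := by
      revert i; cases md <;> decide
    exact ⟨⟨_, congrArg (List.map (termOf b)) h1.1⟩,
      ⟨_, (congrArg (List.map (termOf b)) h1.2).trans List.map_append⟩⟩
  · exact ⟨⟨[], rfl⟩, ⟨[], rfl⟩⟩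

theorem mem_verts (p : Piece Bk S) (x : Vtx md Bk S) : x ∈ p.verts ↔ x.blk = p.name := by
  rcases p with ⟨b, i⟩ | s
  · have h1 : ∀ k : Fin (gadK md), (k : ℕ) ∈ gadPath md i := by
      revert i; cases md <;> decide
    constructor
    · intro h
      obtain ⟨k, -, rfl⟩ := List.mem_map.1 h
      rfl
    · intro h
      rcases x with ⟨b', k⟩ | s
      · have : b' = b := by simpa [blk, Piece.name] using h
        subst this
        exact List.mem_map.2 ⟨k, h1 k, by simp [termOf, Nat.mod_eq_of_lt k.2]⟩
      · simp [blk, Piece.name] at h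
  · rcases x with ⟨b', k⟩ | r <;> simp [blk, Piece.name, Piece.verts]

theorem nodup_verts (p : Piece Bk S) : (p.verts : List (Vtx md Bk S)).Nodup := by
  rcases p with ⟨b, i⟩ | s
  · have h1 : (gadPath md i).Nodup ∧ ∀ k ∈ gadPath md i, k < gadK md := by
      revert i; cases md <;> decide
    refine List.Nodup.map_on ?_ h1.1
    intro k hk k' hk' h
    simpa [termOf, Nat.mod_eq_of_lt (h1.2 k hk), Nat.mod_eq_of_lt (h1.2 k' hk')] using h
  · exact List.nodup_singleton _

def pieceCost (md : Bool) : Bk ⊕ S → ℕ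
  | .inl _ => gadBase md
  | .inr _ => 2

/-- A link has length 2 and any other step at most 4, so each gap adds at most 2. -/
theorem pathLen_flatMap_verts (p : Piece Bk S) (L : List (Piece Bk S)) :
    pathLen W.d ((p :: L).flatMap Piece.verts) + 2 ≤
      ((p :: L).map fun q => pieceCost md q.name).sum + 2 * W.gaps (p :: L) := by
  have hp : ∀ p : Piece Bk S, pathLen W.d (p.verts) + 2 = pieceCost md p.name := by
    intro p
    rw [pathLen_verts]
    rcases p with p | s <;> rfl
  induction L generalizing p with
  | nil =>
    have := hp p
    simp only [List.flatMap_cons, List.flatMap_nil, List.append_nil, List.map_cons, List.map_nil,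
      List.sum_cons, List.sum_nil]
    omega
  | cons p' L ih =>
    have h1 := ih p'
    have h2 := hp p
    obtain ⟨l, hl⟩ := (verts_eq (md := md) p).2
    obtain ⟨⟨l', hl'⟩, -⟩ := verts_eq (md := md) p'
    rw [List.flatMap_cons, hl, List.append_assoc, List.singleton_append]
    rw [List.map_cons, List.sum_cons, gaps, pathLen, ← gaps]
    rw [hl] at h2
    rw [pathLen_append]
    have h3 : pathLen W.d (p.exit :: (p' :: L).flatMap Piece.verts) = W.d p.exit p'.entry +
        pathLen W.d ((p' :: L).flatMap Piece.verts) := by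
      rw [List.flatMap_cons, hl']; rfl
    have h4 : W.d p.exit p'.entry ≤ 2 + 2 * W.gap p p' := by
      unfold gap
      split_ifs with h
      · rw [W.d_link h]
      · exact W.d_le _ _
    rw [h3]
    omega

/-- It is enough that the pieces cover everything and that there are not too many of them. The
constant 2 results from the closing step, at most 4, minus the one link that a path has less than a
cycle. -/
theorem exists_tour_of_pieces [Fintype Bk] [Fintype S] (L : List (Piece Bk S))
    (hm : ∀ x, x ∈ L.map Piece.name) (hlen : L.length ≤ Fintype.card Bk + Fintype.card S)
    (hS : 0 < Fintype.card S) (n : ℕ) (hn : Fintype.card (Vtx md Bk S) = n) :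
    ∃ σ : Fin n ≃ Vtx md Bk S, ∑ i, W.d (σ i) (σ (finRotate n i)) ≤
      gadBase md * Fintype.card Bk + 2 * Fintype.card S + 2 + 2 * W.gaps L := by
  have hfin : (L.map Piece.name).toFinset = Finset.univ := by
    ext x; simpa using hm x
  -- A list that covers a finite type and is not longer than its cardinality has no repetitions.
  have hnd : (L.map Piece.name).Nodup := by
    rw [← Multiset.coe_nodup, ← Multiset.toFinset_card_eq_card_iff_nodup]
    apply le_antisymm (Multiset.toFinset_card_le _)
    rw [List.toFinset_coe, hfin, Finset.card_univ, Fintype.card_sum, Multiset.coe_card,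
      List.length_map]
    exact hlen
  have hsum : (L.map fun q => pieceCost md q.name).sum =
      gadBase md * Fintype.card Bk + 2 * Fintype.card S := by
    have h1 : (L.map fun q => pieceCost md q.name) = (L.map Piece.name).map (pieceCost md) := by
      rw [List.map_map]; rfl
    rw [h1, ← List.sum_toFinset _ hnd, hfin, Fintype.sum_sum_type]
    simp [pieceCost, mul_comm]
  rcases L with _ | ⟨p, L⟩
  · obtain ⟨s⟩ := Fintype.card_pos_iff.1 hS
    exact absurd (hm (.inr s)) (by simp)
  obtain ⟨σ, hσ⟩ := exists_tour W.d ((p :: L).flatMap Piece.verts) (by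
      rw [List.nodup_flatMap]
      refine ⟨fun p _ => nodup_verts p, ?_⟩
      rw [List.Nodup, List.pairwise_map] at hnd
      refine hnd.imp fun {a b} hab x hx hx' => hab ?_
      rw [← (mem_verts a x).1 hx, (mem_verts b x).1 hx']) (by
      intro x
      obtain ⟨q, hq, hx⟩ := List.mem_map.1 (hm x.blk)
      exact List.mem_flatMap.2 ⟨q, hq, (mem_verts q x).2 hx.symm⟩) 4 W.d_le n hn
  have := W.pathLen_flatMap_verts p L
  exact ⟨σ, by omega⟩

end Net
end


noncomputable section
open scoped Classical

open Vtx

/-! ## The tour of an assignment -/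

namespace HybridInstance

variable {H : HybridInstance} {md : Bool} (φ : H.Var → Bool)

/-- The variable gadget of `h` is traversed along the circle of `h`. -/
def Vis (h : H.Var) : Prop :=
  -- If both variables of a matched pair ask for the shared gadget, the lower one gets it.
  φ h = H.nu h ∧ ¬ (¬ H.IsContact h ∧ ¬ H.IsLow h ∧ φ (H.mate h) = true)

def pieceL (g : H.Var) (r : Bool) : Piece H.Blk H.Sgl := .inl (.inl g, if r then 0 else 2)
def pieceC (p : Fin H.m₃ × Fin 3) (i : Fin 4) : Piece H.Blk H.Sgl := .inl (.inr (.inl p), i)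
def pieceM (v : H.Pair) (i : Fin 4) : Piece H.Blk H.Sgl := .inl (.inr (.inr v), i)

def pieceY (h : H.Var) : Piece H.Blk H.Sgl :=
  if hc : H.IsContact h then pieceC (H.place h hc) 0
  else if hl : H.IsLow h then pieceM ⟨h, hl⟩ 0
  else pieceM ⟨H.mate h, H.isLow_mate hc hl⟩ 2

/-- The piece that follows the variable `h`. -/
def pieceN (h : H.Var) : Piece H.Blk H.Sgl :=
  if H.IsCut h then .inr (.inr (.inl (h.1, φ (H.next h)))) else pieceL h (φ (H.next h))

def around (h : H.Var) : List (Piece H.Blk H.Sgl) :=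
  (if Vis φ h then [pieceY h] else []) ++ [pieceN φ h]

/-- The number of gaps at a variable. -/
def varGaps (h : H.Var) : ℕ := (if φ h = φ (H.next h) then 0 else 1) +
  (if φ h = H.nu h ∧ ¬ Vis φ h then 1 else 0)

theorem entry_pieceY (h : H.Var) : (pieceY h).entry = (vY h 0 : Vtx md H.Blk H.Sgl) := by
  unfold pieceY vY
  split_ifs <;> rfl

theorem exit_pieceY (h : H.Var) : (pieceY h).exit = (vY h 1 : Vtx md H.Blk H.Sgl) := by
  unfold pieceY vY
  split_ifs <;> rfl

theorem entry_pieceN (h : H.Var) :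
    (pieceN φ h).entry = (vin (φ (H.next h)) h : Vtx md H.Blk H.Sgl) := by
  unfold pieceN vin
  split_ifs with h1 h2 h2
  · rw [h2]; rfl
  · rw [Bool.eq_false_iff.2 h2]; rfl
  · rw [h2]; rfl
  · rw [Bool.eq_false_iff.2 h2]; rfl

theorem exit_pieceL (g : H.Var) (r : Bool) :
    (pieceL g r).exit = (vout r g : Vtx md H.Blk H.Sgl) := by
  cases r <;> rfl

theorem gap_eq_zero {p p' : Piece H.Blk H.Sgl} (h : Link md p.exit p'.entry) :
    (H.net md).gap p p' = 0 := if_pos h.mem.1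

theorem gap_eq_zero' {p p' : Piece H.Blk H.Sgl} (h : Link md p'.entry p.exit) :
    (H.net md).gap p p' = 0 := if_pos h.mem.2

/-- All transitions are links as long as the value persists and the gadget that `h` asks for is
free. A change of value, and a gadget already taken, account for one gap each. -/
theorem gaps_around (x : Piece H.Blk H.Sgl) (h : H.Var)
    (hx : x.exit = (vout (φ h) (H.prev h) : Vtx md H.Blk H.Sgl)) :
    (H.net md).gaps (x :: around φ h) ≤ varGaps φ h := by
  unfold around varGaps
  by_cases hv : Vis φ h
  · rw [if_pos hv]
    simp only [List.singleton_append, Net.gaps, pathLen, hv, not_true_eq_false, and_false, if_false]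
    have h1 : (H.net md).gap x (pieceY h) = 0 := by
      apply gap_eq_zero
      rw [hx, hv.1, entry_pieceY]
      exact .enter h
    rw [h1]
    split_ifs with h2
    · have : (H.net md).gap (pieceY h) (pieceN φ h) = 0 := by
        apply gap_eq_zero
        rw [exit_pieceY, entry_pieceN, ← h2, hv.1]
        exact .leave h
      omega
    · have := (H.net md).gap_le (pieceY h) (pieceN φ h)
      omega
  · rw [if_neg hv]
    simp only [List.nil_append, Net.gaps, pathLen, hv, not_false_eq_true, and_true]
    have := (H.net md).gap_le x (pieceN φ h)
    split_ifs with h2 h3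
    · omega
    · have : (H.net md).gap x (pieceN φ h) = 0 := by
        apply gap_eq_zero
        rw [hx, entry_pieceN, ← h2]
        exact .pass h _ h3
      omega
    · omega
    · omega

theorem gaps_append {Bk S : Type} (W : Net md Bk S) (l l' : List (Piece Bk S)) (x : Piece Bk S) :
    W.gaps (l ++ x :: l') = W.gaps (l ++ [x]) + W.gaps (x :: l') := pathLen_append _ _ _ _

theorem gaps_walk (n : ℕ) (h : H.Var) (x : Piece H.Blk H.Sgl)
    (hx : x.exit = (vout (φ h) (H.prev h) : Vtx md H.Blk H.Sgl))
    (hc : ∀ i, i + 1 < n → ¬ H.IsCut (H.next^[i] h)) :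
    (H.net md).gaps (x :: (List.iterate H.next h n).flatMap (around φ)) ≤
      ((List.iterate H.next h n).map (varGaps φ)).sum := by
  induction n generalizing h x with
  | zero => simp [Net.gaps, pathLen]
  | succ n ih =>
    simp only [List.iterate, List.flatMap_cons, List.map_cons, List.sum_cons]
    have h1 := gaps_around (md := md) φ x h hx
    rcases n with _ | n
    · simpa using h1
    have hn : ¬ H.IsCut h := hc 0 (by omega)
    have h2 := ih (H.next h) (pieceN φ h) (by
      rw [pieceN, if_neg hn, exit_pieceL, H.prev_next]) (fun i hi => hc (i + 1) (by omega))
    unfold around at h1 ⊢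
    rw [List.append_assoc, List.singleton_append, ← List.cons_append, gaps_append,
      List.cons_append]
    exact Nat.add_le_add h1 h2

theorem next_iterate (k : ℕ) (v : H.Var) : H.next^[k] v = ⟨v.1, ⟨((v.2 : ℕ) + k) % (7 * H.t v.1),
    Nat.mod_lt _ (Nat.mul_pos (by norm_num) (H.t_pos v.1))⟩⟩ := by
  induction k with
  | zero =>
    obtain ⟨l, i⟩ := v
    simp only [Function.iterate_zero, id, Sigma.mk.injEq, heq_eq_eq, true_and]
    ext
    exact (Nat.mod_eq_of_lt i.2).symm
  | succ k ih =>
    rw [Function.iterate_succ_apply', ih]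
    simp only [next, Sigma.mk.injEq, heq_eq_eq, true_and, Fin.mk.injEq]
    rw [Nat.mod_add_mod, add_assoc]

/-- The variables of a circle, starting behind the equation where it is cut open. -/
def orbit (l : Fin H.n) : List H.Var := List.iterate H.next (H.next (H.cutv l)) (7 * H.t l)

theorem circle_fst (l : Fin H.n) (k : ℕ) : (H.next^[k] (H.cutv l)).1 = l := by
  rw [next_iterate]; exact H.cutv_fst l

theorem iterate_inj {l : Fin H.n} {j k : ℕ} (hj : j < 7 * H.t l) (hk : k < 7 * H.t l)
    (h : H.next^[j] (H.cutv l) = H.next^[k] (H.cutv l)) : j = k := by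
  rw [next_iterate, next_iterate] at h
  simp only [Sigma.mk.injEq, heq_eq_eq, true_and, Fin.mk.injEq] at h
  have h' : ((H.cutv l).2 : ℕ) + j ≡ (H.cutv l).2 + k [MOD 7 * H.t (H.cutv l).1] := h
  have := Nat.ModEq.add_left_cancel' _ h'
  rw [H.cutv_fst] at this
  exact Nat.ModEq.eq_of_lt_of_lt this hj hk

theorem iterate_period' (v : H.Var) : H.next^[7 * H.t v.1] v = v := by
  rw [next_iterate]
  obtain ⟨l, i⟩ := v
  simp only [Sigma.mk.injEq, heq_eq_eq, true_and, Nat.add_mod_right]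
  ext
  exact Nat.mod_eq_of_lt i.2

theorem iterate_period (l : Fin H.n) : H.next^[7 * H.t l] (H.cutv l) = H.cutv l := by
  have := iterate_period' (H.cutv l)
  rwa [H.cutv_fst] at this

theorem orbit_nodup (l : Fin H.n) : (orbit l).Nodup := by
  unfold orbit
  rw [← List.range_map_iterate]
  refine List.Nodup.map_on ?_ List.nodup_range
  intro j hj k hk h
  rw [List.mem_range] at hj hk
  rw [← Function.iterate_succ_apply, ← Function.iterate_succ_apply, Function.iterate_succ_apply',
    Function.iterate_succ_apply'] at h
  exact iterate_inj hj hk (H.nextEquiv.injective h)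

theorem orbit_fst {l : Fin H.n} {v : H.Var} (h : v ∈ orbit l) : v.1 = l := by
  unfold orbit at h
  rw [← List.range_map_iterate] at h
  obtain ⟨k, -, rfl⟩ := List.mem_map.1 h
  rw [← Function.iterate_succ_apply]
  exact circle_fst l _

/-- By counting: the orbit has as many distinct elements as the circle has variables. -/
theorem mem_orbit (v : H.Var) : v ∈ orbit v.1 := by
  have h1 : (orbit v.1).toFinset ⊆ Finset.univ.filter fun w : H.Var => w.1 = v.1 := by
    intro w hw
    simpa using orbit_fst (List.mem_toFinset.1 hw)
  have h2 : (Finset.univ.filter fun w : H.Var => w.1 = v.1).card ≤ 7 * H.t v.1 := by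
    have : (Finset.univ.filter fun w : H.Var => w.1 = v.1) ⊆
        (Finset.univ : Finset (Fin (7 * H.t v.1))).image fun i => ⟨v.1, i⟩ := by
      rintro ⟨l, i⟩ hw
      simp only [Finset.mem_filter, Finset.mem_univ, true_and] at hw
      subst hw
      simp
    exact (Finset.card_le_card this).trans (Finset.card_image_le.trans (by simp))
  have h3 := Finset.eq_of_subset_of_card_le h1 (by
    rw [List.toFinset_card_of_nodup (orbit_nodup v.1)]
    exact h2.trans (by simp [orbit]))
  have : v ∈ (orbit v.1).toFinset := by rw [h3]; simp
  exact List.mem_toFinset.1 this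

theorem sum_orbit (f : H.Var → ℕ) : ∑ l, ((orbit l).map f).sum = ∑ v, f v := by
  rw [← Finset.sum_fiberwise Finset.univ (fun v : H.Var => v.1) f]
  refine Finset.sum_congr rfl fun l _ => ?_
  rw [← List.sum_toFinset f (orbit_nodup l)]
  refine Finset.sum_congr ?_ fun _ _ => rfl
  ext v
  simp only [List.mem_toFinset, Finset.mem_filter, Finset.mem_univ, true_and]
  exact ⟨orbit_fst, fun h => h ▸ mem_orbit v⟩

theorem orbit_eq (l : Fin H.n) : ∃ L, orbit l = L ++ [H.cutv l] := by
  have ht := H.t_pos l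
  refine ⟨List.iterate H.next (H.next (H.cutv l)) (7 * H.t l - 1), ?_⟩
  unfold orbit
  rw [show 7 * H.t l = (7 * H.t l - 1) + 1 by omega, List.iterate_add]
  congr 1
  simp only [List.iterate]
  rw [← Function.iterate_succ_apply, Nat.succ_eq_add_one,
    show 7 * H.t l - 1 + 1 = 7 * H.t l by omega, iterate_period]

/-- The part of the tour along a circle, in the direction of the circle. -/
def walk (l : Fin H.n) : List (Piece H.Blk H.Sgl) :=
  .inr (.inr (.inl (l, !φ (H.next (H.cutv l))))) :: pieceL (H.cutv l) (φ (H.next (H.cutv l))) ::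
    (orbit l).flatMap (around φ)

/-- The walk begins at `vq` if the value behind the cut is true and at `vp` if it is false; in both
cases its first step is a link. It meets the cut again only at its end. -/
theorem gaps_walk' (l : Fin H.n) :
    (H.net md).gaps (walk φ l) ≤ ((orbit l).map (varGaps φ)).sum := by
  unfold walk
  rw [Net.gaps, pathLen, ← Net.gaps]
  have h1 := gaps_walk (md := md) φ (7 * H.t l) (H.next (H.cutv l))
    (pieceL (H.cutv l) (φ (H.next (H.cutv l)))) (by rw [exit_pieceL, H.prev_next]) (by
      intro i hi hc
      rw [← Function.iterate_succ_apply] at hc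
      have h2 : H.next^[i.succ] (H.cutv l) = H.next^[0] (H.cutv l) := by
        rw [hc, circle_fst]; rfl
      exact absurd (iterate_inj hi (by omega) h2) (by omega))
  have h2 : (H.net md).gap (.inr (.inr (.inl (l, !φ (H.next (H.cutv l))))))
      (pieceL (H.cutv l) (φ (H.next (H.cutv l)))) = 0 := by
    cases φ (H.next (H.cutv l))
    · exact gap_eq_zero' (.p l)
    · exact gap_eq_zero (.q l)
  rw [h2, Nat.zero_add]
  exact h1

theorem walk_eq (l : Fin H.n) : ∃ L, walk φ l = .inr (.inr (.inl (l, !φ (H.next (H.cutv l))))) ::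
    (L ++ [.inr (.inr (.inl (l, φ (H.next (H.cutv l)))))]) := by
  obtain ⟨L, hL⟩ := orbit_eq l
  refine ⟨pieceL (H.cutv l) (φ (H.next (H.cutv l))) :: (L.flatMap (around φ) ++
    if Vis φ (H.cutv l) then [pieceY (H.cutv l)] else []), ?_⟩
  unfold walk
  rw [hL, List.flatMap_append, List.flatMap_singleton, around, pieceN, if_pos (H.isCut_cutv l),
    H.cutv_fst]
  simp

/-- The part of the tour along a circle, from `q` to `p`. -/
def circlePart (l : Fin H.n) : List (Piece H.Blk H.Sgl) :=
  if φ (H.next (H.cutv l)) then walk φ l else (walk φ l).reverse.map Piece.flip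

theorem gaps_circlePart (l : Fin H.n) :
    (H.net md).gaps (circlePart φ l) ≤ ((orbit l).map (varGaps φ)).sum := by
  unfold circlePart
  split_ifs
  · exact gaps_walk' φ l
  · rw [Net.gaps_reverse]; exact gaps_walk' φ l

theorem circlePart_eq (l : Fin H.n) : ∃ L, circlePart φ l = .inr (.inr (.inl (l, false))) ::
    (L ++ [.inr (.inr (.inl (l, true)))]) := by
  obtain ⟨L, hL⟩ := walk_eq φ l
  unfold circlePart
  rw [hL]
  split_ifs with h
  · rw [h]; exact ⟨L, rfl⟩
  · rw [Bool.eq_false_iff.2 h]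
    exact ⟨L.reverse.map Piece.flip, by simp [Piece.flip]⟩

/-- The path through the variable gadgets that are not visited along the circles. -/
def core (c : Fin H.m₃) : Bool → Bool → Bool → List (Piece H.Blk H.Sgl)
  | true, true, true => []
  | false, false, true => [pieceC (c, 0) 2, pieceC (c, 1) 2]
  | false, true, false => [pieceC (c, 0) 2, pieceC (c, 2) 2]
  -- The second gadget is entered at 3 whenever it directly follows A, and at 2 if it follows the
  -- first gadget.
  | true, false, false => [pieceC (c, 1) 3, pieceC (c, 2) 2]
  | false, true, true => [pieceC (c, 0) 2]
  | true, false, true => [pieceC (c, 1) 3]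
  | true, true, false => [pieceC (c, 2) 2]
  | false, false, false => [pieceC (c, 0) 2, pieceC (c, 1) 2, pieceC (c, 2) 2]

def agree (c : Fin H.m₃) (k : Fin 3) : Bool := φ (H.triple c k) == H.nu (H.triple c k)

def clausePart (c : Fin H.m₃) : List (Piece H.Blk H.Sgl) :=
  .inr (.inl (c, false)) :: (core c (agree φ c 0) (agree φ c 1) (agree φ c 2) ++
    [.inr (.inl (c, true))])

/-- With no or two gadgets left over, the path from A to B consists of links. With one or three left
over, exactly one transition need not be a link. -/
theorem gaps_clausePart (c : Fin H.m₃) :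
    (H.net md).gaps (clausePart φ c) ≤ if Viol φ (.inr (.inr c)) then 1 else 0 := by
  have hv : Viol φ (.inr (.inr c)) ↔
      xor (agree φ c 0) (xor (agree φ c 1) (agree φ c 2)) = false := Iff.rfl
  rw [if_congr hv rfl rfl]
  unfold clausePart
  have h1 : (H.net md).gap (.inr (.inl (c, false))) (pieceC (c, 0) 2) = 0 := gap_eq_zero (.Ax c)
  have h2 : (H.net md).gap (.inr (.inl (c, false))) (pieceC (c, 1) 3) = 0 := gap_eq_zero (.Ay c)
  have h3 : (H.net md).gap (pieceC (c, 0) 2) (pieceC (c, 1) 2) = 0 := gap_eq_zero (.xy c)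
  have h4 : (H.net md).gap (pieceC (c, 0) 2) (pieceC (c, 2) 2) = 0 := gap_eq_zero (.xz c)
  have h5 : (H.net md).gap (pieceC (c, 1) 3) (pieceC (c, 2) 2) = 0 := gap_eq_zero (.yz c)
  have h6 : (H.net md).gap (pieceC (c, 1) 2) (.inr (.inl (c, true))) = 0 := gap_eq_zero (.yB c)
  have h7 : (H.net md).gap (pieceC (c, 2) 2) (.inr (.inl (c, true))) = 0 := gap_eq_zero (.zB c)
  have h8 : (H.net md).gap (.inr (.inl (c, false))) (.inr (.inl (c, true))) = 0 :=
    gap_eq_zero (.AB c)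
  have hle := (H.net md).gap_le
  cases agree φ c 0 <;> cases agree φ c 1 <;> cases agree φ c 2 <;>
    simp [core, Net.gaps, pathLen, h1, h2, h3, h4, h5, h6, h7, h8, hle]

theorem length_clausePart (c : Fin H.m₃) : (clausePart φ c).length = 2 +
    ((if agree φ c 0 then 0 else 1) + (if agree φ c 1 then 0 else 1) +
      (if agree φ c 2 then 0 else 1)) := by
  unfold clausePart
  cases agree φ c 0 <;> cases agree φ c 1 <;> cases agree φ c 2 <;> simp [core]

theorem mem_clausePart (c : Fin H.m₃) (k : Fin 3) (h : agree φ c k = false) :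
    ∃ i, pieceC (c, k) i ∈ clausePart φ c := by
  unfold clausePart
  fin_cases k
  · simp only [Fin.zero_eta] at h ⊢
    rw [h]
    refine ⟨2, ?_⟩
    cases agree φ c 1 <;> cases agree φ c 2 <;> simp [core]
  · simp only [Fin.mk_one] at h ⊢
    rw [h]
    cases agree φ c 0
    · exact ⟨2, by cases agree φ c 2 <;> simp [core]⟩
    · exact ⟨3, by cases agree φ c 2 <;> simp [core]⟩
  · simp only [Fin.reduceFinMk] at h ⊢
    rw [h]
    refine ⟨2, ?_⟩
    cases agree φ c 0 <;> cases agree φ c 1 <;> simp [core]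

theorem length_circlePart (l : Fin H.n) : (circlePart φ l).length =
    2 + ((orbit l).map fun h => 1 + if Vis φ h then 1 else 0).sum := by
  have h1 : (circlePart φ l).length = (walk φ l).length := by
    unfold circlePart; split_ifs <;> simp
  rw [h1, walk, List.length_cons, List.length_cons, List.length_flatMap]
  have h2 : (orbit l).map (fun h => (around φ h).length) =
      (orbit l).map fun h => 1 + if Vis φ h then 1 else 0 := by
    refine List.map_congr_left fun h _ => ?_
    unfold around
    split_ifs <;> rfl
  rw [h2]
  omega

theorem mem_circlePart {l : Fin H.n} {p : Piece H.Blk H.Sgl} (h : p ∈ walk φ l) :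
    p.name ∈ (circlePart φ l).map Piece.name := by
  unfold circlePart
  split_ifs
  · exact List.mem_map_of_mem h
  · rw [List.map_map]
    refine List.mem_map.2 ⟨p, List.mem_reverse.2 h, Piece.name_flip p⟩

end HybridInstance
end


/-! ### Joining the parts at the hubs -/

noncomputable section
open scoped Classical

open Vtx

theorem Net.gaps_cons_le {md : Bool} {Bk S : Type} (W : Net md Bk S) (l : List (Piece Bk S))
    (x : Piece Bk S) : W.gaps (x :: l) ≤ l.length := by
  induction l generalizing x with
  | nil => exact le_rfl
  | cons y l ih =>
    rw [Net.gaps, pathLen, ← Net.gaps, List.length_cons]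
    have := W.gap_le x y
    have := ih y
    omega

theorem Net.gaps_between {md : Bool} {Bk S : Type} (W : Net md Bk S) (l : List (Piece Bk S))
    (x y z w : Piece Bk S) (h1 : W.gap x y = 0) (h2 : W.gap z w = 0) :
    W.gaps (x :: (y :: (l ++ [z]) ++ [w])) = W.gaps (y :: (l ++ [z])) := by
  have e : x :: (y :: (l ++ [z]) ++ [w]) = (x :: y :: l) ++ [z, w] := by simp
  rw [e, Net.gaps, pathLen_concat, h2, Nat.add_zero]
  simp only [List.cons_append, pathLen, h1, Nat.zero_add]
  rfl

/-- The sequence of the parts of the tour, evaluated by `f` and `g`. -/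
def partFn {α : Type} {n m : ℕ} (s : ℕ) (hm : 0 < m) (nil : α) (add : α → α → α) (f : Fin n → α)
    (g : Fin m → α) (j : ℕ) : α :=
  if hj : j < n then if j = s then add (g ⟨0, hm⟩) (f ⟨j, hj⟩) else f ⟨j, hj⟩
  else if hc : j + 1 - n < m then g ⟨j + 1 - n, hc⟩ else nil

/-- The same enumeration is used for the lists, their lengths and their gap bounds. Since index `s`
carries two parts, `n + m - 1` indices suffice for `n + m` parts. -/
theorem sum_partFn {n m : ℕ} {s : ℕ} (hs : s < n) (hm : 0 < m) (f : Fin n → ℕ) (g : Fin m → ℕ) :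
    ∑ j ∈ Finset.range (n + m - 1), partFn s hm 0 (· + ·) f g j = ∑ l, f l + ∑ c, g c := by
  obtain ⟨m, rfl⟩ : ∃ k, m = k + 1 := ⟨m - 1, by omega⟩
  rw [show n + (m + 1) - 1 = n + m by omega, Finset.sum_range_add, Finset.sum_range,
    Finset.sum_range, Fin.sum_univ_succ]
  have h1 : ∀ l : Fin n, partFn s hm 0 (· + ·) f g l =
      (if (l : ℕ) = s then g 0 else 0) + f l := by
    intro l
    rw [partFn, dif_pos l.2]
    split_ifs
    · rfl
    · exact (Nat.zero_add _).symm
  have h2 : ∀ c : Fin m, partFn s hm 0 (· + ·) f g (n + c) = g c.succ := by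
    intro c
    have := c.2
    rw [partFn, dif_neg (by omega), dif_pos (by omega)]
    congr 1
    ext
    simp only [Fin.val_succ]
    omega
  simp only [h1, h2, Finset.sum_add_distrib]
  have h3 : ∑ l : Fin n, (if (l : ℕ) = s then g 0 else 0) = g 0 := by
    rw [Finset.sum_eq_single ⟨s, hs⟩]
    · simp
    · intro l _ hl
      exact if_neg fun h => hl (Fin.ext h)
    · simp
  rw [h3]
  ring

namespace HybridInstance

variable {H : HybridInstance} {md : Bool} (φ : H.Var → Bool)

/-- Reduction modulo the number of hubs only makes the function total. -/
def hubPiece (H : HybridInstance) (j : ℕ) : Piece H.Blk H.Sgl :=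
  .inr (.inr (.inr ⟨j % (H.n + H.m₃), Nat.mod_lt _ (by have := H.n_pos; omega)⟩))

theorem hubPiece_eq (j : Fin (H.n + H.m₃)) : hubPiece H j = .inr (.inr (.inr j)) := by
  unfold hubPiece
  congr
  exact Nat.mod_eq_of_lt j.2

/-- The part of the tour between the hubs `j` and `j + 1`. -/
def part (j : ℕ) : List (Piece H.Blk H.Sgl) :=
  partFn (H.star.1 : ℕ) H.m₃_pos [] (· ++ ·) (circlePart φ) (clausePart φ) j

def partCost (j : ℕ) : ℕ :=
  partFn (H.star.1 : ℕ) H.m₃_pos 0 (· + ·) (fun l => ((orbit l).map (varGaps φ)).sum)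
    (fun c => if Viol φ (.inr (.inr c)) then 1 else 0) j

theorem length_part (j : ℕ) : (part φ j).length = partFn (H.star.1 : ℕ) H.m₃_pos 0 (· + ·)
    (fun l => (circlePart φ l).length) (fun c => (clausePart φ c).length) j := by
  unfold part partFn
  split_ifs <;> simp

theorem gap_hub {s : (Fin H.m₃ × Bool) ⊕ (Fin H.n × Bool)} {j : Fin (H.n + H.m₃)}
    (h : hubNum s = some j) {p : Piece H.Blk H.Sgl} (hp : p.entry = (vSing s : Vtx md H.Blk H.Sgl))
    {i : ℕ} (hi : i = j) : (H.net md).gap (hubPiece H i) p = 0 := by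
  subst hi
  rw [hubPiece_eq]
  apply gap_eq_zero'
  rw [hp]
  exact .hub s j h

theorem gap_hub' {s : (Fin H.m₃ × Bool) ⊕ (Fin H.n × Bool)} {j : Fin (H.n + H.m₃)}
    (h : hubNum s = some j) {p : Piece H.Blk H.Sgl} (hp : p.exit = (vSing s : Vtx md H.Blk H.Sgl))
    {i : ℕ} (hi : i = j) : (H.net md).gap p (hubPiece H i) = 0 := by
  subst hi
  rw [hubPiece_eq]
  apply gap_eq_zero
  rw [hp]
  exact .hub s j h

theorem gaps_part (j : ℕ) (hj : j + 1 < H.n + H.m₃) :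
    (H.net md).gaps (hubPiece H j :: (part φ j ++ [hubPiece H (j + 1)])) ≤ partCost φ j := by
  unfold part partCost partFn
  split_ifs with h1 h2 h3
  -- The part with the special equation followed by the special circle, joined by the link `Bq`.
  · subst h2
    obtain ⟨L, hL⟩ := circlePart_eq φ H.star.1
    have g1 : (H.net md).gap (hubPiece H H.star.1) (.inr (.inl (H.c0, false))) = 0 :=
      gap_hub (s := .inl (H.c0, false)) (j := ⟨H.star.1, by omega⟩) (by simp [hubNum, c0]) rfl rfl
    have g2 : (H.net md).gap (.inr (.inl (H.c0, true))) (.inr (.inr (.inl (H.star.1, false)))) = 0 :=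
      gap_eq_zero .Bq
    have g3 : (H.net md).gap (.inr (.inr (.inl (H.star.1, true)))) (hubPiece H (H.star.1 + 1)) = 0 :=
      gap_hub' (s := .inr (H.star.1, true)) (j := ⟨H.star.1 + 1, by omega⟩) (by simp [hubNum]) rfl rfl
    have g4 := gaps_clausePart (md := md) φ H.c0
    have g5 := gaps_circlePart (md := md) φ H.star.1
    rw [hL] at g5
    change (H.net md).gaps (_ :: (clausePart φ H.c0 ++ circlePart φ H.star.1 ++ _)) ≤ _
    rw [hL]
    have e : hubPiece H H.star.1 :: (clausePart φ H.c0 ++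
        (.inr (.inr (.inl (H.star.1, false))) :: (L ++ [.inr (.inr (.inl (H.star.1, true)))])) ++
          [hubPiece H (H.star.1 + 1)]) =
        (hubPiece H H.star.1 :: clausePart φ H.c0) ++ (.inr (.inr (.inl (H.star.1, false))) ::
          ((L ++ [.inr (.inr (.inl (H.star.1, true)))]) ++ [hubPiece H (H.star.1 + 1)])) := by simp
    rw [e, gaps_append]
    refine Nat.add_le_add ?_ ?_
    · unfold clausePart at g4 ⊢
      rw [List.cons_append]
      exact (Net.gaps_between _ _ _ _ _ _ g1 g2).le.trans g4
    · have e2 : (Sum.inr (.inr (.inl (H.star.1, false))) :: ((L ++ [.inr (.inr (.inl (H.star.1, true)))])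
          ++ [hubPiece H (H.star.1 + 1)]) : List (Piece H.Blk H.Sgl)) =
          (.inr (.inr (.inl (H.star.1, false))) :: L) ++ [.inr (.inr (.inl (H.star.1, true))),
            hubPiece H (H.star.1 + 1)] := by simp
      rw [e2, Net.gaps, pathLen_concat, g3]
      exact g5
  · obtain ⟨L, hL⟩ := circlePart_eq φ ⟨j, h1⟩
    have g5 := gaps_circlePart (md := md) φ ⟨j, h1⟩
    rw [hL] at g5 ⊢
    have g1 : (H.net md).gap (hubPiece H j) (.inr (.inr (.inl (⟨j, h1⟩, false)))) = 0 :=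
      gap_hub (s := .inr (⟨j, h1⟩, false)) (j := ⟨j, by omega⟩)
        (by rw [hubNum, if_neg fun h => h2 (congrArg Fin.val h)]) rfl rfl
    have g2 : (H.net md).gap (.inr (.inr (.inl (⟨j, h1⟩, true)))) (hubPiece H (j + 1)) = 0 :=
      gap_hub' (s := .inr (⟨j, h1⟩, true)) (j := ⟨j + 1, by omega⟩) rfl rfl rfl
    exact (Net.gaps_between _ _ _ _ _ _ g1 g2).le.trans g5
  · have g5 := gaps_clausePart (md := md) φ ⟨j + 1 - H.n, h3⟩
    have hc : j + 1 - H.n ≠ 0 := by omega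
    have g1 : (H.net md).gap (hubPiece H j) (.inr (.inl (⟨j + 1 - H.n, h3⟩, false))) = 0 :=
      gap_hub (s := .inl (⟨j + 1 - H.n, h3⟩, false)) (j := ⟨H.n + (j + 1 - H.n) - 1, by omega⟩)
        (by simp [hubNum, hc]) rfl (by simp only; omega)
    have g2 : (H.net md).gap (.inr (.inl (⟨j + 1 - H.n, h3⟩, true))) (hubPiece H (j + 1)) = 0 :=
      gap_hub' (s := .inl (⟨j + 1 - H.n, h3⟩, true)) (j := ⟨H.n + (j + 1 - H.n), by omega⟩)
        (by simp [hubNum, hc]) rfl (by simp only; omega)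
    exact (Net.gaps_between _ _ _ _ _ _ g1 g2).le.trans g5
  · omega

/-- The tour up to the hub `k`. -/
def tourTo : ℕ → List (Piece H.Blk H.Sgl)
  | 0 => [hubPiece H 0]
  | k + 1 => tourTo k ++ (part φ k ++ [hubPiece H (k + 1)])

theorem tourTo_eq (k : ℕ) : ∃ L, tourTo φ k = L ++ [hubPiece H k] := by
  cases k with
  | zero => exact ⟨[], rfl⟩
  | succ k => exact ⟨tourTo φ k ++ part φ k, by simp [tourTo]⟩

theorem gaps_tourTo (k : ℕ) (hk : k < H.n + H.m₃) :
    (H.net md).gaps (tourTo φ k) ≤ ∑ j ∈ Finset.range k, partCost φ j := by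
  induction k with
  | zero => exact le_rfl
  | succ k ih =>
    obtain ⟨L, hL⟩ := tourTo_eq φ k
    have h1 := ih (by omega)
    have h2 := gaps_part (md := md) φ k hk
    rw [Finset.sum_range_succ, tourTo]
    rw [hL] at h1 ⊢
    rw [List.append_assoc, List.singleton_append, gaps_append]
    exact Nat.add_le_add h1 h2

theorem length_tourTo (k : ℕ) :
    (tourTo φ k).length = 1 + k + ∑ j ∈ Finset.range k, (part φ j).length := by
  induction k with
  | zero => rfl
  | succ k ih =>
    rw [tourTo, List.length_append, ih, List.length_append, Finset.sum_range_succ]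
    simp only [List.length_singleton]
    ring

theorem mem_tourTo_hub {j k : ℕ} (h : j ≤ k) : hubPiece H j ∈ tourTo φ k := by
  induction k with
  | zero => obtain rfl : j = 0 := by omega
            simp [tourTo]
  | succ k ih =>
    rcases Nat.lt_or_ge j (k + 1) with h1 | h1
    · exact List.mem_append_left _ (ih (by omega))
    · obtain rfl : j = k + 1 := by omega
      simp [tourTo]

theorem mem_tourTo_part {j k : ℕ} (h : j < k) {p : Piece H.Blk H.Sgl} (hp : p ∈ part φ j) :
    p ∈ tourTo φ k := by
  induction k with
  | zero => omega
  | succ k ih =>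
    rcases Nat.lt_or_ge j k with h1 | h1
    · exact List.mem_append_left _ (ih h1)
    · obtain rfl : j = k := by omega
      simp [tourTo, hp]

theorem mem_tourTo_circle {l : Fin H.n} {p : Piece H.Blk H.Sgl} (hp : p ∈ circlePart φ l) :
    p ∈ tourTo φ (H.n + H.m₃ - 1) := by
  have := H.m₃_pos
  refine mem_tourTo_part φ (j := l) (by omega) ?_
  rw [part, partFn, dif_pos l.2]
  split_ifs
  · exact List.mem_append_right _ hp
  · exact hp

theorem mem_tourTo_clause {c : Fin H.m₃} {p : Piece H.Blk H.Sgl} (hp : p ∈ clausePart φ c) :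
    p ∈ tourTo φ (H.n + H.m₃ - 1) := by
  have hn := H.n_pos
  have hc := c.2
  by_cases h0 : (c : ℕ) = 0
  · refine mem_tourTo_part φ (j := H.star.1) (by omega) ?_
    rw [part, partFn, dif_pos H.star.1.2, if_pos rfl]
    refine List.mem_append_left _ ?_
    rwa [show (⟨0, H.m₃_pos⟩ : Fin H.m₃) = c from Fin.ext h0.symm]
  · refine mem_tourTo_part φ (j := H.n + c - 1) (by omega) ?_
    rw [part, partFn, dif_neg (by omega), dif_pos (by omega)]
    rwa [show (⟨H.n + c - 1 + 1 - H.n, by omega⟩ : Fin H.m₃) = c from Fin.ext (by simp only; omega)]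

/-- The matching equations whose gadget is not visited along a circle. -/
def leftover : Finset H.Pair := Finset.univ.filter fun v => ¬ Vis φ v.1 ∧ ¬ Vis φ (H.mate v.1)

/-- Matching gadgets that no variable visits are appended behind the last hub, each at the price of
one gap. -/
def pieces : List (Piece H.Blk H.Sgl) :=
  tourTo φ (H.n + H.m₃ - 1) ++ (leftover φ).toList.map fun v => pieceM v 0

theorem vis_triple (c : Fin H.m₃) (k : Fin 3) :
    Vis φ (H.triple c k) ↔ agree φ c k = true := by
  unfold Vis agree
  rw [beq_iff_eq]
  have : H.IsContact (H.triple c k) := H.triple_contact c k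
  simp [this]

theorem vis_low (v : H.Pair) : Vis φ v.1 ↔ φ v.1 = true := by
  simp [Vis, nu_low v.2, v.2]

theorem vis_mate (v : H.Pair) : Vis φ (H.mate v.1) ↔ φ (H.mate v.1) = false ∧ φ v.1 = false := by
  simp [Vis, nu_mate v.2, H.not_contact_mate (H.not_contact_of_low v.2), H.not_low_mate v.2,
    H.mate_mate]

/-- Every gap is assigned to its own violated equation: a change of value to a circle equation; a
gadget that is taken, or left over, to a matching equation; a gap between A and B to an equation
with three variables. -/
theorem gaps_pieces :
    (H.net md).gaps (pieces φ) ≤ (Finset.univ.filter (Viol φ)).card := by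
  have hn := H.n_pos
  obtain ⟨L, hL⟩ := tourTo_eq φ (H.n + H.m₃ - 1)
  have h1 := gaps_tourTo (md := md) φ (H.n + H.m₃ - 1) (by omega)
  have h2 := (H.net md).gaps_cons_le ((leftover φ).toList.map fun v => pieceM v 0)
    (hubPiece H (H.n + H.m₃ - 1))
  have h3 : ∑ j ∈ Finset.range (H.n + H.m₃ - 1), partCost φ j = _ :=
    sum_partFn H.star.1.2 H.m₃_pos _ _
  rw [h3] at h1
  rw [sum_orbit] at h1
  rw [List.length_map, Finset.length_toList] at h2
  unfold pieces
  rw [hL] at h1 ⊢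
  rw [List.append_assoc, List.singleton_append, gaps_append]
  refine (Nat.add_le_add h1 h2).trans ?_
  rw [Finset.card_filter, Fintype.sum_sum_type, Fintype.sum_sum_type]
  unfold varGaps
  rw [Finset.sum_add_distrib]
  -- A requested gadget is refused only to the mate of a lower variable with value true, the mate
  -- having value false. The opposite violation, neither of the two asking, leads to the leftover
  -- gadgets in `h5`.
  have h4 : ∑ h : H.Var, (if φ h = H.nu h ∧ ¬ Vis φ h then 1 else 0) =
      ∑ v : H.Pair, if φ (H.mate v.1) = false ∧ φ v.1 = true then 1 else 0 := by
    rw [sum_var]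
    have a : ∀ c k, (if φ (H.triple c k) = H.nu (H.triple c k) ∧ ¬ Vis φ (H.triple c k) then 1
        else 0) = 0 := by
      intro c k
      rw [if_neg]
      rw [vis_triple, agree, beq_iff_eq]
      tauto
    simp only [a, add_zero, Finset.sum_const_zero]
    refine Finset.sum_congr rfl fun v _ => ?_
    rw [vis_low, vis_mate, nu_low v.2, nu_mate v.2]
    cases φ v.1 <;> cases φ (H.mate v.1) <;> simp
  have h5 : (leftover φ).card =
      ∑ v : H.Pair, if φ (H.mate v.1) = true ∧ φ v.1 = false then 1 else 0 := by
    unfold leftover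
    rw [Finset.card_filter]
    refine Finset.sum_congr rfl fun v _ => ?_
    rw [vis_low, vis_mate]
    cases φ v.1 <;> cases φ (H.mate v.1) <;> simp
  have h6 : ∑ h : H.Var, (if φ h = φ (H.next h) then 0 else 1) =
      ∑ h : H.Var, if Viol φ (.inl h) then 1 else 0 := by
    refine Finset.sum_congr rfl fun v _ => ?_
    by_cases h : φ v = φ (H.next v) <;> simp [Viol, h]
  have h7 : ∑ v : H.Pair, (if Viol φ (.inr (.inl v)) then 1 else 0) =
      ∑ v : H.Pair, (if φ (H.mate v.1) = false ∧ φ v.1 = true then 1 else 0) +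
      ∑ v : H.Pair, if φ (H.mate v.1) = true ∧ φ v.1 = false then 1 else 0 := by
    rw [← Finset.sum_add_distrib]
    refine Finset.sum_congr rfl fun v _ => ?_
    cases h : φ v.1 <;> cases h' : φ (H.mate v.1) <;> simp [Viol, h, h']
  rw [h4, h5, h6, h7]
  omega

theorem card_Sgl : Fintype.card H.Sgl = 2 * H.m₃ + 2 * H.n + (H.n + H.m₃) := by
  simp only [Fintype.card_sum, Fintype.card_prod, Fintype.card_bool, Fintype.card_fin]
  ring

theorem card_Blk : Fintype.card H.Blk = H.m₂ + 3 * H.m₃ := by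
  rw [m₂_eq]
  simp only [Fintype.card_sum, Fintype.card_prod, Fintype.card_fin]
  ring

/-- The counting half of the proof that each gadget occurs exactly once; `mem_pieces` is the other
half. -/
theorem length_pieces : (pieces φ).length ≤ Fintype.card H.Blk + Fintype.card H.Sgl := by
  have hn := H.n_pos
  unfold pieces
  rw [List.length_append, length_tourTo, List.length_map, Finset.length_toList]
  simp only [length_part]
  rw [sum_partFn H.star.1.2]
  simp only [length_circlePart, length_clausePart]
  rw [card_Blk, card_Sgl, m₂_eq, Finset.sum_add_distrib, Finset.sum_add_distrib, sum_orbit,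
    Finset.sum_add_distrib]
  have h0 := H.sum_var fun h => if Vis φ h then 1 else 0
  simp only [Finset.sum_const, Finset.card_univ, Fintype.card_fin, smul_eq_mul, mul_one]
  have h1 : ∑ v : H.Pair, ((if Vis φ v.1 then 1 else 0) + if Vis φ (H.mate v.1) then 1 else 0) +
      (leftover φ).card ≤ Fintype.card H.Pair := by
    rw [leftover, Finset.card_filter, ← Finset.sum_add_distrib, ← Finset.card_univ,
      Finset.card_eq_sum_ones]
    refine Finset.sum_le_sum fun v _ => ?_
    rw [vis_low, vis_mate]
    cases φ v.1 <;> cases φ (H.mate v.1) <;> simp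
  have h2 : ∑ c, ((if Vis φ (H.triple c 0) then 1 else 0) + (if Vis φ (H.triple c 1) then 1 else 0) +
      if Vis φ (H.triple c 2) then 1 else 0) + ∑ c, ((if agree φ c 0 then 0 else 1) +
      (if agree φ c 1 then 0 else 1) + if agree φ c 2 then 0 else 1) = 3 * H.m₃ := by
    rw [← Finset.sum_add_distrib]
    have : ∀ c ∈ (Finset.univ : Finset (Fin H.m₃)), ((if Vis φ (H.triple c 0) then 1 else 0) +
      (if Vis φ (H.triple c 1) then 1 else 0) + if Vis φ (H.triple c 2) then 1 else 0) +
      ((if agree φ c 0 then 0 else 1) + (if agree φ c 1 then 0 else 1) +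
        if agree φ c 2 then 0 else 1) = 3 := by
      intro c _
      rw [vis_triple, vis_triple, vis_triple]
      cases agree φ c 0 <;> cases agree φ c 1 <;> cases agree φ c 2 <;> simp
    rw [Finset.sum_congr rfl this]
    simp [mul_comm]
  omega

theorem mem_pieces_of_walk {l : Fin H.n} {p : Piece H.Blk H.Sgl} (h : p ∈ walk φ l) :
    p.name ∈ (pieces φ).map Piece.name := by
  obtain ⟨q, hq, hqn⟩ := List.mem_map.1 (mem_circlePart φ h)
  rw [← hqn]
  exact List.mem_map_of_mem (List.mem_append_left _ (mem_tourTo_circle φ hq))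

theorem mem_pieces_of_clause {c : Fin H.m₃} {p : Piece H.Blk H.Sgl} (h : p ∈ clausePart φ c) :
    p.name ∈ (pieces φ).map Piece.name :=
  List.mem_map_of_mem (List.mem_append_left _ (mem_tourTo_clause φ h))

theorem mem_walk_around {h : H.Var} {p : Piece H.Blk H.Sgl} (hp : p ∈ around φ h) :
    p ∈ walk φ h.1 :=
  List.mem_cons_of_mem _ (List.mem_cons_of_mem _ (List.mem_flatMap.2 ⟨h, mem_orbit h, hp⟩))

theorem mem_walk_pieceY {h : H.Var} (hv : Vis φ h) : pieceY h ∈ walk φ h.1 :=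
  mem_walk_around φ (by rw [around, if_pos hv]; simp)

theorem name_pieceY_triple (p : Fin H.m₃ × Fin 3) :
    (pieceY (H.triple p.1 p.2)).name = .inl (.inr (.inl p)) := by
  rw [pieceY, dif_pos (show H.IsContact _ from H.triple_contact p.1 p.2), H.place_triple]
  rfl

theorem name_pieceY_low (v : H.Pair) : (pieceY v.1).name = .inl (.inr (.inr v)) := by
  rw [pieceY, dif_neg (H.not_contact_of_low v.2), dif_pos v.2]
  rfl

theorem name_pieceY_mate (v : H.Pair) : (pieceY (H.mate v.1)).name = .inl (.inr (.inr v)) := by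
  rw [pieceY, dif_neg (H.not_contact_mate (H.not_contact_of_low v.2)),
    dif_neg (H.not_low_mate v.2)]
  simp only [H.mate_mate]
  rfl

theorem mem_pieces (x : H.Blk ⊕ H.Sgl) : x ∈ (pieces φ).map Piece.name := by
  rcases x with (g | ⟨c, k⟩ | v) | ⟨c, r⟩ | ⟨l, r⟩ | j
  · by_cases hg : H.IsCut g
    · have hg' : g = H.cutv g.1 := hg
      have : pieceL g (φ (H.next g)) ∈ walk φ g.1 := by
        unfold walk
        rw [← hg']
        simp
      exact mem_pieces_of_walk φ this
    · have : pieceL g (φ (H.next g)) ∈ walk φ g.1 :=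
        mem_walk_around φ (by rw [around, pieceN, if_neg hg]; simp)
      exact mem_pieces_of_walk φ this
  · cases h : agree φ c k
    · obtain ⟨i, hi⟩ := mem_clausePart φ c k h
      exact mem_pieces_of_clause φ hi
    · have := mem_pieces_of_walk φ (mem_walk_pieceY φ ((vis_triple φ c k).2 h))
      rwa [name_pieceY_triple (c, k)] at this
  · by_cases h1 : Vis φ v.1
    · have := mem_pieces_of_walk φ (mem_walk_pieceY φ h1)
      rwa [name_pieceY_low] at this
    by_cases h2 : Vis φ (H.mate v.1)
    · have := mem_pieces_of_walk φ (mem_walk_pieceY φ h2)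
      rwa [name_pieceY_mate] at this
    refine List.mem_map.2 ⟨pieceM v 0, List.mem_append_right _ (List.mem_map.2 ⟨v, ?_, rfl⟩), rfl⟩
    rw [Finset.mem_toList, leftover, Finset.mem_filter]
    exact ⟨Finset.mem_univ _, h1, h2⟩
  · refine mem_pieces_of_clause φ (c := c) (p := .inr (.inl (c, r))) ?_
    cases r <;> simp [clausePart]
  · refine List.mem_map.2 ⟨.inr (.inr (.inl (l, r))),
      List.mem_append_left _ (mem_tourTo_circle φ (l := l) ?_), rfl⟩
    obtain ⟨L, hL⟩ := circlePart_eq φ l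
    rw [hL]
    cases r <;> simp
  · refine List.mem_map.2 ⟨hubPiece H j, List.mem_append_left _ (mem_tourTo_hub φ ?_), ?_⟩
    · have := j.2; omega
    · rw [hubPiece_eq]; rfl

/-- An assignment with few violated equations yields a short tour. -/
theorem exists_tour_le (ψ : H.Assignment) (md : Bool) {n : ℕ}
    (hn : Fintype.card (Vtx md H.Blk H.Sgl) = n) :
    ∃ σ : Fin n ≃ Vtx md H.Blk H.Sgl,
      ∑ i, (H.net md).d (σ i) (σ (finRotate n i)) ≤ gadBase md * (H.m₂ + 3 * H.m₃) + 2 * H.m₃ +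
        2 * H.n + 4 * (H.n + H.m₃) + 2 + 2 * H.unsat ψ := by
  obtain ⟨φ, rfl⟩ := exists_toAssignment ψ
  have h0 := H.n_pos
  obtain ⟨σ, hσ⟩ := (H.net md).exists_tour_of_pieces (pieces φ) (mem_pieces φ) (length_pieces φ)
    (by rw [card_Sgl]; omega) n hn
  refine ⟨σ, hσ.trans ?_⟩
  have := gaps_pieces (md := md) φ
  rw [unsat_eq, card_Blk, card_Sgl]
  omega

end HybridInstance
end


noncomputable section
open scoped Classical

/-! ## Functions computed by the machine in polynomial time -/

namespace Ram

/-- `f` is bounded by a polynomial in `S`. -/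
def PB {α : Type} (S f : α → ℕ) : Prop := ∃ c, ∀ a, f a ≤ (S a + 2) ^ c

section PB
variable {α : Type} {S f g : α → ℕ}

theorem PB.mono (hg : PB S g) (h : ∀ a, f a ≤ g a) : PB S f :=
  hg.imp fun _ hc a => (h a).trans (hc a)

theorem PB.const (m : ℕ) : PB S fun _ => m :=
  ⟨m, fun a => (Nat.lt_pow_self (by omega : 1 < S a + 2)).le⟩

theorem PB.size : PB S S := ⟨1, fun a => by simp⟩

theorem PB.mul (hf : PB S f) (hg : PB S g) : PB S fun a => f a * g a := by
  obtain ⟨c, hc⟩ := hf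
  obtain ⟨d, hd⟩ := hg
  exact ⟨c + d, fun a => by rw [pow_add]; exact Nat.mul_le_mul (hc a) (hd a)⟩

theorem PB.add (hf : PB S f) (hg : PB S g) : PB S fun a => f a + g a := by
  obtain ⟨c, hc⟩ := hf
  obtain ⟨d, hd⟩ := hg
  refine ⟨c + d + 1, fun a => ?_⟩
  have h1 : (S a + 2) ^ c ≤ (S a + 2) ^ (c + d) := Nat.pow_le_pow_right (by omega) (by omega)
  have h2 : (S a + 2) ^ d ≤ (S a + 2) ^ (c + d) := Nat.pow_le_pow_right (by omega) (by omega)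
  have h3 : 2 * (S a + 2) ^ (c + d) ≤ (S a + 2) ^ (c + d) * (S a + 2) := by
    rw [mul_comm]; exact Nat.mul_le_mul_left _ (by omega)
  rw [pow_succ]
  have := hc a
  have := hd a
  dsimp only
  omega

theorem PB.pow (hf : PB S f) (c : ℕ) : PB S fun a => f a ^ c := by
  obtain ⟨d, hd⟩ := hf
  exact ⟨d * c, fun a => by rw [pow_mul]; exact Nat.pow_le_pow_left (hd a) c⟩

theorem PB.comp {β : Type} {S' f' : β → ℕ} (hf : PB S' f') (g : α → β) (h : PB S fun a => S' (g a)) :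
    PB S fun a => f' (g a) := by
  obtain ⟨c, hc⟩ := hf
  exact (((h.add (PB.const 2)).pow c)).mono fun a => hc (g a)

end PB

/-- The rule for counting loops: `e` evaluates to the number of remaining rounds, and `I i` is the
invariant after `i` rounds. -/
theorem exec_for {e : Expr} {p : Prog} {n T : ℕ} (I : ℕ → State → Prop)
    (he : ∀ i s, i ≤ n → I i s → e.eval s = n - i)
    (hp : ∀ i s, i < n → I i s → ∃ t s', Exec p s t s' ∧ t ≤ T ∧ I (i + 1) s') {s : State}
    (h0 : I 0 s) : ∃ t s', Exec (.loop e p) s t s' ∧ t ≤ n * (T + 1) + 1 ∧ I n s' := by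
  have key : ∀ m i s, i + m = n → I i s →
      ∃ t s', Exec (.loop e p) s t s' ∧ t ≤ m * (T + 1) + 1 ∧ I n s' := by
    intro m
    induction m with
    | zero =>
      intro i s hi hs
      obtain rfl : i = n := by omega
      exact ⟨1, s, .loop_false e p s (by rw [he i s le_rfl hs]; omega), by omega, hs⟩
    | succ m ih =>
      intro i s hi hs
      obtain ⟨t, s', h1, h2, h3⟩ := hp i s (by omega) hs
      obtain ⟨t', s'', h4, h5, h6⟩ := ih (i + 1) s' (by omega) h3
      refine ⟨t + t' + 1, s'', .loop_true e p s s' s'' t t' (by rw [he i s (by omega) hs]; omega)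
        h1 h4, ?_, h6⟩
      rw [add_mul]
      omega
  exact key n 0 s (by omega) h0

/-- A description of the contents of the arrays and of some registers. -/
structure Ctx (α : Type) where
  arr : α → ℕ → ℕ → ℕ
  reg : ℕ → α → ℕ
  size : α → ℕ
  arr_le : ∀ a i j, arr a i j ≤ size a
  reg_le : ∀ i a, reg i a ≤ size a

/-- The state `s` is described by `Γ`, the registers being located at `ρ`. -/
structure Ctx.Holds {α : Type} (Γ : Ctx α) (ρ : ℕ → ℕ) (a : α) (s : State) : Prop where
  arr : s.arr = Γ.arr a
  reg : ∀ i, s.reg (ρ i) = Γ.reg i a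

/-- The states differ at most in the registers from `k` on. -/
structure Same (k : ℕ) (s s' : State) : Prop where
  reg : ∀ i < k, s'.reg i = s.reg i
  arr : s'.arr = s.arr
  out : s'.out = s.out

theorem Same.trans {k k' : ℕ} {s s' s'' : State} (h : Same k s s') (h' : Same k' s' s'') (hk : k ≤ k') :
    Same k s s'' :=
  ⟨fun i hi => (h'.reg i (hi.trans_le hk)).trans (h.reg i hi), h'.arr.trans h.arr,
    h'.out.trans h.out⟩

theorem Ctx.Holds.same {α : Type} {Γ : Ctx α} {ρ : ℕ → ℕ} {a : α} {s s' : State} {k : ℕ}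
    (h : Γ.Holds ρ a s) (hs : Same k s s') (hρ : ∀ i, ρ i < k) : Γ.Holds ρ a s' :=
  ⟨hs.arr.trans h.arr, fun i => (hs.reg _ (hρ i)).trans (h.reg i)⟩

/-- `f` can be computed in polynomial time, without changing the memory. -/
def PT {α : Type} (Γ : Ctx α) (f : α → ℕ) : Prop :=
  ∃ T : α → ℕ, PB Γ.size T ∧ PB Γ.size f ∧ ∀ (k : ℕ) (ρ : ℕ → ℕ), (∀ i, ρ i < k) → ∃ p : Prog,
    ∀ a s, Γ.Holds ρ a s → ∃ t s', Exec p s t s' ∧ t ≤ T a ∧ s'.reg k = f a ∧ Same k s s'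

/-- The truth value of `P` can be computed in polynomial time. -/
def PTP {α : Type} (Γ : Ctx α) (P : α → Prop) : Prop := PT Γ fun a => if P a then 1 else 0

/-- The context with an additional register. -/
def Ctx.ext {α : Type} (Γ : Ctx α) {ι : α → Type} (code : ∀ a, ι a → ℕ) : Ctx (Σ a, ι a) where
  arr p := Γ.arr p.1
  reg i p := Nat.rec (code p.1 p.2) (fun j _ => Γ.reg j p.1) i
  size p := Γ.size p.1 + code p.1 p.2
  arr_le p _ _ := (Γ.arr_le _ _ _).trans (Nat.le_add_right _ _)
  reg_le i p := by
    cases i with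
    | zero => exact Nat.le_add_left _ _
    | succ j => exact (Γ.reg_le _ _).trans (Nat.le_add_right _ _)

section PT
variable {α : Type} {Γ : Ctx α} {f g : α → ℕ} {P Q : α → Prop}

theorem same_assign (k : ℕ) (v : ℕ) (s : State) :
    Same k s ⟨Function.update s.reg k v, s.arr, s.out⟩ :=
  ⟨fun _ hi => Function.update_of_ne hi.ne _ _, rfl, rfl⟩

theorem PT.of_expr (hb : PB Γ.size f) (e : (ℕ → ℕ) → Expr)
    (he : ∀ ρ a s, Γ.Holds ρ a s → (e ρ).eval s = f a) : PT Γ f := by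
  refine ⟨fun _ => 1, PB.const 1, hb, fun k ρ hρ => ⟨.assign k (e ρ), fun a s hs => ?_⟩⟩
  exact ⟨1, _, .assign k (e ρ) s, le_rfl, by simp [he ρ a s hs], same_assign _ _ _⟩

theorem PT.const (m : ℕ) : PT Γ fun _ => m :=
  .of_expr (PB.const m) (fun _ => .const m) fun _ _ _ _ => rfl

theorem PT.var (i : ℕ) : PT Γ (Γ.reg i) :=
  .of_expr (PB.size.mono (Γ.reg_le i)) (fun ρ => .reg (ρ i)) fun _ _ _ h => h.reg i

theorem PT.bound (hf : PT Γ f) : PB Γ.size f := by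
  obtain ⟨T, -, h, -⟩ := hf
  exact h

theorem PT.map₁ (hf : PT Γ f) {F : α → ℕ} (hb : PB Γ.size F) (e : ℕ → Expr)
    (he : ∀ k a s, s.arr = Γ.arr a → s.reg k = f a → (e k).eval s = F a) : PT Γ F := by
  obtain ⟨T, hT, -, h⟩ := hf
  refine ⟨fun a => T a + 1, hT.add (PB.const 1), hb, fun k ρ hρ => ?_⟩
  obtain ⟨p, hp⟩ := h k ρ hρ
  refine ⟨.seq p (.assign k (e k)), fun a s hs => ?_⟩
  obtain ⟨t, s', h1, h2, h3, h4⟩ := hp a s hs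
  exact ⟨t + 1, _, .seq _ _ _ _ _ _ _ h1 (.assign k (e k) s'), Nat.succ_le_succ h2,
    by simp [he k a s' (h4.arr.trans hs.arr) h3], h4.trans (same_assign _ _ _) le_rfl⟩

theorem PT.get (i : ℕ) (hf : PT Γ f) : PT Γ fun a => Γ.arr a i (f a) :=
  hf.map₁ (PB.size.mono fun a => Γ.arr_le a i _) (fun k => .arr i (.reg k)) fun k a s h1 h2 => by
    simp [Expr.eval, h1, h2]

theorem PT.map₂ (hf : PT Γ f) (hg : PT Γ g) {F : α → ℕ} (hb : PB Γ.size F) (e : ℕ → Expr)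
    (he : ∀ k a s, s.reg k = f a → s.reg (k + 1) = g a → (e k).eval s = F a) : PT Γ F := by
  obtain ⟨T, hT, -, h⟩ := hf
  obtain ⟨T', hT', -, h'⟩ := hg
  refine ⟨fun a => T a + T' a + 1, (hT.add hT').add (PB.const 1), hb, fun k ρ hρ => ?_⟩
  obtain ⟨p, hp⟩ := h k ρ hρ
  obtain ⟨p', hp'⟩ := h' (k + 1) ρ fun i => (hρ i).trans (Nat.lt_succ_self k)
  refine ⟨.seq (.seq p p') (.assign k (e k)), fun a s hs => ?_⟩
  obtain ⟨t, s', h1, h2, h3, h4⟩ := hp a s hs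
  obtain ⟨t', s'', h5, h6, h7, h8⟩ := hp' a s' (hs.same h4 hρ)
  refine ⟨t + t' + 1, _, .seq _ _ _ _ _ _ _ (.seq _ _ _ _ _ _ _ h1 h5) (.assign k (e k) s''),
    Nat.succ_le_succ (Nat.add_le_add h2 h6), ?_, (h4.trans h8 (Nat.le_succ k)).trans (same_assign _ _ _) le_rfl⟩
  simp [he k a s'' ((h8.reg k (Nat.lt_succ_self k)).trans h3) h7]

theorem PT.add (hf : PT Γ f) (hg : PT Γ g) : PT Γ fun a => f a + g a :=
  hf.map₂ hg (hf.bound.add hg.bound) (fun k => .add (.reg k) (.reg (k + 1))) fun k a s h1 h2 => by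
    simp [Expr.eval, h1, h2]

theorem PT.sub (hf : PT Γ f) (hg : PT Γ g) : PT Γ fun a => f a - g a :=
  hf.map₂ hg (hf.bound.mono fun _ => Nat.sub_le _ _) (fun k => .sub (.reg k) (.reg (k + 1)))
    fun k a s h1 h2 => by simp [Expr.eval, h1, h2]

/-- Change of context. -/
theorem PT.comp {β : Type} {Γ' : Ctx β} {F : β → ℕ} (hF : PT Γ' F) (φ : α → β) (τ : ℕ → ℕ)
    (harr : ∀ a, Γ'.arr (φ a) = Γ.arr a) (hreg : ∀ i a, Γ'.reg i (φ a) = Γ.reg (τ i) a)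
    (hsize : PB Γ.size fun a => Γ'.size (φ a)) : PT Γ fun a => F (φ a) := by
  obtain ⟨T, hT, hb, h⟩ := hF
  refine ⟨fun a => T (φ a), hT.comp φ hsize, hb.comp φ hsize, fun k ρ hρ => ?_⟩
  obtain ⟨p, hp⟩ := h k (fun i => ρ (τ i)) fun i => hρ _
  exact ⟨p, fun a s hs => hp (φ a) s
    ⟨hs.arr.trans (harr a).symm, fun i => (hs.reg _).trans (hreg i a).symm⟩⟩

theorem PT.weaken {ι : α → Type} {code : ∀ a, ι a → ℕ} (hf : PT Γ f) :
    PT (Γ.ext code) fun p => f p.1 :=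
  hf.comp Sigma.fst Nat.succ (fun _ => rfl) (fun _ _ => rfl)
    (PB.size.mono fun _ => Nat.le_add_right _ _)

theorem PT.last {ι : α → Type} {code : ∀ a, ι a → ℕ} : PT (Γ.ext code) fun p => code p.1 p.2 :=
  .var 0

theorem PTP.congr (hP : PTP Γ P) (h : ∀ a, Q a ↔ P a) : PTP Γ Q := by
  rwa [show Q = P from funext fun a => propext (h a)]

theorem PT.congr (hf : PT Γ f) (h : ∀ a, g a = f a) : PT Γ g := by
  rwa [show g = f from funext h]

/-- Guarded change of context. -/
theorem PT.guard {β : Type} {Γ' : Ctx β} {F : β → ℕ} (hP : PTP Γ P) (hF : PT Γ' F)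
    (φ : ∀ a, P a → β) (harr : ∀ a h, Γ'.arr (φ a h) = Γ.arr a)
    (hreg : ∀ i a h, Γ'.reg i (φ a h) = Γ.reg i a)
    (hsize : ∀ a h, Γ'.size (φ a h) = Γ.size a) :
    PT Γ fun a => if h : P a then F (φ a h) else 0 := by
  obtain ⟨T, hT, -, h⟩ := hP
  obtain ⟨T', ⟨c, hc⟩, ⟨d, hd⟩, h'⟩ := hF
  refine ⟨fun a => T a + ((Γ.size a + 2) ^ c + 1) + 1, (hT.add (((PB.size.add
    (PB.const 2)).pow c).add (PB.const 1))).add (PB.const 1), ((PB.size.add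
    (PB.const 2)).pow d).mono fun a => ?_, fun k ρ hρ => ?_⟩
  · split_ifs with ha
    · rw [← hsize a ha]; exact hd _
    · exact Nat.zero_le _
  obtain ⟨p, hp⟩ := h k ρ hρ
  obtain ⟨p', hp'⟩ := h' k ρ hρ
  refine ⟨.seq p (.ite (.reg k) p' (.assign k (.const 0))), fun a s hs => ?_⟩
  obtain ⟨t, s', h1, h2, h3, h4⟩ := hp a s hs
  by_cases ha : P a
  · dsimp only at h3 ⊢
    rw [dif_pos ha]
    rw [if_pos ha] at h3
    have hs' := hs.same h4 hρ
    obtain ⟨t', s'', h5, h6, h7, h8⟩ := hp' (φ a ha) s'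
      ⟨hs'.arr.trans (harr a ha).symm, fun i => (hs'.reg i).trans (hreg i a ha).symm⟩
    have := hc (φ a ha)
    rw [hsize a ha] at this
    exact ⟨t + (t' + 1), s'', .seq _ _ _ _ _ _ _ h1 (.ite_true _ _ _ _ _ _ (by
      simp [Expr.eval, h3]) h5), by omega, h7, h4.trans h8 le_rfl⟩
  · dsimp only at h3 ⊢
    rw [dif_neg ha]
    rw [if_neg ha] at h3
    exact ⟨t + (1 + 1), _, .seq _ _ _ _ _ _ _ h1 (.ite_false _ _ _ _ _ _ (by
      simp [Expr.eval, h3]) (.assign k (.const 0) s')), by omega, by simp [Expr.eval],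
      h4.trans (same_assign _ _ _) le_rfl⟩

/-- The context with an additional register that holds an arbitrary number. -/
abbrev Ctx.push (Γ : Ctx α) : Ctx (Σ _ : α, ℕ) := Γ.ext fun _ j => j

/-- The location of the registers if a new one is added. -/
def cons (r : ℕ) (ρ : ℕ → ℕ) : ℕ → ℕ
  | 0 => r
  | i + 1 => ρ i

theorem Ctx.Holds.ext {ι : α → Type} {code : ∀ a, ι a → ℕ} {ρ : ℕ → ℕ} {a : α} {s : State} {r : ℕ}
    (h : Γ.Holds ρ a s) {i : ι a} (hr : s.reg r = code a i) :
    (Γ.ext code).Holds (cons r ρ) ⟨a, i⟩ s :=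
  ⟨h.arr, fun j => by cases j with
    | zero => exact hr
    | succ j => exact h.reg j⟩

theorem cons_lt {r k : ℕ} {ρ : ℕ → ℕ} (hr : r < k) (hρ : ∀ i, ρ i < k) (i : ℕ) : cons r ρ i < k := by
  cases i with
  | zero => exact hr
  | succ i => exact hρ i

/-- Register `k` accumulates the sum, `k + 1` is the counter and serves as the additional register
of the context, `k + 2` keeps the bound, and the summand is computed from register `k + 3` on. -/
theorem PT.sum_range {C : α → ℕ} (hC : PT Γ C) {F : (Σ _ : α, ℕ) → ℕ} (hF : PT Γ.push F) :
    PT Γ fun a => ∑ j ∈ Finset.range (C a), F ⟨a, j⟩ := by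
  obtain ⟨T, hT, hCb, h⟩ := hC
  obtain ⟨T', ⟨c, hc⟩, ⟨d, hd⟩, h'⟩ := hF
  have hX : ∀ e, PB Γ.size fun a => (Γ.size a + C a + 2) ^ e := fun e =>
    ((PB.size.add hCb).add (PB.const 2)).pow e
  have hmono : ∀ a j e, j < C a → (Γ.push.size ⟨a, j⟩ + 2) ^ e ≤ (Γ.size a + C a + 2) ^ e :=
    fun a j e hj => Nat.pow_le_pow_left (show Γ.size a + j + 2 ≤ _ by omega) e
  refine ⟨fun a => T a + 1 + 1 + (C a * ((Γ.size a + C a + 2) ^ c + 1 + 1 + 1) + 1),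
    ((hT.add (PB.const 1)).add (PB.const 1)).add ((hCb.mul ((((hX c).add (PB.const 1)).add
    (PB.const 1)).add (PB.const 1))).add (PB.const 1)), (hCb.mul (hX d)).mono fun a => ?_,
    fun k ρ hρ => ?_⟩
  · have := Finset.sum_le_card_nsmul (Finset.range (C a)) (fun j => F ⟨a, j⟩)
      ((Γ.size a + C a + 2) ^ d) fun j hj => (hd _).trans (hmono a j d (Finset.mem_range.1 hj))
    simpa using this
  have hρ' : ∀ m i, ρ i < k + m := fun m i => (hρ i).trans_le (Nat.le_add_right _ _)
  obtain ⟨p, hp⟩ := h (k + 2) ρ (hρ' 2)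
  obtain ⟨p', hp'⟩ := h' (k + 3) (cons (k + 1) ρ) (cons_lt (by omega) (hρ' 3))
  refine ⟨.seq (.seq (.seq p (.assign k (.const 0))) (.assign (k + 1) (.const 0)))
    (.loop (.sub (.reg (k + 2)) (.reg (k + 1))) (.seq (.seq p'
      (.assign k (.add (.reg k) (.reg (k + 3))))) (.assign (k + 1) (.add (.reg (k + 1)) (.const 1))))),
    fun a s hs => ?_⟩
  obtain ⟨t, s', h1, h2, h3, h4⟩ := hp a s hs
  set s1 : State := ⟨Function.update s'.reg k 0, s'.arr, s'.out⟩ with hs1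
  set s2 : State := ⟨Function.update s1.reg (k + 1) 0, s1.arr, s1.out⟩ with hs2
  have e2 : Exec _ s (t + 1 + 1) s2 := .seq _ _ _ _ _ _ _ (.seq _ _ _ _ _ _ _ h1
    (.assign k (.const 0) s')) (.assign (k + 1) (.const 0) s1)
  obtain ⟨t', s'', h5, h6, h7, h8, h9, h10⟩ := exec_for (n := C a)
    (T := (Γ.size a + C a + 2) ^ c + 1 + 1)
    (e := .sub (.reg (k + 2)) (.reg (k + 1))) (p := .seq (.seq p'
      (.assign k (.add (.reg k) (.reg (k + 3))))) (.assign (k + 1) (.add (.reg (k + 1)) (.const 1))))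
    (s := s2) (fun i u => Same k s u ∧ u.reg k = ∑ j ∈ Finset.range i, F ⟨a, j⟩ ∧
      u.reg (k + 1) = i ∧ u.reg (k + 2) = C a) (by
      rintro i u - ⟨-, -, hu1, hu2⟩
      simp [Expr.eval, hu1, hu2]) (by
      rintro i u hi ⟨hu, hu0, hu1, hu2⟩
      obtain ⟨t', u', g1, g2, g3, g4⟩ := hp' ⟨a, i⟩ u ((hs.same hu hρ).ext hu1)
      refine ⟨t' + 1 + 1, _, .seq _ _ _ _ _ _ _ (.seq _ _ _ _ _ _ _ g1 (.assign _ _ _))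
        (.assign _ _ _), ?_, ?_, ?_, ?_, ?_⟩
      · have := hc ⟨a, i⟩
        have := hmono a i c hi
        omega
      · refine ⟨fun j hj => ?_, g4.arr.trans hu.arr, g4.out.trans hu.out⟩
        dsimp only
        rw [Function.update_of_ne (by omega), Function.update_of_ne (by omega),
          g4.reg j (by omega), hu.reg j hj]
      · dsimp only
        rw [Function.update_of_ne (by omega), Function.update_self, Finset.sum_range_succ]
        simp [Expr.eval, g3, g4.reg k (by omega), hu0]
      · dsimp only
        rw [Function.update_self]
        simp [Expr.eval, g4.reg (k + 1) (by omega), hu1]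
      · dsimp only
        rw [Function.update_of_ne (by omega), Function.update_of_ne (by omega),
          g4.reg (k + 2) (by omega), hu2]) ⟨⟨fun j hj => by
        simp only [hs2, hs1]
        rw [Function.update_of_ne (by omega), Function.update_of_ne (by omega),
          h4.reg j (by omega)], h4.arr, h4.out⟩, by simp [hs2, hs1], by simp [hs2],
        by simp [hs2, hs1, h3]⟩
  exact ⟨_, s'', .seq _ _ _ _ _ _ _ e2 h5, by beta_reduce; omega, h8, h7⟩

/-- Truncated subtraction turns comparisons into truth values. -/
theorem PTP.le (hf : PT Γ f) (hg : PT Γ g) : PTP Γ fun a => f a ≤ g a :=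
  ((PT.const 1).sub (hf.sub hg)).congr fun a => by split_ifs <;> omega

theorem PTP.lt (hf : PT Γ f) (hg : PT Γ g) : PTP Γ fun a => f a < g a :=
  PTP.le (hf.add (PT.const 1)) hg

theorem PTP.eq (hf : PT Γ f) (hg : PT Γ g) : PTP Γ fun a => f a = g a :=
  ((PT.const 1).sub ((hf.sub hg).add (hg.sub hf))).congr fun a => by split_ifs <;> omega

theorem PTP.not (hP : PTP Γ P) : PTP Γ fun a => ¬ P a :=
  ((PT.const 1).sub hP).congr fun a => by by_cases h : P a <;> simp [h]

theorem PTP.and (hP : PTP Γ P) (hQ : PTP Γ Q) : PTP Γ fun a => P a ∧ Q a :=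
  ((PT.add hP hQ).sub (PT.const 1)).congr fun a => by
    by_cases h : P a <;> by_cases h' : Q a <;> simp [h, h']

theorem PTP.or (hP : PTP Γ P) (hQ : PTP Γ Q) : PTP Γ fun a => P a ∨ Q a :=
  (hP.not.and hQ.not).not.congr fun a => by tauto

theorem PTP.iff (hP : PTP Γ P) (hQ : PTP Γ Q) : PTP Γ fun a => (P a ↔ Q a) :=
  ((hP.and hQ).or (hP.not.and hQ.not)).congr fun a => by tauto

theorem PTP.const (p : Prop) : PTP Γ fun _ => p := PT.const _

/-- The machine cannot multiply, but values are bounded by a polynomial in the size, so an iterated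
sum is fast enough. -/
theorem PT.mul (hf : PT Γ f) (hg : PT Γ g) : PT Γ fun a => f a * g a :=
  (hf.sum_range (hg.weaken (code := fun _ j => j))).congr fun a => by simp

/-- Both branches are evaluated, which is harmless for total functions. Functions defined only on
part of the context need `PT.guard`. -/
theorem PT.ite [∀ a, Decidable (P a)] (hP : PTP Γ P) (hf : PT Γ f) (hg : PT Γ g) :
    PT Γ fun a => if P a then f a else g a :=
  ((hP.mul hf).add (hP.not.mul hg)).congr fun a => by by_cases h : P a <;> simp [h]

/-- A family of finite types whose elements are represented by numbers. -/
structure Listed (Γ : Ctx α) {ι : α → Type} (code : ∀ a, ι a → ℕ) : Prop where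
  inj : ∀ a, Function.Injective (code a)
  bound : ∃ C, PT Γ C ∧ ∀ a i, code a i < C a
  valid : PTP Γ.push fun p : Σ _ : α, ℕ => ∃ i, code p.1 i = p.2

/-- The sum runs over all numbers below the bound and skips those that are not codes; the guard
ensures that the summand is evaluated only at codes. -/
theorem PT.sum {ι : α → Type} [∀ a, Fintype (ι a)] {code : ∀ a, ι a → ℕ} (hι : Listed Γ code)
    {F : (Σ a, ι a) → ℕ} (hF : PT (Γ.ext code) F) : PT Γ fun a => ∑ i, F ⟨a, i⟩ := by
  obtain ⟨hinj, ⟨C, hC, hlt⟩, hv⟩ := hι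
  have h1 := PT.guard hv hF (fun p h => ⟨p.1, h.choose⟩) (fun _ _ => rfl)
    (fun i p h => by
      cases i with
      | zero => exact h.choose_spec
      | succ i => rfl) (fun p h => congrArg (Γ.size p.1 + ·) h.choose_spec)
  refine (hC.sum_range h1).congr fun a => ?_
  set G : ℕ → ℕ := fun j => @dite ℕ (∃ i, code a i = j) (Classical.propDecidable _)
    (fun h => F ⟨a, h.choose⟩) fun _ => 0 with hG
  change _ = ∑ j ∈ Finset.range (C a), G j
  have e : ∀ i, F ⟨a, i⟩ = G (code a i) := by
    intro i
    have h : ∃ j, code a j = code a i := ⟨i, rfl⟩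
    rw [hG]
    dsimp only
    rw [dif_pos h, hinj a h.choose_spec]
  rw [Finset.sum_congr rfl fun i _ => e i,
    ← Finset.sum_image (f := G) (g := code a) fun i _ j _ h => hinj a h]
  refine Finset.sum_subset (fun j hj => ?_) fun j _ hj => ?_
  · obtain ⟨i, -, rfl⟩ := Finset.mem_image.1 hj
    exact Finset.mem_range.2 (hlt a i)
  · rw [hG]
    exact dif_neg fun ⟨i, hi⟩ => hj (Finset.mem_image.2 ⟨i, Finset.mem_univ _, hi⟩)

theorem PTP.exists {ι : α → Type} {code : ∀ a, ι a → ℕ} (hι : Listed Γ code)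
    {R : (Σ a, ι a) → Prop} (hR : PTP (Γ.ext code) R) : PTP Γ fun a => ∃ i, R ⟨a, i⟩ := by
  have hfin : ∀ a, Finite (ι a) := fun a => by
    obtain ⟨C, -, hlt⟩ := hι.bound
    exact Finite.of_injective (fun i => (⟨code a i, hlt a i⟩ : Fin (C a))) fun i j h =>
      hι.inj a (congrArg Fin.val h)
  have : ∀ a, Fintype (ι a) := fun a => Fintype.ofFinite _
  exact (PTP.lt (PT.const 0) (PT.sum hι hR)).congr fun a => by
    simp [Nat.pos_iff_ne_zero]

theorem Listed.fin {N : α → ℕ} (hN : PT Γ N) :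
    Listed Γ (ι := fun a => Fin (N a)) fun _ i => i := by
  refine ⟨fun a => Fin.val_injective, ⟨N, hN, fun a i => i.2⟩, ?_⟩
  have h : PTP Γ.push (fun p : Σ _ : α, ℕ => p.2 < N p.1) := PTP.lt PT.last hN.weaken
  exact h.congr fun p => ⟨fun ⟨i, hi⟩ => hi ▸ i.2, fun h => ⟨⟨_, h⟩, rfl⟩⟩

/-- The quotient is found by counting the positive multiples of `m` up to `f a`. -/
theorem PT.div (hf : PT Γ f) (m : ℕ) (hm : 0 < m) : PT Γ fun a => f a / m := by
  have h : PT Γ.push fun p => if m * (p.2 + 1) ≤ f p.1 then 1 else 0 :=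
    PT.ite (PTP.le ((PT.const m).mul (PT.last.add (PT.const 1))) hf.weaken) (PT.const 1) (PT.const 0)
  refine (hf.sum_range h).congr fun a => ?_
  rw [← Finset.card_filter]
  have : (Finset.range (f a)).filter (fun j => m * (j + 1) ≤ f a) = Finset.range (f a / m) := by
    ext j
    have e : j < f a / m ↔ m * (j + 1) ≤ f a := by
      rw [mul_comm, ← Nat.le_div_iff_mul_le hm]
      exact Nat.succ_le_iff.symm
    rw [Finset.mem_filter, Finset.mem_range, Finset.mem_range, e]
    constructor
    · exact fun h => h.2
    · intro h
      refine ⟨?_, h⟩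
      have := Nat.le_mul_of_pos_left (j + 1) hm
      exact lt_of_lt_of_le (Nat.lt_succ_self j) (this.trans h)
  rw [this, Finset.card_range]

theorem PT.mod (hf : PT Γ f) (m : ℕ) (hm : 0 < m) : PT Γ fun a => f a % m :=
  (hf.sub ((PT.const m).mul (hf.div m hm))).congr fun a => by
    have := Nat.div_add_mod (f a) m
    omega

theorem PT.table (l : List ℕ) (hf : PT Γ f) : PT Γ fun a => l.getD (f a) 0 := by
  induction l generalizing f with
  | nil => exact PT.const 0
  | cons x l ih =>
    refine (PT.ite (PTP.eq hf (PT.const 0)) (PT.const x) (ih (hf.sub (PT.const 1)))).congr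
      fun a => ?_
    rcases h : f a with _ | m <;> simp

theorem PT.table₂ (l : List (List ℕ)) (hf : PT Γ f) (hg : PT Γ g) :
    PT Γ fun a => (l.getD (f a) []).getD (g a) 0 := by
  induction l generalizing f with
  | nil => exact PT.const 0
  | cons x l ih =>
    refine (PT.ite (PTP.eq hf (PT.const 0)) (PT.table x hg) (ih (hf.sub (PT.const 1)))).congr
      fun a => ?_
    rcases h : f a with _ | m <;> simp

end PT

/-- The list `L` can be output in polynomial time, without changing the memory. -/
def Writes {α : Type} (Γ : Ctx α) (L : α → List ℕ) : Prop :=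
  ∃ T : α → ℕ, PB Γ.size T ∧ ∀ (k : ℕ) (ρ : ℕ → ℕ), (∀ i, ρ i < k) → ∃ p : Prog,
    ∀ a s, Γ.Holds ρ a s → ∃ t s', Exec p s t s' ∧ t ≤ T a ∧ s'.out = s.out ++ L a ∧
      (∀ i < k, s'.reg i = s.reg i) ∧ s'.arr = s.arr

section Writes
variable {α : Type} {Γ : Ctx α} {L L' : α → List ℕ}

theorem Writes.single {f : α → ℕ} (hf : PT Γ f) : Writes Γ fun a => [f a] := by
  obtain ⟨T, hT, -, h⟩ := hf
  refine ⟨fun a => T a + 1, hT.add (PB.const 1), fun k ρ hρ => ?_⟩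
  obtain ⟨p, hp⟩ := h k ρ hρ
  refine ⟨.seq p (.write (.reg k)), fun a s hs => ?_⟩
  obtain ⟨t, s', h1, h2, h3, h4⟩ := hp a s hs
  exact ⟨t + 1, _, .seq _ _ _ _ _ _ _ h1 (.write (.reg k) s'), Nat.succ_le_succ h2,
    by simp [Expr.eval, h3, h4.out], h4.reg, h4.arr⟩

theorem Writes.append (h : Writes Γ L) (h' : Writes Γ L') : Writes Γ fun a => L a ++ L' a := by
  obtain ⟨T, hT, h⟩ := h
  obtain ⟨T', hT', h'⟩ := h'
  refine ⟨fun a => T a + T' a, hT.add hT', fun k ρ hρ => ?_⟩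
  obtain ⟨p, hp⟩ := h k ρ hρ
  obtain ⟨p', hp'⟩ := h' k ρ hρ
  refine ⟨.seq p p', fun a s hs => ?_⟩
  obtain ⟨t, s', h1, h2, h3, h4, h5⟩ := hp a s hs
  obtain ⟨t', s'', g1, g2, g3, g4, g5⟩ := hp' a s'
    ⟨h5.trans hs.arr, fun i => (h4 _ (hρ i)).trans (hs.reg i)⟩
  exact ⟨t + t', s'', .seq _ _ _ _ _ _ _ h1 g1, Nat.add_le_add h2 g2, by beta_reduce; rw [g3, h3, List.append_assoc],
    fun i hi => (g4 i hi).trans (h4 i hi), g5.trans h5⟩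

theorem Writes.congr (h : Writes Γ L) (hL : ∀ a, L' a = L a) : Writes Γ L' := by
  rwa [show L' = L from funext hL]

theorem Writes.flatten {C : α → ℕ} (hC : PT Γ C) {L : (Σ a, Fin (C a)) → List ℕ}
    (hL : Writes (Γ.ext (ι := fun a => Fin (C a)) fun _ i => (i : ℕ)) L) :
    Writes Γ fun a => (List.ofFn fun i => L ⟨a, i⟩).flatten := by
  obtain ⟨T, hT, hCb, h⟩ := hC
  obtain ⟨T', ⟨c, hc⟩, h'⟩ := hL
  have hX : ∀ e, PB Γ.size fun a => (Γ.size a + C a + 2) ^ e := fun e =>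
    ((PB.size.add hCb).add (PB.const 2)).pow e
  refine ⟨fun a => T a + 1 + (C a * ((Γ.size a + C a + 2) ^ c + 1 + 1) + 1),
    (hT.add (PB.const 1)).add ((hCb.mul (((hX c).add (PB.const 1)).add
    (PB.const 1))).add (PB.const 1)), fun k ρ hρ => ?_⟩
  have hρ' : ∀ m i, ρ i < k + m := fun m i => (hρ i).trans_le (Nat.le_add_right _ _)
  obtain ⟨p, hp⟩ := h (k + 1) ρ (hρ' 1)
  obtain ⟨p', hp'⟩ := h' (k + 2) (cons k ρ) (cons_lt (by omega) (hρ' 2))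
  refine ⟨.seq (.seq p (.assign k (.const 0)))
    (.loop (.sub (.reg (k + 1)) (.reg k)) (.seq p' (.assign k (.add (.reg k) (.const 1))))),
    fun a s hs => ?_⟩
  obtain ⟨t, s', h1, h2, h3, h4⟩ := hp a s hs
  set s1 : State := ⟨Function.update s'.reg k 0, s'.arr, s'.out⟩ with hs1
  have e1 : Exec _ s (t + 1) s1 := .seq _ _ _ _ _ _ _ h1 (.assign k (.const 0) s')
  have hfl : ∀ i (hi : i < C a), ((List.ofFn fun i => L ⟨a, i⟩).take (i + 1)).flatten =
      ((List.ofFn fun i => L ⟨a, i⟩).take i).flatten ++ L ⟨a, ⟨i, hi⟩⟩ := by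
    intro i hi
    rw [List.take_succ_eq_append_getElem (by simpa using hi), List.flatten_append]
    simp
  obtain ⟨t', s'', h5, h6, h7, h8, h9, h10, h11⟩ := exec_for (n := C a)
    (T := (Γ.size a + C a + 2) ^ c + 1)
    (e := .sub (.reg (k + 1)) (.reg k)) (p := .seq p' (.assign k (.add (.reg k) (.const 1))))
    (s := s1) (fun i u => (∀ j < k, u.reg j = s.reg j) ∧ u.arr = s.arr ∧
      u.out = s.out ++ ((List.ofFn fun i => L ⟨a, i⟩).take i).flatten ∧
      u.reg k = i ∧ u.reg (k + 1) = C a) (by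
      rintro i u - ⟨-, -, -, hu1, hu2⟩
      simp [Expr.eval, hu1, hu2]) (by
      rintro i u hi ⟨hu, hu', hu0, hu1, hu2⟩
      have hh : (Γ.ext (ι := fun a => Fin (C a)) fun _ i => (i : ℕ)).Holds (cons k ρ)
          ⟨a, ⟨i, hi⟩⟩ u :=
        Ctx.Holds.ext ⟨hu'.trans hs.arr, fun j => (hu _ (hρ j)).trans (hs.reg j)⟩ hu1
      obtain ⟨t', u', g1, g2, g3, g4, g5⟩ := hp' ⟨a, ⟨i, hi⟩⟩ u hh
      refine ⟨t' + 1, _, .seq _ _ _ _ _ _ _ g1 (.assign _ _ _), ?_, ?_, ?_, ?_, ?_, ?_⟩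
      · have := hc ⟨a, ⟨i, hi⟩⟩
        have : (Γ.size a + i + 2) ^ c ≤ (Γ.size a + C a + 2) ^ c :=
          Nat.pow_le_pow_left (by omega) c
        simp only [Ctx.ext] at *
        omega
      · intro j hj
        dsimp only
        rw [Function.update_of_ne (by omega), g4 j (by omega), hu j hj]
      · exact g5.trans hu'
      · rw [g3, hu0, hfl i hi, List.append_assoc]
      · dsimp only
        rw [Function.update_self]
        simp [Expr.eval, g4 k (by omega), hu1]
      · dsimp only
        rw [Function.update_of_ne (by omega), g4 (k + 1) (by omega), hu2]) ⟨fun j hj => by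
        simp only [hs1]
        rw [Function.update_of_ne (by omega), h4.reg j (by omega)], h4.arr,
        by simp [hs1, h4.out], by simp [hs1], by simp [hs1, h3]⟩
  refine ⟨_, s'', .seq _ _ _ _ _ _ _ e1 h5, by beta_reduce; omega, ?_, h7, h8⟩
  rw [h9, List.take_of_length_le (by simp)]

end Writes

end Ram
end


noncomputable section
open scoped Classical

/-! ## Reading a Hybrid instance -/

theorem getD_flatten_ofFn {n : ℕ} (L : Fin n → List ℕ) (l : Fin n) (j : ℕ)
    (hj : j < (L l).length) :
    (List.ofFn L).flatten.getD (∑ i : Fin l, (L (Fin.castLE l.2.le i)).length + j) 0 =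
      (L l).getD j 0 := by
  induction n with
  | zero => exact l.elim0
  | succ n ih =>
    rw [List.ofFn_succ, List.flatten_cons]
    refine Fin.cases ?_ (fun l hj => ?_) l hj
    · intro hj
      have h0 : ∑ i : Fin ((0 : Fin (n + 1)) : ℕ), (L (Fin.castLE (0 : Fin (n + 1)).2.le i)).length =
          0 := Finset.sum_eq_zero fun i _ => absurd i.2 (Nat.not_lt_zero _)
      rw [h0, Nat.zero_add, List.getD_append _ _ _ _ hj]
    · have e : ∑ i : Fin l.succ, (L (Fin.castLE l.succ.2.le i)).length =
          (L 0).length + ∑ i : Fin l, (L (Fin.castLE l.2.le i).succ).length := by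
        change ∑ i : Fin (l + 1), (L (Fin.castLE l.succ.2.le i)).length = _
        rw [Fin.sum_univ_succ]
        rfl
      rw [e, List.getD_append_right _ _ _ _ (by omega),
        show (L 0).length + ∑ i : Fin l, (L (Fin.castLE l.2.le i).succ).length + j -
          (L 0).length = ∑ i : Fin l, (L (Fin.castLE l.2.le i).succ).length + j by omega]
      exact ih (fun i => L i.succ) l hj

namespace HybridInstance
variable (H : HybridInstance)

/-- The number of the first variable of a circle. -/
def off (l : Fin H.n) : ℕ := ∑ i : Fin l, 7 * H.t (Fin.castLE l.2.le i)

theorem gid_val (v : H.Var) : (H.gid v : ℕ) = H.off v.1 + v.2 := finSigmaFinEquiv_apply v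

theorem length_listVars (f : H.Var → ℕ) : (H.listVars f).length = H.numVar := by
  simp [listVars, numVar, List.length_flatten, List.sum_ofFn, Function.comp_def]

theorem getD_listVars (f : H.Var → ℕ) (v : H.Var) : (H.listVars f).getD (H.gid v) 0 = f v := by
  have h := getD_flatten_ofFn (fun l : Fin H.n => List.ofFn fun i : Fin (7 * H.t l) => f ⟨l, i⟩) v.1
    v.2 (by simp)
  simp only [List.length_ofFn] at h
  rw [gid_val, listVars, off, h]
  simp

theorem listVars_eq (f : H.Var → ℕ) : H.listVars f = List.ofFn fun j => f (H.gid.symm j) := by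
  refine List.ext_getElem (by simp [length_listVars]) fun i h1 h2 => ?_
  rw [length_listVars] at h1
  have h := H.getD_listVars f (H.gid.symm ⟨i, h1⟩)
  rw [Equiv.apply_symm_apply, List.getD_eq_getElem _ _ (by rwa [length_listVars])] at h
  rw [h, List.getElem_ofFn]

def clauseCode (c : Fin H.m₃) : List ℕ :=
  (List.ofFn fun k : Fin 3 => [((H.triple c k).1 : ℕ), ((H.triple c k).2 : ℕ)]).flatten ++
    [(H.rhs c).val]

theorem clauseCode_eq (c : Fin H.m₃) : H.clauseCode c =
    [((H.triple c 0).1 : ℕ), ((H.triple c 0).2 : ℕ), ((H.triple c 1).1 : ℕ),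
      ((H.triple c 1).2 : ℕ), ((H.triple c 2).1 : ℕ), ((H.triple c 2).2 : ℕ), (H.rhs c).val] := by
  simp [clauseCode, List.ofFn_succ]

theorem encode_eq : H.encode = [H.n] ++ (List.ofFn H.t ++ (H.listVars (fun v => (H.partner v.1 v.2 : ℕ))
    ++ ([H.m₃] ++ (List.ofFn H.clauseCode).flatten))) := by
  unfold encode
  simp only [List.append_assoc]
  rfl

theorem length_clauses : (List.ofFn H.clauseCode).flatten.length = 7 * H.m₃ := by
  simp [List.length_flatten, Function.comp_def, clauseCode_eq, mul_comm]

theorem length_encode : H.encode.length = 2 + H.n + H.numVar + 7 * H.m₃ := by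
  rw [encode_eq]
  simp only [List.length_append, length_clauses, length_listVars, List.length_ofFn,
    List.length_singleton]
  ring

theorem encode_n : H.encode.getD 0 0 = H.n := by rw [encode_eq]; rfl

theorem encode_t (l : Fin H.n) : H.encode.getD (1 + l) 0 = H.t l := by
  rw [encode_eq, List.getD_append_right _ _ _ _ (by simp), List.getD_append _ _ _ _ (by simp)]
  simp

theorem encode_partner (v : H.Var) : H.encode.getD (1 + H.n + H.gid v) 0 = H.partner v.1 v.2 := by
  rw [encode_eq, List.getD_append_right _ _ _ _ (by simp; omega),
    List.getD_append_right _ _ _ _ (by simp; omega), List.getD_append _ _ _ _ (by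
      rw [length_listVars]
      simp only [List.length_singleton, List.length_ofFn]
      have := (H.gid v).2
      omega)]
  simp only [List.length_singleton, List.length_ofFn]
  rw [show 1 + H.n + (H.gid v : ℕ) - 1 - H.n = H.gid v by omega, getD_listVars]

theorem encode_drop (i : ℕ) : H.encode.getD (1 + H.n + H.numVar + i) 0 =
    ([H.m₃] ++ (List.ofFn H.clauseCode).flatten).getD i 0 := by
  rw [encode_eq, List.getD_append_right _ _ _ _ (by simp; omega),
    List.getD_append_right _ _ _ _ (by simp; omega), List.getD_append_right _ _ _ _ (by
      rw [length_listVars]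
      simp only [List.length_singleton, List.length_ofFn]
      omega)]
  rw [length_listVars]
  simp only [List.length_singleton, List.length_ofFn]
  congr 1
  omega

theorem encode_m₃ : H.encode.getD (1 + H.n + H.numVar) 0 = H.m₃ := H.encode_drop 0

theorem encode_clause (c : Fin H.m₃) (r : ℕ) (hr : r < 7) :
    H.encode.getD (2 + H.n + H.numVar + (7 * c + r)) 0 = (H.clauseCode c).getD r 0 := by
  rw [show 2 + H.n + H.numVar + (7 * c + r) = 1 + H.n + H.numVar + (1 + (7 * c + r)) by ring,
    encode_drop, List.getD_append_right _ _ _ _ (by simp)]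
  have hl : ∀ c, (H.clauseCode c).length = 7 := fun c => by rw [clauseCode_eq]; rfl
  have h := getD_flatten_ofFn H.clauseCode c r (by rw [hl]; exact hr)
  simp only [hl, Finset.sum_const, Finset.card_univ, Fintype.card_fin, smul_eq_mul] at h
  rw [← h]
  congr 1
  simp only [List.length_singleton]
  omega

theorem encode_fst (c : Fin H.m₃) (k : Fin 3) :
    H.encode.getD (2 + H.n + H.numVar + (7 * c + 2 * k)) 0 = (H.triple c k).1 := by
  rw [encode_clause _ _ _ (by omega), clauseCode_eq]
  fin_cases k <;> rfl

theorem encode_snd (c : Fin H.m₃) (k : Fin 3) :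
    H.encode.getD (2 + H.n + H.numVar + (7 * c + (2 * k + 1))) 0 = (H.triple c k).2 := by
  rw [encode_clause _ _ _ (by omega), clauseCode_eq]
  fin_cases k <;> rfl

theorem encode_rhs (c : Fin H.m₃) :
    H.encode.getD (2 + H.n + H.numVar + (7 * c + 6)) 0 = (H.rhs c).val := by
  rw [encode_clause _ _ _ (by omega), clauseCode_eq]
  rfl

end HybridInstance

namespace Ram

/-- Array `0` begins with the code of a Hybrid instance. -/
def Reads {α : Type} (Γ : Ctx α) (H : α → HybridInstance) : Prop :=
  ∀ a i, i < (H a).encode.length → Γ.arr a 0 i = (H a).encode.getD i 0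

/-- The family `v` of variables can be computed. -/
abbrev PV {α : Type} (Γ : Ctx α) {H : α → HybridInstance} (v : ∀ a, (H a).Var) : Prop :=
  PT Γ fun a => ((H a).gid (v a) : ℕ)

/-- The family `i` of indices can be computed. -/
abbrev PF {α : Type} (Γ : Ctx α) {N : α → ℕ} (i : ∀ a, Fin (N a)) : Prop :=
  PT Γ fun a => (i a : ℕ)

variable {α : Type} {Γ : Ctx α} {H : α → HybridInstance}

theorem Reads.ext (hΓ : Reads Γ H) {ι : α → Type} {code : ∀ a, ι a → ℕ} :
    Reads (Γ.ext code) fun p => H p.1 := fun p i hi => hΓ p.1 i hi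

theorem Reads.read (hΓ : Reads Γ H) {f g : α → ℕ} (hf : PT Γ f)
    (hlt : ∀ a, f a < (H a).encode.length) (h : ∀ a, (H a).encode.getD (f a) 0 = g a) : PT Γ g :=
  (hf.get 0).congr fun a => by rw [hΓ a _ (hlt a), h]

theorem Reads.n (hΓ : Reads Γ H) : PT Γ fun a => (H a).n :=
  hΓ.read (PT.const 0) (fun a => by rw [HybridInstance.length_encode]; omega) fun a => (H a).encode_n

theorem Reads.t (hΓ : Reads Γ H) {l : ∀ a, Fin (H a).n} (hl : PF Γ l) : PT Γ fun a => (H a).t (l a) :=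
  hΓ.read ((PT.const 1).add hl) (fun a => by
    rw [HybridInstance.length_encode]; have : (l a : ℕ) < (H a).n := (l a).2; omega)
    fun a => (H a).encode_t (l a)

theorem Reads.numVar (hΓ : Reads Γ H) : PT Γ fun a => (H a).numVar :=
  PT.sum (Listed.fin hΓ.n) (F := fun p => 7 * (H p.1).t p.2)
    ((PT.const 7).mul (Reads.t hΓ.ext PT.last))

theorem Reads.off (hΓ : Reads Γ H) {l : ∀ a, Fin (H a).n} (hl : PF Γ l) :
    PT Γ fun a => (H a).off (l a) :=
  PT.sum (Listed.fin hl) (F := fun p => 7 * (H p.1).t (Fin.castLE (l p.1).2.le p.2))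
    ((PT.const 7).mul (Reads.t hΓ.ext PT.last))

theorem Reads.gid_mk (hΓ : Reads Γ H) {v : ∀ a, (H a).Var} (h1 : PF Γ fun a => (v a).1)
    (h2 : PF Γ fun a => (v a).2) : PV Γ v :=
  ((hΓ.off h1).add h2).congr fun a => (H a).gid_val (v a)

theorem Listed.var (hΓ : Reads Γ H) : Listed Γ (ι := fun a => (H a).Var) fun a v => (H a).gid v := by
  refine ⟨fun a => Fin.val_injective.comp (H a).gid.injective, ⟨_, hΓ.numVar, fun a i => Fin.is_lt _⟩,
    (Listed.fin hΓ.numVar).valid.congr fun p => ⟨fun ⟨v, hv⟩ => ⟨_, hv⟩, fun ⟨i, hi⟩ =>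
      ⟨(H p.1).gid.symm i, by simpa using hi⟩⟩⟩

theorem PTP.eqVar {v w : ∀ a, (H a).Var} (hv : PV Γ v) (hw : PV Γ w) : PTP Γ fun a => v a = w a :=
  (PTP.eq hv hw).congr fun a => by rw [Fin.val_inj, (H a).gid.injective.eq_iff]

theorem PTP.eqFin {N : α → ℕ} {i j : ∀ a, Fin (N a)} (hi : PF Γ i) (hj : PF Γ j) :
    PTP Γ fun a => i a = j a :=
  (PTP.eq hi hj).congr fun a => by rw [Fin.val_inj]

/-- A variable is stored by its global number; its circle and its index are recovered by running
through all pairs. The hypothesis quantifies over contexts because the function is evaluated inside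
these two nested sums. -/
theorem Reads.search (hΓ : Reads Γ H) {v : ∀ a, (H a).Var} (hv : PV Γ v)
    {F : ∀ a, (H a).Var → ℕ}
    (hF : ∀ {β : Type} {Γ' : Ctx β} {K : β → α} {l : ∀ b, Fin (H (K b)).n}
      {i : ∀ b, Fin (7 * (H (K b)).t (l b))}, Reads Γ' (fun b => H (K b)) → PF Γ' l → PF Γ' i →
      PT Γ' fun b => F (K b) ⟨l b, i b⟩) : PT Γ fun a => F a (v a) := by
  have h : PT Γ fun a => ∑ l : Fin (H a).n, ∑ i : Fin (7 * (H a).t l),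
      if (⟨l, i⟩ : (H a).Var) = v a then F a ⟨l, i⟩ else 0 := by
    refine PT.sum (Listed.fin hΓ.n) (F := fun p : Σ a, Fin (H a).n =>
      ∑ i : Fin (7 * (H p.1).t p.2), if (⟨p.2, i⟩ : (H p.1).Var) = v p.1 then F p.1 ⟨p.2, i⟩ else 0) ?_
    have hN : PT (Γ.ext (ι := fun a => Fin (H a).n) fun _ i => (i : ℕ))
        fun p => 7 * (H p.1).t p.2 := (PT.const 7).mul (Reads.t hΓ.ext PT.last)
    refine PT.sum (Listed.fin hN)
      (F := fun q => if (⟨q.1.2, q.2⟩ : (H q.1.1).Var) = v q.1.1 then F q.1.1 ⟨q.1.2, q.2⟩ else 0) ?_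
    have h1 : PT ((Γ.ext (ι := fun a => Fin (H a).n) fun _ i => (i : ℕ)).ext
        (ι := fun p => Fin (7 * (H p.1).t p.2)) fun _ i => (i : ℕ)) (fun q => (q.1.2 : ℕ)) :=
      PT.weaken (Γ := Γ.ext (ι := fun a => Fin (H a).n) fun _ i => i) PT.last
    let K : (Σ p : (Σ a, Fin (H a).n), Fin (7 * (H p.1).t p.2)) → α := fun q => q.1.1
    have h3 : Reads ((Γ.ext (ι := fun a => Fin (H a).n) fun _ i => (i : ℕ)).ext
        (ι := fun p => Fin (7 * (H p.1).t p.2)) fun _ i => (i : ℕ)) (fun q => H (K q)) := hΓ.ext.ext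
    have h2 := h3.gid_mk (v := fun q => ⟨q.1.2, q.2⟩) h1 PT.last
    refine PT.ite (PTP.eqVar (H := fun q => H (K q)) h2 hv.weaken.weaken) ?_ (PT.const 0)
    exact hF (K := K) h3 h1 PT.last
  refine h.congr fun a => ?_
  rw [← Fintype.sum_sigma (fun w : (H a).Var => if w = v a then F a w else 0)]
  simp

theorem Reads.fst (hΓ : Reads Γ H) {v : ∀ a, (H a).Var} (hv : PV Γ v) : PF Γ fun a => (v a).1 :=
  hΓ.search hv (F := fun _ v => v.1) fun _ hl _ => hl

theorem Reads.snd (hΓ : Reads Γ H) {v : ∀ a, (H a).Var} (hv : PV Γ v) : PF Γ fun a => (v a).2 :=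
  hΓ.search hv (F := fun _ v => v.2) fun _ _ hi => hi

theorem Reads.circle (hΓ : Reads Γ H) {v : ∀ a, (H a).Var} (hv : PV Γ v) :
    PT Γ fun a => 7 * (H a).t (v a).1 := (PT.const 7).mul (hΓ.t (hΓ.fst hv))

theorem Reads.partner (hΓ : Reads Γ H) {v : ∀ a, (H a).Var} (hv : PV Γ v) :
    PF Γ fun a => (H a).partner (v a).1 (v a).2 :=
  hΓ.read (((PT.const 1).add hΓ.n).add hv) (fun a => by
    rw [HybridInstance.length_encode]; have := ((H a).gid (v a)).2; omega)
    fun a => (H a).encode_partner (v a)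

theorem Reads.mate (hΓ : Reads Γ H) {v : ∀ a, (H a).Var} (hv : PV Γ v) :
    PV Γ fun a => (H a).mate (v a) :=
  hΓ.gid_mk (show PF Γ fun a => (v a).1 from hΓ.fst hv) (hΓ.partner hv)

theorem Reads.next (hΓ : Reads Γ H) {v : ∀ a, (H a).Var} (hv : PV Γ v) :
    PV Γ fun a => (H a).next (v a) :=
  hΓ.gid_mk (show PF Γ fun a => (v a).1 from hΓ.fst hv)
    -- The modulus depends on the instance, so the remainder is replaced by a case distinction.
    ((PT.ite (PTP.eq ((hΓ.snd hv).add (PT.const 1)) (hΓ.circle hv)) (PT.const 0)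
    ((hΓ.snd hv).add (PT.const 1))).congr fun a => by
      change (((v a).2 : ℕ) + 1) % (7 * (H a).t (v a).1) = _
      have : ((v a).2 : ℕ) < 7 * (H a).t (v a).1 := (v a).2.2
      beta_reduce
      split_ifs with h
      · rw [h, Nat.mod_self]
      · rw [Nat.mod_eq_of_lt (by omega)])

theorem Reads.prev (hΓ : Reads Γ H) {v : ∀ a, (H a).Var} (hv : PV Γ v) :
    PV Γ fun a => (H a).prev (v a) :=
  hΓ.gid_mk (show PF Γ fun a => (v a).1 from hΓ.fst hv)
    ((PT.ite (PTP.eq (hΓ.snd hv) (PT.const 0)) ((hΓ.circle hv).sub (PT.const 1))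
    ((hΓ.snd hv).sub (PT.const 1))).congr fun a => by
      change (((v a).2 : ℕ) + (7 * (H a).t (v a).1 - 1)) % (7 * (H a).t (v a).1) = _
      have : ((v a).2 : ℕ) < 7 * (H a).t (v a).1 := (v a).2.2
      beta_reduce
      split_ifs with h
      · rw [h, Nat.zero_add, Nat.mod_eq_of_lt (by omega)]
      · rw [show ((v a).2 : ℕ) + (7 * (H a).t (v a).1 - 1) = (v a).2 - 1 + 7 * (H a).t (v a).1 by omega,
          Nat.add_mod_right, Nat.mod_eq_of_lt (by omega)])

theorem Reads.m₃ (hΓ : Reads Γ H) : PT Γ fun a => (H a).m₃ :=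
  hΓ.read (((PT.const 1).add hΓ.n).add hΓ.numVar) (fun a => by
    rw [HybridInstance.length_encode]; omega) fun a => (H a).encode_m₃

theorem Reads.triple (hΓ : Reads Γ H) {c : ∀ a, Fin (H a).m₃} {k : α → Fin 3} (hc : PF Γ c)
    (hk : PF Γ k) : PV Γ fun a => (H a).triple (c a) (k a) :=
  hΓ.gid_mk
    (hΓ.read ((((PT.const 2).add hΓ.n).add hΓ.numVar).add (((PT.const 7).mul hc).add
      ((PT.const 2).mul hk))) (fun a => by
        rw [HybridInstance.length_encode]; have := (c a).2; have := (k a).2; omega)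
      fun a => (H a).encode_fst (c a) (k a))
    (hΓ.read ((((PT.const 2).add hΓ.n).add hΓ.numVar).add (((PT.const 7).mul hc).add
      (((PT.const 2).mul hk).add (PT.const 1)))) (fun a => by
        rw [HybridInstance.length_encode]; have := (c a).2; have := (k a).2; omega)
      fun a => (H a).encode_snd (c a) (k a))

theorem Reads.rhs (hΓ : Reads Γ H) {c : ∀ a, Fin (H a).m₃} (hc : PF Γ c) :
    PTP Γ fun a => (H a).rhs (c a) = 1 :=
  (PTP.eq (hΓ.read ((((PT.const 2).add hΓ.n).add hΓ.numVar).add (((PT.const 7).mul hc).add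
      (PT.const 6))) (fun a => by rw [HybridInstance.length_encode]; have := (c a).2; omega)
      fun a => (H a).encode_rhs (c a)) (PT.const 1)).congr fun a => by
    generalize (H a).rhs (c a) = x
    revert x
    decide

theorem Reads.star (hΓ : Reads Γ H) : PV Γ fun a => (H a).star :=
  hΓ.triple (c := fun a => ⟨0, (H a).m₃_pos⟩) (k := fun _ => 0) (PT.const 0) (PT.const 0)

theorem Reads.cutv (hΓ : Reads Γ H) {l : ∀ a, Fin (H a).n} (hl : PF Γ l) :
    PV Γ fun a => (H a).cutv (l a) :=
  (PT.ite (PTP.eqFin hl (hΓ.fst hΓ.star)) hΓ.star ((hΓ.off hl).add (((PT.const 7).mul (hΓ.t hl)).sub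
    (PT.const 1)))).congr fun a => by
    change ((H a).gid ((H a).cutv (l a)) : ℕ) = _
    unfold HybridInstance.cutv
    split_ifs
    · rfl
    · rw [HybridInstance.gid_val]

theorem Reads.isCut (hΓ : Reads Γ H) {v : ∀ a, (H a).Var} (hv : PV Γ v) :
    PTP Γ fun a => (H a).IsCut (v a) :=
  PTP.eqVar hv (hΓ.cutv (hΓ.fst hv))

theorem Reads.isContact (hΓ : Reads Γ H) {v : ∀ a, (H a).Var} (hv : PV Γ v) :
    PTP Γ fun a => (H a).IsContact (v a) :=
  (PTP.eq (((hΓ.snd hv).add (PT.const 1)).mod 7 (by norm_num)) (PT.const 0)).congr fun _ =>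
    Nat.dvd_iff_mod_eq_zero

theorem Reads.isLow (hΓ : Reads Γ H) {v : ∀ a, (H a).Var} (hv : PV Γ v) :
    PTP Γ fun a => (H a).IsLow (v a) :=
  PTP.lt (hΓ.snd hv) (hΓ.partner hv)

theorem sum_place (H : HybridInstance) (v : H.Var) (h : H.IsContact v) (f : Fin H.m₃ → Fin 3 → ℕ) :
    ∑ c, ∑ k, (if H.triple c k = v then f c k else 0) = f (H.place v h).1 (H.place v h).2 := by
  rw [← Fintype.sum_prod_type' (f := fun c k => if H.triple c k = v then f c k else 0)]
  rw [Finset.sum_eq_single (H.place v h)]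
  · rw [if_pos (H.triple_place v h)]
  · rintro p - hp
    refine if_neg fun h' => hp ?_
    subst h'
    exact (H.place_triple p h).symm
  · simp

theorem Reads.place (hΓ : Reads Γ H) {v : ∀ a, (H a).Var} (hv : PV Γ v)
    {F : ∀ a, Fin (H a).m₃ → Fin 3 → ℕ}
    (hF : PT ((Γ.ext (ι := fun a => Fin (H a).m₃) fun _ c => (c : ℕ)).ext (ι := fun _ => Fin 3)
      fun _ k => (k : ℕ)) fun q => F q.1.1 q.1.2 q.2) :
    PT Γ fun a => if h : (H a).IsContact (v a) then F a ((H a).place _ h).1 ((H a).place _ h).2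
      else 0 := by
  have h : PT Γ fun a => ∑ c, ∑ k, if (H a).triple c k = v a then F a c k else 0 := by
    refine PT.sum (Listed.fin hΓ.m₃) (F := fun p : Σ a, Fin (H a).m₃ =>
      ∑ k, if (H p.1).triple p.2 k = v p.1 then F p.1 p.2 k else 0) ?_
    refine PT.sum (Listed.fin (PT.const 3)) (F := fun q : (Σ _ : (Σ a, Fin (H a).m₃), Fin 3) =>
      if (H q.1.1).triple q.1.2 q.2 = v q.1.1 then F q.1.1 q.1.2 q.2 else 0) ?_
    have h1 : PT ((Γ.ext (ι := fun a => Fin (H a).m₃) fun _ c => (c : ℕ)).ext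
      (ι := fun _ => Fin 3) fun _ k => (k : ℕ)) (fun q => (q.1.2 : ℕ)) :=
      PT.weaken (Γ := Γ.ext (ι := fun a => Fin (H a).m₃) fun _ i => i) (ι := fun _ => Fin 3) PT.last
    exact PT.ite (PTP.eqVar (H := fun q : (Σ _ : (Σ a, Fin (H a).m₃), Fin 3) => H q.1.1) (hΓ.ext.ext.triple h1 PT.last)
      hv.weaken.weaken) hF (PT.const 0)
  refine (PT.ite (hΓ.isContact hv) h (PT.const 0)).congr fun a => ?_
  split_ifs with ha
  · rw [sum_place _ _ ha]
  · rfl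

theorem Reads.nu (hΓ : Reads Γ H) {v : ∀ a, (H a).Var} (hv : PV Γ v) :
    PTP Γ fun a => (H a).nu (v a) = true := by
  have h1 : PT ((Γ.ext (ι := fun a => Fin (H a).m₃) fun _ c => (c : ℕ)).ext
      (ι := fun _ => Fin 3) fun _ k => (k : ℕ)) (fun q => (q.1.2 : ℕ)) :=
    PT.weaken (Γ := Γ.ext (ι := fun a => Fin (H a).m₃) fun _ i => i) (ι := fun _ => Fin 3) PT.last
  have h2 := hΓ.place hv (F := fun a c k => if k ≠ 1 ∨ (H a).rhs c = 1 then 1 else 0)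
    (PT.ite (((PTP.eq PT.last (PT.const 1)).congr fun _ => Fin.ext_iff).not.or
      (hΓ.ext.ext.rhs h1)) (PT.const 1) (PT.const 0))
  refine ((PTP.eq h2 (PT.const 1)).or ((hΓ.isContact hv).not.and (hΓ.isLow hv))).congr fun a => ?_
  unfold HybridInstance.nu
  by_cases h : (H a).IsContact (v a) <;> simp [h, imp_iff_not_or]

end Ram
end


noncomputable section
open scoped Classical

open Vtx

/-! ## Computing the network -/

namespace HybridInstance
variable {H : HybridInstance} {md : Bool}

/-- Gadgets and single vertices as numbers. -/
def blkNum : H.Blk ⊕ H.Sgl → ℕ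
  | .inl (.inl g) => 6 * H.gid g
  | .inl (.inr (.inl p)) => 6 * (3 * p.1 + p.2) + 1
  | .inl (.inr (.inr v)) => 6 * H.gid v.1 + 2
  | .inr (.inl (c, r)) => 6 * (2 * c + if r then 1 else 0) + 3
  | .inr (.inr (.inl (l, r))) => 6 * (2 * l + if r then 1 else 0) + 4
  | .inr (.inr (.inr j)) => 6 * j + 5

/-- The remainder modulo 6 gives the kind of the gadget or vertex, the quotient its index within the
kind. -/
theorem blkNum_injective : Function.Injective (blkNum : H.Blk ⊕ H.Sgl → ℕ) := by
  rintro ((g | ⟨c, i⟩ | v) | ⟨c, r⟩ | ⟨l, r⟩ | j) ((g' | ⟨c', i'⟩ | v') | ⟨c', r'⟩ | ⟨l', r'⟩ | j') h <;>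
    simp only [blkNum] at h <;> try omega
  · have : (H.gid g : ℕ) = H.gid g' := by omega
    rw [H.gid.injective (Fin.ext this)]
  · have h1 : (c : ℕ) = c' := by omega
    have h2 : (i : ℕ) = i' := by omega
    rw [Fin.ext h1, Fin.ext h2]
  · have : (H.gid v.1 : ℕ) = H.gid v'.1 := by omega
    rw [Subtype.ext (H.gid.injective (Fin.ext this))]
  · have h1 : (c : ℕ) = c' := by split_ifs at h <;> omega
    have h2 : r = r' := by cases r <;> cases r' <;> simp at h ⊢ <;> omega
    rw [Fin.ext h1, h2]
  · have h1 : (l : ℕ) = l' := by split_ifs at h <;> omega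
    have h2 : r = r' := by cases r <;> cases r' <;> simp at h ⊢ <;> omega
    rw [Fin.ext h1, h2]
  · have : (j : ℕ) = j' := by omega
    rw [Fin.ext this]

theorem blkNum_lt (b : H.Blk ⊕ H.Sgl) : blkNum b < 6 * (H.numVar + 3 * H.m₃ + 2 * H.n) := by
  have h3 := H.m₃_pos
  have hn := H.n_pos
  rcases b with (g | ⟨c, i⟩ | v) | ⟨c, r⟩ | ⟨l, r⟩ | j <;> simp only [blkNum]
  · have := (H.gid g).2; omega
  · omega
  · have := (H.gid v.1).2; omega
  · split_ifs <;> omega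
  · split_ifs <;> omega
  · omega

/-- Vertices as numbers. -/
def vnum (x : Vtx md H.Blk H.Sgl) : ℕ := 9 * blkNum x.blk + x.loc

theorem gadK_le (md : Bool) : gadK md ≤ 9 := by cases md <;> decide

theorem vnum_div (x : Vtx md H.Blk H.Sgl) : vnum x / 9 = blkNum x.blk := by
  have := x.loc.2
  have := gadK_le md
  unfold vnum
  omega

theorem vnum_mod (x : Vtx md H.Blk H.Sgl) : vnum x % 9 = x.loc := by
  have := x.loc.2
  have := gadK_le md
  unfold vnum
  omega

theorem blk_eq_iff {x y : Vtx md H.Blk H.Sgl} : x.blk = y.blk ↔ vnum x / 9 = vnum y / 9 := by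
  rw [vnum_div, vnum_div, blkNum_injective.eq_iff]

theorem vnum_injective : Function.Injective (vnum : Vtx md H.Blk H.Sgl → ℕ) := fun x y h => by
  rw [ext_iff', blk_eq_iff, Fin.ext_iff, ← vnum_mod, ← vnum_mod, h]
  simp

theorem vnum_termOf (b : H.Blk) {k : ℕ} (hk : k < 4) :
    vnum (Net.termOf b k : Vtx md H.Blk H.Sgl) = 9 * blkNum (.inl b) + k := by
  unfold vnum
  congr 1
  exact mod_gadK md hk

/-- A first-order form of the inductive definition: quantifiers range over variables, circles and
equations only, and hubs enter through their numbers. Hence the closure properties of `PTP` apply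
directly. -/
theorem link_iff (x y : Vtx md H.Blk H.Sgl) : Link md x y ↔
    (∃ h, x = vout (H.nu h) (H.prev h) ∧ y = vY h 0) ∨
    (∃ h, x = vY h 1 ∧ y = vin (H.nu h) h) ∨
    (∃ h, x = vout (!H.nu h) (H.prev h) ∧ y = vin (!H.nu h) h) ∨
    (∃ l, x = vq l ∧ y = vL (H.cutv l) 0 ∨ x = vL (H.cutv l) 2 ∧ y = vp l ∨
      l ≠ H.star.1 ∧ x = vq l ∧ vnum y = 9 * (6 * l + 5) ∨
      x = vp l ∧ vnum y = 9 * (6 * (l + 1) + 5)) ∨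
    (x = vB H.c0 ∧ y = vq H.star.1) ∨
    (x = vA H.c0 ∧ vnum y = 9 * (6 * H.star.1 + 5)) ∨
    ∃ c : Fin H.m₃, (x = vA c ∧ y = vC (c, 0) 2) ∨ (x = vA c ∧ y = vC (c, 1) 3) ∨
      (x = vC (c, 0) 3 ∧ y = vC (c, 1) 2) ∨ (x = vC (c, 0) 3 ∧ y = vC (c, 2) 2) ∨
      (x = vC (c, 1) 2 ∧ y = vC (c, 2) 2) ∨ (x = vC (c, 1) 3 ∧ y = vB c) ∨
      (x = vC (c, 2) 3 ∧ y = vB c) ∨ (x = vA c ∧ y = vB c) ∨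
      ((c : ℕ) ≠ 0 ∧ x = vA c ∧ vnum y = 9 * (6 * (H.n + c - 1) + 5)) ∨
      ((c : ℕ) ≠ 0 ∧ x = vB c ∧ vnum y = 9 * (6 * (H.n + c) + 5)) := by
  have hn := H.n_pos
  have h3 := H.m₃_pos
  have hs : ∀ (j : Fin (H.n + H.m₃)) (y : Vtx md H.Blk H.Sgl),
      vnum y = 9 * (6 * j + 5) → y = vs j := fun j y h => vnum_injective h
  constructor
  · intro h
    cases h with
    | enter h => exact .inl ⟨h, rfl, rfl⟩
    | leave h => exact .inr (.inl ⟨h, rfl, rfl⟩)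
    | pass h r hr =>
      obtain rfl : r = !H.nu h := by revert hr; cases r <;> cases H.nu h <;> simp
      exact .inr (.inr (.inl ⟨h, rfl, rfl⟩))
    | q l => exact .inr (.inr (.inr (.inl ⟨l, .inl ⟨rfl, rfl⟩⟩)))
    | p l => exact .inr (.inr (.inr (.inl ⟨l, .inr (.inl ⟨rfl, rfl⟩)⟩)))
    | Bq => exact .inr (.inr (.inr (.inr (.inl ⟨rfl, rfl⟩))))
    | Ax c => exact .inr (.inr (.inr (.inr (.inr (.inr ⟨c, by simp⟩)))))
    | Ay c => exact .inr (.inr (.inr (.inr (.inr (.inr ⟨c, by simp⟩)))))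
    | xy c => exact .inr (.inr (.inr (.inr (.inr (.inr ⟨c, by simp⟩)))))
    | xz c => exact .inr (.inr (.inr (.inr (.inr (.inr ⟨c, by simp⟩)))))
    | yz c => exact .inr (.inr (.inr (.inr (.inr (.inr ⟨c, by simp⟩)))))
    | yB c => exact .inr (.inr (.inr (.inr (.inr (.inr ⟨c, by simp⟩)))))
    | zB c => exact .inr (.inr (.inr (.inr (.inr (.inr ⟨c, by simp⟩)))))
    | AB c => exact .inr (.inr (.inr (.inr (.inr (.inr ⟨c, by simp⟩)))))
    | hub s j hj =>
      rcases s with ⟨c, _ | _⟩ | ⟨l, _ | _⟩ <;> simp only [hubNum] at hj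
      · by_cases hc : (c : ℕ) = 0
        · rw [if_pos hc, Option.some_inj] at hj
          obtain rfl : c = H.c0 := Fin.ext hc
          subst hj
          exact .inr (.inr (.inr (.inr (.inr (.inl ⟨rfl, rfl⟩)))))
        · rw [if_neg hc, Option.some_inj] at hj
          subst hj
          exact .inr (.inr (.inr (.inr (.inr (.inr ⟨c, by
            simp only [hc, ne_eq, not_false_eq_true, true_and]
            exact .inr (.inr (.inr (.inr (.inr (.inr (.inr (.inr (.inl ⟨rfl, rfl⟩))))))))⟩)))))
      · by_cases hc : (c : ℕ) = 0
        · rw [if_pos hc] at hj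
          simp at hj
        · rw [if_neg hc, Option.some_inj] at hj
          subst hj
          exact .inr (.inr (.inr (.inr (.inr (.inr ⟨c, by
            simp only [hc, ne_eq, not_false_eq_true, true_and]
            exact .inr (.inr (.inr (.inr (.inr (.inr (.inr (.inr (.inr ⟨rfl, rfl⟩))))))))⟩)))))
      · split_ifs at hj with hl
        rw [Option.some_inj] at hj
        subst hj
        exact .inr (.inr (.inr (.inl ⟨l, .inr (.inr (.inl ⟨hl, rfl, rfl⟩))⟩)))
      · rw [Option.some_inj] at hj
        subst hj
        exact .inr (.inr (.inr (.inl ⟨l, .inr (.inr (.inr ⟨rfl, rfl⟩))⟩)))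
  · rintro (⟨h, rfl, rfl⟩ | ⟨h, rfl, rfl⟩ | ⟨h, rfl, rfl⟩ | ⟨l, ⟨rfl, rfl⟩ | ⟨rfl, rfl⟩ |
      ⟨hl, rfl, hy⟩ | ⟨rfl, hy⟩⟩ | ⟨rfl, rfl⟩ | ⟨rfl, hy⟩ | ⟨c, ⟨rfl, rfl⟩ | ⟨rfl, rfl⟩ | ⟨rfl, rfl⟩ |
      ⟨rfl, rfl⟩ | ⟨rfl, rfl⟩ | ⟨rfl, rfl⟩ | ⟨rfl, rfl⟩ | ⟨rfl, rfl⟩ | ⟨hc, rfl, hy⟩ | ⟨hc, rfl, hy⟩⟩)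
    · exact .enter h
    · exact .leave h
    · exact .pass h _ (by simp)
    · exact .q l
    · exact .p l
    · rw [hs ⟨l, by omega⟩ y hy]
      exact .hub (.inr (l, false)) _ (by rw [hubNum, if_neg hl])
    · rw [hs ⟨l + 1, by omega⟩ y hy]
      exact .hub (.inr (l, true)) _ rfl
    · exact .Bq
    · rw [hs ⟨H.star.1, by omega⟩ y hy]
      exact .hub (.inl (H.c0, false)) _ (by simp [hubNum, c0])
    · exact .Ax c
    · exact .Ay c
    · exact .xy c
    · exact .xz c
    · exact .yz c
    · exact .yB c
    · exact .zB c
    · exact .AB c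
    · rw [hs ⟨H.n + c - 1, by omega⟩ y hy]
      exact .hub (.inl (c, false)) _ (by rw [hubNum, if_neg hc])
    · rw [hs ⟨H.n + c, by omega⟩ y hy]
      exact .hub (.inl (c, true)) _ (by rw [hubNum, if_neg hc])

end HybridInstance

namespace Ram
open HybridInstance

variable {α : Type} {Γ : Ctx α} {H : α → HybridInstance} {md : Bool}

/-- The family `x` of vertices can be computed. -/
abbrev PX (Γ : Ctx α) (x : ∀ a, Vtx md (H a).Blk (H a).Sgl) : Prop := PT Γ fun a => vnum (x a)

theorem PTP.eqX {x y : ∀ a, Vtx md (H a).Blk (H a).Sgl} (hx : PX Γ x) (hy : PX Γ y) :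
    PTP Γ fun a => x a = y a :=
  (PTP.eq hx hy).congr fun _ => vnum_injective.eq_iff.symm

theorem PTP.ex {ι : α → Type} {code : ∀ a, ι a → ℕ} (hι : Listed Γ code) {R : ∀ a, ι a → Prop}
    (hR : PTP (Γ.ext code) fun p => R p.1 p.2) : PTP Γ fun a => ∃ i, R a i :=
  PTP.exists hι hR

/-- Multiplication of a number by a constant and addition of another one. -/
theorem PT.affine {f : α → ℕ} (hf : PT Γ f) (m k : ℕ) : PT Γ fun a => m * f a + k :=
  ((PT.const m).mul hf).add (PT.const k)

theorem PX.vL {g : ∀ a, (H a).Var} (hg : PV Γ g) (k : ℕ) (hk : k < 4) :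
    PX Γ fun a => (vL (g a) k : Vtx md (H a).Blk (H a).Sgl) :=
  (((PT.const 6).mul hg).affine 9 k).congr fun _ => vnum_termOf _ hk

theorem PX.vC {c : ∀ a, Fin (H a).m₃} (hc : PF Γ c) (i : Fin 3) (k : ℕ) (hk : k < 4) :
    PX Γ fun a => (vC (c a, i) k : Vtx md (H a).Blk (H a).Sgl) :=
  (((hc.affine 3 i).affine 6 1).affine 9 k).congr fun _ => vnum_termOf _ hk

theorem PX.vA {c : ∀ a, Fin (H a).m₃} (hc : PF Γ c) :
    PX Γ fun a => (vA (c a) : Vtx md (H a).Blk (H a).Sgl) :=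
  ((PT.const 9).mul ((hc.affine 2 0).affine 6 3)).congr fun _ => rfl

theorem PX.vB {c : ∀ a, Fin (H a).m₃} (hc : PF Γ c) :
    PX Γ fun a => (vB (c a) : Vtx md (H a).Blk (H a).Sgl) :=
  ((PT.const 9).mul ((hc.affine 2 1).affine 6 3)).congr fun _ => rfl

theorem PX.vq {l : ∀ a, Fin (H a).n} (hl : PF Γ l) :
    PX Γ fun a => (vq (l a) : Vtx md (H a).Blk (H a).Sgl) :=
  ((PT.const 9).mul ((hl.affine 2 0).affine 6 4)).congr fun _ => rfl

theorem PX.vp {l : ∀ a, Fin (H a).n} (hl : PF Γ l) :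
    PX Γ fun a => (vp (l a) : Vtx md (H a).Blk (H a).Sgl) :=
  ((PT.const 9).mul ((hl.affine 2 1).affine 6 4)).congr fun _ => rfl

theorem PX.vout {g : ∀ a, (H a).Var} (hg : PV Γ g) {r : α → Bool} (hr : PTP Γ fun a => r a = true) :
    PX Γ fun a => (vout (r a) (g a) : Vtx md (H a).Blk (H a).Sgl) :=
  (PT.ite hr (PX.vL (md := md) hg 1 (by omega)) (PX.vL (md := md) hg 3 (by omega))).congr fun a => by
    beta_reduce
    cases h : r a <;> simp [HybridInstance.vout]

theorem PX.vin (hΓ : Reads Γ H) {g : ∀ a, (H a).Var} (hg : PV Γ g) {r : α → Bool}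
    (hr : PTP Γ fun a => r a = true) :
    PX Γ fun a => (vin (r a) (g a) : Vtx md (H a).Blk (H a).Sgl) :=
  (PT.ite (hΓ.isCut hg) (PT.ite hr (PX.vp (md := md) (hΓ.fst hg)) (PX.vq (md := md) (hΓ.fst hg)))
    (PT.ite hr (PX.vL (md := md) hg 0 (by omega)) (PX.vL (md := md) hg 2 (by omega)))).congr
    fun a => by
      beta_reduce
      by_cases h : (H a).IsCut (g a) <;> cases r a <;> simp [HybridInstance.vin, h]

theorem PX.vY (hΓ : Reads Γ H) {h : ∀ a, (H a).Var} (hh : PV Γ h) (k : ℕ) (hk : k < 2) :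
    PX Γ fun a => (vY (h a) k : Vtx md (H a).Blk (H a).Sgl) := by
  have h1 : PT ((Γ.ext (ι := fun a => Fin (H a).m₃) fun _ c => (c : ℕ)).ext
      (ι := fun _ => Fin 3) fun _ k => (k : ℕ)) (fun q => (q.1.2 : ℕ)) :=
    PT.weaken (Γ := Γ.ext (ι := fun a => Fin (H a).m₃) fun _ i => i) (ι := fun _ => Fin 3) PT.last
  have h2 := hΓ.place hh (F := fun _ c i => 9 * (6 * (3 * c + i) + 1) + k)
    ((((((PT.const 3).mul h1).add PT.last).affine 6 1).affine 9 k))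
  refine (PT.ite (hΓ.isContact hh) h2 (PT.ite (hΓ.isLow hh) ((hh.affine 6 2).affine 9 k)
    (((hΓ.mate hh).affine 6 2).affine 9 (2 + k)))).congr fun a => ?_
  beta_reduce
  unfold HybridInstance.vY
  split_ifs with hc hl
  · exact vnum_termOf _ (by omega)
  · exact vnum_termOf _ (by omega)
  · exact vnum_termOf _ (by omega)

theorem PTP.link (hΓ : Reads Γ H) {x y : ∀ a, Vtx md (H a).Blk (H a).Sgl} (hx : PX Γ x)
    (hy : PX Γ y) : PTP Γ fun a => Link md (x a) (y a) := by
  refine PTP.congr ?_ fun a => link_iff (x a) (y a)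
  let Γv := Γ.ext (ι := fun a => (H a).Var) fun a v => (H a).gid v
  let Γl := Γ.ext (ι := fun a => Fin (H a).n) fun _ l => (l : ℕ)
  let Γc := Γ.ext (ι := fun a => Fin (H a).m₃) fun _ c => (c : ℕ)
  have hv : PV Γv (H := fun p => H p.1) fun p => p.2 := PT.last
  have hl : PF Γl (N := fun p => (H p.1).n) fun p => p.2 := PT.last
  have hc : PF Γc (N := fun p => (H p.1).m₃) fun p => p.2 := PT.last
  have rv : Reads Γv fun p => H p.1 := hΓ.ext
  have rl : Reads Γl fun p => H p.1 := hΓ.ext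
  have rc : Reads Γc fun p => H p.1 := hΓ.ext
  have hnu := rv.nu hv
  have hnu' : PTP Γv fun p => (!(H p.1).nu p.2) = true := hnu.not.congr fun p => by simp
  have xv : PX Γv (H := fun p => H p.1) fun p => x p.1 := PT.weaken hx
  have yv : PX Γv (H := fun p => H p.1) fun p => y p.1 := PT.weaken hy
  have xl : PX Γl (H := fun p => H p.1) fun p => x p.1 := PT.weaken hx
  have yl : PX Γl (H := fun p => H p.1) fun p => y p.1 := PT.weaken hy
  have xc : PX Γc (H := fun p => H p.1) fun p => x p.1 := PT.weaken hx
  have yc : PX Γc (H := fun p => H p.1) fun p => y p.1 := PT.weaken hy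
  have h0 : PF Γ (N := fun a => (H a).m₃) fun a => (H a).c0 := PT.const 0
  have hst : PF Γ (N := fun a => (H a).n) fun a => (H a).star.1 := hΓ.fst hΓ.star
  refine .or ?_ <| .or ?_ <| .or ?_ <| .or ?_ <| .or ?_ <| .or ?_ ?_
  · exact PTP.ex (Listed.var hΓ) ((PTP.eqX xv (PX.vout (rv.prev hv) hnu)).and
      (PTP.eqX yv (PX.vY rv hv 0 (by omega))))
  · exact PTP.ex (Listed.var hΓ) ((PTP.eqX xv (PX.vY rv hv 1 (by omega))).and
      (PTP.eqX yv (PX.vin rv hv hnu)))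
  · exact PTP.ex (Listed.var hΓ) ((PTP.eqX xv (PX.vout (rv.prev hv) hnu')).and
      (PTP.eqX yv (PX.vin rv hv hnu')))
  · refine PTP.ex (Listed.fin hΓ.n) ?_
    refine .or ?_ <| .or ?_ <| .or ?_ ?_
    · exact (PTP.eqX xl (PX.vq hl)).and (PTP.eqX yl (PX.vL (rl.cutv hl) 0 (by omega)))
    · exact (PTP.eqX xl (PX.vL (rl.cutv hl) 2 (by omega))).and (PTP.eqX yl (PX.vp hl))
    · exact (PTP.eqFin hl (rl.fst rl.star)).not.and ((PTP.eqX xl (PX.vq hl)).and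
        (PTP.eq yl ((PT.const 9).mul (hl.affine 6 5))))
    · exact (PTP.eqX xl (PX.vp hl)).and
        (PTP.eq yl ((PT.const 9).mul ((hl.add (PT.const 1)).affine 6 5)))
  · exact (PTP.eqX hx (PX.vB h0)).and (PTP.eqX hy (PX.vq hst))
  · exact (PTP.eqX hx (PX.vA h0)).and (PTP.eq hy ((PT.const 9).mul (hst.affine 6 5)))
  · refine PTP.ex (Listed.fin hΓ.m₃) ?_
    refine .or ?_ <| .or ?_ <| .or ?_ <| .or ?_ <| .or ?_ <| .or ?_ <| .or ?_ <| .or ?_ <| .or ?_ ?_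
    · exact (PTP.eqX xc (PX.vA hc)).and (PTP.eqX yc (PX.vC hc 0 2 (by omega)))
    · exact (PTP.eqX xc (PX.vA hc)).and (PTP.eqX yc (PX.vC hc 1 3 (by omega)))
    · exact (PTP.eqX xc (PX.vC hc 0 3 (by omega))).and (PTP.eqX yc (PX.vC hc 1 2 (by omega)))
    · exact (PTP.eqX xc (PX.vC hc 0 3 (by omega))).and (PTP.eqX yc (PX.vC hc 2 2 (by omega)))
    · exact (PTP.eqX xc (PX.vC hc 1 2 (by omega))).and (PTP.eqX yc (PX.vC hc 2 2 (by omega)))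
    · exact (PTP.eqX xc (PX.vC hc 1 3 (by omega))).and (PTP.eqX yc (PX.vB hc))
    · exact (PTP.eqX xc (PX.vC hc 2 3 (by omega))).and (PTP.eqX yc (PX.vB hc))
    · exact (PTP.eqX xc (PX.vA hc)).and (PTP.eqX yc (PX.vB hc))
    · exact (PTP.eq hc (PT.const 0)).not.and ((PTP.eqX xc (PX.vA hc)).and
        (PTP.eq yc ((PT.const 9).mul (((rc.n.add hc).sub (PT.const 1)).affine 6 5))))
    · exact (PTP.eq hc (PT.const 0)).not.and ((PTP.eqX xc (PX.vB hc)).and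
        (PTP.eq yc ((PT.const 9).mul ((rc.n.add hc).affine 6 5))))

end Ram
end


noncomputable section
open scoped Classical

open Vtx

/-! ## Numbering by rank -/

/-- The numbering of a finite type in the order of the values of an injective function. -/
def rankEquiv {V : Type} [Fintype V] (f : V → ℕ) (hf : Function.Injective f) :
    V ≃ Fin (Fintype.card V) :=
  Equiv.ofBijective (fun x => ⟨(Finset.univ.filter fun y => f y < f x).card,
    Finset.card_lt_univ_of_notMem (x := x) (by simp)⟩) (by
    rw [Fintype.bijective_iff_injective_and_card]
    refine ⟨fun x y h => ?_, by simp⟩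
    have key : ∀ x y, f x < f y → (Finset.univ.filter fun z => f z < f x).card <
        (Finset.univ.filter fun z => f z < f y).card := fun x y hxy =>
      Finset.card_lt_card ⟨fun z hz => by
        rw [Finset.mem_filter] at hz ⊢
        exact ⟨hz.1, hz.2.trans hxy⟩, fun hs => by
        have := hs (Finset.mem_filter.2 ⟨Finset.mem_univ x, hxy⟩)
        simp at this⟩
    have h := congrArg Fin.val h
    rcases lt_trichotomy (f x) (f y) with h1 | h1 | h1
    · exact absurd h (key x y h1).ne
    · exact hf h1
    · exact absurd h (key y x h1).ne')

theorem rankEquiv_val {V : Type} [Fintype V] (f : V → ℕ) (hf : Function.Injective f) (x : V) :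
    (rankEquiv f hf x : ℕ) = ∑ y, if f y < f x then 1 else 0 :=
  Finset.card_filter _ _

namespace HybridInstance
variable {H : HybridInstance} {md : Bool}

/-- The distance in terms of vertex numbers, with the adjacency lists replaced by `Link`; this is
the form that is computed. -/
theorem d_eq (x y : Vtx md H.Blk H.Sgl) : (H.net md).d x y =
    if vnum x / 9 = vnum y / 9 then ((gadTab md).getD (vnum x % 9) []).getD (vnum y % 9) 0
    else if Link md x y ∨ Link md y x then 2
    else if ∃ t, ((Link md x t ∨ Link md t x) ∧ near y t) ∨ ((Link md y t ∨ Link md t y) ∧ near x t)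
      then 3
    else 4 := by
  have hl : ∀ x y : Vtx md H.Blk H.Sgl, y ∈ (H.net md).nbr x ↔ Link md x y ∨ Link md y x :=
    fun x y => ⟨fun h => link_of_mem h, fun h => h.elim (fun h => h.mem.1) fun h => h.mem.2⟩
  unfold Net.d
  simp only [blk_eq_iff, hl, vnum_mod, gadD]
  congr 3
  rw [← exists_or]

/-- The number of vertices. -/
def size (md : Bool) (H : HybridInstance) : ℕ := Fintype.card (Vtx md H.Blk H.Sgl)

/-- The numbering of the vertices. -/
def vertex (md : Bool) (H : HybridInstance) : Fin (size md H) ≃ Vtx md H.Blk H.Sgl :=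
  (rankEquiv vnum vnum_injective).symm

theorem three_le_size (md : Bool) (H : HybridInstance) : 3 ≤ size md H := by
  have hn := H.n_pos
  have h3 := H.m₃_pos
  unfold size
  rw [Fintype.card_sum, card_Sgl]
  omega

/-- The scale of the network distances: they are twice the actual distances in the (1,2)-case. -/
def unit : Bool → ℕ
  | false => 2
  | true => 1

theorem unit_mul_d (x y : Vtx md H.Blk H.Sgl) :
    unit md * ((H.net md).d x y / unit md) = (H.net md).d x y := by
  cases md
  · exact (Net.d_false _ x y).symm
  · simp [unit]

/-- The instance of the traveling salesperson problem: with distances `1` and `2` for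
`md = false`, and with the metric of a graph for `md = true`. -/
def tsp (md : Bool) (H : HybridInstance) : TSPInstance where
  N := size md H
  three_le := three_le_size md H
  d x y := (H.net md).d (vertex md H x) (vertex md H y) / unit md
  d_self x := by rw [Net.d_self, Nat.zero_div]
  d_pos x y h := by
    have h1 := (H.net md).d_pos ((vertex md H).injective.ne h)
    have h2 := unit_mul_d (vertex md H x) (vertex md H y)
    refine Nat.one_le_iff_ne_zero.2 fun h3 => ?_
    rw [h3, Nat.mul_zero] at h2
    omega
  d_symm x y := by rw [Net.d_symm]
  d_triangle x y z := by
    have h1 := (H.net md).d_triangle (vertex md H x) (vertex md H y) (vertex md H z)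
    have h2 := unit_mul_d (vertex md H x) (vertex md H y)
    have h3 := unit_mul_d (vertex md H y) (vertex md H z)
    have h4 := unit_mul_d (vertex md H x) (vertex md H z)
    rw [← h2, ← h3, ← h4, ← mul_add] at h1
    refine Nat.le_of_mul_le_mul_left h1 ?_
    cases md <;> decide

end HybridInstance

namespace Ram
open HybridInstance

variable {α : Type} {Γ : Ctx α} {H : α → HybridInstance} {md : Bool}

theorem PT.sum' {ι : α → Type} [∀ a, Fintype (ι a)] {code : ∀ a, ι a → ℕ} (hι : Listed Γ code)
    {F : ∀ a, ι a → ℕ} (hF : PT (Γ.ext code) fun p => F p.1 p.2) : PT Γ fun a => ∑ i, F a i :=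
  PT.sum hι hF

/-- A test for being the number of a vertex, which allows sums and quantifiers over the vertices. -/
theorem vnum_valid (H : HybridInstance) (md : Bool) (z : ℕ) :
    (∃ x : Vtx md H.Blk H.Sgl, vnum x = z) ↔
    (z / 9 % 6 = 0 ∧ z % 9 < gadK md ∧ z / 9 / 6 < H.numVar) ∨
    (z / 9 % 6 = 1 ∧ z % 9 < gadK md ∧ z / 9 / 6 < 3 * H.m₃) ∨
    (z / 9 % 6 = 2 ∧ z % 9 < gadK md ∧ ∃ v : H.Var, H.IsLow v ∧ (H.gid v : ℕ) = z / 9 / 6) ∨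
    (z / 9 % 6 = 3 ∧ z % 9 = 0 ∧ z / 9 / 6 < 2 * H.m₃) ∨
    (z / 9 % 6 = 4 ∧ z % 9 = 0 ∧ z / 9 / 6 < 2 * H.n) ∨
    (z / 9 % 6 = 5 ∧ z % 9 = 0 ∧ z / 9 / 6 < H.n + H.m₃) := by
  have hk := gadK_le md
  constructor
  · rintro ⟨⟨g | ⟨c, i⟩ | v, k⟩ | ⟨c, r⟩ | ⟨l, r⟩ | j, rfl⟩
    · have := (H.gid g).2
      refine .inl ?_
      simp only [vnum, blk, loc, Sum.map_inl, blkNum]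
      omega
    · refine .inr (.inl ?_)
      simp only [vnum, blk, loc, Sum.map_inl, blkNum]
      omega
    · refine .inr (.inr (.inl ⟨?_, ?_, v.1, v.2, ?_⟩)) <;>
      · simp only [vnum, blk, loc, Sum.map_inl, blkNum]
        omega
    · refine .inr (.inr (.inr (.inl ?_)))
      simp only [vnum, blk, loc, Sum.map_inr, id, blkNum]
      split_ifs <;> omega
    · refine .inr (.inr (.inr (.inr (.inl ?_))))
      simp only [vnum, blk, loc, Sum.map_inr, id, blkNum]
      split_ifs <;> omega
    · refine .inr (.inr (.inr (.inr (.inr ?_))))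
      simp only [vnum, blk, loc, Sum.map_inr, id, blkNum]
      omega
  · rintro (⟨h1, h2, h3⟩ | ⟨h1, h2, h3⟩ | ⟨h1, h2, v, hv, h3⟩ | ⟨h1, h2, h3⟩ |
      ⟨h1, h2, h3⟩ | ⟨h1, h2, h3⟩)
    · refine ⟨.inl (.inl (H.gid.symm ⟨z / 9 / 6, h3⟩), ⟨z % 9, h2⟩), ?_⟩
      simp only [vnum, blk, loc, Sum.map_inl, blkNum, Equiv.apply_symm_apply]
      omega
    · refine ⟨.inl (.inr (.inl (⟨z / 9 / 6 / 3, by omega⟩, ⟨z / 9 / 6 % 3, by omega⟩)), ⟨z % 9, h2⟩), ?_⟩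
      simp only [vnum, blk, loc, Sum.map_inl, blkNum]
      omega
    · refine ⟨.inl (.inr (.inr ⟨v, hv⟩), ⟨z % 9, h2⟩), ?_⟩
      simp only [vnum, blk, loc, Sum.map_inl, blkNum]
      omega
    · refine ⟨.inr (.inl (⟨z / 9 / 6 / 2, by omega⟩, decide (z / 9 / 6 % 2 = 1))), ?_⟩
      simp only [vnum, blk, loc, Sum.map_inr, id, blkNum, decide_eq_true_eq]
      split_ifs <;> omega
    · refine ⟨.inr (.inr (.inl (⟨z / 9 / 6 / 2, by omega⟩, decide (z / 9 / 6 % 2 = 1)))), ?_⟩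
      simp only [vnum, blk, loc, Sum.map_inr, id, blkNum, decide_eq_true_eq]
      split_ifs <;> omega
    · refine ⟨.inr (.inr (.inr ⟨z / 9 / 6, h3⟩)), ?_⟩
      simp only [vnum, blk, loc, Sum.map_inr, id, blkNum]
      omega

theorem Listed.vtx (hΓ : Reads Γ H) :
    Listed Γ (ι := fun a => Vtx md (H a).Blk (H a).Sgl) fun _ x => vnum x := by
  refine ⟨fun _ => vnum_injective, ⟨_, ((PT.const 9).mul ((PT.const 6).mul ((hΓ.numVar.add
    ((PT.const 3).mul hΓ.m₃)).add ((PT.const 2).mul hΓ.n)))), fun a x => ?_⟩,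
    PTP.congr ?_ fun p => vnum_valid (H p.1) md p.2⟩
  · have h1 := blkNum_lt x.blk
    have h2 := x.loc.2
    have h3 := gadK_le md
    unfold vnum
    omega
  have hp : Reads Γ.push fun p => H p.1 := hΓ.ext
  have hz : PT Γ.push fun p => p.2 := PT.last
  have hb := hz.div 9 (by norm_num)
  have hk := hz.mod 9 (by norm_num)
  have ht := hb.mod 6 (by norm_num)
  have hq := hb.div 6 (by norm_num)
  have hK : PT Γ.push fun _ => gadK md := PT.const _
  refine .or ?_ <| .or ?_ <| .or ?_ <| .or ?_ <| .or ?_ ?_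
  · exact (PTP.eq ht (PT.const 0)).and ((PTP.lt hk hK).and (PTP.lt hq hp.numVar))
  · exact (PTP.eq ht (PT.const 1)).and ((PTP.lt hk hK).and (PTP.lt hq ((PT.const 3).mul hp.m₃)))
  · refine (PTP.eq ht (PT.const 2)).and ((PTP.lt hk hK).and (PTP.ex (Listed.var hp) ?_))
    let Γv := Γ.push.ext (ι := fun p => (H p.1).Var) fun p v => (H p.1).gid v
    have rv : Reads Γv fun q => H q.1.1 := hp.ext
    have hv : PV Γv (H := fun q => H q.1.1) fun q => q.2 := PT.last
    exact (rv.isLow hv).and (PTP.eq hv hq.weaken)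
  · exact (PTP.eq ht (PT.const 3)).and ((PTP.eq hk (PT.const 0)).and
      (PTP.lt hq ((PT.const 2).mul hp.m₃)))
  · exact (PTP.eq ht (PT.const 4)).and ((PTP.eq hk (PT.const 0)).and
      (PTP.lt hq ((PT.const 2).mul hp.n)))
  · exact (PTP.eq ht (PT.const 5)).and ((PTP.eq hk (PT.const 0)).and (PTP.lt hq (hp.n.add hp.m₃)))

theorem PTP.near {x y : ∀ a, Vtx md (H a).Blk (H a).Sgl} (hx : PX Γ x) (hy : PX Γ y) :
    PTP Γ fun a => near (x a) (y a) :=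
  ((PTP.eq (hx.div 9 (by norm_num)) (hy.div 9 (by norm_num))).and
    ((PTP.eq (hx.mod 9 (by norm_num)) (hy.mod 9 (by norm_num))).or (PTP.eq (PT.table₂ (gadTab md)
      (hx.mod 9 (by norm_num)) (hy.mod 9 (by norm_num))) (PT.const 1)))).congr fun a => by
    unfold Vtx.near gadD
    rw [blk_eq_iff, Fin.ext_iff, vnum_mod, vnum_mod]

theorem PT.d (hΓ : Reads Γ H) {x y : ∀ a, Vtx md (H a).Blk (H a).Sgl} (hx : PX Γ x) (hy : PX Γ y) :
    PT Γ fun a => ((H a).net md).d (x a) (y a) := by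
  refine PT.congr ?_ fun a => d_eq (x a) (y a)
  refine PT.ite (PTP.eq (hx.div 9 (by norm_num)) (hy.div 9 (by norm_num)))
    (PT.table₂ _ (hx.mod 9 (by norm_num)) (hy.mod 9 (by norm_num))) (PT.ite
    ((PTP.link hΓ hx hy).or (PTP.link hΓ hy hx)) (PT.const 2) (PT.ite ?_ (PT.const 3) (PT.const 4)))
  refine PTP.ex (Listed.vtx hΓ) ?_
  let Γt := Γ.ext (ι := fun a => Vtx md (H a).Blk (H a).Sgl) fun _ x => vnum x
  have rt : Reads Γt fun p => H p.1 := hΓ.ext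
  have ht : PX Γt (H := fun p => H p.1) fun p => p.2 := PT.last
  have xt : PX Γt (H := fun p => H p.1) fun p => x p.1 := PT.weaken hx
  have yt : PX Γt (H := fun p => H p.1) fun p => y p.1 := PT.weaken hy
  exact (((PTP.link rt xt ht).or (PTP.link rt ht xt)).and (PTP.near yt ht)).or
    (((PTP.link rt yt ht).or (PTP.link rt ht yt)).and (PTP.near xt ht))

theorem PT.vertices (hΓ : Reads Γ H) : PT Γ fun a => size md (H a) := by
  refine (PT.sum' (Listed.vtx hΓ (md := md)) (F := fun _ _ => 1) (PT.const 1)).congr fun a => ?_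
  simp [size]

/-- The rank of a vertex is obtained by counting the smaller vertex numbers, and the vertex of given
rank by searching for it. -/
theorem PX.vertex (hΓ : Reads Γ H) {i : ∀ a, Fin (size md (H a))} (hi : PF Γ i) :
    PX Γ fun a => vertex md (H a) (i a) := by
  let Γt := Γ.ext (ι := fun a => Vtx md (H a).Blk (H a).Sgl) fun _ x => vnum x
  have rt : Reads Γt fun p => H p.1 := hΓ.ext
  have h1 : PT Γt fun p => ((HybridInstance.vertex md (H p.1)).symm p.2 : ℕ) :=
    (PT.sum' (Listed.vtx rt (md := md)) (F := fun p y => if vnum y < vnum p.2 then 1 else 0) (PT.ite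
      (PTP.lt PT.last (PT.weaken (Γ := Γt) PT.last)) (PT.const 1) (PT.const 0))).congr
      fun p => rankEquiv_val vnum vnum_injective p.2
  refine (PT.sum' (Listed.vtx hΓ (md := md)) (F := fun a x =>
    if ((HybridInstance.vertex md (H a)).symm x : ℕ) = i a then vnum x else 0)
    (PT.ite (PTP.eq h1 hi.weaken) PT.last (PT.const 0))).congr fun a => ?_
  have : ∀ x, ((HybridInstance.vertex md (H a)).symm x : ℕ) = i a ↔
      HybridInstance.vertex md (H a) (i a) = x := fun x => by
    rw [Fin.val_inj, Equiv.symm_apply_eq, eq_comm]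
  simp only [this]
  simp

end Ram
end


noncomputable section
open scoped Classical

/-! ## The construction of the instance of the traveling salesperson problem -/

namespace HybridInstance
variable (H : HybridInstance)

theorem listVars_forall {f : H.Var → ℕ} {m : ℕ} (h : ∀ v, f v ≤ m) : ∀ x ∈ H.listVars f, x ≤ m := by
  intro x hx
  rw [listVars_eq, List.mem_ofFn] at hx
  obtain ⟨j, rfl⟩ := hx
  exact h _

/-- All entries are bounded by the length of the code. So their sum is polynomial in the bit size,
and loops whose length is a value are admissible. -/
theorem encode_le : ∀ x ∈ H.encode, x ≤ H.encode.length := by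
  have hv : ∀ v : H.Var, (v.1 : ℕ) < H.n ∧ (v.2 : ℕ) < H.numVar := fun v => by
    have h1 := H.gid_val v
    have h2 := (H.gid v).2
    exact ⟨v.1.2, by omega⟩
  have ht : ∀ l, H.t l ≤ H.numVar := fun l => by
    have h1 := Finset.single_le_sum (f := fun l => 7 * H.t l) (fun _ _ => Nat.zero_le _)
      (Finset.mem_univ l)
    have : 7 * H.t l ≤ H.numVar := h1
    omega
  rw [length_encode]
  intro x hx
  unfold encode at hx
  rw [List.mem_append, List.mem_append, List.mem_append, List.mem_append, List.mem_singleton,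
    List.mem_ofFn, List.mem_singleton, List.mem_flatten] at hx
  rcases hx with (((rfl | ⟨l, rfl⟩) | hx) | rfl) | ⟨L, hL, hx⟩
  · omega
  · have := ht l
    omega
  · refine (H.listVars_forall (m := H.numVar) (fun v => ?_) x hx).trans (by omega)
    exact (hv ⟨v.1, H.partner v.1 v.2⟩).2.le
  · omega
  · rw [List.mem_ofFn] at hL
    obtain ⟨c, rfl⟩ := hL
    rw [List.mem_append, List.mem_flatten, List.mem_singleton] at hx
    rcases hx with ⟨L, hL, hx⟩ | rfl
    · rw [List.mem_ofFn] at hL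
      obtain ⟨k, rfl⟩ := hL
      have := hv (H.triple c k)
      simp only [List.mem_cons, List.not_mem_nil, or_false] at hx
      rcases hx with rfl | rfl <;> omega
    · have := (H.rhs c).val_lt
      omega

end HybridInstance

namespace Ram
open HybridInstance

variable {α : Type} {Γ : Ctx α}

theorem length_le_bitSize (l : List ℕ) : l.length ≤ bitSize l := by
  induction l with
  | nil => exact Nat.zero_le _
  | cons x l ih =>
    unfold bitSize at ih ⊢
    rw [List.length_cons, List.map_cons, List.sum_cons]
    omega

theorem sum_le_bitSize_sq {l : List ℕ} (h : ∀ x ∈ l, x ≤ l.length) : l.sum ≤ bitSize l * bitSize l := by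
  refine (List.sum_le_card_nsmul l _ h).trans ?_
  rw [smul_eq_mul]
  exact Nat.mul_le_mul (length_le_bitSize l) (length_le_bitSize l)

theorem getD_le_sum (l : List ℕ) (j : ℕ) : l.getD j 0 ≤ l.sum := by
  by_cases h : j < l.length
  · rw [List.getD_eq_getElem _ _ h]
    exact List.single_le_sum (fun _ _ => Nat.zero_le _) _ (List.getElem_mem h)
  · rw [List.getD_eq_default _ _ (not_lt.1 h)]
    exact Nat.zero_le _

/-- The initial memory. -/
def inputCtx (inp : α → List ℕ) : Ctx α where
  arr a i j := if i = 0 then (inp a).getD j 0 else 0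
  reg _ _ := 0
  size a := (inp a).sum
  arr_le a i j := by
    split_ifs
    · exact getD_le_sum _ _
    · exact Nat.zero_le _
  reg_le _ _ := Nat.zero_le _

theorem inputCtx_start (inp : α → List ℕ) (a : α) :
    (inputCtx inp).Holds (fun _ => 1) a (start (inp a)) :=
  ⟨rfl, fun _ => rfl⟩

theorem polyTime_of_run {inp outp : α → List ℕ} (hle : ∀ a, ∀ x ∈ inp a, x ≤ (inp a).length)
    {T : α → ℕ} (hT : PB (inputCtx inp).size T) (p : Prog)
    (hp : ∀ a, ∃ t s, Exec p (start (inp a)) t s ∧ t ≤ T a ∧ s.out = outp a) :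
    PolyTime inp outp := by
  have hs : PB (fun a => bitSize (inp a)) (inputCtx inp).size :=
    (PB.size.mul PB.size).mono fun a => sum_le_bitSize_sq (hle a)
  obtain ⟨c, hc⟩ := hT.comp id hs
  -- One constant has to serve as factor, exponent and summand. For `b ≥ 1` it follows from `(b + 2)
  -- ^ c ≤ (3 * b) ^ c`; the case `b = 0` uses the summand.
  have h3 : c ≤ 3 ^ c := (Nat.lt_pow_self (by norm_num)).le
  have hb : ∀ b : ℕ, (b + 2) ^ c ≤ 3 ^ c * b ^ 3 ^ c + 3 ^ c := fun b => by
    rcases Nat.eq_zero_or_pos b with rfl | hb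
    · have : (0 + 2) ^ c ≤ 3 ^ c := Nat.pow_le_pow_left (by norm_num) c
      omega
    · have h1 : (b + 2) ^ c ≤ (3 * b) ^ c := Nat.pow_le_pow_left (by omega) c
      have h2 : b ^ c ≤ b ^ 3 ^ c := Nat.pow_le_pow_right hb h3
      rw [mul_pow] at h1
      have := Nat.mul_le_mul_left (3 ^ c) h2
      omega
  refine ⟨p, 3 ^ c, fun a => ?_⟩
  obtain ⟨t, s, h1, h2, h3⟩ := hp a
  exact ⟨t, s, h1, h3, h2.trans ((hc a).trans (hb _))⟩

theorem Writes.ofFn {C : α → ℕ} (hC : PT Γ C) {f : ∀ a, Fin (C a) → ℕ}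
    (hf : PT (Γ.ext (ι := fun a => Fin (C a)) fun _ i => (i : ℕ)) fun p => f p.1 p.2) :
    Writes Γ fun a => List.ofFn (f a) :=
  (Writes.flatten hC (Writes.single hf)).congr fun a => by
    rw [List.ofFn_eq_map, List.ofFn_eq_map, List.map_eq_flatMap, List.flatMap_def]

theorem polyTime_tsp (md : Bool) :
    PolyTime (fun H : HybridInstance => H.encode) fun H => (tsp md H).encode := by
  let Γ := inputCtx fun H : HybridInstance => H.encode
  have hΓ : Reads Γ fun H => H := fun _ _ _ => rfl
  have hN : PT Γ fun H => size md H := PT.vertices hΓ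
  let Γx := Γ.ext (ι := fun H => Fin (size md H)) fun _ x => (x : ℕ)
  have hNx : PT Γx fun p => size md p.1 := PT.weaken hN
  let Γy := Γx.ext (ι := fun p => Fin (size md p.1)) fun _ y => (y : ℕ)
  have ry : Reads Γy fun q => q.1.1 := Reads.ext (Γ := Γx) (Reads.ext hΓ)
  have hx : PF Γy (N := fun q => size md q.1.1) fun q => q.1.2 :=
    PT.weaken (Γ := Γx) PT.last
  have hy : PF Γy (N := fun q => size md q.1.1) fun q => q.2 := PT.last
  have hd : PT Γy fun q => (q.1.1.net md).d (vertex md q.1.1 q.1.2) (vertex md q.1.1 q.2) / unit md :=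
    PT.div (PT.d ry (PX.vertex ry hx) (PX.vertex ry hy)) _ (by cases md <;> decide)
  have hL : Writes Γx fun p => List.ofFn fun y => (tsp md p.1).d p.2 y := Writes.ofFn hNx hd
  obtain ⟨T, hT, h⟩ := (Writes.single hN).append (Writes.flatten hN hL)
  -- The context has only zero registers, all represented by register 1, which is initially 0; work
  -- space begins at register 2.
  obtain ⟨p, hp⟩ := h 2 (fun _ => 1) fun _ => by norm_num
  refine polyTime_of_run (fun H => H.encode_le) hT p fun H => ?_
  obtain ⟨t, s, h1, h2, h3, -⟩ := hp H _ (inputCtx_start _ H)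
  exact ⟨t, s, h1, h2, h3⟩

end Ram
end


noncomputable section
open scoped Classical

open Vtx

/-! ## Reading a tour -/

namespace Ram
open HybridInstance

variable {α : Type} {Γ : Ctx α} {H : α → HybridInstance} {md : Bool}

/-- In array `0`, the code of a Hybrid instance is followed by that of a permutation. -/
def ReadsTour (Γ : Ctx α) (md : Bool) (H : α → HybridInstance)
    (τ : ∀ a, Equiv.Perm (Fin (size md (H a)))) : Prop :=
  ∀ a (i : Fin (size md (H a))), Γ.arr a 0 ((H a).encode.length + i) = τ a i

/-- The tour described by a permutation of the indices. -/
def tour (md : Bool) (H : HybridInstance) (τ : Equiv.Perm (Fin (size md H))) :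
    Fin (size md H) ≃ Vtx md H.Blk H.Sgl := τ.trans (vertex md H)

variable {τ : ∀ a, Equiv.Perm (Fin (size md (H a)))}

theorem ReadsTour.ext (hτ : ReadsTour Γ md H τ) {ι : α → Type} {code : ∀ a, ι a → ℕ} :
    ReadsTour (Γ.ext code) md (fun p => H p.1) fun p => τ p.1 := fun p i => hτ p.1 i

theorem PX.tour (hΓ : Reads Γ H) (hτ : ReadsTour Γ md H τ) {i : ∀ a, Fin (size md (H a))}
    (hi : PF Γ i) : PX Γ fun a => tour md (H a) (τ a) (i a) := by
  have hl : PT Γ fun a => (H a).encode.length :=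
    ((((PT.const 2).add hΓ.n).add hΓ.numVar).add ((PT.const 7).mul hΓ.m₃)).congr fun a =>
      (H a).length_encode
  exact PX.vertex hΓ (((hl.add hi).get 0).congr fun a => (hτ a (i a)).symm)

theorem PF.rotate {N : α → ℕ} (hN : PT Γ N) {i : ∀ a, Fin (N a)} (hi : PF Γ i) :
    PF Γ fun a => finRotate (N a) (i a) := by
  refine (PT.ite (PTP.eq (hi.add (PT.const 1)) hN) (PT.const 0) (hi.add (PT.const 1))).congr
    fun a => ?_
  have key : ∀ (m : ℕ) (j : Fin m), (finRotate m j : ℕ) =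
      if (j : ℕ) + 1 = m then 0 else (j : ℕ) + 1 := by
    intro m j
    cases m with
    | zero => exact j.elim0
    | succ m =>
      rw [coe_finRotate]
      simp [Fin.ext_iff]
  exact key _ _

theorem PTP.real {t u x y : ∀ a, Vtx md (H a).Blk (H a).Sgl} (ht : PX Γ t) (hu : PX Γ u)
    (hx : PX Γ x) (hy : PX Γ y) : PTP Γ fun a => Net.real (t a) (u a) (x a) (y a) :=
  (PTP.near hx ht).and ((PTP.near hy hu).and ((PTP.eqX hx ht).or (PTP.eqX hy hu)))

/-- Decoding depends only on which links are used at all, so the counts themselves need not be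
computed. -/
theorem cnt_pos_iff {Bk S : Type} {n : ℕ} (σ : Fin n ≃ Vtx md Bk S) (t u : Vtx md Bk S) :
    0 < Net.cnt σ t u ↔ ∃ i, Net.real t u (σ i) (σ (finRotate n i)) ∨
      Net.real t u (σ (finRotate n i)) (σ i) := by
  unfold Net.cnt
  rw [Finset.sum_pos_iff]
  refine ⟨fun ⟨i, _, hi⟩ => ⟨i, ?_⟩, fun ⟨i, hi⟩ => ⟨i, Finset.mem_univ i, ?_⟩⟩
  · by_contra h
    rw [not_or] at h
    rw [if_neg h.1, if_neg h.2] at hi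
    exact absurd hi (lt_irrefl _)
  · rcases hi with hi | hi <;> rw [if_pos hi] <;> omega

theorem PTP.cnt (hΓ : Reads Γ H) (hτ : ReadsTour Γ md H τ) {t u : ∀ a, Vtx md (H a).Blk (H a).Sgl}
    (ht : PX Γ t) (hu : PX Γ u) : PTP Γ fun a => 0 < Net.cnt (tour md (H a) (τ a)) (t a) (u a) := by
  refine PTP.congr ?_ fun a => cnt_pos_iff _ _ _
  refine PTP.ex (Listed.fin (PT.vertices hΓ)) ?_
  let Γi := Γ.ext (ι := fun a => Fin (size md (H a))) fun _ i => (i : ℕ)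
  have ri : Reads Γi fun p => H p.1 := hΓ.ext
  have si : ReadsTour Γi md (fun p => H p.1) fun p => τ p.1 := hτ.ext
  have hi : PF Γi (N := fun p => size md (H p.1)) fun p => p.2 := PT.last
  have ti : PX Γi (H := fun p => H p.1) fun p => t p.1 := PT.weaken ht
  have ui : PX Γi (H := fun p => H p.1) fun p => u p.1 := PT.weaken hu
  have h1 := PX.tour ri si hi
  have h2 := PX.tour ri si (PF.rotate (PT.vertices ri) hi)
  exact (PTP.real ti ui h1 h2).or (PTP.real ti ui h2 h1)

theorem PTP.cntEnter (hΓ : Reads Γ H) (hτ : ReadsTour Γ md H τ) {v : ∀ a, (H a).Var}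
    (hv : PV Γ v) : PTP Γ fun a => 0 < cntEnter (tour md (H a) (τ a)) (v a) :=
  PTP.cnt hΓ hτ (PX.vout (hΓ.prev hv) (hΓ.nu hv)) (PX.vY hΓ hv 0 (by omega))

theorem PTP.cntLeave (hΓ : Reads Γ H) (hτ : ReadsTour Γ md H τ) {v : ∀ a, (H a).Var}
    (hv : PV Γ v) : PTP Γ fun a => 0 < cntLeave (tour md (H a) (τ a)) (v a) :=
  PTP.cnt hΓ hτ (PX.vY hΓ hv 1 (by omega)) (PX.vin hΓ hv (hΓ.nu hv))

theorem PTP.cntPass (hΓ : Reads Γ H) (hτ : ReadsTour Γ md H τ) {v : ∀ a, (H a).Var}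
    (hv : PV Γ v) : PTP Γ fun a => 0 < cntPass (tour md (H a) (τ a)) (v a) :=
  have h : PTP Γ fun a => (!(H a).nu (v a)) = true := (hΓ.nu hv).not.congr fun a => by simp
  PTP.cnt hΓ hτ (PX.vout (hΓ.prev hv) h) (PX.vin hΓ hv h)

theorem PTP.pure (hΓ : Reads Γ H) (hτ : ReadsTour Γ md H τ) {v : ∀ a, (H a).Var}
    (hv : PV Γ v) : PTP Γ fun a => Pure (tour md (H a) (τ a)) (v a) :=
  ((PTP.cntEnter hΓ hτ hv).iff (PTP.cntLeave hΓ hτ hv)).and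
    (((PTP.cntEnter hΓ hτ hv).iff (PTP.cntPass hΓ hτ hv).not).congr fun a => by
      rw [Nat.pos_iff_ne_zero (n := HybridInstance.cntPass _ _), not_not])

theorem PTP.val (hΓ : Reads Γ H) (hτ : ReadsTour Γ md H τ) {v : ∀ a, (H a).Var}
    (hv : PV Γ v) : PTP Γ fun a => val (tour md (H a) (τ a)) (v a) = true :=
  (((PTP.cntEnter hΓ hτ hv).iff (hΓ.nu hv))).congr fun a => by
    unfold HybridInstance.val
    split_ifs with h <;> simp [h]

/-! ## Reading an assignment -/

/-- Array `1` holds the values of an assignment. -/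
def Holds₁ (Γ : Ctx α) (H : α → HybridInstance) (φ : ∀ a, (H a).Var → Bool) : Prop :=
  ∀ a v, Γ.arr a 1 ((H a).gid v) = (φ a v).toNat

variable {φ : ∀ a, (H a).Var → Bool}

theorem Holds₁.ext (hφ : Holds₁ Γ H φ) {ι : α → Type} {code : ∀ a, ι a → ℕ} :
    Holds₁ (Γ.ext code) (fun p => H p.1) fun p => φ p.1 := fun p v => hφ p.1 v

theorem Holds₁.val (hφ : Holds₁ Γ H φ) {v : ∀ a, (H a).Var} (hv : PV Γ v) :
    PTP Γ fun a => φ a (v a) = true :=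
  (PTP.eq (hv.get 1) (PT.const 1)).congr fun a => by
    rw [hφ a (v a)]
    cases φ a (v a) <;> simp

theorem Holds₁.ne (hφ : Holds₁ Γ H φ) {v w : ∀ a, (H a).Var} (hv : PV Γ v) (hw : PV Γ w) :
    PTP Γ fun a => φ a (v a) ≠ φ a (w a) :=
  ((hφ.val hv).iff (hφ.val hw)).not.congr fun a => by
    rw [Ne, Bool.eq_iff_iff]

theorem violAt_eq {H : HybridInstance} (x : H.Var) (φ : H.Var → Bool) : violAt x φ =
    (if φ (H.prev x) ≠ φ x then 1 else 0) + (if φ x ≠ φ (H.next x) then 1 else 0) +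
    if H.IsContact x then
      if h : H.IsContact x then if Viol φ (.inr (.inr (H.place x h).1)) then 1 else 0 else 0
    else if φ x ≠ φ (H.mate x) then 1 else 0 := by
  have h1 := prev_ne x
  have e1 : Viol φ (.inl (H.prev x)) ↔ φ (H.prev x) ≠ φ x := by
    simp only [Viol, H.next_prev]
  unfold violAt eqnsOf
  rw [Finset.card_filter, Finset.sum_insert, Finset.sum_insert, Finset.sum_singleton, ← add_assoc]
  · congr 1
    · exact congrArg₂ (· + ·) (if_congr e1 rfl rfl) (if_congr Iff.rfl rfl rfl)
    · by_cases hc : H.IsContact x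
      · rw [third, dif_pos hc, if_pos hc, dif_pos hc]
      · rw [if_neg hc]
        by_cases hl : H.IsLow x
        · rw [third, dif_neg hc, dif_pos hl]
          exact if_congr Iff.rfl rfl rfl
        · have e2 : Viol φ (.inr (.inl ⟨H.mate x, H.isLow_mate hc hl⟩)) ↔ φ x ≠ φ (H.mate x) := by
            simp only [Viol, H.mate_mate]
            exact ne_comm
          rw [third, dif_neg hc, dif_neg hl]
          exact if_congr e2 rfl rfl
  · simpa using (third_ne x x).symm
  · simp [h1, (third_ne x (H.prev x)).symm]

theorem Holds₁.violAt (hΓ : Reads Γ H) (hφ : Holds₁ Γ H φ) {v : ∀ a, (H a).Var} (hv : PV Γ v) :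
    PT Γ fun a => violAt (v a) (φ a) := by
  refine PT.congr ?_ fun a => violAt_eq (v a) (φ a)
  refine PT.add (PT.add (PT.ite (hφ.ne (hΓ.prev hv) hv) (PT.const 1) (PT.const 0))
    (PT.ite (hφ.ne hv (hΓ.next hv)) (PT.const 1) (PT.const 0))) (PT.ite (hΓ.isContact hv) ?_
    (PT.ite (hφ.ne hv (hΓ.mate hv)) (PT.const 1) (PT.const 0)))
  refine hΓ.place hv (F := fun a c _ => if Viol (φ a) (.inr (.inr c)) then 1 else 0)
    (PT.ite ?_ (PT.const 1) (PT.const 0))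
  let Γc := Γ.ext (ι := fun a => Fin (H a).m₃) fun _ c => (c : ℕ)
  let Γk := Γc.ext (ι := fun _ => Fin 3) fun _ k => (k : ℕ)
  have rk : Reads Γk fun q => H q.1.1 := Reads.ext (Γ := Γc) hΓ.ext
  have sk : Holds₁ Γk (fun q => H q.1.1) fun q => φ q.1.1 := Holds₁.ext (Γ := Γc) hφ.ext
  have hc : PF Γk (N := fun q => (H q.1.1).m₃) fun q => q.1.2 := PT.weaken (Γ := Γc) PT.last
  have key : ∀ k : Fin 3, PTP Γk fun q => (φ q.1.1 ((H q.1.1).triple q.1.2 k) ==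
      (H q.1.1).nu ((H q.1.1).triple q.1.2 k)) = true := fun k => by
    have ht : PV Γk (H := fun q => H q.1.1) fun q => (H q.1.1).triple q.1.2 k :=
      rk.triple (k := fun _ => k) hc (PT.const _)
    exact ((sk.val ht).iff (rk.nu ht)).congr fun q => by
      rw [beq_iff_eq, Bool.eq_iff_iff]
  have hx : ∀ x y z : Bool, (xor x (xor y z) = false) ↔ ¬ (x = true ↔ (y = true ↔ z = true)) := by
    decide
  exact ((key 0).iff ((key 1).iff (key 2))).not.congr fun q => hx _ _ _

end Ram
end


noncomputable section
open scoped Classical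

/-! ## Changing an assignment in place -/

namespace Ram
open HybridInstance

variable {α : Type} {Γ : Ctx α} {H : α → HybridInstance}

/-- The context in which array `1` holds an assignment. -/
def board (Γ : Ctx α) (H : α → HybridInstance) : Ctx (Σ a, ((H a).Var → Bool)) where
  arr p i j := if i = 1 then
      if h : j < (H p.1).numVar then (p.2 ((H p.1).gid.symm ⟨j, h⟩)).toNat else 0
    else Γ.arr p.1 i j
  reg i p := Γ.reg i p.1
  size p := Γ.size p.1 + 1
  arr_le p i j := by
    have := Γ.arr_le p.1 i j
    have h (b : Bool) : b.toNat ≤ Γ.size p.1 + 1 := by cases b <;> simp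
    split_ifs
    exacts [h _, Nat.zero_le _, this.trans (Nat.le_succ _)]
  reg_le i p := (Γ.reg_le i p.1).trans (Nat.le_succ _)

theorem board_zero (p : Σ a, ((H a).Var → Bool)) (j : ℕ) :
    (board Γ H).arr p 0 j = Γ.arr p.1 0 j := by
  simp [board]

theorem Reads.board (hΓ : Reads Γ H) : Reads (board Γ H) fun p => H p.1 := fun p i hi =>
  (board_zero p i).trans (hΓ p.1 i hi)

theorem ReadsTour.board {md : Bool} {τ : ∀ a, Equiv.Perm (Fin (HybridInstance.size md (H a)))}
    (hτ : ReadsTour Γ md H τ) : ReadsTour (board Γ H) md (fun p => H p.1) fun p => τ p.1 :=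
  fun p i => (board_zero p _).trans (hτ p.1 i)

theorem Holds₁.board : Holds₁ (board Γ H) (fun p => H p.1) fun p => p.2 := fun p v => by
  simp only [Ram.board, if_true]
  rw [dif_pos (Fin.is_lt _)]
  simp

theorem board_update (a : α) (φ : (H a).Var → Bool) (x : (H a).Var) (b : Bool) :
    Function.update ((board Γ H).arr ⟨a, φ⟩) 1 (Function.update ((board Γ H).arr ⟨a, φ⟩ 1)
      ((H a).gid x) b.toNat) = (board Γ H).arr ⟨a, Function.update φ x b⟩ := by
  funext i j
  by_cases hi : i = 1
  · subst hi
    rw [Function.update_self]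
    by_cases hj : j = (H a).gid x
    · subst hj
      rw [Function.update_self]
      exact ((Holds₁.board (Γ := Γ) ⟨a, Function.update φ x b⟩ x).trans (by simp)).symm
    · rw [Function.update_of_ne hj]
      simp only [Ram.board, if_true]
      split_ifs with h
      · rw [Function.update_of_ne]
        intro he
        rw [← he] at hj
        simp at hj
      · rfl
  · rw [Function.update_of_ne hi]
    simp only [Ram.board, if_neg hi]

/-- The assignment can be transformed in polynomial time, without other changes of the memory. -/
def Trans (Γ : Ctx α) (H : α → HybridInstance)
    (step : ∀ a, ((H a).Var → Bool) → (H a).Var → Bool) : Prop :=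
  ∃ T : α → ℕ, PB Γ.size T ∧ ∀ (k : ℕ) (ρ : ℕ → ℕ), (∀ i, ρ i < k) → ∃ p : Prog,
    ∀ a φ s, (board Γ H).Holds ρ ⟨a, φ⟩ s → ∃ t s', Exec p s t s' ∧ t ≤ T a ∧
      s'.arr = (board Γ H).arr ⟨a, step a φ⟩ ∧ (∀ i < k, s'.reg i = s.reg i) ∧ s'.out = s.out

variable {step step' : ∀ a, ((H a).Var → Bool) → (H a).Var → Bool}

theorem Trans.congr (h : Trans Γ H step) (he : ∀ a φ, step' a φ = step a φ) : Trans Γ H step' := by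
  rwa [show step' = step from funext fun a => funext (he a)]

theorem Trans.comp (h : Trans Γ H step) (h' : Trans Γ H step') :
    Trans Γ H fun a φ => step' a (step a φ) := by
  obtain ⟨T, hT, h⟩ := h
  obtain ⟨T', hT', h'⟩ := h'
  refine ⟨fun a => T a + T' a, hT.add hT', fun k ρ hρ => ?_⟩
  obtain ⟨p, hp⟩ := h k ρ hρ
  obtain ⟨p', hp'⟩ := h' k ρ hρ
  refine ⟨.seq p p', fun a φ s hs => ?_⟩
  obtain ⟨t, s', h1, h2, h3, h4, h5⟩ := hp a φ s hs
  obtain ⟨t', s'', g1, g2, g3, g4, g5⟩ := hp' a (step a φ) s'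
    ⟨h3, fun i => (h4 _ (hρ i)).trans (hs.reg i)⟩
  exact ⟨t + t', s'', .seq _ _ _ _ _ _ _ h1 g1, Nat.add_le_add h2 g2, g3,
    fun i hi => (g4 i hi).trans (h4 i hi), g5.trans h5⟩

theorem Trans.update {x : ∀ a, (H a).Var} {b : ∀ a, ((H a).Var → Bool) → Bool}
    (hx : PV (board Γ H) fun p => x p.1) (hb : PTP (board Γ H) fun p => b p.1 p.2 = true) :
    Trans Γ H fun a φ => Function.update φ (x a) (b a φ) := by
  obtain ⟨T, ⟨c, hc⟩, -, h⟩ := hx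
  obtain ⟨T', ⟨c', hc'⟩, -, h'⟩ := hb
  have hX : ∀ e, PB Γ.size fun a => (Γ.size a + 1 + 2) ^ e := fun e =>
    ((PB.size.add (PB.const 1)).add (PB.const 2)).pow e
  refine ⟨fun a => (Γ.size a + 1 + 2) ^ c + (Γ.size a + 1 + 2) ^ c' + 1,
    ((hX c).add (hX c')).add (PB.const 1), fun k ρ hρ => ?_⟩
  obtain ⟨p, hp⟩ := h k ρ hρ
  obtain ⟨p', hp'⟩ := h' (k + 1) ρ fun i => (hρ i).trans (Nat.lt_succ_self k)
  refine ⟨.seq (.seq p p') (.store 1 (.reg k) (.reg (k + 1))), fun a φ s hs => ?_⟩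
  obtain ⟨t, s', h1, h2, h3, h4⟩ := hp ⟨a, φ⟩ s hs
  obtain ⟨t', s'', h5, h6, h7, h8⟩ := hp' ⟨a, φ⟩ s' (hs.same h4 hρ)
  have h9 := h4.trans h8 (Nat.le_succ k)
  refine ⟨t + t' + 1, _, .seq _ _ _ _ _ _ _ (.seq _ _ _ _ _ _ _ h1 h5) (.store _ _ _ s''),
    Nat.succ_le_succ (Nat.add_le_add (h2.trans (hc _)) (h6.trans (hc' _))), ?_, h9.reg, h9.out⟩
  rw [← board_update, ← hs.arr, ← h9.arr]
  simp only [Expr.eval]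
  rw [h7, h8.reg k (Nat.lt_succ_self k), h3]
  congr 2
  by_cases hb : b a φ = true <;> simp [hb]

theorem Trans.foldl {C : α → ℕ} (hC : PT (board Γ H) fun p => C p.1)
    {step : ∀ a, Fin (C a) → ((H a).Var → Bool) → (H a).Var → Bool}
    (hs : Trans (Γ.ext (ι := fun a => Fin (C a)) fun _ i => (i : ℕ)) (fun p => H p.1)
      fun p φ => step p.1 p.2 φ) :
    Trans Γ H fun a φ => (List.finRange (C a)).foldl (fun φ i => step a i φ) φ := by
  obtain ⟨T, ⟨b, hb⟩, ⟨d, hd⟩, h⟩ := hC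
  obtain ⟨T', ⟨c, hc⟩, h'⟩ := hs
  have hX : ∀ e, PB Γ.size fun a => (Γ.size a + 1 + 2) ^ e := fun e =>
    ((PB.size.add (PB.const 1)).add (PB.const 2)).pow e
  -- The bound for `C` is known in the context with an assignment; inserting an arbitrary assignment
  -- carries it over to `Γ`.
  have hCb : PB Γ.size C := (hX d).mono fun a => hd ⟨a, fun _ => false⟩
  have hY : PB Γ.size fun a => (Γ.size a + C a + 2) ^ c :=
    ((PB.size.add hCb).add (PB.const 2)).pow c
  refine ⟨fun a => (Γ.size a + 1 + 2) ^ b + 1 + (C a * ((Γ.size a + C a + 2) ^ c + 1 + 1) + 1),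
    ((hX b).add (PB.const 1)).add ((hCb.mul ((hY.add (PB.const 1)).add
    (PB.const 1))).add (PB.const 1)), fun k ρ hρ => ?_⟩
  have hρ' : ∀ m i, ρ i < k + m := fun m i => (hρ i).trans_le (Nat.le_add_right _ _)
  obtain ⟨p, hp⟩ := h (k + 1) ρ (hρ' 1)
  obtain ⟨p', hp'⟩ := h' (k + 2) (cons k ρ) (cons_lt (by omega) (hρ' 2))
  refine ⟨.seq (.seq p (.assign k (.const 0)))
    (.loop (.sub (.reg (k + 1)) (.reg k)) (.seq p' (.assign k (.add (.reg k) (.const 1))))),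
    fun a φ s hs => ?_⟩
  obtain ⟨t, s', h1, h2, h3, h4⟩ := hp ⟨a, φ⟩ s hs
  set s1 : State := ⟨Function.update s'.reg k 0, s'.arr, s'.out⟩ with hs1
  have e1 : Exec _ s (t + 1) s1 := .seq _ _ _ _ _ _ _ h1 (.assign k (.const 0) s')
  set f : ((H a).Var → Bool) → Fin (C a) → (H a).Var → Bool := fun φ i => step a i φ with hf
  have hfl : ∀ i (hi : i < C a), ((List.finRange (C a)).take (i + 1)).foldl f φ =
      step a ⟨i, hi⟩ (((List.finRange (C a)).take i).foldl f φ) := by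
    intro i hi
    rw [List.take_succ_eq_append_getElem (by simpa using hi), List.foldl_append]
    simp [hf]
  obtain ⟨t', s'', h5, h6, h7, h8, h9, -, -⟩ := exec_for (n := C a)
    (T := (Γ.size a + C a + 2) ^ c + 1)
    (e := .sub (.reg (k + 1)) (.reg k)) (p := .seq p' (.assign k (.add (.reg k) (.const 1))))
    (s := s1) (fun i u => u.arr = (board Γ H).arr ⟨a, ((List.finRange (C a)).take i).foldl f φ⟩ ∧
      (∀ j < k, u.reg j = s.reg j) ∧ u.out = s.out ∧ u.reg k = i ∧ u.reg (k + 1) = C a) (by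
      rintro i u - ⟨-, -, -, hu1, hu2⟩
      simp [Expr.eval, hu1, hu2]) (by
      rintro i u hi ⟨hu, hu', hu0, hu1, hu2⟩
      obtain ⟨t', u', g1, g2, g3, g4, g5⟩ := hp' ⟨a, ⟨i, hi⟩⟩
        (((List.finRange (C a)).take i).foldl f φ) u
        ⟨hu, fun j => by cases j with
          | zero => exact hu1
          | succ j => exact (hu' _ (hρ j)).trans (hs.reg j)⟩
      refine ⟨t' + 1, _, .seq _ _ _ _ _ _ _ g1 (.assign _ _ _), ?_, ?_, ?_, g5.trans hu0, ?_, ?_⟩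
      · have h1 : T' ⟨a, ⟨i, hi⟩⟩ ≤ (Γ.size a + i + 2) ^ c := hc ⟨a, ⟨i, hi⟩⟩
        have : (Γ.size a + i + 2) ^ c ≤ (Γ.size a + C a + 2) ^ c :=
          Nat.pow_le_pow_left (by omega) c
        omega
      · rw [hfl i hi]
        exact g3
      · intro j hj
        dsimp only
        rw [Function.update_of_ne (by omega), g4 j (by omega), hu' j hj]
      · dsimp only
        rw [Function.update_self]
        simp [Expr.eval, g4 k (by omega), hu1]
      · dsimp only
        rw [Function.update_of_ne (by omega), g4 (k + 1) (by omega), hu2])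
      ⟨h4.arr.trans hs.arr, fun j hj => by
        simp only [hs1]
        rw [Function.update_of_ne (by omega), h4.reg j (by omega)],
        by simp [hs1, h4.out], by simp [hs1], by simp [hs1, h3]⟩
  have := hb ⟨a, φ⟩
  change T ⟨a, φ⟩ ≤ (Γ.size a + 1 + 2) ^ b at this
  refine ⟨_, s'', .seq _ _ _ _ _ _ _ e1 h5, by beta_reduce; omega, ?_, h8, h9⟩
  rw [h7, List.take_of_length_le (by simp)]

end Ram
end


/-! ### The decoding procedure on the machine -/

noncomputable section
open scoped Classical

namespace HybridInstance

/-- A majority step, also if it is skipped, is an update at one place, so `Trans.update` covers all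
cases. -/
theorem improve_eq {H : HybridInstance} (S : Prop) (x : H.Var) (φ : H.Var → Bool) :
    (if S then φ else improve x φ) =
      Function.update φ x (decide (φ x = true ↔ (S ∨ ¬ 2 ≤ violAt x φ))) := by
  unfold improve flip
  by_cases hS : S <;> by_cases hv : 2 ≤ violAt x φ <;> simp [hS, hv]

theorem foldl_update {V ι : Type} [DecidableEq V] (f : V → Bool) (g : ι → V) (L : List ι) (φ : V → Bool) (v : V) :
    L.foldl (fun φ i => Function.update φ (g i) (f (g i))) φ v =
      if ∃ i ∈ L, g i = v then f v else φ v := by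
  induction L generalizing φ with
  | nil => simp
  | cons i L ih =>
    rw [List.foldl_cons, ih]
    by_cases h : ∃ j ∈ L, g j = v
    · rw [if_pos h, if_pos]
      obtain ⟨j, hj, hv⟩ := h
      exact ⟨j, List.mem_cons_of_mem _ hj, hv⟩
    · rw [if_neg h]
      by_cases hi : g i = v
      · rw [if_pos ⟨i, List.mem_cons_self, hi⟩, ← hi, Function.update_self]
      · rw [Function.update_of_ne (Ne.symm hi), if_neg]
        rintro ⟨j, hj, hv⟩
        rcases List.mem_cons.1 hj with rfl | hj
        exacts [hi hv, h ⟨j, hj, hv⟩]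

end HybridInstance

namespace Ram
open HybridInstance

variable {α : Type} {Γ : Ctx α} {H : α → HybridInstance} {md : Bool}

/-- The assignment obtained from a tour. -/
def assignment (md : Bool) (H : HybridInstance) (τ : (tsp md H).Tour) : H.Assignment :=
  toAssignment (decode (Pure (tour md H τ)) (val (tour md H τ)))

theorem Trans.improveAt (hΓ : Reads Γ H) {S : α → Prop} (hS : PTP (board Γ H) fun p => S p.1)
    {x : ∀ a, (H a).Var} (hx : PV (board Γ H) fun p => x p.1) :
    Trans Γ H fun a φ => if S a then φ else improve (x a) φ := by
  refine Trans.congr (Trans.update hx ?_) fun a φ => improve_eq (S a) (x a) φ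
  have hr : Reads (board Γ H) fun p => H p.1 := hΓ.board
  have hh : Holds₁ (board Γ H) (fun p => H p.1) fun p => p.2 := Holds₁.board
  exact ((hh.val hx).iff (hS.or (PTP.le (PT.const 2) (hh.violAt hr hx)).not)).congr fun _ =>
    decide_eq_true_iff

/-- Three passes over the array: the values of all variables are written, the inconsistent variables
are settled in order, and `star` is improved at the end. The first pass overwrites whatever the
array contained. -/
theorem Trans.decode (hΓ : Reads Γ H) {τ : ∀ a, Equiv.Perm (Fin (size md (H a)))}
    (hτ : ReadsTour Γ md H τ) : Trans Γ H fun a _ =>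
      decode (Pure (tour md (H a) (τ a))) (val (tour md (H a) (τ a))) := by
  let Γi := Γ.ext (ι := fun a => Fin (H a).numVar) fun _ i => (i : ℕ)
  have ri : Reads Γi fun p => H p.1 := hΓ.ext
  have si : ReadsTour Γi md (fun p => H p.1) fun p => τ p.1 := hτ.ext
  have rb : Reads (board Γi fun p => H p.1) fun q => H q.1.1 := ri.board
  have sb : ReadsTour (board Γi fun p => H p.1) md (fun q => H q.1.1) fun q => τ q.1.1 := si.board
  have hv : PV (board Γi fun p => H p.1) (H := fun q => H q.1.1) fun q =>
      (H q.1.1).gid.symm q.1.2 := by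
    refine PT.congr (PT.var 0) fun q => ?_
    beta_reduce
    rw [Equiv.apply_symm_apply]
    rfl
  have hN : PT (board Γ H) fun p => (H p.1).numVar := Reads.numVar hΓ.board
  have h1 : Trans Γi (fun p => H p.1) fun p φ => Function.update φ ((H p.1).gid.symm p.2)
      (val (tour md (H p.1) (τ p.1)) ((H p.1).gid.symm p.2)) :=
    Trans.update hv (PTP.val rb sb hv)
  have h2 : Trans Γi (fun p => H p.1) fun p φ =>
      if Pure (tour md (H p.1) (τ p.1)) ((H p.1).gid.symm p.2) then φ
      else improve ((H p.1).gid.symm p.2) φ :=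
    Trans.improveAt ri (PTP.pure rb sb hv) hv
  have h3 : Trans Γ H fun a φ => improve (H a).star φ :=
    (Trans.improveAt hΓ (PTP.const False) (Reads.star hΓ.board)).congr fun _ _ => (if_neg id).symm
  have h4 := Trans.foldl hN (step := fun a i φ => Function.update φ ((H a).gid.symm i)
    (val (tour md (H a) (τ a)) ((H a).gid.symm i))) h1
  have h5 := Trans.foldl hN (step := fun a i φ =>
    if Pure (tour md (H a) (τ a)) ((H a).gid.symm i) then φ else improve ((H a).gid.symm i) φ) h2
  refine Trans.congr ((h4.comp h5).comp h3) fun a φ => ?_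
  have e : (List.finRange (H a).numVar).foldl (fun φ i => Function.update φ ((H a).gid.symm i)
      (val (tour md (H a) (τ a)) ((H a).gid.symm i))) φ =
      val (tour md (H a) (τ a)) := by
    funext v
    rw [foldl_update, if_pos ⟨(H a).gid v, List.mem_finRange _, by simp⟩]
  rw [e]
  unfold HybridInstance.decode settle varList
  rw [List.ofFn_eq_map, List.foldl_map]

theorem Writes.board (hΓ : Reads Γ H) : Writes (board Γ H) fun p =>
    (H p.1).encodeAssignment (toAssignment p.2) := by
  have rb : Reads (Ram.board Γ H) fun p => H p.1 := hΓ.board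
  have hb : Holds₁ (Ram.board Γ H) (fun p => H p.1) fun p => p.2 := Holds₁.board
  let Γi := (Ram.board Γ H).ext (ι := fun p => Fin (H p.1).numVar) fun _ i => (i : ℕ)
  have hi : Holds₁ Γi (fun q => H q.1.1) fun q => q.1.2 := hb.ext
  have hv : PV Γi (H := fun q => H q.1.1) fun q => (H q.1.1).gid.symm q.2 :=
    PT.congr PT.last fun q => by
      beta_reduce
      rw [Equiv.apply_symm_apply]
  have h : PT Γi fun q => (toAssignment q.1.2 ((H q.1.1).gid.symm q.2)).val :=
    PT.congr (hi.val hv) fun q => by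
      unfold toAssignment
      split_ifs <;> rfl
  exact (Writes.ofFn rb.numVar h).congr fun p => listVars_eq _ _

theorem polyTime_assignment (md : Bool) :
    PolyTime (fun x : (H : HybridInstance) × (tsp md H).Tour =>
      x.1.encode ++ (tsp md x.1).encodeTour x.2)
      fun x => x.1.encodeAssignment (assignment md x.1 x.2) := by
  set inp : ((H : HybridInstance) × (tsp md H).Tour) → List ℕ := fun x =>
    x.1.encode ++ (tsp md x.1).encodeTour x.2 with hinp
  let Γ := inputCtx inp
  let K : ((H : HybridInstance) × (tsp md H).Tour) → HybridInstance := fun x => x.1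
  have hΓ : Reads Γ K := fun x i hi =>
    (show Γ.arr x 0 i = (inp x).getD i 0 from rfl).trans (List.getD_append _ _ _ _ hi)
  have hτ : ReadsTour Γ md K fun x => x.2 := fun x i => by
    refine (show Γ.arr x 0 _ = (inp x).getD _ 0 from rfl).trans ?_
    refine (List.getD_append_right _ _ _ _ (Nat.le_add_right _ _)).trans ?_
    rw [Nat.add_sub_cancel_left, TSPInstance.encodeTour, List.getD_eq_getElem _ _ (by
      rw [List.length_ofFn]; exact i.2), List.getElem_ofFn]
    rfl
  have hle : ∀ x, ∀ y ∈ inp x, y ≤ (inp x).length := by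
    intro x y hy
    rw [hinp] at hy ⊢
    simp only [List.length_append, TSPInstance.encodeTour, List.length_ofFn] at hy ⊢
    rcases List.mem_append.1 hy with hy | hy
    · exact (x.1.encode_le y hy).trans (Nat.le_add_right _ _)
    · obtain ⟨i, rfl⟩ := List.mem_ofFn.1 hy
      exact (x.2 i).2.le.trans (Nat.le_add_left _ _)
  obtain ⟨T, hT, h⟩ := Trans.decode hΓ hτ
  obtain ⟨p, hp⟩ := h 2 (fun _ => 1) fun _ => by norm_num
  obtain ⟨T', ⟨c, hc⟩, h'⟩ := Writes.board hΓ
  obtain ⟨p', hp'⟩ := h' 2 (fun _ => 1) fun _ => by norm_num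
  refine polyTime_of_run (T := fun x => T x + (Γ.size x + 1 + 2) ^ c) hle
    (hT.add (((PB.size.add (PB.const 1)).add (PB.const 2)).pow c)) (.seq p p') fun x => ?_
  -- In the initial memory array 1 is zero, which represents the assignment that is false
  -- everywhere.
  have h0 : (board Γ K).Holds (fun _ => 1) ⟨x, fun _ => false⟩ (start (inp x)) := by
    refine ⟨?_, fun _ => rfl⟩
    funext i j
    by_cases hi : i = 1
    · subst hi
      simp [board, start]
    · simp [board, start, hi, Γ, inputCtx]
  obtain ⟨t, s, h1, h2, h3, h4, h5⟩ := hp x _ _ h0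
  obtain ⟨t', s', g1, g2, g3, -⟩ := hp' _ s ⟨h3, fun i => (h4 _ (by norm_num)).trans (h0.reg i)⟩
  exact ⟨t + t', s', .seq _ _ _ _ _ _ _ h1 g1, Nat.add_le_add h2 (g2.trans (hc _)),
    by rw [g3, h5]; rfl⟩

end Ram
end


noncomputable section
open scoped Classical

/-! ## The reductions -/

namespace HybridInstance
open Ram
variable {H : HybridInstance} {md : Bool}

theorem unit_mul_length (σ : (tsp md H).Tour) : unit md * (tsp md H).length σ =
    ∑ i, (H.net md).d (tour md H σ i) (tour md H σ (finRotate _ i)) := by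
  unfold TSPInstance.length
  rw [Finset.mul_sum]
  exact Finset.sum_congr rfl fun i _ => unit_mul_d _ _

theorem unit_mul_length_ge (σ : (tsp md H).Tour) :
    gadBase md * (H.m₂ + 3 * H.m₃) + 2 * H.m₃ + 2 * H.n + 4 * (H.n + H.m₃) + 2 +
      2 * H.unsat (assignment md H σ) ≤ unit md * (tsp md H).length σ := by
  rw [unit_mul_length]
  have := three_le_size md H
  exact unsat_decode_le (tour md H σ) (by omega)

theorem exists_unit_mul_length_le (md : Bool) (ψ : H.Assignment) : ∃ σ : (tsp md H).Tour,
    unit md * (tsp md H).length σ ≤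
      gadBase md * (H.m₂ + 3 * H.m₃) + 2 * H.m₃ + 2 * H.n + 4 * (H.n + H.m₃) + 2 + 2 * H.unsat ψ := by
  obtain ⟨σ, hσ⟩ := exists_tour_le ψ md (n := size md H) rfl
  let τ : Equiv.Perm (Fin (size md H)) := σ.trans (vertex md H).symm
  have e : tour md H τ = σ := Equiv.ext fun i => (vertex md H).apply_symm_apply (σ i)
  refine ⟨τ, (unit_mul_length τ).trans_le ?_⟩
  rw [e]
  exact hσ

theorem tsp_isOneB (md : Bool) (H : HybridInstance) : (tsp md H).IsOneB (4 / unit md) := fun x y _ =>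
  Nat.div_le_div_right ((H.net md).d_le (vertex md H x) (vertex md H y))

/-- The graph joins points at distance 1 or 2. Distance 3 is attained by two edges (`d_three`), 4 is
the cap, and no path is shorter than the distance by the triangle inequality. -/
theorem tsp_isGraphMetric (H : HybridInstance) : (tsp true H).IsGraphMetricCappedAt 4 := by
  set I := tsp true H with hI
  have h3 : ∀ x y, I.d x y = 3 → ∃ z, (I.d x z = 1 ∧ I.d z y = 2) ∨ (I.d x z = 2 ∧ I.d z y = 1) := by
    intro x y h
    have e : ∀ x y, I.d x y = (H.net true).d (vertex true H x) (vertex true H y) := fun x y =>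
      Nat.div_one _
    rw [e] at h
    obtain ⟨z, hz⟩ := (H.net true).d_three h
    obtain ⟨z, rfl⟩ := (vertex true H).surjective z
    have h1 : I.d x z = _ := e x z
    have h2 : I.d z y = _ := e z y
    exact ⟨z, by rwa [h1, h2]⟩
  let G : SimpleGraph (Fin I.N) :=
    { Adj := fun x y => I.d x y = 1 ∨ I.d x y = 2
      symm := ⟨fun x y h => by rwa [I.d_symm y x]⟩
      loopless := ⟨fun x h => by rw [I.d_self] at h; omega⟩ }
  refine ⟨G, Sym2.lift ⟨I.d, I.d_symm⟩, fun e => ?_, fun x y hxy => ⟨?_, ?_⟩⟩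
  · induction e with
    | _ x y => exact id
  · have h4 : I.d x y ≤ 4 := tsp_isOneB true H x y hxy
    have h1 := I.d_pos x y hxy
    obtain h | h | h : (I.d x y = 1 ∨ I.d x y = 2) ∨ I.d x y = 3 ∨ I.d x y = 4 := by omega
    · exact .inl ⟨.cons (show G.Adj x y from h) .nil, by simp⟩
    · obtain ⟨z, hz⟩ := h3 x y h
      refine .inl ⟨.cons (show G.Adj x z from ?_) (.cons (show G.Adj z y from ?_) .nil), ?_⟩
      · exact hz.imp And.left And.left
      · exact hz.symm.imp And.right And.right
      · simp
        omega
    · exact .inr h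
  · rintro k (⟨p, rfl⟩ | rfl)
    · clear hxy
      induction p with
      | nil => simp [I.d_self]
      | cons h p ih =>
        rw [SimpleGraph.Walk.edges_cons, List.map_cons, List.sum_cons]
        exact (I.d_triangle _ _ _).trans (Nat.add_le_add_left ih _)
    · exact tsp_isOneB true H x y hxy

end HybridInstance
end

theorem mainTheorem2 :
    (∃ (G : HybridInstance → TSPInstance)
        (ψ : (H : HybridInstance) → (G H).Tour → H.Assignment),
      PolyTimeReduction G ψ ∧
      ∀ H : HybridInstance,
        (G H).IsOneB 2 ∧
        (∀ (u : ℕ) (φ : H.Assignment), H.unsat φ ≤ u →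
          ∃ σ : (G H).Tour,
            (G H).length σ ≤ 8 * H.m₂ + 27 * H.m₃ + 3 * H.n + 1 + u) ∧
        (∀ (u : ℕ) (σ : (G H).Tour),
          (G H).length σ ≤ 8 * H.m₂ + 27 * H.m₃ + 3 * H.n + 1 + u →
            H.unsat (ψ H σ) ≤ u)) ∧
    (∃ (G : HybridInstance → TSPInstance)
        (ψ : (H : HybridInstance) → (G H).Tour → H.Assignment),
      PolyTimeReduction G ψ ∧
      ∀ H : HybridInstance,
        (G H).IsOneB 4 ∧ (G H).IsGraphMetricCappedAt 4 ∧
        (∀ (u : ℕ) (φ : H.Assignment), H.unsat φ ≤ u →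
          ∃ σ : (G H).Tour,
            (G H).length σ ≤ 10 * H.m₂ + 36 * H.m₃ + 6 * H.n + 2 + 2 * u) ∧
        (∀ (u : ℕ) (σ : (G H).Tour),
          (G H).length σ ≤ 10 * H.m₂ + 36 * H.m₃ + 6 * H.n + 2 + 2 * u →
            H.unsat (ψ H σ) ≤ u)) := by
  refine ⟨⟨HybridInstance.tsp false, Ram.assignment false,
    ⟨Ram.polyTime_tsp false, Ram.polyTime_assignment false⟩, fun H =>
    ⟨HybridInstance.tsp_isOneB false H, fun u φ hφ => ?_, fun u σ hσ => ?_⟩⟩,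
    ⟨HybridInstance.tsp true, Ram.assignment true,
    ⟨Ram.polyTime_tsp true, Ram.polyTime_assignment true⟩, fun H =>
    ⟨HybridInstance.tsp_isOneB true H, H.tsp_isGraphMetric, fun u φ hφ => ?_, fun u σ hσ => ?_⟩⟩⟩
  · obtain ⟨σ, hσ⟩ := HybridInstance.exists_unit_mul_length_le false φ
    refine ⟨σ, ?_⟩
    -- With base cost 16 the doubled bound is `16 m₂ + 54 m₃ + 6 n + 2 + 2 u`, twice the required
    -- one. In the second case base cost 10 yields the required bound without halving.
    simp only [HybridInstance.unit, gadBase] at hσ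
    omega
  · have h := HybridInstance.unit_mul_length_ge σ
    simp only [HybridInstance.unit, gadBase] at h
    omega
  · obtain ⟨σ, hσ⟩ := HybridInstance.exists_unit_mul_length_le true φ
    refine ⟨σ, ?_⟩
    simp only [HybridInstance.unit, gadBase] at hσ
    omega
  · have h := HybridInstance.unit_mul_length_ge σ
    simp only [HybridInstance.unit, gadBase] at h
    omega
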